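/- For an odd positive integer $d$ let $\left(\frac{r}{d}\right)$ be the Jacobi symbol; for $d$ even and $r$ odd put $\left(\frac{r}{d}\right)=\left(\frac{r}{d'}\right)$, where $d'$ is the odd part of $d$. Let $\tau(r)$ denote the number of positive divisors of $r$, and let $\bar r$ denote the multiplicative inverse of $r$ modulo $d$ (so a condition involving $\bar r \pmod d$ includes $(r,d)=1$). There is a function $\mathcal N(D,R,S)$ of real $D,R,S\ge 1$ with the following two properties. (i) For all real $D,R,S\ge 1$ and all complex numbers $\alpha_{rs}$, indexed by positive integers $r,s$ and supported on pairs with $(r,2s)=1$, $R<r\le 2R$ and $S<s\le 2S$, $$\sum_{D<d\le 2D}\ \sum_{a\,(\mathrm{mod}\ d)}\ \Bigl|\sum_{\bar r s\equiv a\,(\mathrm{mod}\ d)}\alpha_{rs}\Bigl(\frac{r}{d}\Bigr)\Bigr|^2\ \le\ \mathcal N(D,R,S)\sum_r\sum_s\tau(r)\,|\alpha_{rs}|^2 .$$ (ii) For every $\varepsilon>0$ there is a constant $C>0$, depending only on $\varepsilon$, such that for all real $D,R,S\ge 1$ $$|\mathcal N(D,R,S)|\ \le\ C\Bigl(D+D^{-\frac12}RS+D^{\frac13}(RS)^{\frac23}(\log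 2RS)^4+(R+S)^{\frac1{12}}(RS)^{\frac{11}{12}+\varepsilon}\Bigr).$$ -/

import Mathlib

/-- The symbol `(a/d)`: the Jacobi symbol of `a` modulo the odd part of `d`. For odd `d` this is the
usual Jacobi symbol; for even `d` it extends the Jacobi symbol at odd `a`. -/
def extJacobi (a : ℤ) (d : ℕ) : ℤ := jacobiSym a (d / 2 ^ d.factorization 2)

/-- The integers `n` with `X < n ≤ 2 X`, for a real `X ≥ 0`. -/
noncomputable def dyadic (X : ℝ) : Finset ℕ := Finset.Ioc ⌊X⌋₊ ⌊2 * X⌋₊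

theorem mem_dyadic {X : ℝ} (hX : 0 ≤ X) (n : ℕ) : n ∈ dyadic X ↔ X < n ∧ (n : ℝ) ≤ 2 * X := by
  rw [dyadic, Finset.mem_Ioc, Nat.floor_lt hX, Nat.le_floor_iff (by linarith)]

/-- The congruence `r̄ s ≡ a (mod d)`, where `r̄` is the inverse of `r` modulo `d`; it includes the
condition that this inverse exists. -/
def InvCongr (d r s a : ℕ) : Prop :=
  r.Coprime d ∧ (r : ZMod d)⁻¹ * (s : ZMod d) = (a : ZMod d)

open Classical in
/-- The Jacobi-twisted sum of `α r s * (r/d)` over `r̄ s ≡ a (mod d)`, where `r`, `s` run over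
the dyadic box `R < r ≤ 2 R`, `S < s ≤ 2 S`. -/
noncomputable def twistedSum (R S : ℝ) (α : ℕ → ℕ → ℂ) (d a : ℕ) : ℂ :=
  ∑ r ∈ dyadic R, ∑ s ∈ dyadic S,
    if InvCongr d r s a then α r s * (extJacobi (r : ℤ) d : ℂ) else 0

/-- The sum over moduli `D < d ≤ 2 D` and over all residue classes `a (mod d)` of the squared
absolute value of the twisted sum. -/
noncomputable def globalVariance (D R S : ℝ) (α : ℕ → ℕ → ℂ) : ℝ :=
  ∑ d ∈ dyadic D, ∑ a ∈ Finset.range d, ‖twistedSum R S α d a‖ ^ 2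

/-- The coefficients `α r s` are supported on pairs with `(r, 2 s) = 1` in the box
`R < r ≤ 2 R`, `S < s ≤ 2 S`. -/
def SupportedInBox (R S : ℝ) (α : ℕ → ℕ → ℂ) : Prop :=
  ∀ r s : ℕ, α r s ≠ 0 →
    (R < r ∧ (r : ℝ) ≤ 2 * R) ∧ (S < s ∧ (s : ℝ) ≤ 2 * S) ∧ r.Coprime (2 * s)

open Finset

/-! Put X = RS and expand the variance modulo d into a quadratic form in the points v = (r, s). Two
points interact exactly when d divides the determinant Δ = r₁s₂ − r₂s₁, and then with coefficient
(r₁/d)(r₂/d). Three devices bound this form, each in its own range of D.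

Direct bound (`varianceBound_small`, `exists_varianceBound`). By duality the coefficients are placed
on the classes (d, a), and r, s run freely. For a pair d₁, d₂ the sum over s of a function of r̄s
modulo lcm(d₁, d₂) is replaced by its mean; the error is controlled on average over r by completion
(`exists_sum_norm_completion_le`). The mean values together form an average of bilinear forms in
(r/d), which Pólya–Vinogradov and reciprocity bound (`exists_symbBound`). Up to X^ε the outcome is
X/√D + R^(3/4)S + RS^(3/4) + D√X, which is useful for D below √X.

Complementary divisors (`supportedBound_flip`). If |Δ| = de with r₁ ≡ r₂ (mod 8), (r₁, r₂) = 1 and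
both points primitive, reciprocity gives (r₁r₂/d) = (r₁r₂/e)(s₁/r₁)(s₂/r₂)
(`symb_mul_symb_complementary`). The last two factors go into the coefficients, so the direct bound
applies to the moduli e. Pairs with |Δ| ≤ Fd cost about FD trivially, because v₁ and Δ determine v₂
(`cross_injective`). For the other pairs the weight in Δ/(eD) must be separated into functions of v₁
and of v₂ (`FormBound.mul_weight`); it is t²/(1 + t²)² since this is built from Lorentz kernels 1/(1
+ t²), which are Laplace transforms of characters. The common factor of r₁ and r₂ is removed by
Möbius inversion, and the sum over it produces τ(r). The method is useful for D above √X, and F =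
(X/D)^(2/3) gives the term D^(1/3)X^(2/3).

Enlarged moduli (`SupportedBound.enlarge`). Near √X neither bound suffices. Multiplying d by the
square of a prime b not dividing r leaves the symbol unchanged; averaging over primes b of size B
bounds the variance at D by that at DB² with a loss of about B, and the complementary divisors at
DB² regain this factor.

With u = min(R, S)^(1/24) the direct bound serves D ≤ √X/u², complementary divisors serve √X u² ≤ D
≤ X, enlargement the range between, and the trivial bound D ≥ X. The remaining errors are
X^(1+ε)/u², at most (R+S)^(1/12) X^(11/12+ε). -/

/-! ### Divisor bounds, duality and elementary sums -/

/-- The divisor function grows more slowly than any positive power. -/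
theorem exists_card_divisors_le_rpow {ε : ℝ} (hε : 0 < ε) :
    ∃ C : ℝ, 1 ≤ C ∧ ∀ n : ℕ, n ≠ 0 → (n.divisors.card : ℝ) ≤ C * (n : ℝ) ^ ε := by
  set A : ℝ := 1 + 1 / (ε * Real.log 2) with hA
  have hl2 : 0 < Real.log 2 := Real.log_pos (by norm_num)
  have hεl : 0 < ε * Real.log 2 := by positivity
  have hA1 : 1 ≤ A := by rw [hA]; linarith [one_div_pos.mpr hεl]
  have hsmall : ∀ p v : ℕ, 2 ≤ p → ((v : ℝ) + 1) ≤ A * ((p : ℝ) ^ v) ^ ε := by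
    intro p v hp
    have h1 : (1 : ℝ) + v * (ε * Real.log 2) ≤ ((p : ℝ) ^ v) ^ ε := by
      have : ((2 : ℝ) ^ v) ^ ε ≤ ((p : ℝ) ^ v) ^ ε := by
        gcongr
        exact_mod_cast hp
      refine le_trans ?_ this
      have h2 : ((2 : ℝ) ^ v) ^ ε = Real.exp (v * (ε * Real.log 2)) := by
        rw [← Real.rpow_natCast, ← Real.rpow_mul (by norm_num), Real.rpow_def_of_pos (by norm_num)]
        congr 1; ring
      rw [h2]
      linarith [Real.add_one_le_exp ((v : ℝ) * (ε * Real.log 2))]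
    have h3 : ((v : ℝ) + 1) ≤ A * (1 + v * (ε * Real.log 2)) := by
      have : A * (1 + v * (ε * Real.log 2)) = 1 + v + v * (ε * Real.log 2) + 1 / (ε * Real.log 2) := by
        rw [hA]; field_simp; ring
      rw [this]
      have : 0 ≤ (v : ℝ) * (ε * Real.log 2) := by positivity
      linarith [one_div_pos.mpr hεl]
    exact h3.trans (by gcongr)
  -- Beyond this bound p^ε ≥ 2, so v + 1 ≤ 2^v costs no constant. Only the primes below `K`, at most
  -- `K` of them, contribute a factor `A` each.
  set K : ℕ := ⌈(2 : ℝ) ^ (1 / ε)⌉₊ with hK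
  have hlarge : ∀ p v : ℕ, K ≤ p → ((v : ℝ) + 1) ≤ ((p : ℝ) ^ v) ^ ε := by
    intro p v hp
    have h1 : (2 : ℝ) ^ (1 / ε) ≤ p := (Nat.le_ceil _).trans (by exact_mod_cast hp)
    have h2 : (2 : ℝ) ≤ (p : ℝ) ^ ε := by
      calc (2 : ℝ) = ((2 : ℝ) ^ (1 / ε)) ^ ε := by
            rw [← Real.rpow_mul (by norm_num), one_div_mul_cancel hε.ne', Real.rpow_one]
        _ ≤ _ := by gcongr
    have h3 : ((p : ℝ) ^ v) ^ ε = ((p : ℝ) ^ ε) ^ v := by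
      rw [← Real.rpow_natCast, ← Real.rpow_natCast, ← Real.rpow_mul (by positivity),
        ← Real.rpow_mul (by positivity), mul_comm]
    rw [h3]
    calc ((v : ℝ) + 1) ≤ (2 : ℝ) ^ v := by exact_mod_cast Nat.lt_two_pow_self
      _ ≤ _ := by gcongr
  refine ⟨A ^ K, one_le_pow₀ hA1, fun n hn => ?_⟩
  have h1 : (n.divisors.card : ℝ) = ∏ p ∈ n.primeFactors, ((n.factorization p : ℝ) + 1) := by
    rw [Nat.card_divisors hn]; push_cast; rfl
  have h2 : (n : ℝ) ^ ε = ∏ p ∈ n.primeFactors, ((p : ℝ) ^ n.factorization p) ^ ε := by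
    rw [Real.finsetProd_rpow _ _ (fun _ _ => by positivity)]
    congr 1
    conv_lhs => rw [← Nat.prod_factorization_pow_eq_self hn]
    simp [Finsupp.prod]
  rw [h1, h2]
  calc ∏ p ∈ n.primeFactors, ((n.factorization p : ℝ) + 1)
      ≤ ∏ p ∈ n.primeFactors, ((if p < K then A else 1) * ((p : ℝ) ^ n.factorization p) ^ ε) := by
        refine Finset.prod_le_prod (fun _ _ => by positivity) fun p hp => ?_
        split_ifs with h
        · exact hsmall p _ (Nat.prime_of_mem_primeFactors hp).two_le
        · rw [one_mul]; exact hlarge p _ (not_lt.mp h)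
    _ = (∏ p ∈ n.primeFactors, (if p < K then A else 1)) *
          ∏ p ∈ n.primeFactors, ((p : ℝ) ^ n.factorization p) ^ ε := Finset.prod_mul_distrib
    _ ≤ A ^ K * ∏ p ∈ n.primeFactors, ((p : ℝ) ^ n.factorization p) ^ ε := by
        gcongr
        rw [Finset.prod_ite, Finset.prod_const_one, mul_one, Finset.prod_const]
        refine pow_le_pow_right₀ hA1 ?_
        calc _ ≤ (Finset.range K).card := Finset.card_le_card (by
              intro p hp; simp at hp ⊢; exact hp.2)
          _ = K := Finset.card_range K

/-- Duality: a bound for the quadratic form of a matrix carries over to the transposed matrix. -/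
theorem sum_norm_sq_le_of_dual {ι κ : Type*} (s : Finset ι) (t : Finset κ) (θ : ι → κ → ℂ) {N : ℝ}
    (hN : 0 ≤ N)
    (h : ∀ c : κ → ℂ, ∑ i ∈ s, ‖∑ j ∈ t, c j * θ i j‖ ^ 2 ≤ N * ∑ j ∈ t, ‖c j‖ ^ 2) (a : ι → ℂ) :
    ∑ j ∈ t, ‖∑ i ∈ s, a i * θ i j‖ ^ 2 ≤ N * ∑ i ∈ s, ‖a i‖ ^ 2 := by
  set T : κ → ℂ := fun j => ∑ i ∈ s, a i * θ i j with hT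
  set V : ℝ := ∑ j ∈ t, ‖T j‖ ^ 2 with hV
  have hV0 : 0 ≤ V := by positivity
  -- The hypothesis is tested on the conjugates of the dual sums; Cauchy–Schwarz then gives V² ≤
  -- ‖a‖² N V, from which one factor V is cancelled.
  have hVc : (V : ℂ) = ∑ i ∈ s, a i * ∑ j ∈ t, (starRingEnd ℂ) (T j) * θ i j := by
    rw [hV]; push_cast
    simp_rw [Finset.mul_sum]
    rw [Finset.sum_comm]
    refine Finset.sum_congr rfl fun j _ => ?_
    rw [← Complex.mul_conj', mul_comm, hT]
    simp only [Finset.mul_sum]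
    exact Finset.sum_congr rfl fun i _ => by ring
  have h1 : V ≤ ∑ i ∈ s, ‖a i‖ * ‖∑ j ∈ t, (starRingEnd ℂ) (T j) * θ i j‖ := by
    calc V = ‖(V : ℂ)‖ := by rw [Complex.norm_real, Real.norm_of_nonneg hV0]
      _ ≤ _ := by
        rw [hVc]
        exact (norm_sum_le _ _).trans (le_of_eq (Finset.sum_congr rfl fun i _ => norm_mul _ _))
  have h2 : V ^ 2 ≤ (∑ i ∈ s, ‖a i‖ ^ 2) * (N * V) := by
    calc V ^ 2 ≤ (∑ i ∈ s, ‖a i‖ * ‖∑ j ∈ t, (starRingEnd ℂ) (T j) * θ i j‖) ^ 2 := by gcongr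
      _ ≤ (∑ i ∈ s, ‖a i‖ ^ 2) * ∑ i ∈ s, ‖∑ j ∈ t, (starRingEnd ℂ) (T j) * θ i j‖ ^ 2 :=
        Finset.sum_mul_sq_le_sq_mul_sq _ _ _
      _ ≤ _ := by
        gcongr
        simpa using h fun j => (starRingEnd ℂ) (T j)
  rcases hV0.eq_or_lt with h0 | h0
  · rw [← h0]; positivity
  · nlinarith

theorem card_dyadic_le {X : ℝ} (hX : 0 ≤ X) : ((dyadic X).card : ℝ) ≤ 3 * X := by
  rw [dyadic, Nat.card_Ioc]
  -- For X < 1/2 the range is empty; otherwise the rounding error 1 is at most 2X.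
  rcases lt_or_ge X (1 / 2) with h | h
  · have : ⌊2 * X⌋₊ = 0 := Nat.floor_eq_zero.mpr (by linarith)
    rw [this]; simp; exact hX
  · have h1 : ⌊X⌋₊ ≤ ⌊2 * X⌋₊ := Nat.floor_mono (by linarith)
    rw [Nat.cast_sub h1]
    linarith [Nat.floor_le (show 0 ≤ 2 * X by linarith), Nat.lt_floor_add_one X]

theorem log_le_rpow {ε : ℝ} (hε : 0 < ε) :
    ∃ C : ℝ, 1 ≤ C ∧ ∀ Z : ℝ, 1 ≤ Z → 1 + Real.log Z ≤ C * Z ^ ε := by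
  refine ⟨1 + 1 / ε, by linarith [one_div_pos.mpr hε], fun Z hZ => ?_⟩
  have h1 := Real.log_le_rpow_div (show 0 ≤ Z by linarith) hε
  have h2 : 1 ≤ Z ^ ε := Real.one_le_rpow hZ hε.le
  calc 1 + Real.log Z ≤ Z ^ ε + Z ^ ε / ε := by linarith
    _ = _ := by ring

theorem sum_inv_Icc_le (n : ℕ) : ∑ j ∈ Icc 1 n, (1 : ℝ) / j ≤ 1 + Real.log n := by
  have := harmonic_le_one_add_log n
  rw [harmonic_eq_sum_Icc] at this
  push_cast at this
  simpa [one_div] using this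

theorem sum_inv_abs_Icc_le (n : ℕ) :
    ∑ j ∈ (Icc (-(n : ℤ)) n).filter (· ≠ 0), (1 : ℝ) / |(j : ℝ)| ≤ 2 * (1 + Real.log n) := by
  have h : (Icc (-(n : ℤ)) n).filter (· ≠ 0) =
      (Icc 1 n).image (fun k : ℕ => (k : ℤ)) ∪ (Icc 1 n).image (fun k : ℕ => -(k : ℤ)) := by
    ext j
    simp only [mem_filter, mem_Icc, mem_union, mem_image]
    constructor
    · rintro ⟨⟨h1, h2⟩, h3⟩
      rcases lt_or_gt_of_ne h3 with h | h
      · right; exact ⟨j.natAbs, by omega, by omega⟩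
      · left; exact ⟨j.natAbs, by omega, by omega⟩
    · rintro (⟨k, hk, rfl⟩ | ⟨k, hk, rfl⟩) <;> omega
  rw [h]
  have hs : ∀ (A B : Finset ℤ) (f : ℤ → ℝ), (∀ x, 0 ≤ f x) →
      ∑ x ∈ A ∪ B, f x ≤ ∑ x ∈ A, f x + ∑ x ∈ B, f x := by
    intro A B f hf
    rw [← Finset.sum_union_inter]
    linarith [Finset.sum_nonneg (s := A ∩ B) (fun x _ => hf x)]
  refine (hs _ _ _ (fun x => by positivity)).trans ?_
  rw [Finset.sum_image (by intro a _ b _ h; simpa using h),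
    Finset.sum_image (by intro a _ b _ h; simpa using h)]
  have := sum_inv_Icc_le n
  simp only [Int.cast_neg, Int.cast_natCast, abs_neg, Nat.abs_cast]
  linarith

/-! ### Completion of sums over intervals -/

open ZMod in
/-- The additive character sum over an interval. -/
noncomputable def intervalCharSum {q : ℕ} [NeZero q] (J : Finset ℕ) (h : ZMod q) : ℂ :=
  ∑ s ∈ J, stdAddChar (h * (s : ZMod q))

open ZMod in
theorem norm_intervalCharSum_le_card {q : ℕ} [NeZero q] (J : Finset ℕ) (h : ZMod q) :
    ‖intervalCharSum J h‖ ≤ J.card := by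
  refine (norm_sum_le _ _).trans ?_
  simp

open ZMod in
theorem norm_intervalCharSum_le {q : ℕ} [NeZero q] (A B : ℕ) (h : ZMod q) (hh : h ≠ 0) :
    ‖intervalCharSum (Ioc A B) h‖ ≤ q / |(h.valMinAbs : ℝ)| := by
  have hq : (0 : ℝ) < q := by exact_mod_cast Nat.pos_of_ne_zero (NeZero.ne q)
  set k : ℤ := h.valMinAbs with hk
  have hk0 : k ≠ 0 := by rw [hk]; simpa [ZMod.valMinAbs_eq_zero] using hh
  have hkq : 2 * |(k : ℝ)| ≤ q := by
    have h1 := ZMod.natAbs_valMinAbs_le h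
    have h2 : (2 : ℝ) * (k.natAbs : ℝ) ≤ q := by
      have : 2 * k.natAbs ≤ q := by rw [hk]; omega
      exact_mod_cast this
    rwa [Nat.cast_natAbs, Int.cast_abs] at h2
  set z : ℂ := stdAddChar h with hz
  have hzk : z = Complex.exp (Complex.I * ((2 * Real.pi * (k / q) : ℝ) : ℂ)) := by
    rw [hz]
    conv_lhs => rw [← ZMod.coe_valMinAbs h]
    rw [ZMod.stdAddChar_coe, ← hk]
    congr 1; push_cast; ring
  have hz1 : ‖z‖ = 1 := by simp [hz]
  have hsum : intervalCharSum (Ioc A B) h = ∑ s ∈ Ioc A B, z ^ s := by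
    refine Finset.sum_congr rfl fun s _ => ?_
    rw [hz, ← AddChar.map_nsmul_eq_pow, nsmul_eq_mul, mul_comm]
  -- Here ‖z − 1‖ = 2|sin(πk/q)|, and |sin x| ≥ 2|x|/π for |x| ≤ π/2 since |k| ≤ q/2.
  have hlow : 4 * (|(k : ℝ)| / q) ≤ ‖z - 1‖ := by
    rw [hzk, Complex.norm_exp_I_mul_ofReal_sub_one]
    have h1 : |2 * Real.pi * (k / q) / 2| ≤ Real.pi / 2 := by
      rw [show 2 * Real.pi * ((k : ℝ) / q) / 2 = Real.pi * (k / q) by ring, abs_mul,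
        abs_of_pos Real.pi_pos, abs_div, abs_of_pos hq]
      have : |(k : ℝ)| / q ≤ 1 / 2 := by rw [div_le_div_iff₀ hq (by norm_num)]; linarith
      nlinarith [Real.pi_pos]
    have h2 := Real.mul_abs_le_abs_sin h1
    rw [norm_mul, Real.norm_eq_abs, Real.norm_eq_abs, abs_two]
    rw [show 2 * Real.pi * ((k : ℝ) / q) / 2 = Real.pi * (k / q) by ring] at h2 ⊢
    rw [abs_mul Real.pi, abs_of_pos Real.pi_pos, abs_div, abs_of_pos hq] at h2
    have h3 : 2 / Real.pi * (Real.pi * (|(k : ℝ)| / q)) = 2 * (|(k : ℝ)| / q) := by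
      field_simp
    linarith
  have hkpos : 0 < |(k : ℝ)| := by positivity
  have hz0 : 0 < ‖z - 1‖ := lt_of_lt_of_le (by positivity) hlow
  rw [hsum]
  rcases le_or_gt A B with hAB | hAB
  · have hg : (∑ s ∈ Ioc A B, z ^ s) * (z - 1) = z ^ (B + 1) - z ^ (A + 1) := by
      rw [← Finset.Ico_add_one_add_one_eq_Ioc]
      exact geom_sum_Ico_mul z (by omega)
    have hn : ‖∑ s ∈ Ioc A B, z ^ s‖ * ‖z - 1‖ ≤ 2 := by
      rw [← norm_mul, hg]
      refine (norm_sub_le _ _).trans ?_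
      rw [norm_pow, norm_pow, hz1]; norm_num
    rw [le_div_iff₀ hkpos]
    have h4 : ‖∑ s ∈ Ioc A B, z ^ s‖ * (4 * (|(k : ℝ)| / q)) ≤ 2 :=
      (mul_le_mul_of_nonneg_left hlow (norm_nonneg _)).trans hn
    have h5 : ‖∑ s ∈ Ioc A B, z ^ s‖ * |(k : ℝ)| * 4 ≤ 2 * q := by
      have : ‖∑ s ∈ Ioc A B, z ^ s‖ * (4 * (|(k : ℝ)| / q)) =
        (‖∑ s ∈ Ioc A B, z ^ s‖ * |(k : ℝ)| * 4) / q := by ring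
      rw [this, div_le_iff₀ hq] at h4
      exact h4
    linarith
  · rw [Finset.Ioc_eq_empty (by omega)]
    simp; positivity

open ZMod in
theorem sum_interval_eq_dft {q : ℕ} [NeZero q] (J : Finset ℕ) (G : ZMod q → ℂ) :
    ∑ s ∈ J, G s = (q : ℂ)⁻¹ * ∑ h : ZMod q, dft G h * intervalCharSum J h := by
  have h1 : ∀ x, G x = (q : ℂ)⁻¹ * ∑ h : ZMod q, dft G h * stdAddChar (h * x) := by
    intro x
    have := congrFun (LinearEquiv.symm_apply_apply dft G) x
    rw [← this, invDFT_apply, smul_eq_mul]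
    congr 1
    exact Finset.sum_congr rfl fun h _ => by rw [smul_eq_mul, mul_comm]
  have h2 : ∑ s ∈ J, G s =
      ∑ s ∈ J, (q : ℂ)⁻¹ * ∑ h : ZMod q, dft G h * stdAddChar (h * (s : ZMod q)) :=
    Finset.sum_congr rfl fun s _ => h1 _
  rw [h2, ← Finset.mul_sum, Finset.sum_comm]
  congr 1
  exact Finset.sum_congr rfl fun h _ => by rw [intervalCharSum, Finset.mul_sum]

open ZMod in
-- The frequency zero carries exactly the mean of `G`, so the nonzero frequencies measure the error
-- made in replacing the interval sum by its mean.
theorem sum_interval_sub_mean {q : ℕ} [NeZero q] (J : Finset ℕ) (G : ZMod q → ℂ) :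
    ∑ s ∈ J, G s - (J.card / q : ℂ) * ∑ x, G x =
      (q : ℂ)⁻¹ * ∑ h ∈ univ.filter (fun h : ZMod q => h ≠ 0), dft G h * intervalCharSum J h := by
  rw [sum_interval_eq_dft, ← Finset.sum_filter_add_sum_filter_not univ (fun h : ZMod q => h ≠ 0),
    mul_add]
  have : univ.filter (fun h : ZMod q => ¬ h ≠ 0) = {0} := by ext; simp
  rw [this, Finset.sum_singleton, dft_apply_zero]
  have h2 : intervalCharSum J (0 : ZMod q) = J.card := by simp [intervalCharSum]
  rw [h2]; ring

open ZMod in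
-- Parseval for the unnormalised transform, by Fourier inversion.
theorem sum_norm_sq_dft {q : ℕ} [NeZero q] (G : ZMod q → ℂ) :
    ∑ h, ‖dft G h‖ ^ 2 = q * ∑ x, ‖G x‖ ^ 2 := by
  have hc : ((∑ h, ‖dft G h‖ ^ 2 : ℝ) : ℂ) = ((q * ∑ x, ‖G x‖ ^ 2 : ℝ) : ℂ) := by
    push_cast
    have h1 : ∀ h, ((‖dft G h‖ : ℂ)) ^ 2 =
        ∑ x, (starRingEnd ℂ (G x)) * (stdAddChar (h * x) * dft G h) := by
      intro h
      rw [← Complex.conj_mul']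
      have h2 : (starRingEnd ℂ) (dft G h) =
          ∑ x, (starRingEnd ℂ) (stdAddChar (-(x * h)) • G x) := by rw [dft_apply, map_sum]
      rw [h2, Finset.sum_mul]
      refine Finset.sum_congr rfl fun x _ => ?_
      rw [smul_eq_mul, map_mul, ← AddChar.map_neg_eq_conj, neg_neg, mul_comm x h]
      ring
    rw [Finset.sum_congr rfl fun h _ => h1 h, Finset.sum_comm, Finset.mul_sum]
    refine Finset.sum_congr rfl fun x _ => ?_
    rw [← Finset.mul_sum]
    have h2 := congrFun (LinearEquiv.symm_apply_apply dft G) x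
    rw [invDFT_apply, smul_eq_mul] at h2
    simp only [smul_eq_mul] at h2
    have hq : (q : ℂ) ≠ 0 := by exact_mod_cast NeZero.ne q
    have h3 : ∑ h, stdAddChar (h * x) * dft G h = q * G x := by
      rw [← h2]; field_simp
    rw [h3, ← Complex.conj_mul']; ring
  exact_mod_cast hc

theorem sum_inv_valMinAbs_le {q : ℕ} [NeZero q] :
    ∑ h ∈ univ.filter (fun h : ZMod q => h ≠ 0), (1 : ℝ) / |(h.valMinAbs : ℝ)|
      ≤ 2 * (1 + Real.log q) := by
  refine le_trans ?_ (sum_inv_abs_Icc_le q)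
  have hinj : Set.InjOn (fun h : ZMod q => h.valMinAbs)
      (univ.filter (fun h : ZMod q => h ≠ 0) : Finset (ZMod q)) :=
    fun a _ b _ h => ZMod.injective_valMinAbs h
  rw [← Finset.sum_image (f := fun j : ℤ => (1 : ℝ) / |(j : ℝ)|) hinj]
  refine Finset.sum_le_sum_of_subset_of_nonneg ?_ (fun _ _ _ => by positivity)
  intro j hj
  simp only [mem_image, mem_filter, mem_univ, true_and, mem_Icc] at hj ⊢
  obtain ⟨h, h0, rfl⟩ := hj
  have h1 := ZMod.natAbs_valMinAbs_le h
  have h2 : h.valMinAbs ≠ 0 := by simpa [ZMod.valMinAbs_eq_zero] using h0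
  omega

/-- An interval meets each residue class in its expected number of points with error at most 1, so
every value of `G` enters with a coefficient of modulus at most 1. No logarithm is lost, unlike in
completion. -/
theorem norm_sum_interval_sub_mean_le {q : ℕ} [NeZero q] {A B : ℕ} (hAB : A ≤ B)
    (G : ZMod q → ℂ) :
    ‖∑ s ∈ Ioc A B, G s - ((Ioc A B).card / q : ℂ) * ∑ x, G x‖ ≤ ∑ x, ‖G x‖ := by
  have hq : 0 < q := Nat.pos_of_ne_zero (NeZero.ne q)
  have hqr : (0 : ℝ) < q := by exact_mod_cast hq
  have h1 : ∑ s ∈ Ioc A B, G s =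
      ∑ x : ZMod q, (((Ioc A B).filter (fun s : ℕ => (s : ZMod q) = x)).card : ℂ) * G x := by
    rw [← Finset.sum_fiberwise (Ioc A B) (fun s : ℕ => (s : ZMod q))]
    refine Finset.sum_congr rfl fun x _ => ?_
    rw [← nsmul_eq_mul, ← Finset.sum_const]
    exact Finset.sum_congr rfl fun s hs => by rw [(Finset.mem_filter.mp hs).2]
  rw [h1, Finset.mul_sum, ← Finset.sum_sub_distrib]
  refine (norm_sum_le _ _).trans (Finset.sum_le_sum fun x _ => ?_)
  rw [← sub_mul, norm_mul]
  refine mul_le_of_le_one_left (norm_nonneg _) ?_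
  have h2 : ((Ioc A B).filter (fun s : ℕ => (s : ZMod q) = x)) =
      (Ioc A B).filter (fun s : ℕ => s ≡ x.val [MOD q]) := by
    refine Finset.filter_congr fun s _ => ?_
    rw [← ZMod.natCast_eq_natCast_iff, ZMod.natCast_zmod_val]
  rw [h2]
  have h3 := Nat.Ioc_filter_modEq_card A B hq x.val
  have h4 : ((((Ioc A B).filter (fun s : ℕ => s ≡ x.val [MOD q])).card : ℤ) : ℝ) =
    ((max (⌊((B : ℚ) - x.val) / q⌋ - ⌊((A : ℚ) - x.val) / q⌋) 0 : ℤ) : ℝ) := by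
    exact_mod_cast congrArg (fun z : ℤ => (z : ℝ)) h3
  have hmono : ⌊((A : ℚ) - x.val) / q⌋ ≤ ⌊((B : ℚ) - x.val) / q⌋ := by
    apply Int.floor_mono
    gcongr
  rw [max_eq_left (by linarith)] at h4
  have e1 := Int.floor_le (((B : ℚ) - x.val) / q)
  have e2 := Int.lt_floor_add_one (((B : ℚ) - x.val) / q)
  have e3 := Int.floor_le (((A : ℚ) - x.val) / q)
  have e4 := Int.lt_floor_add_one (((A : ℚ) - x.val) / q)
  have e1' : ((⌊((B : ℚ) - x.val) / q⌋ : ℤ) : ℝ) ≤ ((B : ℝ) - x.val) / q := by exact_mod_cast e1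
  have e2' : ((B : ℝ) - x.val) / q < ((⌊((B : ℚ) - x.val) / q⌋ : ℤ) : ℝ) + 1 := by exact_mod_cast e2
  have e3' : ((⌊((A : ℚ) - x.val) / q⌋ : ℤ) : ℝ) ≤ ((A : ℝ) - x.val) / q := by exact_mod_cast e3
  have e4' : ((A : ℝ) - x.val) / q < ((⌊((A : ℚ) - x.val) / q⌋ : ℤ) : ℝ) + 1 := by exact_mod_cast e4
  rw [Nat.card_Ioc]
  have h5 : ‖((((Ioc A B).filter (fun s : ℕ => s ≡ x.val [MOD q])).card : ℂ) - ((B - A : ℕ) : ℂ) / q)‖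
      = |((((Ioc A B).filter (fun s : ℕ => s ≡ x.val [MOD q])).card : ℤ) : ℝ) - ((B : ℝ) - A) / q| := by
    rw [← Real.norm_eq_abs, ← Complex.norm_real]
    congr 1
    push_cast [Nat.cast_sub hAB]
    ring
  rw [h5, h4]
  push_cast
  have h6 : ((B : ℝ) - A) / q = ((B : ℝ) - x.val) / q - ((A : ℝ) - x.val) / q := by ring
  rw [abs_le]; constructor <;> linarith

open ZMod in
-- Dilating the argument by the inverse of r dilates the frequency by r. This is how the products r
-- h enter the completion argument.
theorem dft_comp_inv_mul {q : ℕ} [NeZero q] (F : ZMod q → ℂ) {r : ℕ} (hr : r.Coprime q)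
    (h : ZMod q) : dft (fun x => F ((r : ZMod q)⁻¹ * x)) h = dft F (r * h) := by
  have := dft_comp_unitMul F (ZMod.unitOfCoprime r hr)⁻¹ h
  simpa [ZMod.unitOfCoprime] using this

theorem sum_comp_inv_mul {q : ℕ} [NeZero q] {M : Type*} [AddCommMonoid M] (F : ZMod q → M) {r : ℕ}
    (hr : r.Coprime q) : ∑ x, F ((r : ZMod q)⁻¹ * x) = ∑ x, F x := by
  have := Equiv.sum_comp (Units.mulLeft (ZMod.unitOfCoprime r hr)⁻¹) F
  simpa [ZMod.unitOfCoprime] using this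

/-! ### Pólya–Vinogradov -/

/-- Pólya–Vinogradov for primitive characters. -/
theorem norm_sum_interval_primitive_le {f : ℕ} [NeZero f] {χ : DirichletCharacter ℂ f}
    (hχ : χ.IsPrimitive) (hf : f ≠ 1) (A B : ℕ) :
    ‖∑ s ∈ Ioc A B, χ s‖ ≤ 2 * √f * (1 + Real.log f) := by
  have hfr : (0 : ℝ) < f := by exact_mod_cast Nat.pos_of_ne_zero (NeZero.ne f)
  have hdft : ∀ h, ZMod.dft χ h = χ⁻¹ (-h) * gaussSum χ ZMod.stdAddChar :=
    fun h => hχ.fourierTransform_eq_inv_mul_gaussSum h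
  set τ : ℂ := gaussSum χ ZMod.stdAddChar
  have hval : ∀ x : ZMod f, IsUnit x → ‖χ x‖ = 1 := fun x hx => by
    obtain ⟨u, rfl⟩ := hx; exact χ.unit_norm_eq_one u
  have hvali : ∀ x : ZMod f, ‖χ⁻¹ x‖ = ‖χ x‖ := fun x => by
    by_cases hx : IsUnit x
    · rw [hval x hx]; obtain ⟨u, rfl⟩ := hx; exact DirichletCharacter.unit_norm_eq_one _ u
    · rw [MulChar.map_nonunit _ hx, MulChar.map_nonunit _ hx]
  -- The modulus of the Gauss sum comes from Parseval: the transform of χ has modulus |τ||χ(−h)|.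
  have hτ : ‖τ‖ ^ 2 = f := by
    have hp := sum_norm_sq_dft (χ : ZMod f → ℂ)
    have h1 : ∀ h : ZMod f, ‖ZMod.dft χ h‖ ^ 2 = ‖χ (-h)‖ ^ 2 * ‖τ‖ ^ 2 := fun h => by
      rw [hdft, norm_mul, hvali, mul_pow]
    have h1' : ∑ h : ZMod f, ‖χ (-h)‖ ^ 2 = ∑ h : ZMod f, ‖χ h‖ ^ 2 :=
      Equiv.sum_comp (Equiv.neg (ZMod f)) (fun h => ‖χ h‖ ^ 2)
    rw [Finset.sum_congr rfl fun h _ => h1 h, ← Finset.sum_mul, h1'] at hp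
    have hpos : 0 < ∑ x : ZMod f, ‖χ x‖ ^ 2 := by
      refine Finset.sum_pos' (fun _ _ => by positivity) ⟨1, Finset.mem_univ _, by simp⟩
    nlinarith [hp, mul_right_cancel₀ hpos.ne' (by linarith : ‖τ‖ ^ 2 * _ = (f : ℝ) * _)]
  have hτ' : ‖τ‖ = √f := by rw [← hτ, Real.sqrt_sq (norm_nonneg _)]
  have hsum0 : ∑ x : ZMod f, χ x = 0 := by
    apply MulChar.sum_eq_zero_of_ne_one
    rintro rfl
    exact hf (by rw [← (DirichletCharacter.isPrimitive_def _).mp hχ, DirichletCharacter.conductor_one])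
  have h2 := sum_interval_sub_mean (Ioc A B) (χ : ZMod f → ℂ)
  rw [hsum0, mul_zero, sub_zero] at h2
  rw [h2, norm_mul, norm_inv, Complex.norm_natCast]
  have h3 : ‖∑ h ∈ univ.filter (fun h : ZMod f => h ≠ 0),
      ZMod.dft χ h * intervalCharSum (Ioc A B) h‖ ≤
      ∑ h ∈ univ.filter (fun h : ZMod f => h ≠ 0), √f * f * (1 / |(h.valMinAbs : ℝ)|) := by
    refine (norm_sum_le _ _).trans (Finset.sum_le_sum fun h hh => ?_)
    rw [norm_mul, hdft, norm_mul, hvali, hτ', mul_assoc, mul_one_div]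
    have h4 := norm_intervalCharSum_le A B h (Finset.mem_filter.mp hh).2
    have h5 : ‖χ (-h)‖ ≤ 1 := DirichletCharacter.norm_le_one χ _
    calc ‖χ (-h)‖ * (√f * ‖intervalCharSum (Ioc A B) h‖)
        ≤ 1 * (√f * (f / |(h.valMinAbs : ℝ)|)) := by gcongr
      _ = _ := by ring
  rw [← Finset.mul_sum] at h3
  have h4 := sum_inv_valMinAbs_le (q := f)
  calc (f : ℝ)⁻¹ * _ ≤ (f : ℝ)⁻¹ * (√f * f * (2 * (1 + Real.log f))) := by
        gcongr
        refine h3.trans ?_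
        gcongr
    _ = _ := by field_simp

theorem sum_moebius_divisors (n : ℕ) :
    ∑ t ∈ n.divisors, ArithmeticFunction.moebius t = if n = 1 then 1 else 0 := by
  rw [← ArithmeticFunction.coe_zeta_mul_apply, ArithmeticFunction.coe_zeta_mul_moebius,
    ArithmeticFunction.one_apply]

/-- Pólya–Vinogradov, up to a divisor function, for non-principal characters. -/
theorem norm_sum_interval_character_le {q : ℕ} [NeZero q] {χ : DirichletCharacter ℂ q}
    (hχ : χ ≠ 1) (A B : ℕ) :
    ‖∑ s ∈ Ioc A B, χ s‖ ≤ q.divisors.card * (2 * √q * (1 + Real.log q)) := by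
  have hq0 : q ≠ 0 := NeZero.ne q
  set f := χ.conductor with hf
  have hfq : f ∣ q := χ.conductor_dvd_level
  have : NeZero f := ⟨fun h => hq0 (by rw [h] at hfq; exact Nat.eq_zero_of_zero_dvd hfq)⟩
  have hf1 : f ≠ 1 := fun h => hχ (DirichletCharacter.eq_one_iff_conductor_eq_one.mpr h)
  set ψ := χ.primitiveCharacter
  have hψ : ψ.IsPrimitive := χ.primitiveCharacter_isPrimitive
  -- χ is the primitive character ψ restricted to s coprime to q; Möbius inversion over t ∣ gcd(q,
  -- s) detects the restriction. Each t then gives an interval sum of ψ, whence the divisor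
  -- function.
  have hexp : ∀ s : ℕ, χ s = ∑ t ∈ q.divisors, if t ∣ s then (ArithmeticFunction.moebius t : ℂ) * ψ s
      else 0 := by
    intro s
    have hm : ∑ t ∈ q.divisors, (if t ∣ s then (ArithmeticFunction.moebius t : ℂ) * ψ s else 0) =
        (∑ t ∈ (q.gcd s).divisors, (ArithmeticFunction.moebius t : ℂ)) * ψ s := by
      rw [← Finset.sum_filter, Finset.sum_mul]
      refine Finset.sum_congr ?_ fun _ _ => rfl
      ext t
      simp only [mem_filter, Nat.mem_divisors, Nat.dvd_gcd_iff, ne_eq, Nat.gcd_eq_zero_iff]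
      tauto
    have hm2 : (∑ t ∈ (q.gcd s).divisors, (ArithmeticFunction.moebius t : ℂ)) =
        if q.gcd s = 1 then 1 else 0 := by
      have := congrArg (fun z : ℤ => (z : ℂ)) (sum_moebius_divisors (q.gcd s))
      push_cast at this
      exact this
    rw [hm, hm2]
    split_ifs with h
    · rw [one_mul]
      have hc : IsCoprime (s : ℤ) q := by
        rw [Nat.isCoprime_iff_coprime]; exact (Nat.coprime_comm).mp h
      have := χ.primitiveCharacter_apply_of_isCoprime hc
      simpa using this.symm
    · rw [zero_mul]
      apply MulChar.map_nonunit
      rw [ZMod.isUnit_iff_coprime]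
      exact fun h' => h (Nat.coprime_comm.mp h')
  rw [Finset.sum_congr rfl fun s _ => hexp s, Finset.sum_comm]
  refine (norm_sum_le _ _).trans ?_
  rw [← nsmul_eq_mul]
  refine Finset.sum_le_card_nsmul _ _ _ fun t ht => ?_
  have ht0 : 0 < t := Nat.pos_of_mem_divisors ht
  have h1 : ∑ s ∈ Ioc A B, (if t ∣ s then (ArithmeticFunction.moebius t : ℂ) * ψ s else 0) =
      (ArithmeticFunction.moebius t : ℂ) * ψ t * ∑ s ∈ Ioc (A / t) (B / t), ψ s := by
    rw [← Finset.sum_filter]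
    have : (Ioc A B).filter (t ∣ ·) = (Ioc (A / t) (B / t)).image (t * ·) := by
      ext s
      simp only [mem_filter, mem_Ioc, mem_image]
      constructor
      · rintro ⟨⟨h1, h2⟩, ⟨u, rfl⟩⟩
        exact ⟨u, ⟨(Nat.div_lt_iff_lt_mul ht0).mpr (by linarith),
          (Nat.le_div_iff_mul_le ht0).mpr (by linarith)⟩, rfl⟩
      · rintro ⟨u, ⟨h1, h2⟩, rfl⟩
        rw [Nat.div_lt_iff_lt_mul ht0] at h1
        rw [Nat.le_div_iff_mul_le ht0] at h2
        exact ⟨⟨by linarith, by linarith⟩, dvd_mul_right _ _⟩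
    rw [this, Finset.sum_image (fun a _ b _ h => Nat.eq_of_mul_eq_mul_left ht0 h), Finset.mul_sum]
    refine Finset.sum_congr rfl fun u _ => ?_
    push_cast; rw [map_mul]; ring
  rw [h1, norm_mul, norm_mul]
  have h2 : ‖(ArithmeticFunction.moebius t : ℂ)‖ ≤ 1 := by
    rw [Complex.norm_intCast]
    exact_mod_cast ArithmeticFunction.abs_moebius_le_one
  have h3 : ‖ψ t‖ ≤ 1 := DirichletCharacter.norm_le_one ψ _
  have h4 := norm_sum_interval_primitive_le hψ hf1 (A / t) (B / t)
  have h5 : (f : ℝ) ≤ q := by exact_mod_cast Nat.le_of_dvd (Nat.pos_of_ne_zero hq0) hfq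
  have hf1' : (1 : ℝ) ≤ f := by exact_mod_cast Nat.pos_of_ne_zero (NeZero.ne f)
  have hlog : Real.log f ≤ Real.log q := Real.log_le_log (by linarith) h5
  have hlog0 : 0 ≤ Real.log f := Real.log_nonneg hf1'
  calc _ ≤ 1 * 1 * (2 * √f * (1 + Real.log f)) := by gcongr
    _ ≤ _ := by
      rw [one_mul, one_mul]
      have := Real.sqrt_le_sqrt h5
      gcongr

/-! ### Completion on average over inverses -/

/-- The pairs `(r, h)` with `R < r ≤ 2 R` and `h r` in a given residue class, weighted by the
size of an interval sum with frequency `h`. -/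
theorem exists_sum_weight_le {ε : ℝ} (hε : 0 < ε) :
    ∃ C : ℝ, 1 ≤ C ∧ ∀ Z R S : ℝ, 1 ≤ Z → 0 < R → 0 < S → R ≤ Z → S ≤ Z →
      ∀ (q : ℕ) [NeZero q], (q : ℝ) ≤ 4 * Z ^ 2 → ∀ n : ZMod q,
        ∑ p ∈ (dyadic R ×ˢ univ.filter (fun h : ZMod q => h ≠ 0)).filter
          (fun p => (p.1 : ZMod q) * p.2 = n),
          min (3 * S) (q / |(p.2.valMinAbs : ℝ)|) ≤ C * Z ^ ε * (R + S) := by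
  obtain ⟨C₁, hC₁, hdiv⟩ := exists_card_divisors_le_rpow (show 0 < ε / 6 by positivity)
  obtain ⟨C₂, hC₂, hlog⟩ := log_le_rpow (show 0 < ε / 6 by positivity)
  refine ⟨C₁ * 4 ^ (ε / 6) * (18 * (C₂ * 4 ^ (ε / 6))), ?_, ?_⟩
  · have : (1 : ℝ) ≤ 4 ^ (ε / 6) := Real.one_le_rpow (by norm_num) (by positivity)
    nlinarith [mul_le_mul hC₁ this zero_le_one (by linarith), mul_le_mul hC₂ this zero_le_one (by linarith)]
  intro Z R S hZ hR hS hRZ hSZ q _ hqZ n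
  have hq : 0 < q := Nat.pos_of_ne_zero (NeZero.ne q)
  have hqr : (0 : ℝ) < q := by exact_mod_cast hq
  have hqz : (0 : ℤ) < q := by exact_mod_cast hq
  set P := (dyadic R ×ˢ univ.filter (fun h : ZMod q => h ≠ 0)).filter
          (fun p => (p.1 : ZMod q) * p.2 = n) with hP
  -- With h represented by its least absolute residue, the congruence r h = n says that the integer
  -- k = r h lies in a fixed class modulo q. Thus k is determined by j = ⌊k/q⌋, and the pair (r, h)
  -- is determined by the divisor r of k ≠ 0. Each j therefore has at most τ(k) pairs.
  set kf : ℕ × ZMod q → ℤ := fun p => p.2.valMinAbs * p.1 with hkf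
  set T : ℝ := C₁ * (4 * Z ^ 3) ^ (ε / 6) with hT
  set M : ℕ := ⌊R⌋₊ + 1 with hM
  have hmem : ∀ p ∈ P, (R < p.1 ∧ (p.1 : ℝ) ≤ 2 * R) ∧ p.2.valMinAbs ≠ 0 ∧
      2 * |(p.2.valMinAbs : ℝ)| ≤ q ∧ kf p % q = n.val := by
    intro p hp
    rw [hP, mem_filter, mem_product, mem_filter] at hp
    obtain ⟨⟨h1, -, h2⟩, h3⟩ := hp
    refine ⟨(mem_dyadic hR.le _).mp h1, by simpa [ZMod.valMinAbs_eq_zero] using h2, ?_, ?_⟩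
    · have h1 := ZMod.natAbs_valMinAbs_le p.2
      have h2 : (2 : ℝ) * (p.2.valMinAbs.natAbs : ℝ) ≤ q := by
        have : 2 * p.2.valMinAbs.natAbs ≤ q := by omega
        exact_mod_cast this
      rwa [Nat.cast_natAbs, Int.cast_abs] at h2
    · have h4 : ((kf p : ℤ) : ZMod q) = ((n.val : ℤ) : ZMod q) := by
        rw [hkf]; push_cast
        rw [ZMod.natCast_zmod_val, mul_comm, h3]
      rw [ZMod.intCast_eq_intCast_iff] at h4
      have h5 : kf p % q = (n.val : ℤ) % q := h4
      rw [h5, Int.emod_eq_of_lt (by positivity) (by exact_mod_cast ZMod.val_lt n)]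
  have habs : ∀ p ∈ P, |(kf p : ℝ)| ≤ q * R ∧ 0 < |(kf p : ℝ)| := by
    intro p hp
    obtain ⟨⟨h1, h2⟩, h3, h4, -⟩ := hmem p hp
    rw [hkf]; push_cast
    rw [abs_mul, Nat.abs_cast]
    have : 0 < |(p.2.valMinAbs : ℝ)| := by positivity
    constructor
    · nlinarith
    · have : (0 : ℝ) < p.1 := by linarith
      positivity
  set J : Finset ℤ := Icc (-(M : ℤ)) M with hJ
  have hmap : ∀ p ∈ P, kf p / q ∈ J := by
    intro p hp
    have h1 := (habs p hp).1
    have h2 : (kf p : ℝ) ≤ q * R := (le_abs_self _).trans h1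
    have h3 : -(q * R) ≤ (kf p : ℝ) := by linarith [neg_abs_le (kf p : ℝ)]
    have hfl : R < ⌊R⌋₊ + 1 := Nat.lt_floor_add_one R
    have hMr : R ≤ ((M : ℤ) : ℝ) := by rw [hM]; push_cast; linarith
    rw [hJ, mem_Icc]
    constructor
    · rw [Int.le_ediv_iff_mul_le hqz]
      have : ((-(M : ℤ) * q : ℤ) : ℝ) ≤ kf p := by push_cast at hMr ⊢; nlinarith
      exact_mod_cast this
    · have : kf p ≤ M * q := by
        have : (kf p : ℝ) ≤ ((M * q : ℤ) : ℝ) := by push_cast at hMr ⊢; nlinarith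
        exact_mod_cast this
      have h4 := Int.ediv_le_ediv hqz this
      rwa [Int.mul_ediv_cancel _ hqz.ne'] at h4
  have hT0 : 0 ≤ T := by positivity
  have hfib : ∀ j ∈ J, (((P.filter (fun p => kf p / q = j)).card : ℝ)) ≤ T := by
    intro j _
    rcases (P.filter (fun p => kf p / q = j)).eq_empty_or_nonempty with h0 | ⟨p₀, hp₀⟩
    · rw [h0]; simpa using hT0
    have hk : ∀ p ∈ P.filter (fun p => kf p / q = j), kf p = q * j + n.val := by
      intro p hp
      rw [mem_filter] at hp
      have h1 := Int.mul_ediv_add_emod (kf p) q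
      rw [hp.2, (hmem p hp.1).2.2.2] at h1
      linarith
    have hp₀' := (mem_filter.mp hp₀).1
    set k := kf p₀ with hkk
    have hk0 : k ≠ 0 := by
      have := (habs p₀ hp₀').2
      intro h; rw [← hkk, h] at this; simp at this
    have hle : (P.filter (fun p => kf p / q = j)).card ≤ k.natAbs.divisors.card := by
      refine Finset.card_le_card_of_injOn (fun p => p.1) ?_ ?_
      · intro p hp
        have hp' : kf p = k := by rw [hk p hp, hkk, hk p₀ hp₀]
        simp only [mem_coe, Nat.mem_divisors]
        refine ⟨?_, by simpa using hk0⟩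
        rw [← hp', hkf]; simp only [Int.natAbs_mul, Int.natAbs_natCast]
        exact dvd_mul_left _ _
      · intro p hp p' hp' h
        simp only at h
        have e1 : kf p = kf p' := by rw [hk p hp, hk p' hp']
        have hpos : (0 : ℝ) < p.1 := by
          linarith [(hmem p (mem_filter.mp hp).1).1.1]
        have hpos' : (p.1 : ℤ) ≠ 0 := by
          have : p.1 ≠ 0 := by rintro h0; rw [h0] at hpos; simp at hpos
          exact_mod_cast this
        rw [hkf] at e1; simp only at e1
        rw [← h] at e1
        exact Prod.ext h (ZMod.injective_valMinAbs (mul_right_cancel₀ hpos' e1))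
    calc (((P.filter (fun p => kf p / q = j)).card : ℝ)) ≤ k.natAbs.divisors.card := by
          exact_mod_cast hle
      _ ≤ C₁ * (k.natAbs : ℝ) ^ (ε / 6) := hdiv _ (by simpa using hk0)
      _ ≤ T := by
        rw [hT]
        gcongr
        rw [Nat.cast_natAbs, Int.cast_abs]
        calc |(k : ℝ)| ≤ q * R := (habs p₀ hp₀').1
          _ ≤ 4 * Z ^ 2 * Z := by gcongr
          _ = _ := by ring
  -- For j = 0 and j = −1 the integer k may be close to 0, and the bound 3S is taken. Otherwise |k|
  -- ≥ q|j|/3, so q/|h| = qr/|k| ≤ 6R/|j|, which sums to R times a logarithm.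
  have hwt : ∀ p ∈ P, min (3 * S) (q / |(p.2.valMinAbs : ℝ)|) ≤
      (if kf p / q = 0 ∨ kf p / q = -1 then 3 * S else 0) +
      (if kf p / q ≠ 0 then 6 * R * (1 / |((kf p / q : ℤ) : ℝ)|) else 0) := by
    intro p hp
    obtain ⟨⟨h1, h2⟩, h3, h4, h5⟩ := hmem p hp
    set j := kf p / q with hj
    by_cases hc : j = 0 ∨ j = -1
    · rw [if_pos hc]
      refine (min_le_left _ _).trans ?_
      have : 0 ≤ (if j ≠ 0 then 6 * R * (1 / |((j : ℤ) : ℝ)|) else 0) := by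
        split_ifs <;> positivity
      linarith
    · rw [if_neg hc, if_pos (by tauto), zero_add]
      refine (min_le_right _ _).trans ?_
      have hv : 0 < |(p.2.valMinAbs : ℝ)| := by positivity
      have hj0 : j ≠ 0 := by tauto
      have hjr : 0 < |(j : ℝ)| := by positivity
      have hkj : (q : ℝ) * |(j : ℝ)| ≤ 3 * |(kf p : ℝ)| := by
        have e1 := Int.mul_ediv_add_emod (kf p) q
        have e2 := Int.emod_nonneg (kf p) hqz.ne'
        have e3 := Int.emod_lt_of_pos (kf p) hqz
        rw [← hj] at e1
        have hz : (q : ℤ) * |j| ≤ 3 * |kf p| := by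
          rcases lt_or_ge j 0 with hneg | hpos
          · have hj2 : j ≤ -2 := by omega
            rw [abs_of_neg hneg]
            have : kf p < 0 := by nlinarith
            rw [abs_of_neg this]
            nlinarith
          · rw [abs_of_nonneg hpos]
            have : 0 ≤ kf p := by nlinarith
            rw [abs_of_nonneg this]
            nlinarith
        exact_mod_cast hz
      have hkv : |(kf p : ℝ)| ≤ |(p.2.valMinAbs : ℝ)| * (2 * R) := by
        rw [hkf]; push_cast
        rw [abs_mul, Nat.abs_cast]
        gcongr
      rw [mul_one_div, div_le_div_iff₀ hv hjr]
      nlinarith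
  set f : ℤ → ℝ := fun j => (if j = 0 ∨ j = -1 then 3 * S else 0) +
      (if j ≠ 0 then 6 * R * (1 / |(j : ℝ)|) else 0) with hf
  have hf0 : ∀ j, 0 ≤ f j := by
    intro j; rw [hf]; simp only
    have : 0 ≤ 6 * R * (1 / |(j : ℝ)|) := by positivity
    split_ifs <;> linarith
  have hsumf : ∑ j ∈ J, f j ≤ 6 * S + 12 * R * (1 + Real.log M) := by
    rw [hf, Finset.sum_add_distrib]
    have e1 : ∑ j ∈ J, (if j = 0 ∨ j = -1 then 3 * S else 0) ≤ 6 * S := by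
      rw [← Finset.sum_filter, Finset.sum_const, nsmul_eq_mul]
      have : (J.filter (fun j => j = 0 ∨ j = -1)).card ≤ 2 := by
        refine (Finset.card_le_card (t := {0, -1}) ?_).trans (by simp)
        intro j hj; simp at hj ⊢; exact hj.2
      have : ((J.filter (fun j => j = 0 ∨ j = -1)).card : ℝ) ≤ 2 := by exact_mod_cast this
      nlinarith
    have e2 : ∑ j ∈ J, (if j ≠ 0 then 6 * R * (1 / |(j : ℝ)|) else 0) ≤
        12 * R * (1 + Real.log M) := by
      rw [← Finset.sum_filter, ← Finset.mul_sum]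
      nlinarith [sum_inv_abs_Icc_le M]
    linarith
  have hMlog : 1 + Real.log M ≤ C₂ * (4 ^ (ε / 6) * Z ^ (ε / 6)) := by
    have hM1 : (M : ℝ) ≤ 4 * Z := by
      rw [hM]; push_cast; linarith [Nat.floor_le hR.le]
    have hM0 : (0 : ℝ) < M := by rw [hM]; positivity
    have := hlog (4 * Z) (by linarith)
    rw [Real.mul_rpow (by norm_num) (by linarith)] at this
    linarith [Real.log_le_log hM0 hM1]
  calc ∑ p ∈ P, min (3 * S) (q / |(p.2.valMinAbs : ℝ)|)
      ≤ ∑ p ∈ P, f (kf p / q) := Finset.sum_le_sum hwt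
    _ = ∑ j ∈ J, ∑ p ∈ P.filter (fun p => kf p / q = j), f (kf p / q) :=
        (Finset.sum_fiberwise_of_maps_to hmap _).symm
    _ = ∑ j ∈ J, ((P.filter (fun p => kf p / q = j)).card : ℝ) * f j := by
        refine Finset.sum_congr rfl fun j _ => ?_
        rw [← nsmul_eq_mul, ← Finset.sum_const]
        exact Finset.sum_congr rfl fun p hp => by rw [(mem_filter.mp hp).2]
    _ ≤ ∑ j ∈ J, T * f j := Finset.sum_le_sum fun j hj =>
        mul_le_mul_of_nonneg_right (hfib j hj) (hf0 j)
    _ ≤ T * (6 * S + 12 * R * (1 + Real.log M)) := by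
        rw [← Finset.mul_sum]; gcongr
    _ ≤ T * (18 * (C₂ * (4 ^ (ε / 6) * Z ^ (ε / 6))) * (R + S)) := by
        gcongr
        set Y := C₂ * (4 ^ (ε / 6) * Z ^ (ε / 6)) with hY
        have hY1 : 1 ≤ Y := by
          have a1 : (1 : ℝ) ≤ 4 ^ (ε / 6) := Real.one_le_rpow (by norm_num) (by positivity)
          have a2 : (1 : ℝ) ≤ Z ^ (ε / 6) := Real.one_le_rpow hZ (by positivity)
          rw [hY]
          exact one_le_mul_of_one_le_of_one_le hC₂ (one_le_mul_of_one_le_of_one_le a1 a2)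
        nlinarith [mul_le_mul_of_nonneg_left hMlog hR.le, mul_le_mul_of_nonneg_left hY1 hS.le]
    _ = C₁ * 4 ^ (ε / 6) * (18 * (C₂ * 4 ^ (ε / 6))) * ((Z ^ (3 : ℕ)) ^ (ε / 6) * Z ^ (ε / 6)) *
          (R + S) := by
        rw [hT, Real.mul_rpow (by norm_num) (by positivity)]; ring
    _ ≤ _ := by
        have e : (Z ^ (3 : ℕ)) ^ (ε / 6) * Z ^ (ε / 6) ≤ Z ^ ε := by
          rw [← Real.rpow_natCast, ← Real.rpow_mul (by linarith), ← Real.rpow_add (by linarith)]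
          apply Real.rpow_le_rpow_of_exponent_le hZ
          push_cast; linarith
        gcongr

/-- Completion of a sum over an interval twisted by inverses, on average over the inverses. -/
theorem exists_sum_norm_completion_le {ε : ℝ} (hε : 0 < ε) :
    ∃ C : ℝ, 1 ≤ C ∧ ∀ Z R S : ℝ, 1 ≤ Z → 0 < R → 0 < S → R ≤ Z → S ≤ Z →
      ∀ (q : ℕ) [NeZero q], (q : ℝ) ≤ 4 * Z ^ 2 → ∀ F : ZMod q → ℂ,
        ∑ r ∈ (dyadic R).filter (fun r => r.Coprime q),
          ‖∑ s ∈ dyadic S, F ((r : ZMod q)⁻¹ * s) - ((dyadic S).card / q : ℂ) * ∑ x, F x‖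
        ≤ C * Z ^ ε * (√(R * S) + R) * √(∑ x, ‖F x‖ ^ 2) := by
  obtain ⟨C₁, hC₁, hw⟩ := exists_sum_weight_le hε
  obtain ⟨C₂, hC₂, hlog⟩ := log_le_rpow (show 0 < ε / 2 by positivity)
  refine ⟨C₁ * (6 * (C₂ * 4 ^ (ε / 2))), ?_, ?_⟩
  · have : (1 : ℝ) ≤ 4 ^ (ε / 2) := Real.one_le_rpow (by norm_num) (by positivity)
    nlinarith [mul_le_mul hC₂ this zero_le_one (by linarith)]
  intro Z R S hZ hR hS hRZ hSZ q _ hqZ F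
  have hq : 0 < q := Nat.pos_of_ne_zero (NeZero.ne q)
  have hqr : (0 : ℝ) < q := by exact_mod_cast hq
  set Λ : ZMod q → ℝ := fun h => min (3 * S) (q / |(h.valMinAbs : ℝ)|) with hΛ
  have hΛ0 : ∀ h, 0 ≤ Λ h := fun h => by rw [hΛ]; positivity
  set H := univ.filter (fun h : ZMod q => h ≠ 0) with hH
  set Q := dyadic R ×ˢ H with hQ
  have hΛle : ∀ h ∈ H, ‖intervalCharSum (dyadic S) h‖ ≤ Λ h := by
    intro h hh
    refine le_min ((norm_intervalCharSum_le_card _ _).trans (card_dyadic_le hS.le)) ?_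
    exact norm_intervalCharSum_le _ _ h (mem_filter.mp hh).2
  have hstep : ∀ r ∈ (dyadic R).filter (fun r => r.Coprime q),
      ‖∑ s ∈ dyadic S, F ((r : ZMod q)⁻¹ * s) - ((dyadic S).card / q : ℂ) * ∑ x, F x‖ ≤
        (q : ℝ)⁻¹ * ∑ h ∈ H, Λ h * ‖ZMod.dft F (r * h)‖ := by
    intro r hr
    have hrc := (mem_filter.mp hr).2
    have h1 := sum_interval_sub_mean (dyadic S) (fun x => F ((r : ZMod q)⁻¹ * x))
    rw [sum_comp_inv_mul F hrc] at h1
    rw [h1, norm_mul, norm_inv, Complex.norm_natCast]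
    gcongr
    refine (norm_sum_le _ _).trans (Finset.sum_le_sum fun h hh => ?_)
    rw [norm_mul, dft_comp_inv_mul F hrc, mul_comm]
    exact mul_le_mul_of_nonneg_right (hΛle h hh) (norm_nonneg _)
  have hsum1 : ∑ r ∈ (dyadic R).filter (fun r => r.Coprime q),
      ‖∑ s ∈ dyadic S, F ((r : ZMod q)⁻¹ * s) - ((dyadic S).card / q : ℂ) * ∑ x, F x‖ ≤
      (q : ℝ)⁻¹ * ∑ p ∈ Q, Λ p.2 * ‖ZMod.dft F (p.1 * p.2)‖ := by
    refine (Finset.sum_le_sum hstep).trans ?_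
    rw [← Finset.mul_sum, hQ, Finset.sum_product]
    refine mul_le_mul_of_nonneg_left ?_ (by positivity)
    refine Finset.sum_le_sum_of_subset_of_nonneg (Finset.filter_subset _ _) fun r _ _ => ?_
    exact Finset.sum_nonneg fun h _ => mul_nonneg (hΛ0 h) (norm_nonneg _)
  have hA : ∑ p ∈ Q, Λ p.2 ≤ 3 * R * (q * (2 * (1 + Real.log q))) := by
    rw [hQ, Finset.sum_product]
    simp only [Finset.sum_const, nsmul_eq_mul]
    have : ∑ h ∈ H, Λ h ≤ q * (2 * (1 + Real.log q)) := by
      calc ∑ h ∈ H, Λ h ≤ ∑ h ∈ H, q * (1 / |(h.valMinAbs : ℝ)|) :=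
            Finset.sum_le_sum fun h _ => by rw [mul_one_div]; exact min_le_right _ _
        _ ≤ _ := by rw [← Finset.mul_sum]; gcongr; exact sum_inv_valMinAbs_le
    exact mul_le_mul (card_dyadic_le hR.le) this (Finset.sum_nonneg fun h _ => hΛ0 h) (by positivity)
  have hB : ∑ p ∈ Q, Λ p.2 * ‖ZMod.dft F (p.1 * p.2)‖ ^ 2 ≤
      C₁ * Z ^ ε * (R + S) * (q * ∑ x, ‖F x‖ ^ 2) := by
    rw [← sum_norm_sq_dft, Finset.mul_sum,
      ← Finset.sum_fiberwise Q (fun p => (p.1 : ZMod q) * p.2)]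
    refine Finset.sum_le_sum fun n _ => ?_
    calc ∑ p ∈ Q.filter (fun p => (p.1 : ZMod q) * p.2 = n), Λ p.2 * ‖ZMod.dft F (p.1 * p.2)‖ ^ 2
        = (∑ p ∈ Q.filter (fun p => (p.1 : ZMod q) * p.2 = n), Λ p.2) * ‖ZMod.dft F n‖ ^ 2 := by
          rw [Finset.sum_mul]
          exact Finset.sum_congr rfl fun p hp => by rw [(mem_filter.mp hp).2]
      _ ≤ _ := by
          gcongr
          exact hw Z R S hZ hR hS hRZ hSZ q hqZ n
  -- The weight is shared by the two factors of Cauchy–Schwarz. The plain sum of weights is about Rq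
  -- up to a logarithm; the other sum is grouped by n = r h, where the preceding weight bound holds
  -- uniformly in n and Parseval applies.
  have hCS : (∑ p ∈ Q, Λ p.2 * ‖ZMod.dft F (p.1 * p.2)‖) ^ 2 ≤
      (∑ p ∈ Q, Λ p.2) * ∑ p ∈ Q, Λ p.2 * ‖ZMod.dft F (p.1 * p.2)‖ ^ 2 := by
    refine Finset.sum_sq_le_sum_mul_sum_of_sq_le_mul _ (fun p _ => hΛ0 _)
      (fun p _ => mul_nonneg (hΛ0 _) (by positivity)) (fun p _ => le_of_eq (by ring))
  have hlogq : 1 + Real.log q ≤ 2 * (C₂ * 4 ^ (ε / 2)) * Z ^ ε := by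
    have h1 : (1 : ℝ) ≤ q := by exact_mod_cast hq
    have h2 : Real.log q ≤ Real.log (4 * Z ^ 2) := Real.log_le_log hqr hqZ
    have h3 := hlog (4 * Z ^ 2) (by nlinarith)
    have h4 : (4 * Z ^ 2) ^ (ε / 2) = 4 ^ (ε / 2) * Z ^ ε := by
      rw [Real.mul_rpow (by norm_num) (by positivity), ← Real.rpow_natCast Z 2,
        ← Real.rpow_mul (by linarith)]
      congr 2; push_cast; ring
    rw [h4] at h3
    have : 0 ≤ C₂ * 4 ^ (ε / 2) * Z ^ ε := by positivity
    linarith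
  have hZe : 0 < Z ^ ε := by positivity
  refine hsum1.trans ?_
  rw [inv_mul_le_iff₀ hqr]
  set Φ := ∑ x, ‖F x‖ ^ 2 with hΦ
  have hΦ0 : 0 ≤ Φ := by positivity
  refine abs_le_of_sq_le_sq' (hCS.trans ?_) (by positivity) |>.2
  have e1 : (√(R * S) + R) ^ 2 ≥ R * (R + S) := by
    have := Real.sq_sqrt (show 0 ≤ R * S by positivity)
    nlinarith [Real.sqrt_nonneg (R * S)]
  have e2 : √Φ ^ 2 = Φ := Real.sq_sqrt hΦ0
  have c1 : 1 ≤ C₂ * 4 ^ (ε / 2) := by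
    have : (1 : ℝ) ≤ 4 ^ (ε / 2) := Real.one_le_rpow (by norm_num) (by positivity)
    nlinarith [mul_le_mul hC₂ this zero_le_one (by linarith)]
  set c := C₂ * 4 ^ (ε / 2) with hc
  have hsq : ∀ a b : ℝ, 1 ≤ a → 1 ≤ b → 12 * a * b ≤ (b * (6 * a)) ^ 2 := by
    intro a b ha hb
    have h1 : 1 ≤ a * b := one_le_mul_of_one_le_of_one_le ha hb
    nlinarith
  calc (∑ p ∈ Q, Λ p.2) * ∑ p ∈ Q, Λ p.2 * ‖ZMod.dft F (p.1 * p.2)‖ ^ 2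
      ≤ (3 * R * (q * (2 * (2 * c * Z ^ ε)))) * (C₁ * Z ^ ε * (R + S) * (q * Φ)) := by
        refine mul_le_mul (hA.trans ?_) hB
          (Finset.sum_nonneg fun p _ => mul_nonneg (hΛ0 _) (by positivity)) (by positivity)
        gcongr
    _ = (12 * c * C₁) * ((Z ^ ε) ^ 2 * (R * (R + S)) * (q ^ 2 * Φ)) := by ring
    _ ≤ (C₁ * (6 * c)) ^ 2 * ((Z ^ ε) ^ 2 * ((√(R * S) + R) ^ 2) * (q ^ 2 * Φ)) := by
        have := hsq c C₁ c1 hC₁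
        gcongr
    _ = (q * (C₁ * (6 * c) * Z ^ ε * (√(R * S) + R) * √Φ)) ^ 2 := by
        rw [← e2]; simp only [Real.sqrt_sq_eq_abs, abs_of_nonneg (Real.sqrt_nonneg Φ)]; ring

/-! ### The extended Jacobi symbol and its two characters -/

/-- The odd part of a natural number. -/
def oddPart (d : ℕ) : ℕ := d / 2 ^ d.factorization 2

theorem oddPart_mul (a b : ℕ) : oddPart (a * b) = oddPart a * oddPart b := Nat.ordCompl_mul a b 2

theorem odd_oddPart {d : ℕ} (hd : d ≠ 0) : Odd (oddPart d) := by
  rw [← Nat.not_even_iff_odd, even_iff_two_dvd]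
  exact Nat.not_dvd_ordCompl Nat.prime_two hd

theorem oddPart_dvd (d : ℕ) : oddPart d ∣ d := Nat.ordCompl_dvd d 2

theorem oddPart_ne_zero {d : ℕ} (hd : d ≠ 0) : oddPart d ≠ 0 := (Nat.ordCompl_pos 2 hd).ne'

theorem oddPart_of_odd {d : ℕ} (hd : Odd d) : oddPart d = d := by
  rw [oddPart, Nat.factorization_eq_zero_of_not_dvd (by
    rw [← even_iff_two_dvd, Nat.not_even_iff_odd]; exact hd)]
  simp

theorem two_pow_mul_oddPart (d : ℕ) : 2 ^ d.factorization 2 * oddPart d = d :=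
  Nat.ordProj_mul_ordCompl_eq_self d 2

theorem extJacobi_eq (a : ℤ) (d : ℕ) : extJacobi a d = jacobiSym a (oddPart d) := rfl

/-- The extended Jacobi symbol, set to zero at arguments that are not coprime. -/
def symb (r d : ℕ) : ℤ := if r.Coprime d then extJacobi r d else 0

theorem symb_of_coprime {r d : ℕ} (h : r.Coprime d) : symb r d = jacobiSym r (oddPart d) := by
  rw [symb, if_pos h, extJacobi_eq]

theorem symb_of_not_coprime {r d : ℕ} (h : ¬ r.Coprime d) : symb r d = 0 := if_neg h

theorem symb_mul_left (r₁ r₂ d : ℕ) : symb (r₁ * r₂) d = symb r₁ d * symb r₂ d := by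
  by_cases h₁ : r₁.Coprime d
  · by_cases h₂ : r₂.Coprime d
    · rw [symb_of_coprime h₁, symb_of_coprime h₂, symb_of_coprime (Nat.Coprime.mul_left h₁ h₂)]
      push_cast; exact jacobiSym.mul_left _ _ _
    · rw [symb_of_not_coprime h₂, symb_of_not_coprime (fun h => h₂ (Nat.Coprime.coprime_mul_left h)),
        mul_zero]
  · rw [symb_of_not_coprime h₁, symb_of_not_coprime (fun h => h₁ (Nat.Coprime.coprime_mul_right h)),
      zero_mul]

theorem symb_mul_right (r : ℕ) {d₁ d₂ : ℕ} (hd₁ : d₁ ≠ 0) (hd₂ : d₂ ≠ 0) :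
    symb r (d₁ * d₂) = symb r d₁ * symb r d₂ := by
  by_cases h₁ : r.Coprime d₁
  · by_cases h₂ : r.Coprime d₂
    · rw [symb_of_coprime h₁, symb_of_coprime h₂, symb_of_coprime (Nat.Coprime.mul_right h₁ h₂),
        oddPart_mul, jacobiSym.mul_right' _ (oddPart_ne_zero hd₁) (oddPart_ne_zero hd₂)]
    · rw [symb_of_not_coprime h₂,
        symb_of_not_coprime (fun h => h₂ (Nat.Coprime.coprime_mul_left_right h)), mul_zero]
  · rw [symb_of_not_coprime h₁,
      symb_of_not_coprime (fun h => h₁ (Nat.Coprime.coprime_mul_right_right h)), zero_mul]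

theorem symb_eq_one_or {r d : ℕ} (h : r.Coprime d) : symb r d = 1 ∨ symb r d = -1 := by
  rw [symb_of_coprime h]
  apply jacobiSym.eq_one_or_neg_one
  exact_mod_cast Nat.Coprime.coprime_dvd_right (oddPart_dvd d) h

theorem symb_mul_self {r d : ℕ} (h : r.Coprime d) : symb r d * symb r d = 1 := by
  rcases symb_eq_one_or h with h | h <;> rw [h] <;> rfl

theorem abs_symb_le_one (r d : ℕ) : |symb r d| ≤ 1 := by
  by_cases h : r.Coprime d
  · rcases symb_eq_one_or h with h | h <;> rw [h] <;> simp
  · rw [symb_of_not_coprime h]; simp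

theorem norm_symb_le_one (r d : ℕ) : ‖(symb r d : ℂ)‖ ≤ 1 := by
  rw [Complex.norm_intCast]; exact_mod_cast abs_symb_le_one r d

theorem symb_congr {r r' d : ℕ} (h : r ≡ r' [MOD d]) : symb r d = symb r' d := by
  have hc : r.Coprime d ↔ r'.Coprime d := by
    rw [Nat.coprime_iff_gcd_eq_one, Nat.coprime_iff_gcd_eq_one, h.gcd_eq]
  by_cases h₁ : r.Coprime d
  · rw [symb_of_coprime h₁, symb_of_coprime (hc.mp h₁)]
    apply jacobiSym.mod_left'
    have := h.of_dvd (oddPart_dvd d)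
    exact_mod_cast this
  · rw [symb_of_not_coprime h₁, symb_of_not_coprime (fun h => h₁ (hc.mpr h))]

theorem symb_one (d : ℕ) : symb 1 d = 1 := by
  rw [symb_of_coprime (Nat.coprime_one_left d)]; exact_mod_cast jacobiSym.one_left _

/-- The Dirichlet character given by the extended Jacobi symbol in its numerator. -/
noncomputable def symbChar (q : ℕ) [NeZero q] : DirichletCharacter ℂ q where
  toFun x := (symb x.val q : ℂ)
  map_one' := by
    have h : ((1 : ZMod q).val) ≡ 1 [MOD q] := by
      rw [← ZMod.natCast_eq_natCast_iff, ZMod.natCast_zmod_val, Nat.cast_one]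
    rw [symb_congr h, symb_one]; simp
  map_mul' x y := by
    have h : (x * y).val ≡ x.val * y.val [MOD q] := by
      rw [← ZMod.natCast_eq_natCast_iff]; simp
    rw [symb_congr h, symb_mul_left]; push_cast; rfl
  map_nonunit' x hx := by
    rw [symb_of_not_coprime]
    · simp
    · intro h
      apply hx
      have := (ZMod.isUnit_iff_coprime x.val q).mpr h
      rwa [ZMod.natCast_zmod_val] at this

theorem symbChar_natCast (q : ℕ) [NeZero q] (r : ℕ) : symbChar q (r : ZMod q) = symb r q := by
  change ((symb (r : ZMod q).val q : ℤ) : ℂ) = _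
  rw [symb_congr]
  rw [← ZMod.natCast_eq_natCast_iff, ZMod.natCast_zmod_val]

/-- A non-square odd modulus has a non-residue for the Jacobi symbol that is `1` modulo `8`. -/
theorem exists_jacobiSym_eq_neg_one {n : ℕ} (hn : Odd n) (hsq : ¬ IsSquare n) :
    ∃ x : ℕ, x % 8 = 1 ∧ x.Coprime n ∧ jacobiSym x n = -1 := by
  have hn0 : n ≠ 0 := by rintro rfl; simp at hn
  -- Write n = b²a with a squarefree and greater than 1, and pick a prime p ∣ a; p divides a exactly
  -- once.
  obtain ⟨a, b, hab, ha⟩ := Nat.sq_mul_squarefree n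
  have ha1 : a ≠ 1 := by
    rintro rfl
    exact hsq ⟨b, by rw [← hab]; ring⟩
  obtain ⟨p, hp, hpa⟩ := Nat.exists_prime_and_dvd ha1
  obtain ⟨a', rfl⟩ := hpa
  have hpn : p ∣ n := by rw [← hab]; exact dvd_mul_of_dvd_right (dvd_mul_right _ _) _
  have hp2 : p ≠ 2 := by
    rintro rfl
    exact (Nat.not_even_iff_odd.mpr hn) (even_iff_two_dvd.mpr hpn)
  have : Fact p.Prime := ⟨hp⟩
  have hpa' : ¬ p ∣ a' := by
    rintro ⟨c, rfl⟩
    have := ha p ⟨c, by ring⟩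
    exact hp.one_lt.ne' (Nat.isUnit_iff.mp this)
  obtain ⟨u, hu⟩ := FiniteField.exists_nonsquare (F := ZMod p) (by rw [ZMod.ringChar_zmod_n]; exact hp2)
  -- By the Chinese remainder theorem x is a non-residue modulo p and 1 modulo the part of 8n prime
  -- to p. Then b² and a/p contribute 1 to the symbol, and p contributes −1.
  set N := ordCompl[p] (8 * n) with hN
  have h8n : 8 * n ≠ 0 := by omega
  have hcop : p.Coprime N := Nat.coprime_ordCompl hp h8n
  obtain ⟨x, hx1, hx2⟩ := Nat.chineseRemainder hcop u.val 1
  have hdvdN : ∀ m, m ∣ 8 * n → ¬ p ∣ m → m ∣ N := by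
    intro m hm hpm
    have : m ∣ ordProj[p] (8 * n) * N := by rwa [Nat.ordProj_mul_ordCompl_eq_self]
    refine Nat.Coprime.dvd_of_dvd_mul_left ?_ this
    exact Nat.Coprime.pow_right _ ((Nat.Prime.coprime_iff_not_dvd hp).mpr hpm).symm
  have hp8 : ¬ p ∣ 8 := by
    intro h
    have : p ∣ 2 ^ 3 := by simpa using h
    exact hp2 ((Nat.prime_dvd_prime_iff_eq hp Nat.prime_two).mp (hp.dvd_of_dvd_pow this))
  have hxp : jacobiSym x p = -1 := by
    rw [← jacobiSym.legendreSym.to_jacobiSym, legendreSym.eq_neg_one_iff]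
    have : ((x : ℤ) : ZMod p) = u := by
      push_cast
      rw [← ZMod.natCast_zmod_val u]
      exact (ZMod.natCast_eq_natCast_iff _ _ _).mpr hx1
    rw [this]; exact hu
  have hxmod : ∀ m, m ∣ N → x ≡ 1 [MOD m] := fun m hm => hx2.of_dvd hm
  have hxcop : x.Coprime n := by
    apply Nat.Coprime.symm
    rw [Nat.coprime_iff_gcd_eq_one]
    by_contra hne
    obtain ⟨l, hl, hld⟩ := Nat.exists_prime_and_dvd hne
    have hln : l ∣ n := hld.trans (Nat.gcd_dvd_left _ _)
    have hlx : l ∣ x := hld.trans (Nat.gcd_dvd_right _ _)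
    by_cases hlp : l = p
    · subst hlp
      have : jacobiSym x l = 0 := by
        rw [jacobiSym.eq_zero_iff]
        refine ⟨hl.ne_zero, ?_⟩
        simp only [Int.gcd_natCast_natCast]
        rw [Nat.gcd_eq_right hlx]; exact hl.one_lt.ne'
      rw [this] at hxp; simp at hxp
    · have hpl : ¬ p ∣ l := fun h => hlp ((Nat.prime_dvd_prime_iff_eq hp hl).mp h).symm
      have h1 := hxmod l (hdvdN l (dvd_mul_of_dvd_right hln _) hpl)
      have h2 : x ≡ 0 [MOD l] := (Nat.modEq_zero_iff_dvd).mpr hlx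
      have h3 := (h1.symm.trans h2)
      rw [Nat.modEq_zero_iff_dvd] at h3
      exact hl.one_lt.ne' (Nat.dvd_one.mp h3)
  refine ⟨x, ?_, hxcop, ?_⟩
  · exact hxmod 8 (hdvdN 8 (dvd_mul_right _ _) hp8)
  · have hb0 : b ^ 2 ≠ 0 := by rintro h; rw [h, zero_mul] at hab; exact hn0 hab.symm
    have ha0 : a' ≠ 0 := by rintro rfl; simp at hab; exact hn0 hab.symm
    rw [← hab, jacobiSym.mul_right' _ hb0 (mul_ne_zero hp.ne_zero ha0),
      jacobiSym.mul_right' _ hp.ne_zero ha0, jacobiSym.pow_right, hxp]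
    have hxb : x.Coprime b := Nat.Coprime.coprime_dvd_right
      ((dvd_pow_self b two_ne_zero).trans ⟨p * a', hab.symm⟩) hxcop
    rw [jacobiSym.sq_one (by exact_mod_cast hxb)]
    have : jacobiSym x a' = 1 := by
      rw [← jacobiSym.one_left a']
      apply jacobiSym.mod_left'
      have := hxmod a' (hdvdN a' (dvd_mul_of_dvd_right
        (by rw [← hab]; exact dvd_mul_of_dvd_right (dvd_mul_left _ _) _) _) hpa')
      exact_mod_cast this
    rw [this]; norm_num

theorem symbChar_ne_one {q : ℕ} [NeZero q] (hq : ¬ IsSquare (oddPart q)) : symbChar q ≠ 1 := by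
  intro h
  obtain ⟨x, hx8, hxc, hxj⟩ := exists_jacobiSym_eq_neg_one (odd_oddPart (NeZero.ne q)) hq
  have hxq : x.Coprime q := by
    rw [← two_pow_mul_oddPart q]
    refine Nat.Coprime.mul_right (Nat.Coprime.pow_right _ ?_) hxc
    rw [Nat.coprime_two_right, Nat.odd_iff]; omega
  have h1 : symbChar q (x : ZMod q) = 1 := by
    rw [h]; exact MulChar.one_apply ((ZMod.isUnit_iff_coprime x q).mpr hxq)
  rw [symbChar_natCast, symb_of_coprime hxq, hxj] at h1
  norm_num at h1

/-- The Dirichlet character given by the Jacobi symbol in its denominator. -/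
noncomputable def denomChar (r : ℕ) [NeZero r] : DirichletCharacter ℂ (4 * r) where
  -- For odd denominators the Jacobi symbol has period 4r; the value 0 at even arguments makes it a
  -- character modulo 4r.
  toFun x := if Odd x.val then (jacobiSym r x.val : ℂ) else 0
  map_one' := by
    have : Fact (1 < 4 * r) := ⟨by have := Nat.pos_of_ne_zero (NeZero.ne r); omega⟩
    rw [ZMod.val_one]; simp
  map_mul' x y := by
    have h2 : ∀ m : ℕ, Odd (m % (4 * r)) ↔ Odd m := by
      intro m
      rw [Nat.odd_iff, Nat.odd_iff, Nat.mod_mod_of_dvd _ ⟨2 * r, by ring⟩]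
    rw [ZMod.val_mul]
    by_cases hx : Odd x.val
    · by_cases hy : Odd y.val
      · rw [if_pos hx, if_pos hy, if_pos ((h2 _).mpr (hx.mul hy)),
          ← jacobiSym.mod_right' r (hx.mul hy),
          jacobiSym.mul_right' _ (Nat.pos_of_ne_zero (by rintro h; rw [h] at hx; simp at hx)).ne'
            (Nat.pos_of_ne_zero (by rintro h; rw [h] at hy; simp at hy)).ne']
        push_cast; rfl
      · rw [if_neg hy, if_neg (fun h => hy (Nat.odd_mul.mp ((h2 _).mp h)).2), mul_zero]
    · rw [if_neg hx, if_neg (fun h => hx (Nat.odd_mul.mp ((h2 _).mp h)).1), zero_mul]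
  map_nonunit' x hx := by
    by_cases ho : Odd x.val
    · rw [if_pos ho]
      have hx0 : x.val ≠ 0 := by rintro h; rw [h] at ho; simp at ho
      have : jacobiSym r x.val = 0 := by
        rw [jacobiSym.eq_zero_iff]
        refine ⟨hx0, fun h => hx ?_⟩
        have hc : x.val.Coprime (4 * r) := by
          refine Nat.Coprime.mul_right ?_ ?_
          · exact Nat.Coprime.pow_right 2 (Nat.coprime_two_right.mpr ho)
          · rw [Nat.coprime_comm, Nat.coprime_iff_gcd_eq_one]; exact_mod_cast h
        have := (ZMod.isUnit_iff_coprime x.val (4 * r)).mpr hc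
        rwa [ZMod.natCast_zmod_val] at this
      rw [this]; simp
    · rw [if_neg ho]

theorem denomChar_natCast (r : ℕ) [NeZero r] (n : ℕ) :
    denomChar r (n : ZMod (4 * r)) = if Odd n then (symb r n : ℂ) else 0 := by
  change (if Odd (n : ZMod (4 * r)).val then (jacobiSym r (n : ZMod (4 * r)).val : ℂ) else 0) = _
  rw [ZMod.val_natCast]
  have h2 : Odd (n % (4 * r)) ↔ Odd n := by
    rw [Nat.odd_iff, Nat.odd_iff, Nat.mod_mod_of_dvd _ ⟨2 * r, by ring⟩]
  by_cases hn : Odd n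
  · rw [if_pos hn, if_pos (h2.mpr hn), ← jacobiSym.mod_right' r hn]
    by_cases hc : r.Coprime n
    · rw [symb_of_coprime hc, oddPart_of_odd hn]
    · rw [symb_of_not_coprime hc, jacobiSym.eq_zero_iff.mpr]
      refine ⟨by rintro rfl; simp at hn, fun h => hc ?_⟩
      rw [Nat.coprime_iff_gcd_eq_one]; exact_mod_cast h
  · rw [if_neg hn, if_neg (fun h => hn (h2.mp h))]

/-- The witness x ≡ 1 (mod 8) has (2/x) = 1 and passes through reciprocity without sign, so (r/x)
equals the symbol of x over the odd part of r, which is −1. -/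
theorem denomChar_ne_one {r : ℕ} [NeZero r] (hr : ¬ IsSquare (oddPart r)) : denomChar r ≠ 1 := by
  intro h
  obtain ⟨x, hx8, hxc, hxj⟩ := exists_jacobiSym_eq_neg_one (odd_oddPart (NeZero.ne r)) hr
  have hxo : Odd x := by rw [Nat.odd_iff]; omega
  have hxr : x.Coprime r := by
    rw [← two_pow_mul_oddPart r]
    exact Nat.Coprime.mul_right (Nat.Coprime.pow_right _ (Nat.coprime_two_right.mpr hxo)) hxc
  have hx4 : x.Coprime (4 * r) := by
    refine Nat.Coprime.mul_right ?_ hxr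
    rw [show 4 = 2 ^ 2 by norm_num]
    exact Nat.Coprime.pow_right _ (Nat.coprime_two_right.mpr hxo)
  have h1 : denomChar r (x : ZMod (4 * r)) = 1 := by
    rw [h]; exact MulChar.one_apply ((ZMod.isUnit_iff_coprime x (4 * r)).mpr hx4)
  rw [denomChar_natCast, if_pos hxo, symb_of_coprime hxr.symm, oddPart_of_odd hxo] at h1
  have h2 : jacobiSym r x = -1 := by
    conv_lhs => rw [← two_pow_mul_oddPart r]
    push_cast
    rw [jacobiSym.mul_left, jacobiSym.pow_left, jacobiSym.at_two hxo, ZMod.χ₈_nat_mod_eight, hx8,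
      jacobiSym.quadratic_reciprocity_one_mod_four' (odd_oddPart (NeZero.ne r)) (by omega), hxj]
    have : ZMod.χ₈ ((1 : ℕ) : ZMod 8) = 1 := by decide
    rw [this]; simp
  rw [h2] at h1; norm_num at h1

/-- Numbers whose product with a fixed number is a square up to powers of two are sparse. -/
theorem card_isSquare_oddPart_mul_le {d₁ : ℕ} (hd₁ : d₁ ≠ 0) {D : ℝ} (hD : 0 ≤ D) :
    (((dyadic D).filter (fun d => IsSquare (oddPart (d₁ * d)))).card : ℝ) ≤ 3 * √D := by
  obtain ⟨k, a, hka, hk⟩ := Nat.sq_mul_squarefree (oddPart d₁)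
  have ho1 := oddPart_ne_zero hd₁
  have ha0 : a ≠ 0 := by rintro rfl; simp at hka; exact ho1 hka.symm
  have hk0 : k ≠ 0 := by rintro rfl; simp at hka; exact ho1 hka.symm
  -- If `k` is the squarefree kernel of the odd part of `d₁`, the odd part of d is k times a square.
  -- The even part of 2^v joins the square and one factor 2 may remain, so d = 2^j k c² with j < 2
  -- and c ≤ √(2D).
  have hform : ∀ d ∈ (dyadic D).filter (fun d => IsSquare (oddPart (d₁ * d))),
      ∃ c j : ℕ, j < 2 ∧ 1 ≤ c ∧ d = 2 ^ j * (k * c ^ 2) := by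
    intro d hd
    rw [mem_filter] at hd
    have hd0 : d ≠ 0 := by
      have := ((mem_dyadic hD d).mp hd.1).1
      rintro rfl; simp at this; linarith
    obtain ⟨e, he⟩ := hd.2
    rw [oddPart_mul, ← hka] at he
    have hae : a ∣ e := by
      rw [← Nat.pow_dvd_pow_iff (n := 2) two_ne_zero]
      exact ⟨k * oddPart d, by rw [sq e, ← he]; ring⟩
    obtain ⟨e', rfl⟩ := hae
    have h1 : k * oddPart d = e' ^ 2 := by
      have h3 : a ^ 2 * (k * oddPart d) = a ^ 2 * e' ^ 2 := by linarith
      exact Nat.eq_of_mul_eq_mul_left (by positivity) h3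
    have hke : k ∣ e' := (hk.dvd_pow_iff_dvd two_ne_zero).mp ⟨oddPart d, h1.symm⟩
    obtain ⟨b, rfl⟩ := hke
    have h2 : oddPart d = k * b ^ 2 := by
      have : k * oddPart d = k * (k * b ^ 2) := by rw [h1]; ring
      exact Nat.eq_of_mul_eq_mul_left (Nat.pos_of_ne_zero hk0) this
    have hb0 : b ≠ 0 := by
      rintro rfl
      exact oddPart_ne_zero hd0 (by rw [h2]; simp)
    set v := d.factorization 2 with hv
    refine ⟨2 ^ (v / 2) * b, v % 2, Nat.mod_lt _ two_pos, Nat.pos_of_ne_zero (by positivity), ?_⟩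
    conv_lhs => rw [← two_pow_mul_oddPart d, h2, ← hv, ← Nat.mod_add_div v 2]
    rw [pow_add, mul_pow, ← pow_mul, mul_comm 2 (v / 2)]; ring
  rcases lt_or_ge D (1 / 2) with hDs | hDs
  · have : dyadic D = ∅ := by
      rw [dyadic, Nat.floor_eq_zero.mpr (show 2 * D < 1 by linarith)]; simp
    rw [this]; simp
  choose! c j hj hc hd using hform
  set n := ⌊√(2 * D)⌋₊ with hn
  have hcard : ((dyadic D).filter (fun d => IsSquare (oddPart (d₁ * d)))).card ≤
      (Icc 1 n ×ˢ range 2).card := by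
    refine Finset.card_le_card_of_injOn (fun d => (c d, j d)) ?_ ?_
    · intro d hdm
      have hdm' := (mem_filter.mp hdm).1
      have hle := ((mem_dyadic hD d).mp hdm').2
      simp only [coe_product, Set.mem_prod, mem_coe, mem_Icc, mem_range]
      refine ⟨⟨hc d hdm, ?_⟩, hj d hdm⟩
      apply Nat.le_floor
      apply Real.le_sqrt_of_sq_le
      refine le_trans ?_ hle
      have : c d ^ 2 ≤ d := by
        conv_rhs => rw [hd d hdm]
        calc c d ^ 2 = 1 * (1 * c d ^ 2) := by ring
          _ ≤ 2 ^ j d * (k * c d ^ 2) := by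
            gcongr
            · exact Nat.one_le_two_pow
            · exact Nat.pos_of_ne_zero hk0
      exact_mod_cast this
    · intro d hdm d' hdm' h
      simp only [Prod.mk.injEq] at h
      rw [hd d hdm, hd d' hdm', h.1, h.2]
  calc (((dyadic D).filter (fun d => IsSquare (oddPart (d₁ * d)))).card : ℝ)
      ≤ ((Icc 1 n ×ˢ range 2).card : ℝ) := by exact_mod_cast hcard
    _ = 2 * n := by rw [card_product, Nat.card_Icc, card_range, Nat.add_sub_cancel]; push_cast; ring
    _ ≤ 2 * √(2 * D) := by gcongr; exact Nat.floor_le (Real.sqrt_nonneg _)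
    _ ≤ 3 * √D := by
        rw [Real.sqrt_mul (by norm_num)]
        have : √2 ≤ 3 / 2 := by
          rw [Real.sqrt_le_left (by norm_num)]; norm_num
        nlinarith [Real.sqrt_nonneg D]

/-! ### Bilinear forms in the symbol -/

/-- A bound for the Gram matrix of the columns bounds the quadratic form. -/
theorem sum_norm_sq_le_of_gram {ι κ : Type*} (s : Finset ι) (t : Finset κ) (θ : ι → κ → ℂ)
    (G : κ → κ → ℝ) {M : ℝ} (hsymm : ∀ j j', G j j' = G j' j)
    (hG : ∀ j ∈ t, ∀ j' ∈ t, ‖∑ i ∈ s, θ i j * (starRingEnd ℂ) (θ i j')‖ ≤ G j j')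
    (hrow : ∀ j ∈ t, ∑ j' ∈ t, G j j' ≤ M) (c : κ → ℂ) :
    ∑ i ∈ s, ‖∑ j ∈ t, c j * θ i j‖ ^ 2 ≤ M * ∑ j ∈ t, ‖c j‖ ^ 2 := by
  have h1 : ((∑ i ∈ s, ‖∑ j ∈ t, c j * θ i j‖ ^ 2 : ℝ) : ℂ) =
      ∑ j ∈ t, ∑ j' ∈ t, c j * (starRingEnd ℂ) (c j') *
        ∑ i ∈ s, θ i j * (starRingEnd ℂ) (θ i j') := by
    push_cast
    have : ∀ i ∈ s, ((‖∑ j ∈ t, c j * θ i j‖ : ℝ) : ℂ) ^ 2 =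
        ∑ j ∈ t, ∑ j' ∈ t, c j * (starRingEnd ℂ) (c j') * (θ i j * (starRingEnd ℂ) (θ i j')) := by
      intro i _
      rw [← Complex.mul_conj', map_sum, Finset.sum_mul_sum]
      refine Finset.sum_congr rfl fun j _ => Finset.sum_congr rfl fun j' _ => ?_
      rw [map_mul]; ring
    rw [Finset.sum_congr rfl this, Finset.sum_comm]
    refine Finset.sum_congr rfl fun j _ => ?_
    rw [Finset.sum_comm]
    exact Finset.sum_congr rfl fun j' _ => by rw [Finset.mul_sum]
  have h2 : ∑ i ∈ s, ‖∑ j ∈ t, c j * θ i j‖ ^ 2 ≤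
      ∑ j ∈ t, ∑ j' ∈ t, ‖c j‖ * ‖c j'‖ * G j j' := by
    calc _ = ‖((∑ i ∈ s, ‖∑ j ∈ t, c j * θ i j‖ ^ 2 : ℝ) : ℂ)‖ := by
          rw [Complex.norm_real, Real.norm_of_nonneg (by positivity)]
      _ ≤ _ := by
          rw [h1]
          refine (norm_sum_le _ _).trans (Finset.sum_le_sum fun j hj => ?_)
          refine (norm_sum_le _ _).trans (Finset.sum_le_sum fun j' hj' => ?_)
          rw [norm_mul, norm_mul, RCLike.norm_conj]
          exact mul_le_mul_of_nonneg_left (hG j hj j' hj') (by positivity)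
  have h3 : ∑ j ∈ t, ∑ j' ∈ t, ‖c j‖ * ‖c j'‖ * G j j' ≤
      ∑ j ∈ t, ∑ j' ∈ t, (‖c j‖ ^ 2 * G j j' / 2 + ‖c j'‖ ^ 2 * G j j' / 2) := by
    refine Finset.sum_le_sum fun j hj => Finset.sum_le_sum fun j' hj' => ?_
    have hG0 : 0 ≤ G j j' := (norm_nonneg _).trans (hG j hj j' hj')
    nlinarith [mul_nonneg hG0 (sq_nonneg (‖c j‖ - ‖c j'‖))]
  have h4 : ∑ j ∈ t, ∑ j' ∈ t, (‖c j‖ ^ 2 * G j j' / 2 + ‖c j'‖ ^ 2 * G j j' / 2) =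
      ∑ j ∈ t, ‖c j‖ ^ 2 * ∑ j' ∈ t, G j j' := by
    simp_rw [Finset.sum_add_distrib]
    rw [Finset.sum_comm (f := fun j j' => ‖c j'‖ ^ 2 * G j j' / 2), ← Finset.sum_add_distrib]
    refine Finset.sum_congr rfl fun j _ => ?_
    rw [← Finset.sum_add_distrib, Finset.mul_sum]
    exact Finset.sum_congr rfl fun j' _ => by rw [hsymm j' j]; ring
  refine (h2.trans h3).trans (h4.le.trans ?_)
  rw [Finset.mul_sum]
  refine Finset.sum_le_sum fun j hj => ?_
  rw [mul_comm M]
  exact mul_le_mul_of_nonneg_left (hrow j hj) (by positivity)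

theorem pos_of_mem_dyadic {X : ℝ} (hX : 0 ≤ X) {n : ℕ} (hn : n ∈ dyadic X) : 0 < n := by
  have := ((mem_dyadic hX n).mp hn).1
  rcases Nat.eq_zero_or_pos n with rfl | h
  · simp at this; linarith
  · exact h

/-- The bound `M` for the bilinear form with the extended Jacobi symbol over dyadic ranges. -/
def SymbBound (R D M : ℝ) : Prop :=
  ∀ x : ℕ → ℂ, ∑ r ∈ dyadic R, ‖∑ d ∈ dyadic D, x d * (symb r d : ℂ)‖ ^ 2 ≤
    M * ∑ d ∈ dyadic D, ‖x d‖ ^ 2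

/-- The Gram matrix of the columns d₁, d₂ is the sum over r of the symbol at d₁d₂. When the odd part
of d₁d₂ is a square the character may be principal, and the entry is bounded by 3R. Each d₁ has at
most 3√D such partners, which gives 9R√D. -/
theorem symbBound_of_forall_le {R D P : ℝ} (hR : 0 ≤ R) (hD : 0 ≤ D) (hP : 0 ≤ P)
    (h : ∀ d₁ ∈ dyadic D, ∀ d₂ ∈ dyadic D, ¬ IsSquare (oddPart (d₁ * d₂)) →
      ‖∑ r ∈ dyadic R, (symb r (d₁ * d₂) : ℂ)‖ ≤ P) :
    SymbBound R D (9 * (R * √D) + 3 * (D * P)) := by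
  intro x
  refine sum_norm_sq_le_of_gram (dyadic R) (dyadic D) (fun r d => (symb r d : ℂ))
    (fun d₁ d₂ => if IsSquare (oddPart (d₁ * d₂)) then 3 * R else P)
    (fun d₁ d₂ => by simp only [mul_comm]) ?_ ?_ x
  · intro d₁ hd₁ d₂ hd₂
    have e1 := (pos_of_mem_dyadic hD hd₁).ne'
    have e2 := (pos_of_mem_dyadic hD hd₂).ne'
    have : ∑ r ∈ dyadic R, (symb r d₁ : ℂ) * (starRingEnd ℂ) (symb r d₂ : ℂ) =
        ∑ r ∈ dyadic R, (symb r (d₁ * d₂) : ℂ) := by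
      refine Finset.sum_congr rfl fun r _ => ?_
      rw [symb_mul_right r e1 e2, map_intCast (starRingEnd ℂ)]; push_cast; rfl
    rw [this]
    split_ifs with hs
    · refine (norm_sum_le _ _).trans ((Finset.sum_le_card_nsmul _ _ 1
        fun r _ => norm_symb_le_one _ _).trans ?_)
      simpa using card_dyadic_le hR
    · exact h d₁ hd₁ d₂ hd₂ hs
  · intro d₁ hd₁
    rw [Finset.sum_ite, Finset.sum_const, Finset.sum_const, nsmul_eq_mul, nsmul_eq_mul]
    have h1 := card_isSquare_oddPart_mul_le (pos_of_mem_dyadic hD hd₁).ne' hD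
    have h2 : (((dyadic D).filter (fun d => ¬ IsSquare (oddPart (d₁ * d)))).card : ℝ) ≤ 3 * D :=
      le_trans (by exact_mod_cast Finset.card_filter_le _ _) (card_dyadic_le hD)
    nlinarith [mul_le_mul_of_nonneg_right h1 hR, mul_le_mul_of_nonneg_right h2 hP]

theorem mul_le_of_mem_dyadic {D : ℝ} (hD : 0 ≤ D) {d₁ d₂ : ℕ} (h₁ : d₁ ∈ dyadic D)
    (h₂ : d₂ ∈ dyadic D) : ((d₁ * d₂ : ℕ) : ℝ) ≤ 4 * D ^ 2 := by
  have e1 := ((mem_dyadic hD _).mp h₁).2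
  have e2 := ((mem_dyadic hD _).mp h₂).2
  push_cast
  calc (d₁ : ℝ) * d₂ ≤ (2 * D) * (2 * D) := by gcongr
    _ = _ := by ring

theorem floor_le_floor_two_mul {X : ℝ} (hX : 0 ≤ X) : ⌊X⌋₊ ≤ ⌊2 * X⌋₊ :=
  Nat.floor_mono (by linarith)

theorem sum_symb_eq_sum_symbChar (J : Finset ℕ) (q : ℕ) [NeZero q] :
    ∑ r ∈ J, (symb r q : ℂ) = ∑ r ∈ J, symbChar q (r : ZMod q) :=
  Finset.sum_congr rfl fun r _ => (symbChar_natCast q r).symm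

/-- The bilinear bound that uses only periodicity. -/
theorem symbBound_trivial {R D : ℝ} (hR : 0 ≤ R) (hD : 0 ≤ D) :
    SymbBound R D (12 * (R * √D + D ^ 3)) := by
  have h := symbBound_of_forall_le (P := 4 * D ^ 2) hR hD (by positivity) ?_
  · intro x
    refine (h x).trans ?_
    gcongr
    have : 0 ≤ R * √D := by positivity
    nlinarith
  · intro d₁ hd₁ d₂ hd₂ hs
    have : NeZero (d₁ * d₂) := ⟨mul_ne_zero (pos_of_mem_dyadic hD hd₁).ne'
      (pos_of_mem_dyadic hD hd₂).ne'⟩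
    rw [sum_symb_eq_sum_symbChar, dyadic]
    have h1 := norm_sum_interval_sub_mean_le (floor_le_floor_two_mul hR)
      (symbChar (d₁ * d₂) : ZMod (d₁ * d₂) → ℂ)
    rw [MulChar.sum_eq_zero_of_ne_one (symbChar_ne_one hs), mul_zero, sub_zero] at h1
    refine h1.trans ?_
    refine (Finset.sum_le_card_nsmul _ _ 1 fun x _ => DirichletCharacter.norm_le_one _ _).trans ?_
    rw [Finset.card_univ, ZMod.card, nsmul_eq_mul, mul_one]
    exact mul_le_of_mem_dyadic hD hd₁ hd₂

theorem exists_polyaVinogradov_le {ε : ℝ} (hε : 0 < ε) :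
    ∃ C : ℝ, 1 ≤ C ∧ ∀ Y : ℝ, 1 ≤ Y → ∀ (q : ℕ) [NeZero q], (q : ℝ) ≤ Y →
      ∀ χ : DirichletCharacter ℂ q, χ ≠ 1 → ∀ A B : ℕ,
        ‖∑ s ∈ Ioc A B, χ s‖ ≤ C * Y ^ ε * √q := by
  obtain ⟨C₁, hC₁, hdiv⟩ := exists_card_divisors_le_rpow (show 0 < ε / 2 by positivity)
  obtain ⟨C₂, hC₂, hlog⟩ := log_le_rpow (show 0 < ε / 2 by positivity)
  refine ⟨C₁ * (2 * C₂), by nlinarith, fun Y hY q _ hqY χ hχ A B => ?_⟩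
  have hq : 0 < q := Nat.pos_of_ne_zero (NeZero.ne q)
  have hq1 : (1 : ℝ) ≤ q := by exact_mod_cast hq
  refine (norm_sum_interval_character_le hχ A B).trans ?_
  have h1 : (q.divisors.card : ℝ) ≤ C₁ * Y ^ (ε / 2) := (hdiv q hq.ne').trans (by gcongr)
  have h2 : 1 + Real.log q ≤ C₂ * Y ^ (ε / 2) := (hlog q hq1).trans (by gcongr)
  have h0 : 0 ≤ 1 + Real.log q := by linarith [Real.log_nonneg hq1]
  calc (q.divisors.card : ℝ) * (2 * √q * (1 + Real.log q))
      ≤ (C₁ * Y ^ (ε / 2)) * (2 * √q * (C₂ * Y ^ (ε / 2))) := by gcongr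
    _ = C₁ * (2 * C₂) * (Y ^ (ε / 2) * Y ^ (ε / 2)) * √q := by ring
    _ = _ := by rw [← Real.rpow_add (by linarith), add_halves]

/-- The modulus d₁d₂ ≤ 4D² makes the Pólya–Vinogradov bound of size D, instead of the D² that
periodicity alone gives. -/
theorem exists_symbBound_left {ε : ℝ} (hε : 0 < ε) :
    ∃ C : ℝ, 1 ≤ C ∧ ∀ Z R D : ℝ, 1 ≤ Z → 0 ≤ R → 0 ≤ D → D ≤ Z →
      SymbBound R D (C * Z ^ ε * (R * √D + D ^ 2)) := by
  obtain ⟨C, hC, hPV⟩ := exists_polyaVinogradov_le (show 0 < ε / 2 by positivity)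
  refine ⟨9 * (C * 4 ^ (ε / 2)), ?_, fun Z R D hZ hR hD hDZ => ?_⟩
  · have : (1 : ℝ) ≤ 4 ^ (ε / 2) := Real.one_le_rpow (by norm_num) (by positivity)
    nlinarith [mul_le_mul hC this zero_le_one (by linarith)]
  set K := C * 4 ^ (ε / 2) * Z ^ ε with hK
  have hY : (4 * Z ^ 2) ^ (ε / 2) = 4 ^ (ε / 2) * Z ^ ε := by
    rw [Real.mul_rpow (by norm_num) (by positivity), ← Real.rpow_natCast Z 2,
      ← Real.rpow_mul (by linarith)]
    congr 2; push_cast; ring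
  have hK1 : 1 ≤ K := by
    have a1 : (1 : ℝ) ≤ 4 ^ (ε / 2) := Real.one_le_rpow (by norm_num) (by positivity)
    have a2 : (1 : ℝ) ≤ Z ^ ε := Real.one_le_rpow hZ hε.le
    exact one_le_mul_of_one_le_of_one_le (one_le_mul_of_one_le_of_one_le hC a1) a2
  have h := symbBound_of_forall_le (P := K * (2 * D)) hR hD (by positivity) ?_
  · intro x
    refine (h x).trans ?_
    gcongr
    have : 0 ≤ R * √D := by positivity
    nlinarith [mul_le_mul_of_nonneg_right hK1 this, mul_nonneg (by linarith : 0 ≤ K) (sq_nonneg D)]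
  · intro d₁ hd₁ d₂ hd₂ hs
    have : NeZero (d₁ * d₂) := ⟨mul_ne_zero (pos_of_mem_dyadic hD hd₁).ne'
      (pos_of_mem_dyadic hD hd₂).ne'⟩
    have hle := mul_le_of_mem_dyadic hD hd₁ hd₂
    rw [sum_symb_eq_sum_symbChar, dyadic]
    refine (hPV (4 * Z ^ 2) (by nlinarith) (d₁ * d₂) (hle.trans (by gcongr)) _
      (symbChar_ne_one hs) _ _).trans ?_
    rw [hY, hK, ← mul_assoc C]
    gcongr
    rw [Real.sqrt_le_left (by positivity)]
    linarith

/-- The character `denomChar` sees odd n only. An even n = 2m contributes (r/2) times the sum over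
the halved interval, and repeated halving costs a logarithm. -/
theorem norm_sum_symb_denominator_le {r : ℕ} [NeZero r] {P : ℝ}
    (h : ∀ A B : ℕ, ‖∑ n ∈ Ioc A B, denomChar r (n : ZMod (4 * r))‖ ≤ P) (B : ℕ) :
    ∀ A : ℕ, ‖∑ n ∈ Ioc A B, (symb r n : ℂ)‖ ≤ (Nat.log 2 B + 1) * P := by
  have hP : 0 ≤ P := (norm_nonneg _).trans (h 0 0)
  induction B using Nat.strong_induction_on with
  | _ B ih =>
    intro A
    rcases Nat.eq_zero_or_pos B with rfl | hB
    · simp; exact hP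
    have hsplit : ∑ n ∈ Ioc A B, (symb r n : ℂ) =
        ∑ n ∈ Ioc A B, denomChar r (n : ZMod (4 * r)) +
          (symb r 2 : ℂ) * ∑ n ∈ Ioc (A / 2) (B / 2), (symb r n : ℂ) := by
      rw [← Finset.sum_filter_add_sum_filter_not (Ioc A B) (fun n => Odd n)]
      congr 1
      · rw [Finset.sum_filter]
        exact Finset.sum_congr rfl fun n _ => (denomChar_natCast r n).symm
      · have : (Ioc A B).filter (fun n => ¬ Odd n) = (Ioc (A / 2) (B / 2)).image (2 * ·) := by
          ext n
          simp only [mem_filter, mem_Ioc, mem_image, Nat.not_odd_iff_even]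
          constructor
          · rintro ⟨h1, ⟨m, rfl⟩⟩
            exact ⟨m, by omega, by omega⟩
          · rintro ⟨m, h1, rfl⟩
            exact ⟨by omega, even_two_mul m⟩
        rw [this, Finset.sum_image (fun a _ b _ h => by simpa using h), Finset.mul_sum]
        refine Finset.sum_congr rfl fun m hm => ?_
        have hm0 : m ≠ 0 := by have := (mem_Ioc.mp hm).1; omega
        rw [symb_mul_right r two_ne_zero hm0]; push_cast; rfl
    rw [hsplit]
    refine (norm_add_le _ _).trans ?_
    rw [norm_mul]
    rcases Nat.lt_or_ge B 2 with hB2 | hB2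
    · have : B / 2 = 0 := by omega
      rw [this]
      simp only [Finset.Ioc_eq_empty_of_le (Nat.zero_le _), sum_empty, norm_zero, mul_zero, add_zero]
      refine (h A B).trans ?_
      have : (0 : ℝ) ≤ Nat.log 2 B := by positivity
      nlinarith
    · have h1 := ih (B / 2) (by omega) (A / 2)
      have hl : Nat.log 2 B = Nat.log 2 (B / 2) + 1 := by
        rw [Nat.log_div_base]
        have := Nat.log_pos (b := 2) (by norm_num) hB2
        omega
      rw [hl]
      have h2 := norm_symb_le_one r 2
      push_cast
      nlinarith [h A B, norm_nonneg (∑ n ∈ Ioc (A / 2) (B / 2), (symb r n : ℂ)),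
        mul_le_mul_of_nonneg_right h2 (norm_nonneg (∑ n ∈ Ioc (A / 2) (B / 2), (symb r n : ℂ)))]

/-- Small powers of polynomially bounded quantities are small. -/
theorem exists_rpow_le_rpow (A : ℝ) (k : ℕ) {ε : ℝ} (hε : 0 < ε) :
    ∃ δ : ℝ, 0 < δ ∧ ∃ C : ℝ, 1 ≤ C ∧ ∀ Z : ℝ, 1 ≤ Z → ∀ Y : ℝ, 0 ≤ Y → Y ≤ A * Z ^ k →
      Y ^ δ ≤ C * Z ^ ε := by
  have hk : (0 : ℝ) < k + 1 := by positivity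
  refine ⟨ε / (k + 1), by positivity, (max A 1) ^ (ε / (k + 1)),
    Real.one_le_rpow (le_max_right _ _) (by positivity), fun Z hZ Y hY hYA => ?_⟩
  have h1 : Y ≤ max A 1 * Z ^ (k + 1) := by
    refine hYA.trans ?_
    have : Z ^ k ≤ Z ^ (k + 1) := pow_le_pow_right₀ hZ (by omega)
    have h0 : 0 ≤ Z ^ k := by positivity
    nlinarith [le_max_left A 1, le_max_right A 1]
  calc Y ^ (ε / (k + 1)) ≤ (max A 1 * Z ^ (k + 1)) ^ (ε / (k + 1)) := by gcongr
    _ = (max A 1) ^ (ε / (k + 1)) * Z ^ ε := by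
      rw [Real.mul_rpow (by positivity) (by positivity), ← Real.rpow_natCast Z,
        ← Real.rpow_mul (by linarith)]
      congr 2; push_cast; field_simp

theorem exists_card_divisors_le (A : ℝ) (k : ℕ) {ε : ℝ} (hε : 0 < ε) :
    ∃ C : ℝ, 1 ≤ C ∧ ∀ Z : ℝ, 1 ≤ Z → ∀ n : ℕ, n ≠ 0 → (n : ℝ) ≤ A * Z ^ k →
      (n.divisors.card : ℝ) ≤ C * Z ^ ε := by
  obtain ⟨δ, hδ, C₁, hC₁, h₁⟩ := exists_rpow_le_rpow A k hε
  obtain ⟨C₂, hC₂, h₂⟩ := exists_card_divisors_le_rpow hδ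
  refine ⟨C₂ * C₁, one_le_mul_of_one_le_of_one_le hC₂ hC₁, fun Z hZ n hn hnZ => ?_⟩
  refine (h₂ n hn).trans ?_
  rw [mul_assoc]
  exact mul_le_mul_of_nonneg_left (h₁ Z hZ n (by positivity) hnZ) (by linarith)

theorem exists_one_add_log_le (A : ℝ) (k : ℕ) {ε : ℝ} (hε : 0 < ε) :
    ∃ C : ℝ, 1 ≤ C ∧ ∀ Z : ℝ, 1 ≤ Z → ∀ Y : ℝ, 1 ≤ Y → Y ≤ A * Z ^ k →
      1 + Real.log Y ≤ C * Z ^ ε := by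
  obtain ⟨δ, hδ, C₁, hC₁, h₁⟩ := exists_rpow_le_rpow A k hε
  obtain ⟨C₂, hC₂, h₂⟩ := log_le_rpow hδ
  refine ⟨C₂ * C₁, one_le_mul_of_one_le_of_one_le hC₂ hC₁, fun Z hZ Y hY hYZ => ?_⟩
  refine (h₂ Y hY).trans ?_
  rw [mul_assoc]
  exact mul_le_mul_of_nonneg_left (h₁ Z hZ Y (by linarith) hYZ) (by linarith)

theorem natLog_two_add_one_le (B : ℕ) :
    ((Nat.log 2 B : ℝ) + 1) ≤ 2 * (1 + Real.log B) := by
  have h1 : (Nat.log 2 B : ℝ) ≤ Real.logb 2 B := by exact_mod_cast Real.natLog_le_logb B 2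
  have h2 : Real.logb 2 B ≤ 2 * Real.log B := by
    rw [Real.logb, div_le_iff₀ (Real.log_pos (by norm_num))]
    have := Real.log_two_gt_d9
    have h0 : 0 ≤ Real.log B := Real.log_natCast_nonneg B
    nlinarith
  linarith

/-- The bilinear form of the symbol over all denominators up to a bound. -/
theorem exists_symb_denominator_bound {ε : ℝ} (hε : 0 < ε) :
    ∃ C : ℝ, 1 ≤ C ∧ ∀ Z R Y : ℝ, 1 ≤ Z → 0 ≤ R → R ≤ Z → 0 ≤ Y → Y ≤ 4 * Z ^ 2 → ∀ X : ℕ → ℂ,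
      ∑ r ∈ dyadic R, ‖∑ n ∈ Ioc 0 ⌊Y⌋₊, X n * (symb r n : ℂ)‖ ^ 2 ≤
        C * Z ^ ε * (Y * √R + R ^ 2) * ∑ n ∈ Ioc 0 ⌊Y⌋₊, ‖X n‖ ^ 2 := by
  obtain ⟨δ, hδ, C₀, hC₀, h₀⟩ := exists_rpow_le_rpow 16 2 (show 0 < ε / 2 by positivity)
  obtain ⟨C₁, hC₁, hPV⟩ := exists_polyaVinogradov_le hδ
  obtain ⟨C₂, hC₂, hlog⟩ := exists_one_add_log_le 4 2 (show 0 < ε / 2 by positivity)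
  refine ⟨24 * (C₂ * (C₁ * C₀)), ?_, fun Z R Y hZ hR hRZ hY hYZ => ?_⟩
  · have := one_le_mul_of_one_le_of_one_le hC₂ (one_le_mul_of_one_le_of_one_le hC₁ hC₀)
    linarith
  set K := C₂ * (C₁ * C₀) * Z ^ ε with hK
  have hK1 : 1 ≤ K := one_le_mul_of_one_le_of_one_le
    (one_le_mul_of_one_le_of_one_le hC₂ (one_le_mul_of_one_le_of_one_le hC₁ hC₀))
    (Real.one_le_rpow hZ hε.le)
  have hgoal : 24 * (C₂ * (C₁ * C₀)) * Z ^ ε * (Y * √R + R ^ 2) = 24 * K * (Y * √R + R ^ 2) := by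
    rw [hK]; ring
  rw [hgoal]
  -- Duality exchanges the variables, so that the free sum is over denominators n; it is bounded
  -- through the character of modulus 4r₁r₂.
  refine sum_norm_sq_le_of_dual (Ioc 0 ⌊Y⌋₊) (dyadic R) (fun n r => (symb r n : ℂ))
    (by positivity) ?_
  intro c
  refine sum_norm_sq_le_of_gram (Ioc 0 ⌊Y⌋₊) (dyadic R) (fun n r => (symb r n : ℂ))
    (fun r₁ r₂ => if IsSquare (oddPart (r₁ * r₂)) then Y else 8 * K * R)
    (fun d₁ d₂ => by simp only [mul_comm]) ?_ ?_ c
  · intro r₁ hr₁ r₂ hr₂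
    have e1 := (pos_of_mem_dyadic hR hr₁).ne'
    have e2 := (pos_of_mem_dyadic hR hr₂).ne'
    have : ∑ n ∈ Ioc 0 ⌊Y⌋₊, (symb r₁ n : ℂ) * (starRingEnd ℂ) (symb r₂ n : ℂ) =
        ∑ n ∈ Ioc 0 ⌊Y⌋₊, (symb (r₁ * r₂) n : ℂ) := by
      refine Finset.sum_congr rfl fun n _ => ?_
      rw [symb_mul_left, map_intCast (starRingEnd ℂ)]; push_cast; rfl
    rw [this]
    split_ifs with hs
    · refine (norm_sum_le _ _).trans ((Finset.sum_le_card_nsmul _ _ 1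
        fun r _ => norm_symb_le_one _ _).trans ?_)
      simpa using Nat.floor_le hY
    · have hle := mul_le_of_mem_dyadic hR hr₁ hr₂
      have : NeZero (r₁ * r₂) := ⟨mul_ne_zero e1 e2⟩
      have hq : ((4 * (r₁ * r₂) : ℕ) : ℝ) ≤ 16 * Z ^ 2 := by
        push_cast at hle ⊢
        nlinarith
      have hbound : ∀ A B : ℕ, ‖∑ n ∈ Ioc A B, denomChar (r₁ * r₂) (n : ZMod (4 * (r₁ * r₂)))‖ ≤
          C₁ * (C₀ * Z ^ (ε / 2)) * (4 * R) := by
        intro A B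
        refine (hPV (16 * Z ^ 2) (by nlinarith) _ hq _ (denomChar_ne_one hs) A B).trans ?_
        gcongr
        · exact h₀ Z hZ _ (by positivity) le_rfl
        · rw [Real.sqrt_le_left (by positivity)]
          push_cast at hle ⊢
          nlinarith
      refine (norm_sum_symb_denominator_le hbound ⌊Y⌋₊ 0).trans ?_
      rcases Nat.eq_zero_or_pos ⌊Y⌋₊ with h0 | h0
      · rw [h0]
        have hz : (1 : ℝ) ≤ C₂ * Z ^ (ε / 2) :=
          one_le_mul_of_one_le_of_one_le hC₂ (Real.one_le_rpow hZ (by positivity))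
        have hw : 0 ≤ C₁ * (C₀ * Z ^ (ε / 2)) * (4 * R) := by positivity
        have : K = C₂ * Z ^ (ε / 2) * (C₁ * (C₀ * Z ^ (ε / 2))) := by
          rw [hK, ← add_halves ε, Real.rpow_add (by linarith)]; simp only [add_halves]; ring
        rw [this]
        simp only [Nat.log_zero_right, Nat.cast_zero, zero_add, one_mul]
        nlinarith
      · have hl := natLog_two_add_one_le ⌊Y⌋₊
        have hl2 := hlog Z hZ (⌊Y⌋₊ : ℝ) (by exact_mod_cast h0) ((Nat.floor_le hY).trans hYZ)
        have : 8 * K * R =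
            2 * (C₂ * Z ^ (ε / 2)) * (C₁ * (C₀ * Z ^ (ε / 2)) * (4 * R)) := by
          rw [hK, ← add_halves ε, Real.rpow_add (by linarith)]; simp only [add_halves]; ring
        rw [this]
        gcongr
        linarith
  · intro r₁ hr₁
    rw [Finset.sum_ite, Finset.sum_const, Finset.sum_const, nsmul_eq_mul, nsmul_eq_mul]
    have h1 := card_isSquare_oddPart_mul_le (pos_of_mem_dyadic hR hr₁).ne' hR
    have h2 : (((dyadic R).filter (fun d => ¬ IsSquare (oddPart (r₁ * d)))).card : ℝ) ≤ 3 * R :=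
      le_trans (by exact_mod_cast Finset.card_filter_le _ _) (card_dyadic_le hR)
    have h3 := mul_le_mul_of_nonneg_right h1 hY
    have h4 := mul_le_mul_of_nonneg_right h2 (show 0 ≤ 8 * K * R by positivity)
    have h5 : 0 ≤ Y * √R := by positivity
    nlinarith

theorem norm_sum_mul_sq_le_card_mul {ι : Type*} (s : Finset ι) (x : ι → ℂ) :
    ‖∑ i ∈ s, x i‖ ^ 2 ≤ s.card * ∑ i ∈ s, ‖x i‖ ^ 2 :=
  (pow_le_pow_left₀ (norm_nonneg _) (norm_sum_le _ _) 2).trans sq_sum_le_card_mul_sum_sq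

/-- The bilinear bound obtained from reciprocity after squaring out. -/
theorem exists_symbBound_right {ε : ℝ} (hε : 0 < ε) :
    ∃ C : ℝ, 1 ≤ C ∧ ∀ Z R D : ℝ, 1 ≤ Z → 0 ≤ R → R ≤ Z → 0 ≤ D → D ≤ Z →
      SymbBound R D (C * Z ^ ε * (D * R ^ (3 / 4 : ℝ) + R ^ (3 / 2 : ℝ))) := by
  obtain ⟨C₁, hC₁, hden⟩ := exists_symb_denominator_bound hε
  obtain ⟨C₂, hC₂, hdiv⟩ := exists_card_divisors_le 4 2 hε
  refine ⟨12 * (C₁ * C₂), ?_, fun Z R D hZ hR hRZ hD hDZ x => ?_⟩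
  · linarith [one_le_mul_of_one_le_of_one_le hC₁ hC₂]
  set Y := 4 * D ^ 2 with hY
  set J := dyadic D ×ˢ dyadic D with hJ
  set N := Ioc 0 ⌊Y⌋₊ with hN
  set X : ℕ → ℂ := fun n => ∑ p ∈ J with p.1 * p.2 = n, x p.1 * x p.2 with hX
  set A : ℕ → ℂ := fun r => ∑ d ∈ dyadic D, x d * (symb r d : ℂ) with hA
  set T := ∑ d ∈ dyadic D, ‖x d‖ ^ 2 with hT
  have hT0 : 0 ≤ T := by positivity
  have hmaps : ∀ p ∈ J, p.1 * p.2 ∈ N := by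
    intro p hp
    rw [hJ, mem_product] at hp
    rw [hN, mem_Ioc]
    exact ⟨Nat.mul_pos (pos_of_mem_dyadic hD hp.1) (pos_of_mem_dyadic hD hp.2),
      Nat.le_floor (mul_le_of_mem_dyadic hD hp.1 hp.2)⟩
  -- The square of the form in d is again a linear form, in n = d₁d₂ ≤ 4D². Cauchy–Schwarz over r
  -- and the bound for all denominators up to 4D² then give (∑‖A‖²)² ≪ R(D²√R + R²) up to small
  -- powers. Lengthening the sum over denominators makes the term R² harmless.
  have hsq : ∀ r, A r ^ 2 = ∑ n ∈ N, X n * (symb r n : ℂ) := by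
    intro r
    rw [hA, sq, Finset.sum_mul_sum, ← Finset.sum_product', ← Finset.sum_fiberwise_of_maps_to hmaps]
    refine Finset.sum_congr rfl fun n _ => ?_
    rw [hX, Finset.sum_mul]
    refine Finset.sum_congr rfl fun p hp => ?_
    rw [mem_filter, hJ, mem_product] at hp
    rw [← hp.2, symb_mul_right r (pos_of_mem_dyadic hD hp.1.1).ne'
      (pos_of_mem_dyadic hD hp.1.2).ne']
    push_cast; ring
  have hYZ : Y ≤ 4 * Z ^ 2 := by rw [hY]; gcongr
  have hXle : ∑ n ∈ N, ‖X n‖ ^ 2 ≤ C₂ * Z ^ ε * T ^ 2 := by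
    have hone : ∀ n ∈ N, ‖X n‖ ^ 2 ≤
        C₂ * Z ^ ε * ∑ p ∈ J with p.1 * p.2 = n, ‖x p.1‖ ^ 2 * ‖x p.2‖ ^ 2 := by
      intro n hn
      have hn' := mem_Ioc.mp hn
      refine (norm_sum_mul_sq_le_card_mul _ _).trans ?_
      have hc : ((J.filter fun p => p.1 * p.2 = n).card : ℝ) ≤ C₂ * Z ^ ε := by
        refine le_trans ?_ (hdiv Z hZ n hn'.1.ne'
          (((Nat.le_floor_iff (by positivity)).mp hn'.2).trans hYZ))
        norm_cast
        refine Finset.card_le_card_of_injOn (fun p => p.1) ?_ ?_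
        · intro p hp
          exact Nat.mem_divisors.mpr ⟨⟨p.2, (mem_filter.mp hp).2.symm⟩, hn'.1.ne'⟩
        · intro p hp p' hp' h
          have e1 := (mem_filter.mp hp).2
          have e2 := (mem_filter.mp hp').2
          have h' : p.1 = p'.1 := h
          have h0 : 0 < p.1 := Nat.pos_of_mul_pos_right (e1 ▸ hn'.1)
          refine Prod.ext h' (Nat.eq_of_mul_eq_mul_left h0 ?_)
          rw [e1, h', e2]
      have e : ∀ p : ℕ × ℕ, ‖x p.1 * x p.2‖ ^ 2 = ‖x p.1‖ ^ 2 * ‖x p.2‖ ^ 2 := by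
        intro p; rw [norm_mul, mul_pow]
      simp_rw [e]
      exact mul_le_mul_of_nonneg_right hc (Finset.sum_nonneg fun _ _ => by positivity)
    refine (Finset.sum_le_sum hone).trans ?_
    rw [← Finset.mul_sum, Finset.sum_fiberwise_of_maps_to hmaps, hJ, sq T, hT, Finset.sum_mul_sum,
      ← Finset.sum_product']
  have h4 : (∑ r ∈ dyadic R, ‖A r‖ ^ 2) ^ 2 ≤
      3 * R * (C₁ * Z ^ ε * (Y * √R + R ^ 2) * (C₂ * Z ^ ε * T ^ 2)) := by
    refine sq_sum_le_card_mul_sum_sq.trans ?_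
    refine mul_le_mul (card_dyadic_le hR) ?_ (by positivity) (by positivity)
    have e : ∀ r ∈ dyadic R, (‖A r‖ ^ 2) ^ 2 = ‖∑ n ∈ N, X n * (symb r n : ℂ)‖ ^ 2 := by
      intro r _
      rw [← hsq r, norm_pow]
    rw [Finset.sum_congr rfl e]
    refine (hden Z R Y hZ hR hRZ (by positivity) hYZ X).trans ?_
    gcongr
  refine le_of_sq_le_sq ?_ (by positivity)
  refine h4.trans ?_
  have r1 : R * √R = (R ^ (3 / 4 : ℝ)) ^ 2 := by
    rcases hR.eq_or_lt with rfl | hR'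
    · rw [Real.zero_rpow (by norm_num)]; simp
    rw [Real.sqrt_eq_rpow, ← Real.rpow_natCast, ← Real.rpow_mul hR]
    nth_rewrite 1 [← Real.rpow_one R]
    rw [← Real.rpow_add hR']; norm_num
  have r2 : R ^ 3 = (R ^ (3 / 2 : ℝ)) ^ 2 := by
    rw [← Real.rpow_natCast, ← Real.rpow_natCast, ← Real.rpow_mul hR]; norm_num
  set a := R ^ (3 / 4 : ℝ) with ha
  set b := R ^ (3 / 2 : ℝ) with hb
  have ha0 : 0 ≤ a := by positivity
  have hb0 : 0 ≤ b := by positivity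
  calc 3 * R * (C₁ * Z ^ ε * (Y * √R + R ^ 2) * (C₂ * Z ^ ε * T ^ 2))
      = C₁ * C₂ * (Z ^ ε * T) ^ 2 * (12 * D ^ 2 * (R * √R) + 3 * R ^ 3) := by rw [hY]; ring
    _ = C₁ * C₂ * (Z ^ ε * T) ^ 2 * (12 * D ^ 2 * a ^ 2 + 3 * b ^ 2) := by rw [r1, r2]
    _ ≤ (C₁ * C₂) ^ 2 * (Z ^ ε * T) ^ 2 * (144 * (D * a + b) ^ 2) := by
        have h1 := one_le_mul_of_one_le_of_one_le hC₁ hC₂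
        gcongr
        · nlinarith
        · nlinarith [mul_nonneg (mul_nonneg hD ha0) hb0, sq_nonneg (D * a), sq_nonneg b]
    _ = _ := by ring

/-- The bilinear bound for the symbol in the form used below. -/
theorem exists_symbBound {ε : ℝ} (hε : 0 < ε) :
    ∃ C : ℝ, 1 ≤ C ∧ ∀ Z R D : ℝ, 1 ≤ Z → 0 ≤ R → R ≤ Z → 0 ≤ D → D ≤ Z →
      SymbBound R D (C * Z ^ ε * (R * √D + D * R ^ (3 / 4 : ℝ))) := by
  obtain ⟨C₁, hC₁, h₁⟩ := exists_symbBound_left hε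
  obtain ⟨C₂, hC₂, h₂⟩ := exists_symbBound_right hε
  refine ⟨2 * C₁ + 2 * C₂, by linarith, fun Z R D hZ hR hRZ hD hDZ x => ?_⟩
  have hz : 0 ≤ Z ^ ε := by positivity
  -- The two bounds meet here: below, D² ≤ D R^(3/4); above, R^(3/2) ≤ D R^(3/4).
  rcases le_total D (R ^ (3 / 4 : ℝ)) with h | h
  · refine (h₁ Z R D hZ hR hD hDZ x).trans ?_
    gcongr
    · linarith
    · nlinarith
  · refine (h₂ Z R D hZ hR hRZ hD hDZ x).trans ?_
    have : R ^ (3 / 2 : ℝ) = R ^ (3 / 4 : ℝ) * R ^ (3 / 4 : ℝ) := by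
      rw [← sq, ← Real.rpow_natCast, ← Real.rpow_mul hR]; norm_num
    have ha : 0 ≤ R ^ (3 / 4 : ℝ) := by positivity
    have hb : 0 ≤ R * √D := by positivity
    have hc : D * R ^ (3 / 4 : ℝ) + R ^ (3 / 2 : ℝ) ≤ 2 * (R * √D + D * R ^ (3 / 4 : ℝ)) := by
      rw [this]; nlinarith
    calc C₂ * Z ^ ε * (D * R ^ (3 / 4 : ℝ) + R ^ (3 / 2 : ℝ)) * ∑ d ∈ dyadic D, ‖x d‖ ^ 2
        ≤ C₂ * Z ^ ε * (2 * (R * √D + D * R ^ (3 / 4 : ℝ))) * ∑ d ∈ dyadic D, ‖x d‖ ^ 2 := by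
          gcongr
      _ ≤ _ := by
          have : 0 ≤ C₁ * Z ^ ε * (2 * (R * √D + D * R ^ (3 / 4 : ℝ))) *
            ∑ d ∈ dyadic D, ‖x d‖ ^ 2 := by positivity
          nlinarith

/-! ### The dual form of the variance and the direct bound -/

theorem zmod_sum_cast {d Q : ℕ} [NeZero d] [NeZero Q] (h : d ∣ Q) {M : Type*} [AddCommMonoid M]
    (G : ZMod d → M) : ∑ y : ZMod Q, G y.cast = (Q / d) • ∑ x, G x := by
  classical
  have hf : ∀ x : ZMod d, (univ.filter fun y : ZMod Q => (y.cast : ZMod d) = x).card =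
      (univ.filter fun y : ZMod Q => (y.cast : ZMod d) = 0).card := fun x =>
    AddMonoidHom.card_fiber_eq_of_mem_range (ZMod.castHom h (ZMod d))
      (ZMod.castHom_surjective h x) (ZMod.castHom_surjective h 0)
  have hc : d * (univ.filter fun y : ZMod Q => (y.cast : ZMod d) = 0).card = Q := by
    have := Finset.card_eq_sum_card_fiberwise (s := (univ : Finset (ZMod Q)))
      (t := (univ : Finset (ZMod d))) (f := fun y => (y.cast : ZMod d)) (fun _ _ => by simp)
    simp_rw [hf] at this
    rw [Finset.sum_const, Finset.card_univ, Finset.card_univ, ZMod.card, ZMod.card] at this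
    rw [← smul_eq_mul]; exact this.symm
  rw [← Finset.sum_fiberwise univ (fun y : ZMod Q => (y.cast : ZMod d)), Finset.smul_sum]
  refine Finset.sum_congr rfl fun x _ => ?_
  rw [Finset.sum_congr rfl (g := fun _ => G x), Finset.sum_const, hf x]
  · congr 1
    exact (Nat.div_eq_of_eq_mul_right (Nat.pos_of_ne_zero (NeZero.ne d)) hc.symm).symm
  · intro y hy
    rw [(mem_filter.mp hy).2]

theorem zmod_cast_inv_mul {d L r : ℕ} (h : d ∣ L) (hr : r.Coprime L) (s : ℕ) :
    (((r : ZMod L)⁻¹ * (s : ZMod L)).cast : ZMod d) = (r : ZMod d)⁻¹ * (s : ZMod d) := by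
  have hrd : r.Coprime d := Nat.Coprime.coprime_dvd_right h hr
  have h1 : ((r : ZMod L)⁻¹.cast : ZMod d) = (r : ZMod d)⁻¹ := by
    have e1 := ZMod.coe_mul_inv_eq_one r hr
    have e2 := ZMod.coe_mul_inv_eq_one r hrd
    have e3 := congrArg (ZMod.castHom h (ZMod d)) e1
    rw [map_mul, map_one, map_natCast, ZMod.castHom_apply] at e3
    calc ((r : ZMod L)⁻¹.cast : ZMod d) = ((r : ZMod L)⁻¹.cast : ZMod d) * (r * (r : ZMod d)⁻¹) := by
          rw [e2, mul_one]
      _ = (r * ((r : ZMod L)⁻¹.cast : ZMod d)) * (r : ZMod d)⁻¹ := by ring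
      _ = _ := by rw [e3, one_mul]
  have h2 := map_mul (ZMod.castHom h (ZMod d)) (r : ZMod L)⁻¹ (s : ZMod L)
  rw [map_natCast, ZMod.castHom_apply, ZMod.castHom_apply, h1] at h2
  exact h2

theorem zmod_cast_cast {d L Q : ℕ} [NeZero Q] (h : d ∣ L) (h' : L ∣ Q) (y : ZMod Q) :
    ((y.cast : ZMod L).cast : ZMod d) = y.cast := by
  obtain ⟨n, rfl⟩ := ZMod.natCast_zmod_surjective y
  rw [ZMod.cast_natCast h', ZMod.cast_natCast h, ZMod.cast_natCast (h.trans h')]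

theorem zmod_cast_pair_injective {d₁ d₂ : ℕ} [NeZero (Nat.lcm d₁ d₂)] :
    Function.Injective (fun x : ZMod (Nat.lcm d₁ d₂) => ((x.cast : ZMod d₁), (x.cast : ZMod d₂))) := by
  intro x y hxy
  obtain ⟨m, rfl⟩ := ZMod.natCast_zmod_surjective x
  obtain ⟨n, rfl⟩ := ZMod.natCast_zmod_surjective y
  simp only [Prod.mk.injEq] at hxy
  rw [ZMod.cast_natCast (Nat.dvd_lcm_left _ _), ZMod.cast_natCast (Nat.dvd_lcm_left _ _),
    ZMod.cast_natCast (Nat.dvd_lcm_right _ _), ZMod.cast_natCast (Nat.dvd_lcm_right _ _),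
    ZMod.natCast_eq_natCast_iff, ZMod.natCast_eq_natCast_iff] at hxy
  rw [ZMod.natCast_eq_natCast_iff]
  simp only [Nat.modEq_iff_dvd, Int.natCast_dvd] at hxy ⊢
  exact Nat.lcm_dvd hxy.1 hxy.2

/-- The bound `N` for the global variance of arbitrary coefficients in a box. -/
def VarianceBound (D R S N : ℝ) : Prop :=
  ∀ α : ℕ → ℕ → ℂ, globalVariance D R S α ≤ N * ∑ r ∈ dyadic R, ∑ s ∈ dyadic S, ‖α r s‖ ^ 2

theorem VarianceBound.mono {D R S N N' : ℝ} (h : VarianceBound D R S N) (hN : N ≤ N') :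
    VarianceBound D R S N' := fun α => (h α).trans (by gcongr)

/-- The contribution to the dual form of a pair of moduli, as a function on residues modulo their
least common multiple. -/
noncomputable def pairFun (c : ∀ d : ℕ, ZMod d → ℂ) (d₁ d₂ : ℕ) : ZMod (Nat.lcm d₁ d₂) → ℂ :=
  fun x => c d₁ x.cast * (starRingEnd ℂ) (c d₂ x.cast)

/-- The twisted sum through the values of the symbol at coprime arguments. -/
theorem twistedSum_eq (R S : ℝ) (α : ℕ → ℕ → ℂ) (d : ℕ) [NeZero d] (a : ℕ) :
    twistedSum R S α d a = ∑ r ∈ dyadic R, ∑ s ∈ dyadic S,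
      if (r : ZMod d)⁻¹ * (s : ZMod d) = (a : ZMod d) then α r s * (symb r d : ℂ) else 0 := by
  rw [twistedSum]
  refine Finset.sum_congr rfl fun r _ => Finset.sum_congr rfl fun s _ => ?_
  by_cases h : r.Coprime d
  · by_cases h' : (r : ZMod d)⁻¹ * (s : ZMod d) = (a : ZMod d)
    · rw [if_pos (show InvCongr d r s a from ⟨h, h'⟩), if_pos h', symb, if_pos h]
    · rw [if_neg (fun hI : InvCongr d r s a => h' hI.2), if_neg h']
  · simp [InvCongr, h, symb]

theorem sum_range_eq_sum_zmod (d : ℕ) [NeZero d] {M : Type*} [AddCommMonoid M] (f : ZMod d → M) :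
    ∑ a ∈ range d, f a = ∑ x, f x := by
  refine Finset.sum_nbij' (fun a => (a : ZMod d)) (fun x => x.val) (by simp)
    (by intro x _; simpa using ZMod.val_lt x) ?_ (by simp) (by simp)
  intro a ha
  exact ZMod.val_cast_of_lt (mem_range.mp ha)

/-- Duality for the matrix with rows (r, s) and columns (d, a). For given (r, s) and d only the
class a ≡ r̄s survives, so the dual form evaluates a function `c d` at r̄s. -/
theorem varianceBound_of_dual {D R S N : ℝ} (hD : 0 ≤ D) (hN : 0 ≤ N)
    (h : ∀ c : ∀ d : ℕ, ZMod d → ℂ, ∑ r ∈ dyadic R, ∑ s ∈ dyadic S,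
      ‖∑ d ∈ dyadic D, c d ((r : ZMod d)⁻¹ * s) * (symb r d : ℂ)‖ ^ 2 ≤
        N * ∑ d ∈ dyadic D, ∑ a ∈ range d, ‖c d a‖ ^ 2) :
    VarianceBound D R S N := by
  classical
  intro α
  set θ : ℕ × ℕ → (Σ _ : ℕ, ℕ) → ℂ := fun v j =>
    if (v.1 : ZMod j.1)⁻¹ * (v.2 : ZMod j.1) = (j.2 : ZMod j.1) then (symb v.1 j.1 : ℂ) else 0
    with hθ
  have key := sum_norm_sq_le_of_dual (dyadic R ×ˢ dyadic S)
    ((dyadic D).sigma fun d => range d) θ hN ?_ (fun v => α v.1 v.2)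
  · rw [Finset.sum_sigma, Finset.sum_product] at key
    refine le_trans (le_of_eq ?_) key
    rw [globalVariance]
    refine Finset.sum_congr rfl fun d hd => Finset.sum_congr rfl fun a _ => ?_
    have : NeZero d := ⟨(pos_of_mem_dyadic hD hd).ne'⟩
    rw [twistedSum_eq, Finset.sum_product]
    simp only [hθ, mul_ite, mul_zero]
  · intro c
    have h1 := h (fun d x => c ⟨d, x.val⟩)
    rw [Finset.sum_sigma, Finset.sum_product]
    calc _ = ∑ r ∈ dyadic R, ∑ s ∈ dyadic S,
          ‖∑ d ∈ dyadic D, c ⟨d, ((r : ZMod d)⁻¹ * s).val⟩ * (symb r d : ℂ)‖ ^ 2 := by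
          refine Finset.sum_congr rfl fun r _ => Finset.sum_congr rfl fun s _ => ?_
          congr 2
          rw [Finset.sum_sigma]
          refine Finset.sum_congr rfl fun d hd => ?_
          have : NeZero d := ⟨(pos_of_mem_dyadic hD hd).ne'⟩
          rw [Finset.sum_eq_single (((r : ZMod d)⁻¹ * s).val)]
          · simp [hθ]
          · intro a ha hne
            rw [hθ]
            dsimp only
            rw [if_neg, mul_zero]
            intro he
            apply hne
            rw [he, ZMod.val_cast_of_lt (mem_range.mp ha)]
          · intro hn
            exact absurd (mem_range.mpr (ZMod.val_lt _)) hn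
      _ ≤ _ := by
          refine h1.trans (le_of_eq ?_)
          congr 1
          refine Finset.sum_congr rfl fun d _ => Finset.sum_congr rfl fun a ha => ?_
          rw [ZMod.val_cast_of_lt (mem_range.mp ha)]

/-- The deviation of the sum over `s` of the pair function from its mean value. -/
noncomputable def pairDeviation (S : ℝ) (c : ∀ d : ℕ, ZMod d → ℂ) (d₁ d₂ r : ℕ) : ℂ :=
  ∑ s ∈ dyadic S, pairFun c d₁ d₂ ((r : ZMod (Nat.lcm d₁ d₂))⁻¹ * s) -
    ((dyadic S).card / (Nat.lcm d₁ d₂ : ℕ) : ℂ) *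
      ∑ x ∈ range (Nat.lcm d₁ d₂), pairFun c d₁ d₂ x

theorem cast_sum_norm_sq_eq {ι : Type*} (s : Finset ι) (z : ι → ℂ) :
    ((‖∑ i ∈ s, z i‖ : ℝ) : ℂ) ^ 2 = ∑ i ∈ s, ∑ j ∈ s, z i * (starRingEnd ℂ) (z j) := by
  rw [← Complex.mul_conj', map_sum, Finset.sum_mul_sum]

/-- For r coprime to both moduli the product of the two values of c depends only on r̄s modulo the
least common multiple; all other r are removed by the symbols. -/
theorem dual_form_eq (D R S : ℝ) (c : ∀ d : ℕ, ZMod d → ℂ) :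
    ((∑ r ∈ dyadic R, ∑ s ∈ dyadic S,
      ‖∑ d ∈ dyadic D, c d ((r : ZMod d)⁻¹ * s) * (symb r d : ℂ)‖ ^ 2 : ℝ) : ℂ) =
    ∑ r ∈ dyadic R, ∑ d₁ ∈ dyadic D, ∑ d₂ ∈ dyadic D, (symb r d₁ * symb r d₂ : ℂ) *
      ∑ s ∈ dyadic S, pairFun c d₁ d₂ ((r : ZMod (Nat.lcm d₁ d₂))⁻¹ * s) := by
  push_cast
  refine Finset.sum_congr rfl fun r _ => ?_
  simp_rw [cast_sum_norm_sq_eq, Finset.mul_sum]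
  rw [Finset.sum_comm]
  refine Finset.sum_congr rfl fun d₁ _ => ?_
  rw [Finset.sum_comm]
  refine Finset.sum_congr rfl fun d₂ _ => Finset.sum_congr rfl fun s _ => ?_
  by_cases h1 : r.Coprime d₁
  · by_cases h2 : r.Coprime d₂
    · have hL : r.Coprime (Nat.lcm d₁ d₂) :=
        Nat.Coprime.coprime_dvd_right (Nat.lcm_dvd_mul d₁ d₂) (Nat.Coprime.mul_right h1 h2)
      rw [pairFun, zmod_cast_inv_mul (Nat.dvd_lcm_left _ _) hL,
        zmod_cast_inv_mul (Nat.dvd_lcm_right _ _) hL, map_mul, map_intCast (starRingEnd ℂ)]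
      ring
    · simp [symb_of_not_coprime h2]
  · simp [symb_of_not_coprime h1]

theorem zmod_mean_cast {d Q : ℕ} [NeZero d] [NeZero Q] (h : d ∣ Q) (G : ZMod d → ℂ) :
    (∑ x, G x) / d = (∑ y : ZMod Q, G y.cast) / Q := by
  rw [zmod_sum_cast h, nsmul_eq_mul, Nat.cast_div h (by exact_mod_cast NeZero.ne d)]
  have : (Q : ℂ) ≠ 0 := by exact_mod_cast NeZero.ne Q
  have : (d : ℂ) ≠ 0 := by exact_mod_cast NeZero.ne d
  field_simp

/-- The mean values in the dual form are controlled by the bilinear form of the symbol. -/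
theorem norm_dual_main_le {D R S M : ℝ} (hD : 0 < D) (hS : 0 ≤ S) (hM : 0 ≤ M)
    (hMB : SymbBound R D M) (c : ∀ d : ℕ, ZMod d → ℂ) :
    ‖∑ r ∈ dyadic R, ∑ d₁ ∈ dyadic D, ∑ d₂ ∈ dyadic D, (symb r d₁ * symb r d₂ : ℂ) *
      (((dyadic S).card / (Nat.lcm d₁ d₂ : ℕ) : ℂ) *
        ∑ x ∈ range (Nat.lcm d₁ d₂), pairFun c d₁ d₂ x)‖ ≤
      3 * S * M / D * ∑ d ∈ dyadic D, ∑ a ∈ range d, ‖c d a‖ ^ 2 := by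
  -- Means modulo lcm(d₁, d₂) are all lifted to the one common modulus `Q`. The main part thereby
  -- becomes an average over y modulo Q of the squares ‖∑ c d y (r/d)‖², and the bilinear bound
  -- applies for every y.
  set Q := ∏ d ∈ dyadic D, d with hQ
  have hQ0 : Q ≠ 0 := Finset.prod_ne_zero_iff.mpr fun d hd => (pos_of_mem_dyadic hD.le hd).ne'
  have : NeZero Q := ⟨hQ0⟩
  have hQr : (0 : ℝ) < Q := by exact_mod_cast Nat.pos_of_ne_zero hQ0
  have hdQ : ∀ d ∈ dyadic D, d ∣ Q := fun d hd => Finset.dvd_prod_of_mem _ hd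
  have hmean : ∀ d₁ ∈ dyadic D, ∀ d₂ ∈ dyadic D,
      ((dyadic S).card / (Nat.lcm d₁ d₂ : ℕ) : ℂ) * ∑ x ∈ range (Nat.lcm d₁ d₂), pairFun c d₁ d₂ x =
      ((dyadic S).card / Q : ℂ) *
        ∑ y : ZMod Q, c d₁ y.cast * (starRingEnd ℂ) (c d₂ y.cast) := by
    intro d₁ hd₁ d₂ hd₂
    have hL : Nat.lcm d₁ d₂ ∣ Q := Nat.lcm_dvd (hdQ _ hd₁) (hdQ _ hd₂)
    have : NeZero (Nat.lcm d₁ d₂) := ⟨fun h => hQ0 (Nat.eq_zero_of_zero_dvd (h ▸ hL))⟩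
    have hm := zmod_mean_cast hL (pairFun c d₁ d₂)
    rw [sum_range_eq_sum_zmod, div_mul_eq_mul_div, mul_div_assoc, hm, div_mul_eq_mul_div,
      mul_div_assoc]
    congr 2
    refine Finset.sum_congr rfl fun y _ => ?_
    rw [pairFun, zmod_cast_cast (Nat.dvd_lcm_left _ _) hL,
      zmod_cast_cast (Nat.dvd_lcm_right _ _) hL]
  have heq : (∑ r ∈ dyadic R, ∑ d₁ ∈ dyadic D, ∑ d₂ ∈ dyadic D, (symb r d₁ * symb r d₂ : ℂ) *
      (((dyadic S).card / (Nat.lcm d₁ d₂ : ℕ) : ℂ) *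
        ∑ x ∈ range (Nat.lcm d₁ d₂), pairFun c d₁ d₂ x)) =
      ((((dyadic S).card / Q : ℝ) * ∑ y : ZMod Q, ∑ r ∈ dyadic R,
        ‖∑ d ∈ dyadic D, c d y.cast * (symb r d : ℂ)‖ ^ 2 : ℝ) : ℂ) := by
    push_cast
    rw [Finset.sum_comm (s := (univ : Finset (ZMod Q))), Finset.mul_sum]
    refine Finset.sum_congr rfl fun r _ => ?_
    simp_rw [cast_sum_norm_sq_eq]
    rw [Finset.sum_comm (s := (univ : Finset (ZMod Q))), Finset.mul_sum]
    refine Finset.sum_congr rfl fun d₁ hd₁ => ?_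
    rw [Finset.sum_comm (s := (univ : Finset (ZMod Q))), Finset.mul_sum]
    refine Finset.sum_congr rfl fun d₂ hd₂ => ?_
    rw [hmean d₁ hd₁ d₂ hd₂, Finset.mul_sum, Finset.mul_sum, Finset.mul_sum]
    refine Finset.sum_congr rfl fun y _ => ?_
    rw [map_mul, map_intCast (starRingEnd ℂ)]
    ring
  rw [heq, Complex.norm_real, Real.norm_of_nonneg (by positivity)]
  have h1 : ∑ y : ZMod Q, ∑ r ∈ dyadic R, ‖∑ d ∈ dyadic D, c d y.cast * (symb r d : ℂ)‖ ^ 2 ≤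
      M * (Q / D * ∑ d ∈ dyadic D, ∑ a ∈ range d, ‖c d a‖ ^ 2) := by
    refine (Finset.sum_le_sum fun y _ => hMB (fun d => c d y.cast)).trans ?_
    rw [← Finset.mul_sum, Finset.sum_comm, Finset.mul_sum (a := (Q / D : ℝ))]
    refine mul_le_mul_of_nonneg_left (Finset.sum_le_sum fun d hd => ?_) hM
    have : NeZero d := ⟨(pos_of_mem_dyadic hD.le hd).ne'⟩
    rw [zmod_sum_cast (hdQ d hd) (fun x => ‖c d x‖ ^ 2), nsmul_eq_mul,
      sum_range_eq_sum_zmod d (fun x => ‖c d x‖ ^ 2),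
      Nat.cast_div (hdQ d hd) (by exact_mod_cast NeZero.ne d)]
    have := ((mem_dyadic hD.le d).mp hd).1
    gcongr
  calc ((dyadic S).card / Q : ℝ) * ∑ y : ZMod Q, ∑ r ∈ dyadic R,
        ‖∑ d ∈ dyadic D, c d y.cast * (symb r d : ℂ)‖ ^ 2
      ≤ (3 * S / Q) * (M * (Q / D * ∑ d ∈ dyadic D, ∑ a ∈ range d, ‖c d a‖ ^ 2)) := by
        gcongr
        exact card_dyadic_le hS
    _ = _ := by field_simp

/-- The dual form: bilinear bound for the mean values, pairwise bound for the deviations. -/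
theorem varianceBound_of_deviation {D R S M E : ℝ} (hD : 0 < D) (hS : 0 ≤ S) (hM : 0 ≤ M)
    (hE : 0 ≤ E) (hMB : SymbBound R D M)
    (hdev : ∀ c : ∀ d : ℕ, ZMod d → ℂ, ∀ d₁ ∈ dyadic D, ∀ d₂ ∈ dyadic D,
      ∑ r ∈ (dyadic R).filter (fun r => r.Coprime (Nat.lcm d₁ d₂)), ‖pairDeviation S c d₁ d₂ r‖ ≤
        E * (√(∑ a ∈ range d₁, ‖c d₁ a‖ ^ 2) * √(∑ a ∈ range d₂, ‖c d₂ a‖ ^ 2))) :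
    VarianceBound D R S (3 * S * M / D + 3 * D * E) := by
  refine varianceBound_of_dual hD.le (by positivity) fun c => ?_
  set T := ∑ d ∈ dyadic D, ∑ a ∈ range d, ‖c d a‖ ^ 2 with hT
  set n : ℕ → ℝ := fun d => √(∑ a ∈ range d, ‖c d a‖ ^ 2) with hn
  have hsplit : ((∑ r ∈ dyadic R, ∑ s ∈ dyadic S,
      ‖∑ d ∈ dyadic D, c d ((r : ZMod d)⁻¹ * s) * (symb r d : ℂ)‖ ^ 2 : ℝ) : ℂ) =
      (∑ r ∈ dyadic R, ∑ d₁ ∈ dyadic D, ∑ d₂ ∈ dyadic D, (symb r d₁ * symb r d₂ : ℂ) *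
        (((dyadic S).card / (Nat.lcm d₁ d₂ : ℕ) : ℂ) *
          ∑ x ∈ range (Nat.lcm d₁ d₂), pairFun c d₁ d₂ x)) +
      ∑ r ∈ dyadic R, ∑ d₁ ∈ dyadic D, ∑ d₂ ∈ dyadic D, (symb r d₁ * symb r d₂ : ℂ) *
        pairDeviation S c d₁ d₂ r := by
    rw [dual_form_eq]
    simp_rw [← Finset.sum_add_distrib]
    refine Finset.sum_congr rfl fun r _ => Finset.sum_congr rfl fun d₁ _ =>
      Finset.sum_congr rfl fun d₂ _ => ?_
    rw [pairDeviation]; ring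
  have hoff : ‖∑ r ∈ dyadic R, ∑ d₁ ∈ dyadic D, ∑ d₂ ∈ dyadic D, (symb r d₁ * symb r d₂ : ℂ) *
        pairDeviation S c d₁ d₂ r‖ ≤ 3 * D * E * T := by
    calc _ ≤ ∑ r ∈ dyadic R, ∑ d₁ ∈ dyadic D, ∑ d₂ ∈ dyadic D,
          (if r.Coprime (Nat.lcm d₁ d₂) then ‖pairDeviation S c d₁ d₂ r‖ else 0) := by
          refine (norm_sum_le _ _).trans (Finset.sum_le_sum fun r _ => ?_)
          refine (norm_sum_le _ _).trans (Finset.sum_le_sum fun d₁ _ => ?_)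
          refine (norm_sum_le _ _).trans (Finset.sum_le_sum fun d₂ _ => ?_)
          rw [norm_mul, norm_mul]
          by_cases h1 : r.Coprime d₁
          · by_cases h2 : r.Coprime d₂
            · rw [if_pos (Nat.Coprime.coprime_dvd_right (Nat.lcm_dvd_mul d₁ d₂)
                (Nat.Coprime.mul_right h1 h2))]
              exact mul_le_of_le_one_left (norm_nonneg _)
                (mul_le_one₀ (norm_symb_le_one _ _) (norm_nonneg _) (norm_symb_le_one _ _))
            · rw [symb_of_not_coprime h2]; simp; split_ifs <;> positivity
          · rw [symb_of_not_coprime h1]; simp; split_ifs <;> positivity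
      _ = ∑ d₁ ∈ dyadic D, ∑ d₂ ∈ dyadic D,
          ∑ r ∈ (dyadic R).filter (fun r => r.Coprime (Nat.lcm d₁ d₂)),
            ‖pairDeviation S c d₁ d₂ r‖ := by
          rw [Finset.sum_comm]
          refine Finset.sum_congr rfl fun d₁ _ => ?_
          rw [Finset.sum_comm]
          exact Finset.sum_congr rfl fun d₂ _ => by rw [Finset.sum_filter]
      _ ≤ ∑ d₁ ∈ dyadic D, ∑ d₂ ∈ dyadic D, E * (n d₁ * n d₂) :=
          Finset.sum_le_sum fun d₁ h₁ => Finset.sum_le_sum fun d₂ h₂ => hdev c d₁ h₁ d₂ h₂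
      _ = E * (∑ d ∈ dyadic D, n d) ^ 2 := by
          rw [sq, Finset.sum_mul_sum, Finset.mul_sum]
          exact Finset.sum_congr rfl fun d₁ _ => by rw [Finset.mul_sum]
      _ ≤ E * ((3 * D) * T) := by
          refine mul_le_mul_of_nonneg_left (sq_sum_le_card_mul_sum_sq.trans ?_) hE
          have : ∑ d ∈ dyadic D, n d ^ 2 = T :=
            Finset.sum_congr rfl fun d _ => Real.sq_sqrt (Finset.sum_nonneg fun _ _ => by positivity)
          rw [this]
          exact mul_le_mul_of_nonneg_right (card_dyadic_le hD.le) (by positivity)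
      _ = _ := by ring
  have h0 : (0 : ℝ) ≤ ∑ r ∈ dyadic R, ∑ s ∈ dyadic S,
      ‖∑ d ∈ dyadic D, c d ((r : ZMod d)⁻¹ * s) * (symb r d : ℂ)‖ ^ 2 := by positivity
  rw [← Real.norm_of_nonneg h0, ← Complex.norm_real, hsplit, add_mul]
  exact (norm_add_le _ _).trans (add_le_add (norm_dual_main_le hD hS hM hMB c) hoff)

theorem sum_comp_le_sum_of_injOn {ι κ : Type*} {s : Finset ι} {t : Finset κ} {i : ι → κ}
    (g : κ → ℝ) (hi : ∀ x ∈ s, i x ∈ t) (hinj : Set.InjOn i s) (hg : ∀ y ∈ t, 0 ≤ g y) :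
    ∑ x ∈ s, g (i x) ≤ ∑ y ∈ t, g y := by
  classical
  rw [← Finset.sum_image (f := g) hinj]
  refine Finset.sum_le_sum_of_subset_of_nonneg ?_ fun y hy _ => hg y hy
  intro y hy
  obtain ⟨x, hx, rfl⟩ := mem_image.mp hy
  exact hi x hx

theorem sum_norm_pairFun_le (c : ∀ d : ℕ, ZMod d → ℂ) {d₁ d₂ : ℕ} [NeZero d₁] [NeZero d₂]
    [NeZero (Nat.lcm d₁ d₂)] :
    ∑ x, ‖pairFun c d₁ d₂ x‖ ≤
      √(d₁ * d₂) * (√(∑ a ∈ range d₁, ‖c d₁ a‖ ^ 2) * √(∑ a ∈ range d₂, ‖c d₂ a‖ ^ 2)) := by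
  set L := Nat.lcm d₁ d₂ with hL
  have hd : ∀ d : ℕ, [NeZero d] → d ∣ L → ∑ x : ZMod L, ‖c d x.cast‖ ^ 2 =
      L / d * ∑ a ∈ range d, ‖c d a‖ ^ 2 := by
    intro d _ hdL
    rw [zmod_sum_cast hdL (fun x => ‖c d x‖ ^ 2), nsmul_eq_mul,
      sum_range_eq_sum_zmod d (fun x => ‖c d x‖ ^ 2),
      Nat.cast_div hdL (by exact_mod_cast NeZero.ne d)]
  have h1 : ∑ x, ‖pairFun c d₁ d₂ x‖ = ∑ x : ZMod L, ‖c d₁ x.cast‖ * ‖c d₂ x.cast‖ :=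
    Finset.sum_congr rfl fun x _ => by rw [pairFun, norm_mul, RCLike.norm_conj]
  rw [h1]
  refine (Real.sum_mul_le_sqrt_mul_sqrt _ _ _).trans ?_
  rw [hd d₁ (Nat.dvd_lcm_left _ _), hd d₂ (Nat.dvd_lcm_right _ _), Real.sqrt_mul (by positivity),
    Real.sqrt_mul (by positivity)]
  have hp1 : (0 : ℝ) < d₁ := by exact_mod_cast Nat.pos_of_ne_zero (NeZero.ne d₁)
  have hp2 : (0 : ℝ) < d₂ := by exact_mod_cast Nat.pos_of_ne_zero (NeZero.ne d₂)
  have hLle : (L : ℝ) ≤ d₁ * d₂ := by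
    exact_mod_cast Nat.le_of_dvd (Nat.mul_pos (Nat.pos_of_ne_zero (NeZero.ne d₁))
      (Nat.pos_of_ne_zero (NeZero.ne d₂))) (Nat.lcm_dvd_mul d₁ d₂)
  have h2 : √(L / d₁ : ℝ) * √(L / d₂ : ℝ) ≤ √(d₁ * d₂ : ℝ) := by
    rw [← Real.sqrt_mul (by positivity)]
    apply Real.sqrt_le_sqrt
    rw [div_mul_div_comm, div_le_iff₀ (by positivity)]
    gcongr
  calc _ = √(L / d₁ : ℝ) * √(L / d₂ : ℝ) *
        (√(∑ a ∈ range d₁, ‖c d₁ a‖ ^ 2) * √(∑ a ∈ range d₂, ‖c d₂ a‖ ^ 2)) := by ring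
    _ ≤ _ := by gcongr

/-- A residue modulo the least common multiple is determined by its two reductions, so the sum runs
over a subset of all pairs of residues. -/
theorem sum_norm_sq_pairFun_le (c : ∀ d : ℕ, ZMod d → ℂ) {d₁ d₂ : ℕ} [NeZero d₁] [NeZero d₂]
    [NeZero (Nat.lcm d₁ d₂)] :
    ∑ x, ‖pairFun c d₁ d₂ x‖ ^ 2 ≤
      (∑ a ∈ range d₁, ‖c d₁ a‖ ^ 2) * ∑ a ∈ range d₂, ‖c d₂ a‖ ^ 2 := by
  classical
  rw [sum_range_eq_sum_zmod d₁ (fun x => ‖c d₁ x‖ ^ 2),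
    sum_range_eq_sum_zmod d₂ (fun x => ‖c d₂ x‖ ^ 2), Finset.sum_mul_sum, ← Finset.sum_product']
  have h1 : ∀ x, ‖pairFun c d₁ d₂ x‖ ^ 2 =
      (fun p : ZMod d₁ × ZMod d₂ => ‖c d₁ p.1‖ ^ 2 * ‖c d₂ p.2‖ ^ 2) (x.cast, x.cast) := by
    intro x; rw [pairFun, norm_mul, RCLike.norm_conj, mul_pow]
  rw [Finset.sum_congr rfl fun x _ => h1 x]
  exact sum_comp_le_sum_of_injOn (fun p : ZMod d₁ × ZMod d₂ => ‖c d₁ p.1‖ ^ 2 * ‖c d₂ p.2‖ ^ 2)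
    (by simp) (fun x _ y _ h => zmod_cast_pair_injective h) fun _ _ => by positivity

theorem neZero_lcm {d₁ d₂ : ℕ} (h₁ : 0 < d₁) (h₂ : 0 < d₂) : NeZero (Nat.lcm d₁ d₂) :=
  ⟨(Nat.lcm_pos h₁ h₂).ne'⟩

/-- The direct bound with absolute constants. -/
theorem varianceBound_small {D R S : ℝ} (hD : 0 < D) (hR : 0 ≤ R) (hS : 0 ≤ S) :
    VarianceBound D R S (36 * (R * S / √D + (R + S) * D ^ 2)) := by
  -- Only periodicity is used, so that no small power is lost: this keeps the constant in front of R
  -- S / √D absolute for small moduli.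
  have key := varianceBound_of_deviation (E := 6 * (R * D)) hD hS (by positivity) (by positivity)
    (symbBound_trivial hR hD.le) ?_
  · refine key.mono ?_
    have hs : √D * √D = D := Real.mul_self_sqrt hD.le
    have hs0 : 0 < √D := Real.sqrt_pos.mpr hD
    have e1 : 3 * S * (12 * (R * √D + D ^ 3)) / D = 36 * (R * S / √D + S * D ^ 2) := by
      rw [div_eq_iff hD.ne']
      have : R * S / √D * D = R * S * √D := by
        rw [div_mul_eq_mul_div, div_eq_iff hs0.ne', mul_assoc _ √D, hs]
      linear_combination -36 * this
    rw [e1]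
    nlinarith [mul_nonneg hR (sq_nonneg D)]
  · intro c d₁ hd₁ d₂ hd₂
    have p1 := pos_of_mem_dyadic hD.le hd₁
    have p2 := pos_of_mem_dyadic hD.le hd₂
    have : NeZero d₁ := ⟨p1.ne'⟩
    have : NeZero d₂ := ⟨p2.ne'⟩
    have := neZero_lcm p1 p2
    set T := √(∑ a ∈ range d₁, ‖c d₁ a‖ ^ 2) * √(∑ a ∈ range d₂, ‖c d₂ a‖ ^ 2) with hT
    have hbound : ∀ r ∈ (dyadic R).filter (fun r => r.Coprime (Nat.lcm d₁ d₂)),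
        ‖pairDeviation S c d₁ d₂ r‖ ≤ 2 * D * T := by
      intro r hr
      have hr' := (mem_filter.mp hr).2
      have h1 := norm_sum_interval_sub_mean_le (floor_le_floor_two_mul hS)
        (fun x => pairFun c d₁ d₂ ((r : ZMod (Nat.lcm d₁ d₂))⁻¹ * x))
      rw [sum_comp_inv_mul (pairFun c d₁ d₂) hr',
        sum_comp_inv_mul (fun x => ‖pairFun c d₁ d₂ x‖) hr'] at h1
      rw [pairDeviation, sum_range_eq_sum_zmod]
      refine h1.trans ((sum_norm_pairFun_le c).trans ?_)
      gcongr
      rw [Real.sqrt_le_left (by positivity)]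
      have := mul_le_of_mem_dyadic hD.le hd₁ hd₂
      push_cast at this
      nlinarith
    refine (Finset.sum_le_card_nsmul _ _ _ hbound).trans ?_
    rw [nsmul_eq_mul]
    have hc : (((dyadic R).filter (fun r => r.Coprime (Nat.lcm d₁ d₂))).card : ℝ) ≤ 3 * R :=
      le_trans (by exact_mod_cast Finset.card_filter_le _ _) (card_dyadic_le hR)
    calc _ ≤ 3 * R * (2 * D * T) := by gcongr
      _ = _ := by ring

/-- The means contribute (S/D)(R√D + D R^(3/4)) and the deviations D(√(RS) + R). The assumption R ≤
S is what absorbs R into √(RS). -/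
theorem exists_varianceBound_of_le {ε : ℝ} (hε : 0 < ε) :
    ∃ C : ℝ, 1 ≤ C ∧ ∀ Z D R S : ℝ, 1 ≤ Z → 0 < D → D ≤ Z → 0 < R → R ≤ S → S ≤ Z →
      VarianceBound D R S
        (C * Z ^ ε * (R * S / √D + R ^ (3 / 4 : ℝ) * S + D * √(R * S))) := by
  obtain ⟨C₁, hC₁, h₁⟩ := exists_symbBound hε
  obtain ⟨C₂, hC₂, h₂⟩ := exists_sum_norm_completion_le hε
  refine ⟨3 * C₁ + 6 * C₂, by linarith, fun Z D R S hZ hD hDZ hR hRS hSZ => ?_⟩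
  have hS : 0 < S := hR.trans_le hRS
  have key := varianceBound_of_deviation (E := C₂ * Z ^ ε * (√(R * S) + R)) hD hS.le
    (by positivity) (by positivity) (h₁ Z R D hZ hR.le (hRS.trans hSZ) hD.le hDZ) ?_
  · refine key.mono ?_
    have hs : √D * √D = D := Real.mul_self_sqrt hD.le
    have hs0 : 0 < √D := Real.sqrt_pos.mpr hD
    have e1 : 3 * S * (C₁ * Z ^ ε * (R * √D + D * R ^ (3 / 4 : ℝ))) / D =
        3 * C₁ * Z ^ ε * (R * S / √D + R ^ (3 / 4 : ℝ) * S) := by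
      rw [div_eq_iff hD.ne']
      have : R * S / √D * D = R * S * √D := by
        rw [div_mul_eq_mul_div, div_eq_iff hs0.ne', mul_assoc _ √D, hs]
      linear_combination -3 * C₁ * Z ^ ε * this
    have e2 : R ≤ √(R * S) := Real.le_sqrt_of_sq_le (by nlinarith)
    rw [e1]
    have hz : 0 ≤ Z ^ ε := by positivity
    have e3 : 3 * D * (C₂ * Z ^ ε * (√(R * S) + R)) ≤ 6 * C₂ * Z ^ ε * (D * √(R * S)) := by
      have : 0 ≤ D * (C₂ * Z ^ ε) := by positivity
      nlinarith
    have e4 : 0 ≤ C₂ * Z ^ ε * (R * S / √D + R ^ (3 / 4 : ℝ) * S) := by positivity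
    have e5 : 0 ≤ C₁ * Z ^ ε * (D * √(R * S)) := by positivity
    nlinarith
  · intro c d₁ hd₁ d₂ hd₂
    have p1 := pos_of_mem_dyadic hD.le hd₁
    have p2 := pos_of_mem_dyadic hD.le hd₂
    have : NeZero d₁ := ⟨p1.ne'⟩
    have : NeZero d₂ := ⟨p2.ne'⟩
    have := neZero_lcm p1 p2
    have hL : ((Nat.lcm d₁ d₂ : ℕ) : ℝ) ≤ 4 * Z ^ 2 := by
      have e1 : ((Nat.lcm d₁ d₂ : ℕ) : ℝ) ≤ (d₁ * d₂ : ℕ) := by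
        exact_mod_cast Nat.le_of_dvd (Nat.mul_pos p1 p2) (Nat.lcm_dvd_mul d₁ d₂)
      refine e1.trans ((mul_le_of_mem_dyadic hD.le hd₁ hd₂).trans ?_)
      gcongr
    have h3 := h₂ Z R S hZ hR hS (hRS.trans hSZ) hSZ (Nat.lcm d₁ d₂) hL (pairFun c d₁ d₂)
    simp only [pairDeviation, sum_range_eq_sum_zmod]
    refine h3.trans ?_
    rw [← Real.sqrt_mul (by positivity)]
    gcongr
    exact sum_norm_sq_pairFun_le c

/-! ### Interchanging the two variables -/

theorem mem_dyadic_div {S : ℝ} (hS : 0 ≤ S) {k : ℕ} (hk : 0 < k) (n : ℕ) :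
    n ∈ dyadic (S / k) ↔ k * n ∈ dyadic S := by
  have hkr : (0 : ℝ) < k := by exact_mod_cast hk
  rw [mem_dyadic (by positivity), mem_dyadic hS, div_lt_iff₀ hkr, mul_div_assoc', le_div_iff₀ hkr]
  push_cast
  rw [mul_comm (n : ℝ)]

/-- Summation over the multiples of `k` in a dyadic range. -/
theorem sum_dyadic_multiples {S : ℝ} (hS : 0 ≤ S) {k : ℕ} (hk : 0 < k) {M : Type*}
    [AddCommMonoid M] (f : ℕ → M) :
    ∑ s ∈ dyadic S with k ∣ s, f s = ∑ s ∈ dyadic (S / k), f (k * s) := by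
  have : (dyadic S).filter (fun s => k ∣ s) = (dyadic (S / k)).image (k * ·) := by
    ext n
    simp only [mem_filter, mem_image, mem_dyadic_div hS hk]
    constructor
    · rintro ⟨h, m, rfl⟩; exact ⟨m, h, rfl⟩
    · rintro ⟨m, h, rfl⟩; exact ⟨h, m, rfl⟩
  rw [this, Finset.sum_image fun a _ b _ h => Nat.eq_of_mul_eq_mul_left hk h]

theorem inv_mul_eq_iff_of_coprime {r d : ℕ} (hr : r.Coprime d) (s a : ZMod d) :
    (r : ZMod d)⁻¹ * s = a ↔ s = r * a := by
  have e := ZMod.coe_mul_inv_eq_one r hr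
  constructor
  · rintro rfl; rw [← mul_assoc, e, one_mul]
  · rintro rfl; rw [← mul_assoc, mul_comm _ (r : ZMod d), e, one_mul]

/-- Interchange of the roles of the two variables in the summand. -/
theorem symb_swap {k d a r s : ℕ} (hk : 0 < k) (hd : 0 < d) (ha : a.Coprime d) :
    (if (r : ZMod (k * d))⁻¹ * ((k * s : ℕ) : ZMod (k * d)) = ((k * a : ℕ) : ZMod (k * d))
      then symb r (k * d) else 0) =
    symb a d * (if (s : ZMod d)⁻¹ * (r : ZMod d) = (a : ZMod d)⁻¹ then symb r k * symb s d else 0) := by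
  rw [symb_mul_right r hk.ne' hd.ne']
  have hau := ZMod.coe_mul_inv_eq_one a ha
  by_cases hrk : r.Coprime k
  swap
  · simp [symb_of_not_coprime hrk]
  by_cases hsd : s.Coprime d
  · simp only [inv_mul_eq_iff_of_coprime hsd]
    by_cases hrd : r.Coprime d
    · simp only [inv_mul_eq_iff_of_coprime (Nat.Coprime.mul_right hrk hrd)]
      have e1 : ((k * s : ℕ) : ZMod (k * d)) = r * ((k * a : ℕ) : ZMod (k * d)) ↔
          (s : ZMod d) = r * a := by
        rw [← Nat.cast_mul, ← Nat.cast_mul, ZMod.natCast_eq_natCast_iff,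
          ZMod.natCast_eq_natCast_iff, mul_left_comm r k a]
        exact Nat.ModEq.mul_left_cancel_iff' hk.ne'
      have e2 : (r : ZMod d) = s * (a : ZMod d)⁻¹ ↔ (s : ZMod d) = r * a := by
        constructor
        · intro h; rw [h, mul_assoc, mul_comm _ (a : ZMod d), hau, mul_one]
        · intro h; rw [h, mul_assoc, hau, mul_one]
      simp only [e1, e2]
      split_ifs with h
      · rw [← Nat.cast_mul, ZMod.natCast_eq_natCast_iff] at h
        rw [symb_congr h, symb_mul_left]
        linear_combination (-symb r k * symb r d) * symb_mul_self ha
      · simp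
    · have hn : (r : ZMod d) ≠ s * (a : ZMod d)⁻¹ := by
        intro h
        apply hrd
        rw [← ZMod.isUnit_iff_coprime, h]
        exact ((ZMod.isUnit_iff_coprime s d).mpr hsd).mul
          (IsUnit.of_mul_eq_one (a : ZMod d) (by rw [mul_comm]; exact hau))
      simp [symb_of_not_coprime hrd, hn]
  · rw [symb_of_not_coprime hsd]
    simp only [mul_zero, ite_self]
    by_cases hrd : r.Coprime d
    · rw [if_neg]
      rw [inv_mul_eq_iff_of_coprime (Nat.Coprime.mul_right hrk hrd), ← Nat.cast_mul, ZMod.natCast_eq_natCast_iff, mul_left_comm r k a,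
        Nat.ModEq.mul_left_cancel_iff' hk.ne']
      intro h
      apply hsd
      rw [Nat.coprime_iff_gcd_eq_one, h.gcd_eq]
      exact Nat.Coprime.mul_left hrd ha
    · simp [symb_of_not_coprime hrd]

/-- The modulus and the class are divided by their greatest common divisor k. The congruence forces
k ∣ s, and with s = k s′ it becomes s′ ≡ ra (mod d). Inverting a exchanges r and s′, while (r/d) =
(a/d)(s′/d). -/
theorem twistedSum_swap {R S : ℝ} (hS : 0 ≤ S) (α : ℕ → ℕ → ℂ) {k d a : ℕ} (hk : 0 < k)
    (hd : 0 < d) (ha : a.Coprime d) :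
    twistedSum R S α (k * d) (k * a) = (symb a d : ℂ) *
      twistedSum (S / k) R (fun s r => α r (k * s) * (symb r k : ℂ)) d ((a : ZMod d)⁻¹).val := by
  have : NeZero d := ⟨hd.ne'⟩
  have : NeZero (k * d) := ⟨(Nat.mul_pos hk hd).ne'⟩
  rw [twistedSum_eq, twistedSum_eq, Finset.sum_comm (s := dyadic (S / k)), Finset.mul_sum]
  refine Finset.sum_congr rfl fun r _ => ?_
  rw [Finset.mul_sum, ← Finset.sum_filter_of_ne (p := fun s => k ∣ s), sum_dyadic_multiples hS hk]
  · refine Finset.sum_congr rfl fun s _ => ?_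
    rw [ZMod.natCast_zmod_val]
    have h := congrArg (fun z : ℤ => α r (k * s) * (z : ℂ)) (symb_swap (r := r) (s := s) hk hd ha)
    push_cast at h ⊢
    simp only [mul_ite, mul_zero] at h ⊢
    rw [h]
    split_ifs <;> ring
  · intro s _ hne
    by_contra hks
    apply hne
    by_cases hr : r.Coprime (k * d)
    · rw [if_neg]
      rw [inv_mul_eq_iff_of_coprime hr, ← Nat.cast_mul, ZMod.natCast_eq_natCast_iff]
      intro h
      apply hks
      have h' := (h.of_mul_right d).dvd_iff (dvd_refl k)
      exact h'.mpr ⟨r * a, by ring⟩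
    · simp [symb_of_not_coprime hr]

/-- The global variance is bounded by variances with the roles of `r` and `s` interchanged. -/
theorem globalVariance_le_swap {D R S : ℝ} (hD : 0 ≤ D) (hS : 0 ≤ S) (α : ℕ → ℕ → ℂ) :
    globalVariance D R S α ≤ ∑ k ∈ Icc 1 ⌊2 * D⌋₊,
      globalVariance (D / k) (S / k) R (fun s r => α r (k * s) * (symb r k : ℂ)) := by
  classical
  set T : ℕ → ℕ → ℕ → ℝ := fun k d b =>
    ‖twistedSum (S / k) R (fun s r => α r (k * s) * (symb r k : ℂ)) d b‖ ^ 2 with hT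
  set U := (Icc 1 ⌊2 * D⌋₊).sigma fun k => (dyadic (D / k)).sigma fun d => range d with hU
  -- A pair (modulus, class) goes to (gcd, reduced modulus, inverse of the reduced class), and this
  -- map is injective.
  set ι : (Σ _ : ℕ, ℕ) → (Σ _ : ℕ, Σ _ : ℕ, ℕ) := fun p =>
    ⟨p.2.gcd p.1, p.1 / p.2.gcd p.1,
      (((p.2 / p.2.gcd p.1 : ℕ) : ZMod (p.1 / p.2.gcd p.1))⁻¹).val⟩ with hι
  have hdata : ∀ p ∈ (dyadic D).sigma fun d => range d, ∃ k d a : ℕ, 0 < k ∧ 0 < d ∧ a < d ∧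
      a.Coprime d ∧ p = ⟨k * d, k * a⟩ ∧ ι p = ⟨k, d, ((a : ZMod d)⁻¹).val⟩ ∧ k * d ∈ dyadic D := by
    intro p hp
    rw [mem_sigma, mem_range] at hp
    have h0 := pos_of_mem_dyadic hD hp.1
    have hg : 0 < p.2.gcd p.1 := Nat.gcd_pos_of_pos_right _ h0
    have e1 : p.2.gcd p.1 * (p.1 / p.2.gcd p.1) = p.1 := Nat.mul_div_cancel' (Nat.gcd_dvd_right _ _)
    have e2 : p.2.gcd p.1 * (p.2 / p.2.gcd p.1) = p.2 := Nat.mul_div_cancel' (Nat.gcd_dvd_left _ _)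
    refine ⟨p.2.gcd p.1, p.1 / p.2.gcd p.1, p.2 / p.2.gcd p.1, hg,
      Nat.div_pos (Nat.le_of_dvd h0 (Nat.gcd_dvd_right _ _)) hg, ?_,
      Nat.coprime_div_gcd_div_gcd hg, by rw [e1, e2], rfl, by rw [e1]; exact hp.1⟩
    exact Nat.div_lt_div_of_lt_of_dvd (Nat.gcd_dvd_right _ _) hp.2
  have hle : ∑ p ∈ (dyadic D).sigma fun d => range d, ‖twistedSum R S α p.1 p.2‖ ^ 2 ≤
      ∑ q ∈ U, T q.1 q.2.1 q.2.2 := by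
    have h1 : ∀ p ∈ (dyadic D).sigma fun d => range d, ‖twistedSum R S α p.1 p.2‖ ^ 2 ≤
        (fun q : (Σ _ : ℕ, Σ _ : ℕ, ℕ) => T q.1 q.2.1 q.2.2) (ι p) := by
      intro p hp
      obtain ⟨k, d, a, hk, hd, -, ha, rfl, hιp, -⟩ := hdata p hp
      rw [hιp]
      dsimp only
      rw [twistedSum_swap hS α hk hd ha, norm_mul, mul_pow]
      refine mul_le_of_le_one_left (by positivity) (pow_le_one₀ (norm_nonneg _) (norm_symb_le_one _ _))
    refine (Finset.sum_le_sum h1).trans ?_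
    refine sum_comp_le_sum_of_injOn (fun q : (Σ _ : ℕ, Σ _ : ℕ, ℕ) => T q.1 q.2.1 q.2.2) ?_ ?_
      fun _ _ => by positivity
    · intro p hp
      obtain ⟨k, d, a, hk, hd, -, ha, rfl, hιp, hm⟩ := hdata p hp
      rw [hιp, hU, mem_sigma, mem_sigma, mem_Icc, mem_range, mem_dyadic_div hD hk]
      have : NeZero d := ⟨hd.ne'⟩
      refine ⟨⟨hk, ?_⟩, hm, ZMod.val_lt _⟩
      have h2 := ((mem_dyadic hD _).mp hm).2
      apply Nat.le_floor
      refine le_trans ?_ h2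
      exact_mod_cast Nat.le_mul_of_pos_right k hd
    · intro p hp p' hp' he
      obtain ⟨k, d, a, hk, hd, had, ha, rfl, hιp, -⟩ := hdata p hp
      obtain ⟨k', d', a', hk', hd', had', ha', rfl, hιp', -⟩ := hdata p' hp'
      rw [hιp, hιp'] at he
      simp only [Sigma.mk.injEq, heq_eq_eq] at he
      obtain ⟨rfl, rfl, he⟩ := he
      have : NeZero d := ⟨hd.ne'⟩
      have h3 : (a : ZMod d)⁻¹ = (a' : ZMod d)⁻¹ := ZMod.val_injective d he
      have e1 := ZMod.coe_mul_inv_eq_one a ha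
      have e2 := ZMod.coe_mul_inv_eq_one a' ha'
      have h4 : (a : ZMod d) = a' := by
        calc (a : ZMod d) = a * (a' * (a' : ZMod d)⁻¹) := by rw [e2, mul_one]
          _ = a' * (a * (a : ZMod d)⁻¹) := by rw [h3]; ring
          _ = a' := by rw [e1, mul_one]
      rw [ZMod.natCast_eq_natCast_iff] at h4
      have h5 := h4.eq_of_lt_of_lt had had'
      rw [h5]
  rw [Finset.sum_sigma] at hle
  refine hle.trans (le_of_eq ?_)
  rw [hU, Finset.sum_sigma]
  refine Finset.sum_congr rfl fun k _ => ?_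
  rw [Finset.sum_sigma, globalVariance]

/-- A given s is counted once for every k ∣ s, which costs the divisor bound `P`. -/
theorem varianceBound_swap {D R S N P : ℝ} (hD : 0 ≤ D) (hS : 0 ≤ S) (hN : 0 ≤ N)
    (hP : ∀ s ∈ dyadic S, (s.divisors.card : ℝ) ≤ P)
    (h : ∀ k ∈ Icc 1 ⌊2 * D⌋₊, VarianceBound (D / k) (S / k) R N) :
    VarianceBound D R S (P * N) := by
  intro α
  refine (globalVariance_le_swap hD hS α).trans ?_
  have h1 : ∀ k ∈ Icc 1 ⌊2 * D⌋₊,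
      globalVariance (D / k) (S / k) R (fun s r => α r (k * s) * (symb r k : ℂ)) ≤
        N * ∑ s ∈ dyadic S, if k ∣ s then ∑ r ∈ dyadic R, ‖α r s‖ ^ 2 else 0 := by
    intro k hk
    refine (h k hk _).trans (mul_le_mul_of_nonneg_left ?_ hN)
    rw [← Finset.sum_filter, sum_dyadic_multiples hS (mem_Icc.mp hk).1]
    refine Finset.sum_le_sum fun s _ => Finset.sum_le_sum fun r _ => ?_
    rw [norm_mul, mul_pow]
    exact mul_le_of_le_one_right (by positivity)
      (pow_le_one₀ (norm_nonneg _) (norm_symb_le_one _ _))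
  refine (Finset.sum_le_sum h1).trans ?_
  rw [← Finset.mul_sum, Finset.sum_comm, mul_comm P N, mul_assoc]
  refine mul_le_mul_of_nonneg_left ?_ hN
  rw [Finset.sum_comm (s := dyadic R), Finset.mul_sum]
  refine Finset.sum_le_sum fun s hs => ?_
  rw [← Finset.sum_filter, Finset.sum_const, nsmul_eq_mul]
  refine mul_le_mul_of_nonneg_right (le_trans ?_ (hP s hs)) (by positivity)
  norm_cast
  refine Finset.card_le_card fun k hk => ?_
  exact Nat.mem_divisors.mpr ⟨(mem_filter.mp hk).2, (pos_of_mem_dyadic hS hs).ne'⟩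

/-- The direct bound up to small powers, symmetric in the two variables. -/
theorem exists_varianceBound {ε : ℝ} (hε : 0 < ε) :
    ∃ C : ℝ, 1 ≤ C ∧ ∀ Z D R S : ℝ, 1 ≤ Z → 0 < D → D ≤ Z → 0 < R → R ≤ Z → 0 < S → S ≤ Z →
      VarianceBound D R S (C * Z ^ ε * (R * S / √D + (R ^ (3 / 4 : ℝ) * S + R * S ^ (3 / 4 : ℝ)) +
        D * √(R * S))) := by
  obtain ⟨C₁, hC₁, h₁⟩ := exists_varianceBound_of_le (show 0 < ε / 2 by positivity)
  obtain ⟨C₂, hC₂, h₂⟩ := exists_card_divisors_le 2 1 (show 0 < ε / 2 by positivity)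
  refine ⟨C₂ * C₁, one_le_mul_of_one_le_of_one_le hC₂ hC₁,
    fun Z D R S hZ hD hDZ hR hRZ hS hSZ => ?_⟩
  have hz : 1 ≤ Z ^ (ε / 2) := Real.one_le_rpow hZ (by positivity)
  have hzz : Z ^ ε = Z ^ (ε / 2) * Z ^ (ε / 2) := by
    rw [← Real.rpow_add (by linarith), add_halves]
  have hP1 : 1 ≤ C₂ * Z ^ (ε / 2) := one_le_mul_of_one_le_of_one_le hC₂ hz
  have heq : C₂ * C₁ * Z ^ ε = (C₂ * Z ^ (ε / 2)) * (C₁ * Z ^ (ε / 2)) := by rw [hzz]; ring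
  rw [heq, mul_assoc]
  rcases le_total R S with hRS | hRS
  · refine (h₁ Z D R S hZ hD hDZ hR hRS hSZ).mono ?_
    refine le_trans ?_ (le_mul_of_one_le_left (by positivity) hP1)
    gcongr
    exact le_add_of_nonneg_right (by positivity)
  -- After the interchange the first side is S/k ≤ S ≤ R, so the ordered case applies to every k.
  · refine varianceBound_swap hD.le hS.le (by positivity) ?_ ?_
    · intro s hs
      refine h₂ Z hZ s (pos_of_mem_dyadic hS.le hs).ne' ?_
      rw [pow_one]
      exact (((mem_dyadic hS.le s).mp hs).2).trans (by gcongr)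
    · intro k hk
      have hk1 : (1 : ℝ) ≤ k := by exact_mod_cast (mem_Icc.mp hk).1
      have hk0 : (0 : ℝ) < k := by linarith
      have hSk : S / k ≤ S := div_le_self hS.le hk1
      have hDk : D / k ≤ D := div_le_self hD.le hk1
      refine (h₁ Z (D / k) (S / k) R hZ (by positivity) (hDk.trans hDZ) (by positivity)
        (hSk.trans hRS) hRZ).mono ?_
      have e1 : S / k * R / √(D / k) ≤ R * S / √D := by
        rw [Real.sqrt_div hD.le]
        have hs0 : 0 < √D := Real.sqrt_pos.mpr hD
        have hsk : √(k : ℝ) ≤ k := by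
          rw [Real.sqrt_le_left hk0.le]; nlinarith
        have : S / k * R / (√D / √k) = R * S / √D * (√k / k) := by
          field_simp
        rw [this]
        exact mul_le_of_le_one_right (by positivity) ((div_le_one hk0).mpr hsk)
      have e2 : (S / k) ^ (3 / 4 : ℝ) * R ≤ R * S ^ (3 / 4 : ℝ) := by
        rw [mul_comm]; gcongr
      have e3 : D / k * √(S / k * R) ≤ D * √(R * S) := by
        rw [mul_comm R S]; gcongr
      have e4 : 0 ≤ R ^ (3 / 4 : ℝ) * S := by positivity
      gcongr
      linarith

/-! ### Separation of variables in sesquilinear forms -/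

/-- A family of sesquilinear forms, with kernels `k e`, is bounded by `N` in the sum over `e`. -/
def FormBound {ι : Type*} (Es : Finset ℕ) (P : Finset ι) (k : ℕ → ι → ι → ℂ) (N : ℝ) : Prop :=
  ∀ β γ : ι → ℂ, ∑ e ∈ Es, ‖∑ v₁ ∈ P, ∑ v₂ ∈ P, β v₁ * (starRingEnd ℂ) (γ v₂) * k e v₁ v₂‖ ≤
    N * (√(∑ v ∈ P, ‖β v‖ ^ 2) * √(∑ v ∈ P, ‖γ v‖ ^ 2))

namespace FormBound

variable {ι : Type*} {Es : Finset ℕ} {P : Finset ι} {k k' : ℕ → ι → ι → ℂ} {N N' : ℝ}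

theorem congr (h : FormBound Es P k N)
    (hk : ∀ e ∈ Es, ∀ v₁ ∈ P, ∀ v₂ ∈ P, k' e v₁ v₂ = k e v₁ v₂) : FormBound Es P k' N := by
  intro β γ
  refine le_trans (le_of_eq ?_) (h β γ)
  refine Finset.sum_congr rfl fun e he => ?_
  congr 1
  exact Finset.sum_congr rfl fun v₁ h₁ => Finset.sum_congr rfl fun v₂ h₂ => by
    rw [hk e he v₁ h₁ v₂ h₂]

theorem mono (h : FormBound Es P k N) (hN : N ≤ N') : FormBound Es P k N' :=
  fun β γ => (h β γ).trans (by gcongr)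

theorem add (h : FormBound Es P k N) (h' : FormBound Es P k' N') :
    FormBound Es P (fun e v₁ v₂ => k e v₁ v₂ + k' e v₁ v₂) (N + N') := by
  intro β γ
  rw [add_mul]
  refine le_trans ?_ (add_le_add (h β γ) (h' β γ))
  rw [← Finset.sum_add_distrib]
  refine Finset.sum_le_sum fun e _ => ?_
  simp_rw [mul_add, Finset.sum_add_distrib]
  exact norm_add_le _ _

theorem zero : FormBound Es P (fun _ _ _ => 0) 0 := by
  intro β γ; simp

theorem sum {κ : Type*} (J : Finset κ) {k : κ → ℕ → ι → ι → ℂ} {N : κ → ℝ}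
    (h : ∀ j ∈ J, FormBound Es P (k j) (N j)) :
    FormBound Es P (fun e v₁ v₂ => ∑ j ∈ J, k j e v₁ v₂) (∑ j ∈ J, N j) := by
  classical
  induction J using Finset.induction_on with
  | empty => simpa using zero
  | insert j J hj ih =>
    rw [Finset.sum_insert hj]
    refine ((h j (mem_insert_self _ _)).add (ih fun i hi => h i (mem_insert_of_mem hi))).congr ?_
    intro e _ v₁ _ v₂ _
    rw [Finset.sum_insert hj]

/-- Multiplication of the kernels by a separated function. -/
theorem mul_sep (h : FormBound Es P k N) (hN : 0 ≤ N) {c : ℕ → ℂ} {a b : ι → ℂ} {A B C : ℝ}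
    (hA : 0 ≤ A) (hB : 0 ≤ B) (hC : 0 ≤ C)
    (hc : ∀ e ∈ Es, ‖c e‖ ≤ C) (ha : ∀ v ∈ P, ‖a v‖ ≤ A) (hb : ∀ v ∈ P, ‖b v‖ ≤ B) :
    FormBound Es P (fun e v₁ v₂ => c e * (a v₁ * b v₂) * k e v₁ v₂) (C * (A * B) * N) := by
  intro β γ
  have hnorm : ∀ (f : ι → ℂ) (g : ι → ℂ) (G : ℝ), 0 ≤ G → (∀ v ∈ P, ‖g v‖ ≤ G) →
      √(∑ v ∈ P, ‖f v * g v‖ ^ 2) ≤ G * √(∑ v ∈ P, ‖f v‖ ^ 2) := by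
    intro f g G hG hg
    rw [← Real.sqrt_sq hG, ← Real.sqrt_mul (by positivity), Finset.mul_sum]
    refine Real.sqrt_le_sqrt (Finset.sum_le_sum fun v hv => ?_)
    rw [norm_mul, mul_pow, mul_comm]
    gcongr
    exact hg v hv
  have h1 := h (fun v => β v * a v) (fun v => γ v * (starRingEnd ℂ) (b v))
  have h2 := hnorm β a A hA ha
  have h3 := hnorm γ (fun v => (starRingEnd ℂ) (b v)) B hB
    (fun v hv => by rw [RCLike.norm_conj]; exact hb v hv)
  calc ∑ e ∈ Es, ‖∑ v₁ ∈ P, ∑ v₂ ∈ P,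
        β v₁ * (starRingEnd ℂ) (γ v₂) * (c e * (a v₁ * b v₂) * k e v₁ v₂)‖
      ≤ ∑ e ∈ Es, C * ‖∑ v₁ ∈ P, ∑ v₂ ∈ P,
        (β v₁ * a v₁) * (starRingEnd ℂ) (γ v₂ * (starRingEnd ℂ) (b v₂)) * k e v₁ v₂‖ := by
        refine Finset.sum_le_sum fun e he => ?_
        have : ∑ v₁ ∈ P, ∑ v₂ ∈ P,
            β v₁ * (starRingEnd ℂ) (γ v₂) * (c e * (a v₁ * b v₂) * k e v₁ v₂) =
            c e * ∑ v₁ ∈ P, ∑ v₂ ∈ P,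
        (β v₁ * a v₁) * (starRingEnd ℂ) (γ v₂ * (starRingEnd ℂ) (b v₂)) * k e v₁ v₂ := by
          simp_rw [Finset.mul_sum]
          refine Finset.sum_congr rfl fun v₁ _ => Finset.sum_congr rfl fun v₂ _ => ?_
          rw [map_mul, Complex.conj_conj]; ring
        rw [this, norm_mul]
        exact mul_le_mul_of_nonneg_right (hc e he) (norm_nonneg _)
    _ ≤ C * (N * ((A * √(∑ v ∈ P, ‖β v‖ ^ 2)) * (B * √(∑ v ∈ P, ‖γ v‖ ^ 2)))) := by
        rw [← Finset.mul_sum]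
        refine mul_le_mul_of_nonneg_left (h1.trans ?_) hC
        refine mul_le_mul_of_nonneg_left ?_ hN
        exact mul_le_mul h2 h3 (by positivity) (by positivity)
    _ = _ := by ring

theorem neg (h : FormBound Es P k N) : FormBound Es P (fun e v₁ v₂ => -k e v₁ v₂) N := by
  intro β γ
  simpa using h β γ

theorem sub (h : FormBound Es P k N) (h' : FormBound Es P k' N') :
    FormBound Es P (fun e v₁ v₂ => k e v₁ v₂ - k' e v₁ v₂) (N + N') :=
  (h.add h'.neg).congr fun _ _ _ _ _ _ => sub_eq_add_neg _ _

/-- A crude finite bound, needed only to start the iteration in `of_improve`. -/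
theorem exists_formBound (Es : Finset ℕ) (P : Finset ι) (k : ℕ → ι → ι → ℂ) :
    ∃ N : ℝ, 0 ≤ N ∧ FormBound Es P k N := by
  refine ⟨∑ e ∈ Es, ∑ v₁ ∈ P, ∑ v₂ ∈ P, ‖k e v₁ v₂‖, by positivity, fun β γ => ?_⟩
  have hle : ∀ (f : ι → ℂ), ∀ v ∈ P, ‖f v‖ ≤ √(∑ v ∈ P, ‖f v‖ ^ 2) := by
    intro f v hv
    refine Real.le_sqrt_of_sq_le ?_
    exact Finset.single_le_sum (f := fun v => ‖f v‖ ^ 2) (fun _ _ => by positivity) hv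
  simp_rw [Finset.sum_mul]
  refine Finset.sum_le_sum fun e _ => ?_
  refine (norm_sum_le _ _).trans (Finset.sum_le_sum fun v₁ h₁ => ?_)
  refine (norm_sum_le _ _).trans (Finset.sum_le_sum fun v₂ h₂ => ?_)
  rw [norm_mul, norm_mul, RCLike.norm_conj, mul_comm]
  have := hle β v₁ h₁
  have := hle γ v₂ h₂
  gcongr

/-- A limiting argument for bounds that improve themselves. -/
theorem of_improve {k : ℕ → ι → ι → ℂ}
    (h : ∀ M : ℝ, 0 ≤ M → FormBound Es P k M → FormBound Es P k (N + M / 2)) (hN : 0 ≤ N) :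
    FormBound Es P k (2 * N) := by
  obtain ⟨M, hM, hM'⟩ := exists_formBound Es P k
  have hstep : ∀ n : ℕ, FormBound Es P k (2 * N + M / 2 ^ n) := by
    intro n
    induction n with
    | zero => exact hM'.mono (by simp; exact hN)
    | succ n ih =>
      refine (h _ (by positivity) ih).mono (le_of_eq ?_)
      rw [pow_succ]; field_simp; ring
  intro β γ
  have hlim : Filter.Tendsto (fun n : ℕ => (2 * N + M / 2 ^ n) *
      (√(∑ v ∈ P, ‖β v‖ ^ 2) * √(∑ v ∈ P, ‖γ v‖ ^ 2))) Filter.atTop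
      (nhds ((2 * N + 0) * (√(∑ v ∈ P, ‖β v‖ ^ 2) * √(∑ v ∈ P, ‖γ v‖ ^ 2)))) := by
    refine Filter.Tendsto.mul_const _ (Filter.Tendsto.const_add _ ?_)
    exact Filter.Tendsto.div_atTop tendsto_const_nhds (tendsto_pow_atTop_atTop_of_one_lt (by norm_num))
  rw [add_zero] at hlim
  exact ge_of_tendsto' hlim fun n => hstep n β γ

open MeasureTheory in
/-- Multiplication by the Laplace transform of a character. -/
theorem mul_laplace (h : FormBound Es P k N) (ρ : ι → ℝ) {p : ℕ → ℝ} {p₀ : ℝ} (hp₀ : 0 < p₀)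
    (hp : ∀ e ∈ Es, p₀ ≤ p e ∧ p e ≤ 2 * p₀) :
    FormBound Es P
      (fun e v₁ v₂ => (p e / (p e - (ρ v₁ - ρ v₂) * Complex.I) : ℂ) * k e v₁ v₂) (2 * N) := by
  intro β γ
  set T := √(∑ v ∈ P, ‖β v‖ ^ 2) * √(∑ v ∈ P, ‖γ v‖ ^ 2) with hT
  -- p/(p − ix) is the integral of p e^(−pη) e^(ixη) over η > 0. With x = ρ(v₁) − ρ(v₂) the
  -- oscillating factor splits into unimodular functions of v₁ and v₂. The dependence on e is
  -- removed by e^(−pη) ≤ e^(−p₀η), and p ≤ 2p₀ accounts for the factor 2.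
  set z : ℝ → ι → ι → ℂ := fun q v₁ v₂ => -q + (ρ v₁ - ρ v₂) * Complex.I with hz
  have hzre : ∀ q : ℝ, ∀ v₁ v₂, (z q v₁ v₂).re = -q := by
    intro q v₁ v₂; simp [hz]
  set G : ℕ → ℝ → ℝ → ℂ := fun e q η => ∑ v₁ ∈ P, ∑ v₂ ∈ P,
    β v₁ * (starRingEnd ℂ) (γ v₂) * k e v₁ v₂ * Complex.exp (z q v₁ v₂ * η) with hG
  have hGint : ∀ e, ∀ q : ℝ, 0 < q → IntegrableOn (G e q) (Set.Ioi 0) := by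
    intro e q hq
    refine integrable_finsetSum _ fun v₁ _ => integrable_finsetSum _ fun v₂ _ => ?_
    exact (integrableOn_exp_mul_complex_Ioi (by rw [hzre]; linarith) 0).const_mul _
  have hGnorm : ∀ e, ∀ q η : ℝ, ‖G e q η‖ = Real.exp (-(q * η)) * ‖∑ v₁ ∈ P, ∑ v₂ ∈ P,
      (β v₁ * Complex.exp (ρ v₁ * Complex.I * η)) *
        (starRingEnd ℂ) (γ v₂ * Complex.exp (ρ v₂ * Complex.I * η)) * k e v₁ v₂‖ := by
    intro e q η
    have : G e q η = Complex.exp ((-(q * η) : ℝ) : ℂ) * ∑ v₁ ∈ P, ∑ v₂ ∈ P,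
      (β v₁ * Complex.exp (ρ v₁ * Complex.I * η)) *
        (starRingEnd ℂ) (γ v₂ * Complex.exp (ρ v₂ * Complex.I * η)) * k e v₁ v₂ := by
      rw [hG, Finset.mul_sum]
      refine Finset.sum_congr rfl fun v₁ _ => ?_
      rw [Finset.mul_sum]
      refine Finset.sum_congr rfl fun v₂ _ => ?_
      have e1 : Complex.exp (z q v₁ v₂ * η) = Complex.exp ((-(q * η) : ℝ) : ℂ) *
          Complex.exp (ρ v₁ * Complex.I * η) * Complex.exp (-(ρ v₂ * Complex.I * η)) := by
        rw [← Complex.exp_add, ← Complex.exp_add]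
        congr 1
        rw [hz]; push_cast; ring
      have e2 : (starRingEnd ℂ) (Complex.exp (ρ v₂ * Complex.I * η)) =
          Complex.exp (-(ρ v₂ * Complex.I * η)) := by
        rw [← Complex.exp_conj]
        congr 1
        simp
      rw [map_mul, e1, e2]; ring
    rw [this, norm_mul, Complex.norm_exp_ofReal]
  have hsum : ∀ η : ℝ, ∑ e ∈ Es, ‖G e p₀ η‖ ≤ Real.exp (-(p₀ * η)) * (N * T) := by
    intro η
    simp_rw [hGnorm]
    rw [← Finset.mul_sum]
    refine mul_le_mul_of_nonneg_left ((h _ _).trans (le_of_eq ?_)) (Real.exp_pos _).le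
    have : ∀ (f : ι → ℂ) (v : ι), ‖f v * Complex.exp (ρ v * Complex.I * η)‖ = ‖f v‖ := by
      intro f v
      have : (ρ v * Complex.I * η : ℂ) = ((ρ v * η : ℝ) : ℂ) * Complex.I := by push_cast; ring
      rw [norm_mul, this, Complex.norm_exp_ofReal_mul_I, mul_one]
    simp_rw [this, hT]
  have hform : ∀ e ∈ Es, ‖∑ v₁ ∈ P, ∑ v₂ ∈ P, β v₁ * (starRingEnd ℂ) (γ v₂) *
      ((p e / (p e - (ρ v₁ - ρ v₂) * Complex.I) : ℂ) * k e v₁ v₂)‖ ≤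
      2 * p₀ * ∫ η in Set.Ioi (0 : ℝ), ‖G e p₀ η‖ := by
    intro e he
    obtain ⟨hp1, hp2⟩ := hp e he
    have hpe : 0 < p e := by linarith
    have hint : ∑ v₁ ∈ P, ∑ v₂ ∈ P, β v₁ * (starRingEnd ℂ) (γ v₂) *
      ((p e / (p e - (ρ v₁ - ρ v₂) * Complex.I) : ℂ) * k e v₁ v₂) =
      p e * ∫ η in Set.Ioi (0 : ℝ), G e (p e) η := by
      rw [hG]
      dsimp only
      rw [integral_finsetSum _ fun v₁ _ => integrable_finsetSum _ fun v₂ _ =>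
        (integrableOn_exp_mul_complex_Ioi (by rw [hzre]; linarith) 0).const_mul _, Finset.mul_sum]
      refine Finset.sum_congr rfl fun v₁ _ => ?_
      rw [integral_finsetSum _ fun v₂ _ =>
        (integrableOn_exp_mul_complex_Ioi (by rw [hzre]; linarith) 0).const_mul _, Finset.mul_sum]
      refine Finset.sum_congr rfl fun v₂ _ => ?_
      rw [integral_const_mul, integral_exp_mul_complex_Ioi (by rw [hzre]; linarith)]
      have hne : z (p e) v₁ v₂ ≠ 0 := by
        intro h0
        have := hzre (p e) v₁ v₂
        rw [h0] at this
        simp at this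
        linarith
      have hneg : (p e - (ρ v₁ - ρ v₂) * Complex.I : ℂ) = -z (p e) v₁ v₂ := by rw [hz]; ring
      rw [hneg]
      simp only [Complex.ofReal_zero, mul_zero, Complex.exp_zero]
      field_simp
    rw [hint, norm_mul, Complex.norm_real, Real.norm_of_nonneg hpe.le]
    have h1 : ‖∫ η in Set.Ioi (0 : ℝ), G e (p e) η‖ ≤ ∫ η in Set.Ioi (0 : ℝ), ‖G e p₀ η‖ := by
      refine (norm_integral_le_integral_norm _).trans ?_
      refine setIntegral_mono_on (hGint e _ hpe).norm (hGint e _ hp₀).norm measurableSet_Ioi ?_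
      intro η hη
      rw [hGnorm, hGnorm]
      refine mul_le_mul_of_nonneg_right (Real.exp_le_exp.mpr ?_) (norm_nonneg _)
      have : (0 : ℝ) < η := hη
      nlinarith
    exact mul_le_mul hp2 h1 (norm_nonneg _) (by positivity)
  refine (Finset.sum_le_sum hform).trans ?_
  rw [← Finset.mul_sum, ← integral_finsetSum _ fun e _ => (hGint e _ hp₀).norm]
  have hexp : IntegrableOn (fun η : ℝ => Real.exp (-(p₀ * η)) * (N * T)) (Set.Ioi 0) := by
    have := (integrableOn_exp_mul_Ioi (show -p₀ < 0 by linarith) 0).mul_const (N * T)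
    simp only [neg_mul] at this
    exact this
  have hle : ∫ η in Set.Ioi (0 : ℝ), ∑ e ∈ Es, ‖G e p₀ η‖ ≤
      ∫ η in Set.Ioi (0 : ℝ), Real.exp (-(p₀ * η)) * (N * T) :=
    setIntegral_mono_on (integrable_finsetSum _ fun e _ => (hGint e _ hp₀).norm) hexp
      measurableSet_Ioi fun η _ => hsum η
  have hval : ∫ η in Set.Ioi (0 : ℝ), Real.exp (-(p₀ * η)) * (N * T) = 1 / p₀ * (N * T) := by
    rw [integral_mul_const]
    congr 1
    have := integral_exp_mul_Ioi (show -p₀ < 0 by linarith) 0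
    simp only [neg_mul] at this
    rw [this]; simp
  rw [hval] at hle
  calc 2 * p₀ * ∫ η in Set.Ioi (0 : ℝ), ∑ e ∈ Es, ‖G e p₀ η‖
      ≤ 2 * p₀ * (1 / p₀ * (N * T)) := by gcongr
    _ = 2 * N * T := by field_simp

/-- Multiplication by the Lorentz kernel in a difference of two coordinates. -/
theorem mul_lorentz_sub (h : FormBound Es P k N) (ρ : ι → ℝ) {p : ℕ → ℝ} {p₀ : ℝ} (hp₀ : 0 < p₀)
    (hp : ∀ e ∈ Es, p₀ ≤ p e ∧ p e ≤ 2 * p₀) :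
    FormBound Es P
      (fun e v₁ v₂ => ((p e ^ 2 / (p e ^ 2 + (ρ v₁ - ρ v₂) ^ 2) : ℝ) : ℂ) * k e v₁ v₂) (2 * N) := by
  -- The Lorentz kernel is half the sum of p/(p − ix) and p/(p + ix); the second comes from −ρ.
  have h1 := h.mul_laplace ρ hp₀ hp
  have h2 := h.mul_laplace (fun v => -ρ v) hp₀ hp
  intro β γ
  have h3 := (h1.add h2) β γ
  have key : ∀ e ∈ Es, ‖∑ v₁ ∈ P, ∑ v₂ ∈ P, β v₁ * (starRingEnd ℂ) (γ v₂) *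
      (((p e ^ 2 / (p e ^ 2 + (ρ v₁ - ρ v₂) ^ 2) : ℝ) : ℂ) * k e v₁ v₂)‖ =
      1 / 2 * ‖∑ v₁ ∈ P, ∑ v₂ ∈ P, β v₁ * (starRingEnd ℂ) (γ v₂) *
      ((p e / (p e - (ρ v₁ - ρ v₂) * Complex.I) : ℂ) * k e v₁ v₂ +
        (p e / (p e - ((-ρ v₁ : ℝ) - (-ρ v₂ : ℝ)) * Complex.I) : ℂ) * k e v₁ v₂)‖ := by
    intro e he
    have hpe : 0 < p e := lt_of_lt_of_le hp₀ (hp e he).1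
    have : (1 / 2 : ℝ) = ‖(1 / 2 : ℂ)‖ := by simp
    rw [this, ← norm_mul, Finset.mul_sum]
    congr 1
    refine Finset.sum_congr rfl fun v₁ _ => ?_
    rw [Finset.mul_sum]
    refine Finset.sum_congr rfl fun v₂ _ => ?_
    set x := ρ v₁ - ρ v₂ with hx
    have hn1 : (p e - (x : ℂ) * Complex.I : ℂ) ≠ 0 := by
      intro h0
      have := congrArg Complex.re h0
      simp at this; linarith
    have hn2 : (p e + (x : ℂ) * Complex.I : ℂ) ≠ 0 := by
      intro h0
      have := congrArg Complex.re h0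
      simp at this; linarith
    have hn3 : (p e : ℂ) ^ 2 + (x : ℂ) ^ 2 ≠ 0 := by
      have : (0 : ℝ) < p e ^ 2 + x ^ 2 := by positivity
      exact_mod_cast this.ne'
    have e1 : (p e - ((ρ v₁ : ℂ) - ρ v₂) * Complex.I : ℂ) = p e - (x : ℂ) * Complex.I := by
      rw [hx]; push_cast; ring
    have e2 : (p e - (((-ρ v₁ : ℝ) : ℂ) - (-ρ v₂ : ℝ)) * Complex.I : ℂ) =
        p e + (x : ℂ) * Complex.I := by
      rw [hx]; push_cast; ring
    rw [e1, e2]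
    have e3 : (((p e ^ 2 / (p e ^ 2 + x ^ 2) : ℝ)) : ℂ) =
        1 / 2 * (p e / (p e - (x : ℂ) * Complex.I) + p e / (p e + (x : ℂ) * Complex.I)) := by
      push_cast
      have hf : (p e - (x : ℂ) * Complex.I) * (p e + (x : ℂ) * Complex.I) =
          (p e : ℂ) ^ 2 + (x : ℂ) ^ 2 := by
        linear_combination (-(x : ℂ) ^ 2) * Complex.I_sq
      rw [div_add_div _ _ hn1 hn2, hf]
      field_simp
      ring
    rw [e3]; ring
  rw [Finset.sum_congr rfl key, ← Finset.mul_sum]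
  linarith

/-- Multiplication by a perturbed Lorentz kernel. -/
theorem mul_lorentz_perturbed (h : FormBound Es P k N) (hN : 0 ≤ N) (ρ : ι → ℝ) {p : ℕ → ℝ}
    {p₀ : ℝ} (hp₀ : 0 < p₀) (hp : ∀ e ∈ Es, p₀ ≤ p e ∧ p e ≤ 2 * p₀) {z₁ z₂ : ι → ℝ}
    (hz₁ : ∀ v ∈ P, |z₁ v - 1| ≤ 1 / 13) (hz₂ : ∀ v ∈ P, |z₂ v - 1| ≤ 1 / 13) :
    FormBound Es P (fun e v₁ v₂ =>
      ((p e ^ 2 / (p e ^ 2 + z₁ v₁ * z₂ v₂ * (ρ v₁ - ρ v₂) ^ 2) : ℝ) : ℂ) * k e v₁ v₂) (4 * N) := by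
  set f : ℕ → ι → ι → ℂ := fun e v₁ v₂ =>
      ((p e ^ 2 / (p e ^ 2 + z₁ v₁ * z₂ v₂ * (ρ v₁ - ρ v₂) ^ 2) : ℝ) : ℂ) * k e v₁ v₂ with hf
  have hrew : 4 * N = 2 * (2 * N) := by ring
  rw [hrew]
  -- Let L be the unperturbed kernel p²/(p² + x²) and Δ = z₁z₂ − 1 = (z₁ − 1)z₂ + (z₂ − 1). The
  -- perturbed form satisfies f = L k − (Δ − L Δ) f. Multiplication by Δ costs 27/169 and by L a
  -- factor 2, so the error is at most 81/169 < 1/2 of the bound assumed for f.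
  refine of_improve (fun M hM hfM => ?_) (by positivity)
  have hb : ∀ z : ι → ℝ, (∀ v ∈ P, |z v - 1| ≤ 1 / 13) → ∀ v ∈ P, ‖((z v - 1 : ℝ) : ℂ)‖ ≤ 1 / 13 := by
    intro z hz v hv
    rw [Complex.norm_real]; exact hz v hv
  have hb2 : ∀ v ∈ P, ‖((z₂ v : ℝ) : ℂ)‖ ≤ 14 / 13 := by
    intro v hv
    rw [Complex.norm_real, Real.norm_eq_abs, abs_le]
    have := abs_le.mp (hz₂ v hv)
    constructor <;> linarith
  have s1 := hfM.mul_sep hM (c := fun _ => 1) (a := fun v => ((z₁ v - 1 : ℝ) : ℂ))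
    (b := fun v => ((z₂ v : ℝ) : ℂ)) (A := 1 / 13) (B := 14 / 13) (C := 1) (by norm_num)
    (by norm_num) (by norm_num) (fun _ _ => by simp) (hb z₁ hz₁) hb2
  have s2 := hfM.mul_sep hM (c := fun _ => 1) (a := fun _ => 1)
    (b := fun v => ((z₂ v - 1 : ℝ) : ℂ)) (A := 1) (B := 1 / 13) (C := 1) (by norm_num)
    (by norm_num) (by norm_num) (fun _ _ => by simp) (fun _ _ => by simp) (hb z₂ hz₂)
  have s3 := s1.add s2
  have s4 := s3.mul_lorentz_sub ρ hp₀ hp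
  have s5 := (h.mul_lorentz_sub ρ hp₀ hp).sub (s3.sub s4)
  refine (s5.mono ?_).congr ?_
  · linarith
  · intro e he v₁ h₁ v₂ h₂
    rw [hf]
    set x := ρ v₁ - ρ v₂ with hx
    have hpe : 0 < p e := lt_of_lt_of_le hp₀ (hp e he).1
    have a1 := abs_le.mp (hz₁ v₁ h₁)
    have a2 := abs_le.mp (hz₂ v₂ h₂)
    have hz : 0 ≤ z₁ v₁ * z₂ v₂ := mul_nonneg (by linarith) (by linarith)
    have hd1 : (0 : ℝ) < p e ^ 2 + z₁ v₁ * z₂ v₂ * x ^ 2 := by positivity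
    have hd2 : (0 : ℝ) < p e ^ 2 + x ^ 2 := by positivity
    have hid : p e ^ 2 / (p e ^ 2 + z₁ v₁ * z₂ v₂ * x ^ 2) = p e ^ 2 / (p e ^ 2 + x ^ 2) -
        (((z₁ v₁ - 1) * z₂ v₂ + (z₂ v₂ - 1)) - p e ^ 2 / (p e ^ 2 + x ^ 2) *
          ((z₁ v₁ - 1) * z₂ v₂ + (z₂ v₂ - 1))) *
            (p e ^ 2 / (p e ^ 2 + z₁ v₁ * z₂ v₂ * x ^ 2)) := by
      have e1 := hd1.ne'
      have e2 := hd2.ne'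
      field_simp
      ring
    have hid' := congrArg (fun y : ℝ => (y : ℂ) * k e v₁ v₂) hid
    dsimp only at hid' ⊢
    refine hid'.trans ?_
    simp only [← hx]
    push_cast
    ring

end FormBound

/-! ### Kernels depending on the determinant -/

/-- The determinant of two integer points. -/
def cross (v₁ v₂ : ℕ × ℕ) : ℤ := v₁.1 * v₂.2 - v₂.1 * v₁.2

/-- The weight function `t² / (1 + t²)²`. -/
noncomputable def weight (t : ℝ) : ℝ := t ^ 2 / (1 + t ^ 2) ^ 2

/-- The box `R < r ≤ 2 R`, `S < s ≤ 2 S`. -/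
noncomputable def pairBox (R S : ℝ) : Finset (ℕ × ℕ) := dyadic R ×ˢ dyadic S

namespace FormBound

variable {Es : Finset ℕ} {R S : ℝ} {k : ℕ → ℕ × ℕ → ℕ × ℕ → ℂ} {N : ℝ}

/-- Multiplication by the Lorentz kernel in the determinant. -/
theorem mul_lorentz (h : FormBound Es (pairBox R S) k N) (hN : 0 ≤ N) (hS : 0 < S) {Q : ℕ → ℝ}
    {q : ℝ} (hq : 0 < q) (hQ : ∀ e ∈ Es, q ≤ Q e ∧ Q e ≤ 2 * q) :
    FormBound Es (pairBox R S) (fun e v₁ v₂ =>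
      ((1 / (1 + (cross v₁ v₂ / Q e) ^ 2) : ℝ) : ℂ) * k e v₁ v₂) (1024 * N) := by
  -- The determinant is s₁s₂(ρ₁ − ρ₂) with ρ = r/s. To make s₁s₂ nearly constant the range of s is
  -- cut into 16 cells with centres `Sc j`; then (s/Sc)² is within 1/13 of 1, as the perturbed
  -- kernel requires. Taking the ceiling minus 1 matches the half-open range S < s ≤ 2S.
  set idx : ℕ × ℕ → ℕ := fun v => ⌈16 * ((v.2 : ℝ) / S - 1)⌉₊ - 1 with hidx
  set Sc : ℕ → ℝ := fun j => S * (1 + (2 * j + 1) / 32) with hSc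
  have hSc0 : ∀ j, 0 < Sc j := fun j => by rw [hSc]; positivity
  have hmem : ∀ v ∈ pairBox R S, S < v.2 ∧ (v.2 : ℝ) ≤ 2 * S := fun v hv =>
    (mem_dyadic hS.le _).mp (mem_product.mp hv).2
  have hcell : ∀ v ∈ pairBox R S, idx v < 16 ∧ |((v.2 : ℝ) / Sc (idx v)) ^ 2 - 1| ≤ 1 / 13 := by
    intro v hv
    obtain ⟨h1, h2⟩ := hmem v hv
    set y := 16 * ((v.2 : ℝ) / S - 1) with hy
    have hsy : (v.2 : ℝ) = S * (1 + y / 16) := by rw [hy]; field_simp; ring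
    have hy0 : 0 < y := by
      rw [hy]; have : 1 < (v.2 : ℝ) / S := (one_lt_div hS).mpr h1
      linarith
    have hy16 : y ≤ 16 := by
      rw [hy]; have : (v.2 : ℝ) / S ≤ 2 := (div_le_iff₀ hS).mpr h2
      linarith
    have hc1 : 0 < ⌈y⌉₊ := Nat.ceil_pos.mpr hy0
    have hc2 : ⌈y⌉₊ ≤ 16 := Nat.ceil_le.mpr (by exact_mod_cast hy16)
    have hj : idx v + 1 = ⌈y⌉₊ := by
      have : idx v = ⌈y⌉₊ - 1 := rfl
      omega
    have hj1 : y ≤ idx v + 1 := by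
      have := Nat.le_ceil y
      rw [← hj] at this; exact_mod_cast this
    have hj2 : (idx v : ℝ) < y := by
      have : idx v < ⌈y⌉₊ := by omega
      exact Nat.lt_ceil.mp this
    refine ⟨by omega, ?_⟩
    set j : ℝ := (idx v : ℝ) with hjdef
    have hj0 : 0 ≤ j := Nat.cast_nonneg _
    have hratio : (v.2 : ℝ) / Sc (idx v) = (1 + y / 16) / (1 + (2 * j + 1) / 32) := by
      rw [hsy, hSc]
      dsimp only
      rw [mul_div_mul_left _ _ hS.ne']
    rw [hratio]
    set x := (1 + y / 16) / (1 + (2 * j + 1) / 32) with hx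
    have hx1 : x ≤ 34 / 33 := by
      rw [hx, div_le_iff₀ (by positivity)]; nlinarith
    have hx2 : 32 / 33 ≤ x := by
      rw [hx, le_div_iff₀ (by positivity)]; nlinarith
    rw [abs_le]
    constructor <;> nlinarith
  have hpair : ∀ j j' : ℕ, FormBound Es (pairBox R S) (fun e v₁ v₂ =>
      ((1 / (1 + (cross v₁ v₂ / Q e) ^ 2) : ℝ) : ℂ) *
        (((if idx v₁ = j then 1 else 0) * (if idx v₂ = j' then 1 else 0)) * k e v₁ v₂)) (4 * N) := by
    intro j j'
    have s1 := h.mul_sep hN (c := fun _ => 1) (a := fun v => if idx v = j then 1 else 0)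
      (b := fun v => if idx v = j' then 1 else 0) (A := 1) (B := 1) (C := 1) zero_le_one zero_le_one
      zero_le_one (fun _ _ => by simp) (fun v _ => by split_ifs <;> simp)
      (fun v _ => by split_ifs <;> simp)
    -- Outside the cell the perturbation is set to 1; the indicator functions remove those points
    -- from the kernel anyway.
    have hz : ∀ i : ℕ, ∀ v ∈ pairBox R S,
        |(if idx v = i then ((v.2 : ℝ) / Sc i) ^ 2 else 1) - 1| ≤ 1 / 13 := by
      intro i v hv
      split_ifs with hi
      · rw [← hi]; exact (hcell v hv).2
      · norm_num
    have hSS : 0 < Sc j * Sc j' := mul_pos (hSc0 j) (hSc0 j')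
    have s2 := s1.mul_lorentz_perturbed (by linarith) (fun v => (v.1 : ℝ) / v.2)
      (p := fun e => Q e / (Sc j * Sc j')) (p₀ := q / (Sc j * Sc j')) (by positivity)
      (fun e he => ⟨by have := (hQ e he).1; gcongr, by
        rw [← mul_div_assoc]; have := (hQ e he).2; gcongr⟩) (hz j) (hz j')
    refine (s2.mono (by linarith)).congr ?_
    intro e he v₁ h₁ v₂ h₂
    by_cases e1 : idx v₁ = j
    · by_cases e2 : idx v₂ = j'
      · simp only [e1, e2, if_true, one_mul]
        congr 2
        have p1 : (0 : ℝ) < v₁.2 := hS.trans (hmem v₁ h₁).1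
        have p2 : (0 : ℝ) < v₂.2 := hS.trans (hmem v₂ h₂).1
        have p3 : 0 < Q e := lt_of_lt_of_le hq (hQ e he).1
        have p4 := hSc0 j
        have p5 := hSc0 j'
        have hx : ((v₁.1 : ℝ) / v₁.2 - v₂.1 / v₂.2) = cross v₁ v₂ / (v₁.2 * v₂.2) := by
          rw [cross]; push_cast; field_simp
        rw [hx]
        field_simp
      · simp [e2]
    · simp [e1]
  -- 256 pairs of cells at 4N each give 1024N.
  have hsum := sum (range 16) (fun j _ => sum (range 16) (fun j' _ => hpair j j'))
  refine (hsum.mono (by simp; linarith)).congr ?_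
  intro e _ v₁ h₁ v₂ h₂
  rw [Finset.sum_eq_single_of_mem (idx v₁) (mem_range.mpr (hcell v₁ h₁).1),
    Finset.sum_eq_single_of_mem (idx v₂) (mem_range.mpr (hcell v₂ h₂).1)]
  · simp
  · intro j _ hj; simp [hj.symm]
  · intro j _ hj; simp [hj.symm]

/-- Multiplication by the weight of the determinant. -/
theorem mul_weight (h : FormBound Es (pairBox R S) k N) (hN : 0 ≤ N) (hR : 0 ≤ R) (hS : 0 < S)
    {Q : ℕ → ℝ} {q : ℝ} (hq : 0 < q) (hQ : ∀ e ∈ Es, q ≤ Q e ∧ Q e ≤ 2 * q) :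
    FormBound Es (pairBox R S) (fun e v₁ v₂ => ((weight (cross v₁ v₂ / Q e) : ℝ) : ℂ) * k e v₁ v₂)
      (2 ^ 26 * min 1 ((R * S / q) ^ 2) * N) := by
  have s1 := h.mul_lorentz hN hS hq hQ
  have s2 := s1.mul_lorentz (by positivity) hS hq hQ
  rcases le_total 1 ((R * S / q) ^ 2) with hle | hle
  · rw [min_eq_left hle]
    refine ((s1.sub s2).mono (by linarith)).congr ?_
    intro e _ v₁ _ v₂ _
    set t := (cross v₁ v₂ : ℝ) / Q e with ht
    have : weight t = 1 / (1 + t ^ 2) - 1 / (1 + t ^ 2) * (1 / (1 + t ^ 2)) := by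
      have : (1 + t ^ 2) ≠ 0 := by positivity
      rw [weight]; field_simp; ring
    rw [this]; push_cast; ring
  -- When R S is small against q, the weight is written as Δ²/Q² times the square of the Lorentz
  -- kernel. Expanding Δ² = (r₁s₂ − r₂s₁)² gives four separated terms of size at most 16(RS)²/q²
  -- each, against 2^20 N for the squared kernel: in all 2^26.
  · rw [min_eq_right hle]
    have hmem : ∀ v ∈ pairBox R S, (v.1 : ℝ) ≤ 2 * R ∧ (v.2 : ℝ) ≤ 2 * S := fun v hv =>
      ⟨((mem_dyadic hR _).mp (mem_product.mp hv).1).2,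
        ((mem_dyadic hS.le _).mp (mem_product.mp hv).2).2⟩
    have hc : ∀ e ∈ Es, ‖((1 / Q e ^ 2 : ℝ) : ℂ)‖ ≤ 1 / q ^ 2 := by
      intro e he
      have := hQ e he
      rw [Complex.norm_real, Real.norm_of_nonneg (by positivity)]
      gcongr
      exact this.1
    have hnn : ∀ n : ℕ, ∀ X : ℝ, (n : ℝ) ≤ X → ‖(n : ℂ) ^ 2‖ ≤ X ^ 2 := by
      intro n X hn
      rw [norm_pow, Complex.norm_natCast]; gcongr
    have hrs : ∀ v ∈ pairBox R S, ‖((v.1 * v.2 : ℕ) : ℂ)‖ ≤ (2 * R) * (2 * S) := by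
      intro v hv
      rw [Complex.norm_natCast]; push_cast
      have := hmem v hv
      exact mul_le_mul this.1 this.2 (by positivity) (by positivity)
    have t1 := s2.mul_sep (by positivity) (c := fun e => ((1 / Q e ^ 2 : ℝ) : ℂ))
      (a := fun v => (v.1 : ℂ) ^ 2) (b := fun v => (v.2 : ℂ) ^ 2) (A := (2 * R) ^ 2)
      (B := (2 * S) ^ 2) (C := 1 / q ^ 2) (by positivity) (by positivity) (by positivity) hc
      (fun v hv => hnn _ _ (hmem v hv).1) (fun v hv => hnn _ _ (hmem v hv).2)
    have t2 := s2.mul_sep (by positivity) (c := fun e => ((1 / Q e ^ 2 : ℝ) : ℂ))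
      (a := fun v => (v.2 : ℂ) ^ 2) (b := fun v => (v.1 : ℂ) ^ 2) (A := (2 * S) ^ 2)
      (B := (2 * R) ^ 2) (C := 1 / q ^ 2) (by positivity) (by positivity) (by positivity) hc
      (fun v hv => hnn _ _ (hmem v hv).2) (fun v hv => hnn _ _ (hmem v hv).1)
    have t3 := s2.mul_sep (by positivity) (c := fun e => ((1 / Q e ^ 2 : ℝ) : ℂ))
      (a := fun v => ((v.1 * v.2 : ℕ) : ℂ)) (b := fun v => ((v.1 * v.2 : ℕ) : ℂ))
      (A := (2 * R) * (2 * S)) (B := (2 * R) * (2 * S)) (C := 1 / q ^ 2) (by positivity)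
      (by positivity) (by positivity) hc hrs hrs
    refine (((t1.add t2).sub (t3.add t3)).mono (le_of_eq ?_)).congr ?_
    · field_simp; ring
    · intro e he v₁ _ v₂ _
      have p3 : 0 < Q e := lt_of_lt_of_le hq (hQ e he).1
      set t := (cross v₁ v₂ : ℝ) / Q e with ht
      have e1 : weight t = (cross v₁ v₂ : ℝ) ^ 2 * (1 / Q e ^ 2) *
          (1 / (1 + t ^ 2) * (1 / (1 + t ^ 2))) := by
        have : (1 + t ^ 2) ≠ 0 := by positivity
        have e2 : (cross v₁ v₂ : ℝ) ^ 2 * (1 / Q e ^ 2) = t ^ 2 := by rw [ht]; field_simp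
        rw [e2, weight]; field_simp
      rw [e1, cross]; push_cast; ring

end FormBound

/-! ### The variance kernel and reciprocity for complementary divisors -/

/-- The kernel of the variance modulo `d`. -/
noncomputable def varKernel (d : ℕ) (v₁ v₂ : ℕ × ℕ) : ℂ :=
  if (d : ℤ) ∣ cross v₁ v₂ then (symb v₁.1 d : ℂ) * (symb v₂.1 d : ℂ) else 0

/-- The variance modulo `d`. -/
noncomputable def variance (R S : ℝ) (α : ℕ → ℕ → ℂ) (d : ℕ) : ℝ :=
  ∑ a ∈ range d, ‖twistedSum R S α d a‖ ^ 2

/-- Two points coprime to d in their first coordinates lie in the same class r̄s modulo d exactly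
when d divides their determinant. -/
theorem varianceForm_eq {R S : ℝ} (β γ : ℕ → ℕ → ℂ) {d : ℕ} (hd : 0 < d) :
    ∑ a ∈ range d, twistedSum R S β d a * (starRingEnd ℂ) (twistedSum R S γ d a) =
      ∑ v₁ ∈ pairBox R S, ∑ v₂ ∈ pairBox R S,
        β v₁.1 v₁.2 * (starRingEnd ℂ) (γ v₂.1 v₂.2) * varKernel d v₁ v₂ := by
  have : NeZero d := ⟨hd.ne'⟩
  have htw : ∀ (α : ℕ → ℕ → ℂ) (x : ℕ), twistedSum R S α d x = ∑ v ∈ pairBox R S,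
      if (v.1 : ZMod d)⁻¹ * (v.2 : ZMod d) = (x : ZMod d) then α v.1 v.2 * (symb v.1 d : ℂ) else 0 := by
    intro α x; rw [twistedSum_eq, pairBox, Finset.sum_product]
  simp_rw [htw, map_sum, Finset.sum_mul_sum]
  rw [Finset.sum_comm]
  refine Finset.sum_congr rfl fun v₁ _ => ?_
  rw [Finset.sum_comm]
  refine Finset.sum_congr rfl fun v₂ _ => ?_
  rw [sum_range_eq_sum_zmod d (fun x => (if (v₁.1 : ZMod d)⁻¹ * (v₁.2 : ZMod d) = x then
      β v₁.1 v₁.2 * (symb v₁.1 d : ℂ) else 0) * (starRingEnd ℂ) (if (v₂.1 : ZMod d)⁻¹ *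
        (v₂.2 : ZMod d) = x then γ v₂.1 v₂.2 * (symb v₂.1 d : ℂ) else 0)),
    Finset.sum_eq_single ((v₁.1 : ZMod d)⁻¹ * (v₁.2 : ZMod d))]
  · rw [if_pos rfl, varKernel]
    by_cases h1 : v₁.1.Coprime d
    · by_cases h2 : v₂.1.Coprime d
      · have hiff : ((v₂.1 : ZMod d)⁻¹ * (v₂.2 : ZMod d) = (v₁.1 : ZMod d)⁻¹ * (v₁.2 : ZMod d)) ↔
            (d : ℤ) ∣ cross v₁ v₂ := by
          rw [inv_mul_eq_iff_of_coprime h2, mul_left_comm, eq_comm, inv_mul_eq_iff_of_coprime h1,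
            eq_comm, ← sub_eq_zero, ← ZMod.intCast_zmod_eq_zero_iff_dvd, cross]
          push_cast
          rfl
        by_cases h3 : (d : ℤ) ∣ cross v₁ v₂
        · rw [if_pos (hiff.mpr h3), if_pos h3, map_mul, map_intCast (starRingEnd ℂ)]; ring
        · rw [if_neg (fun h => h3 (hiff.mp h)), if_neg h3]; simp
      · simp [symb_of_not_coprime h2]
    · simp [symb_of_not_coprime h1]
  · intro x _ hx
    rw [if_neg (Ne.symm hx), zero_mul]
  · simp

theorem variance_eq {R S : ℝ} (α : ℕ → ℕ → ℂ) {d : ℕ} (hd : 0 < d) :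
    ((variance R S α d : ℝ) : ℂ) = ∑ v₁ ∈ pairBox R S, ∑ v₂ ∈ pairBox R S,
        α v₁.1 v₁.2 * (starRingEnd ℂ) (α v₂.1 v₂.2) * varKernel d v₁ v₂ := by
  rw [← varianceForm_eq α α hd, variance]
  push_cast
  exact Finset.sum_congr rfl fun a _ => (Complex.mul_conj' _).symm

theorem variance_nonneg (R S : ℝ) (α : ℕ → ℕ → ℂ) (d : ℕ) : 0 ≤ variance R S α d := by
  rw [variance]; positivity

theorem globalVariance_eq (D R S : ℝ) (α : ℕ → ℕ → ℂ) :
    globalVariance D R S α = ∑ d ∈ dyadic D, variance R S α d := rfl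

/-- The variance bound in terms of sesquilinear forms. -/
theorem VarianceBound.formBound {E R S N : ℝ} (hE : 0 ≤ E) (hN : 0 ≤ N)
    (h : VarianceBound E R S N) : FormBound (dyadic E) (pairBox R S) varKernel N := by
  intro β γ
  have hV : ∀ f : ℕ × ℕ → ℂ, globalVariance E R S (fun r s => f (r, s)) ≤
      N * ∑ v ∈ pairBox R S, ‖f v‖ ^ 2 := by
    intro f
    rw [pairBox, Finset.sum_product]
    exact h _
  have h1 : ∀ e ∈ dyadic E, ‖∑ v₁ ∈ pairBox R S, ∑ v₂ ∈ pairBox R S,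
      β v₁ * (starRingEnd ℂ) (γ v₂) * varKernel e v₁ v₂‖ ≤
      √(variance R S (fun r s => β (r, s)) e) * √(variance R S (fun r s => γ (r, s)) e) := by
    intro e he
    have := varianceForm_eq (R := R) (S := S) (fun r s => β (r, s)) (fun r s => γ (r, s))
      (pos_of_mem_dyadic hE he)
    rw [← this]
    refine (norm_sum_le _ _).trans ?_
    simp_rw [norm_mul, RCLike.norm_conj]
    exact Real.sum_mul_le_sqrt_mul_sqrt _ _ _
  refine (Finset.sum_le_sum h1).trans ?_
  refine (Real.sum_mul_le_sqrt_mul_sqrt _ _ _).trans ?_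
  simp_rw [Real.sq_sqrt (variance_nonneg _ _ _ _)]
  rw [← globalVariance_eq, ← globalVariance_eq]
  calc _ ≤ √(N * ∑ v ∈ pairBox R S, ‖β v‖ ^ 2) * √(N * ∑ v ∈ pairBox R S, ‖γ v‖ ^ 2) := by
        gcongr
        · exact hV β
        · exact hV γ
    _ = _ := by
        rw [Real.sqrt_mul hN, Real.sqrt_mul hN]
        linear_combination (√(∑ v ∈ pairBox R S, ‖β v‖ ^ 2) * √(∑ v ∈ pairBox R S, ‖γ v‖ ^ 2)) *
          Real.mul_self_sqrt hN

/-- Reciprocity for the extended symbol at numerators congruent to one modulo eight. -/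
theorem symb_eq_jacobiSym_of_mod_eight {n m : ℕ} (hn : n % 8 = 1) (hm : m ≠ 0)
    (hc : n.Coprime m) : symb n m = jacobiSym m n := by
  have hno : Odd n := by rw [Nat.odd_iff]; omega
  rw [symb_of_coprime hc, jacobiSym.quadratic_reciprocity_one_mod_four (by omega) (odd_oddPart hm)]
  conv_rhs => rw [← two_pow_mul_oddPart m]
  have h2 : jacobiSym 2 n = 1 := by
    rw [jacobiSym.at_two hno, ← ZMod.natCast_mod n 8, hn]; rfl
  push_cast
  rw [jacobiSym.mul_left, jacobiSym.pow_left, h2, one_pow, one_mul]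

theorem coprime_natAbs_cross_left {v₁ v₂ : ℕ × ℕ} (h : v₁.1.Coprime v₂.1)
    (h₁ : v₁.1.Coprime v₁.2) : v₁.1.Coprime (cross v₁ v₂).natAbs := by
  have : IsCoprime (v₁.1 : ℤ) (cross v₁ v₂) := by
    have h1 : IsCoprime (v₁.1 : ℤ) (v₂.1 * v₁.2) :=
      IsCoprime.mul_right (Nat.isCoprime_iff_coprime.mpr h) (Nat.isCoprime_iff_coprime.mpr h₁)
    have h2 := (h1.neg_right).add_mul_left_right (v₂.2 : ℤ)
    rw [cross]
    rwa [neg_add_eq_sub] at h2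
  rw [Int.isCoprime_iff_gcd_eq_one] at this
  exact this

theorem cross_comm (v₁ v₂ : ℕ × ℕ) : cross v₂ v₁ = -cross v₁ v₂ := by
  rw [cross, cross]; ring

theorem coprime_natAbs_cross_right {v₁ v₂ : ℕ × ℕ} (h : v₁.1.Coprime v₂.1)
    (h₂ : v₂.1.Coprime v₂.2) : v₂.1.Coprime (cross v₁ v₂).natAbs := by
  rw [← Int.natAbs_neg, ← cross_comm]
  exact coprime_natAbs_cross_left h.symm h₂

/-- The product of the symbols at complementary divisors of the determinant. -/
theorem symb_mul_symb_complementary {v₁ v₂ : ℕ × ℕ} (hodd : Odd v₁.1)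
    (hmod : v₁.1 % 8 = v₂.1 % 8) (h : v₁.1.Coprime v₂.1) (h₁ : v₁.1.Coprime v₁.2)
    (h₂ : v₂.1.Coprime v₂.2) {d e : ℕ} (hde : d * e = (cross v₁ v₂).natAbs) (h0 : d * e ≠ 0) :
    symb v₁.1 d * symb v₂.1 d =
      symb v₁.1 e * symb v₂.1 e * (jacobiSym v₁.2 v₁.1 * jacobiSym v₂.2 v₂.1) := by
  set r₁ := v₁.1 with hr₁
  set r₂ := v₂.1 with hr₂
  have ho1 : r₁ % 2 = 1 := Nat.odd_iff.mp hodd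
  have ho2 : r₂ % 2 = 1 := by omega
  have hn8 : (r₁ * r₂) % 8 = 1 := by
    rw [Nat.mul_mod, ← hmod]
    have : r₁ % 8 = 1 ∨ r₁ % 8 = 3 ∨ r₁ % 8 = 5 ∨ r₁ % 8 = 7 := by omega
    rcases this with h | h | h | h <;> rw [h]
  have c1 := coprime_natAbs_cross_left h h₁
  have c2 := coprime_natAbs_cross_right h h₂
  rw [← hde] at c1 c2
  have hcn : (r₁ * r₂).Coprime (d * e) := Nat.Coprime.mul_left c1 c2
  have hcd : (r₁ * r₂).Coprime d := Nat.Coprime.coprime_mul_right_right hcn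
  have hce : (r₁ * r₂).Coprime e := Nat.Coprime.coprime_mul_left_right hcn
  have hd0 : d ≠ 0 := left_ne_zero_of_mul h0
  have he0 : e ≠ 0 := right_ne_zero_of_mul h0
  have hr10 : r₁ ≠ 0 := by omega
  have hr20 : r₂ ≠ 0 := by omega
  have hno : Odd (r₁ * r₂) := by rw [Nat.odd_iff]; omega
  have hneg : jacobiSym (-1) (r₁ * r₂) = 1 := by
    rw [jacobiSym.at_neg_one hno]
    exact ZMod.χ₄_nat_one_mod_four (by omega)
  -- Since r₁r₂ ≡ 1 (mod 8), both symbols flip without sign and even factors contribute 1. The sign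
  -- of the determinant does not matter because (−1/r₁r₂) = 1.
  have hprod : symb (r₁ * r₂) d * symb (r₁ * r₂) e = jacobiSym (cross v₁ v₂) (r₁ * r₂) := by
    rw [symb_eq_jacobiSym_of_mod_eight hn8 hd0 hcd, symb_eq_jacobiSym_of_mod_eight hn8 he0 hce,
      ← jacobiSym.mul_left, ← Nat.cast_mul, hde]
    rcases Int.natAbs_eq (cross v₁ v₂) with hx | hx
    · rw [← hx]
    · conv_rhs => rw [hx, ← neg_one_mul, jacobiSym.mul_left, hneg, one_mul]
  -- The determinant is −r₂s₁ modulo r₁ and r₁s₂ modulo r₂. The leftover (−1/r₁)(r₂/r₁)(r₁/r₂) is 1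
  -- by reciprocity, as r₁ ≡ r₂ (mod 4).
  have hmul : jacobiSym (cross v₁ v₂) (r₁ * r₂) = jacobiSym v₁.2 r₁ * jacobiSym v₂.2 r₂ := by
    rw [jacobiSym.mul_right' _ hr10 hr20]
    have e1 : jacobiSym (cross v₁ v₂) r₁ =
        jacobiSym (-1) r₁ * jacobiSym r₂ r₁ * jacobiSym v₁.2 r₁ := by
      rw [← jacobiSym.mul_left, ← jacobiSym.mul_left]
      apply jacobiSym.mod_left'
      rw [Int.emod_eq_emod_iff_emod_sub_eq_zero]
      exact Int.emod_eq_zero_of_dvd ⟨v₂.2, by rw [cross]; ring⟩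
    have e2 : jacobiSym (cross v₁ v₂) r₂ = jacobiSym r₁ r₂ * jacobiSym v₂.2 r₂ := by
      rw [← jacobiSym.mul_left]
      apply jacobiSym.mod_left'
      rw [Int.emod_eq_emod_iff_emod_sub_eq_zero]
      exact Int.emod_eq_zero_of_dvd ⟨-v₁.2, by rw [cross]; ring⟩
    have e3 : jacobiSym (-1) r₁ * jacobiSym r₂ r₁ * jacobiSym r₁ r₂ = 1 := by
      have hg : (r₂ : ℤ).gcd r₁ = 1 := by rw [Int.gcd_natCast_natCast]; exact h.symm
      have hsq := jacobiSym.sq_one hg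
      rcases (show r₁ % 4 = 1 ∨ r₁ % 4 = 3 by omega) with h4 | h4
      · rw [jacobiSym.at_neg_one hodd, ZMod.χ₄_nat_one_mod_four h4,
          jacobiSym.quadratic_reciprocity_one_mod_four h4 (Nat.odd_iff.mpr ho2)]
        linarith
      · rw [jacobiSym.at_neg_one hodd, ZMod.χ₄_nat_three_mod_four h4,
          jacobiSym.quadratic_reciprocity_three_mod_four h4 (by omega)]
        linarith
    rw [e1, e2]
    linear_combination (jacobiSym v₁.2 r₁ * jacobiSym v₂.2 r₂) * e3
  have hse := symb_mul_self hce
  rw [← symb_mul_left, ← symb_mul_left, ← hmul, ← hprod]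
  linear_combination (-symb (r₁ * r₂) d) * hse

theorem varKernel_of_dvd {d : ℕ} {v₁ v₂ : ℕ × ℕ} (h : d ∣ (cross v₁ v₂).natAbs) :
    varKernel d v₁ v₂ = ((symb v₁.1 d * symb v₂.1 d : ℤ) : ℂ) := by
  rw [varKernel, if_pos (Int.natCast_dvd.mpr h)]; push_cast; rfl

theorem varKernel_of_not_dvd {d : ℕ} {v₁ v₂ : ℕ × ℕ} (h : ¬ d ∣ (cross v₁ v₂).natAbs) :
    varKernel d v₁ v₂ = 0 := by
  rw [varKernel, if_neg (fun h' => h (Int.natCast_dvd.mp h'))]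

theorem cross_scale (g : ℕ) (r₁ s₁ r₂ s₂ : ℕ) :
    cross (g * r₁, s₁) (g * r₂, s₂) = g * cross (r₁, s₁) (r₂, s₂) := by
  simp only [cross]; push_cast; ring

/-- A common factor of the first coordinates acts on the kernel by a coprimality condition. -/
theorem varKernel_scale (g d : ℕ) (r₁ s₁ r₂ s₂ : ℕ) :
    varKernel d (g * r₁, s₁) (g * r₂, s₂) =
      if g.Coprime d then varKernel d (r₁, s₁) (r₂, s₂) else 0 := by
  split_ifs with hg
  · have hiff : d ∣ (cross (g * r₁, s₁) (g * r₂, s₂)).natAbs ↔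
        d ∣ (cross (r₁, s₁) (r₂, s₂)).natAbs := by
      rw [cross_scale, Int.natAbs_mul, Int.natAbs_natCast]
      exact hg.symm.dvd_mul_left
    by_cases h : d ∣ (cross (r₁, s₁) (r₂, s₂)).natAbs
    · rw [varKernel_of_dvd h, varKernel_of_dvd (hiff.mpr h)]
      congr 1
      rw [symb_mul_left, symb_mul_left]
      linear_combination (symb r₁ d * symb r₂ d) * symb_mul_self hg
    · rw [varKernel_of_not_dvd h, varKernel_of_not_dvd (fun h' => h (hiff.mp h'))]
  · rw [varKernel]
    split_ifs
    · simp only [symb_mul_left, symb_of_not_coprime hg]; simp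
    · rfl

theorem sum_moebius_coprime (g d : ℕ) (hg : g ≠ 0) :
    ∑ l ∈ g.divisors with l ∣ d, ArithmeticFunction.moebius l = if g.Coprime d then 1 else 0 := by
  have h := sum_moebius_divisors (g.gcd d)
  simp only [← Nat.coprime_iff_gcd_eq_one] at h
  rw [← h]
  refine Finset.sum_congr ?_ fun _ _ => rfl
  ext l
  simp only [mem_filter, Nat.mem_divisors, Nat.dvd_gcd_iff]
  constructor
  · rintro ⟨⟨h1, _⟩, h2⟩; exact ⟨⟨h1, h2⟩, Nat.gcd_ne_zero_left hg⟩
  · rintro ⟨⟨h1, h2⟩, _⟩; exact ⟨⟨h1, hg⟩, h2⟩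

/-- Passage to complementary divisors in the sum over large complementary divisors. -/
theorem sum_varKernel_flip {g r₁ s₁ r₂ s₂ T : ℕ} {D F : ℝ} (W : ℝ → ℝ) (hg : 0 < g)
    (hD : 0 < D) (hodd : Odd r₁) (hmod : r₁ % 8 = r₂ % 8) (h : r₁.Coprime r₂)
    (h₁ : r₁.Coprime s₁) (h₂ : r₂.Coprime s₂) (h0 : cross (r₁, s₁) (r₂, s₂) ≠ 0)
    (hT : (cross (r₁, s₁) (r₂, s₂)).natAbs ≤ T) :
    ∑ d ∈ Icc 1 T with F * ((d : ℕ) : ℝ) < g * (cross (r₁, s₁) (r₂, s₂)).natAbs,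
        (W (d / D) : ℂ) * varKernel d (g * r₁, s₁) (g * r₂, s₂) =
      ∑ l ∈ g.divisors, (ArithmeticFunction.moebius l : ℂ) *
        ∑ e ∈ Icc 1 T with l ∣ e ∧ F * l < g * ((e : ℕ) : ℝ),
          (W ((cross (r₁, s₁) (r₂, s₂)).natAbs / (e * D / l)) : ℂ) *
            varKernel e (r₁, s₁) (r₂, s₂) *
              ((jacobiSym s₁ r₁ * symb r₁ l : ℤ) * (jacobiSym s₂ r₂ * symb r₂ l : ℤ)) := by
  set n := (cross (r₁, s₁) (r₂, s₂)).natAbs with hn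
  have hn0 : n ≠ 0 := Int.natAbs_ne_zero.mpr h0
  have hsub : ∀ d ∈ n.divisors, d ∈ Icc 1 T := fun d hd =>
    mem_Icc.mpr ⟨Nat.pos_of_mem_divisors hd, (Nat.divisor_le hd).trans hT⟩
  have c1 : r₁.Coprime n := coprime_natAbs_cross_left (v₁ := (r₁, s₁)) (v₂ := (r₂, s₂)) h h₁
  have c2 : r₂.Coprime n := coprime_natAbs_cross_right (v₁ := (r₁, s₁)) (v₂ := (r₂, s₂)) h h₂
  have hlhs : ∑ d ∈ Icc 1 T with F * ((d : ℕ) : ℝ) < g * n,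
      (W (d / D) : ℂ) * varKernel d (g * r₁, s₁) (g * r₂, s₂) =
      ∑ l ∈ g.divisors, (ArithmeticFunction.moebius l : ℂ) *
        ∑ d ∈ n.divisors with l ∣ d ∧ F * ((d : ℕ) : ℝ) < g * n,
          (W (d / D) : ℂ) * ((symb r₁ d * symb r₂ d : ℤ) : ℂ) := by
    have hterm : ∀ d : ℕ, (W (d / D) : ℂ) * varKernel d (g * r₁, s₁) (g * r₂, s₂) =
        if d ∣ n then ∑ l ∈ g.divisors with l ∣ d, (ArithmeticFunction.moebius l : ℂ) *
          ((W (d / D) : ℂ) * ((symb r₁ d * symb r₂ d : ℤ) : ℂ)) else 0 := by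
      intro d
      rw [varKernel_scale]
      split_ifs with hc hd hd
      · rw [← Finset.sum_mul, ← Int.cast_sum, sum_moebius_coprime g d hg.ne', if_pos hc,
          varKernel_of_dvd hd]
        simp
      · rw [varKernel_of_not_dvd hd, mul_zero]
      · rw [← Finset.sum_mul, ← Int.cast_sum, sum_moebius_coprime g d hg.ne', if_neg hc]
        simp
      · simp
    rw [Finset.sum_congr rfl fun d _ => hterm d, ← Finset.sum_filter, Finset.filter_filter]
    have hset : (Icc 1 T).filter (fun d : ℕ => F * (d : ℝ) < g * n ∧ d ∣ n) =
        n.divisors.filter (fun d : ℕ => F * (d : ℝ) < g * n) := by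
      ext d
      simp only [mem_filter]
      constructor
      · rintro ⟨_, h2, h3⟩; exact ⟨Nat.mem_divisors.mpr ⟨h3, hn0⟩, h2⟩
      · rintro ⟨h1, h2⟩; exact ⟨hsub d h1, h2, Nat.dvd_of_mem_divisors h1⟩
    rw [hset]
    simp_rw [Finset.sum_filter, Finset.mul_sum]
    rw [Finset.sum_comm (s := g.divisors)]
    refine Finset.sum_congr rfl fun d _ => ?_
    by_cases hF : F * (d : ℝ) < g * n
    · simp only [hF, if_true, and_true]
      exact Finset.sum_congr rfl fun l _ => by split_ifs <;> simp
    · simp [hF]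
  rw [hlhs]
  refine Finset.sum_congr rfl fun l hl => ?_
  congr 1
  have hl0 : 0 < l := Nat.pos_of_mem_divisors hl
  have hlr : (0 : ℝ) < l := by exact_mod_cast hl0
  have hrhs : ∑ e ∈ Icc 1 T with l ∣ e ∧ F * l < g * ((e : ℕ) : ℝ), (W (n / (e * D / l)) : ℂ) *
      varKernel e (r₁, s₁) (r₂, s₂) *
        ((jacobiSym s₁ r₁ * symb r₁ l : ℤ) * (jacobiSym s₂ r₂ * symb r₂ l : ℤ)) =
      ∑ e ∈ n.divisors with l ∣ e ∧ F * l < g * ((e : ℕ) : ℝ), (W (n / (e * D / l)) : ℂ) *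
      varKernel e (r₁, s₁) (r₂, s₂) *
        ((jacobiSym s₁ r₁ * symb r₁ l : ℤ) * (jacobiSym s₂ r₂ * symb r₂ l : ℤ)) := by
    symm
    refine Finset.sum_subset ?_ ?_
    · intro e he
      rw [mem_filter] at he ⊢
      exact ⟨hsub e he.1, he.2⟩
    · intro e he hne
      rw [mem_filter] at he hne
      rw [varKernel_of_not_dvd, mul_zero, zero_mul]
      intro hd
      exact hne ⟨Nat.mem_divisors.mpr ⟨hd, hn0⟩, he.2⟩
  rw [hrhs]
  have hform : ∀ d, d ∈ n.divisors → l ∣ d → ∃ d' m : ℕ, 0 < d' ∧ 0 < m ∧ d = l * d' ∧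
      n = l * d' * m ∧ l * (n / d) = l * m := by
    intro d hd hld
    obtain ⟨d', rfl⟩ := hld
    obtain ⟨m, hm⟩ := Nat.dvd_of_mem_divisors hd
    have hp : 0 < l * d' * m := hm ▸ Nat.pos_of_ne_zero hn0
    have h3 : 0 < l * d' := Nat.pos_of_mul_pos_right hp
    refine ⟨d', m, Nat.pos_of_mul_pos_left h3, Nat.pos_of_mul_pos_left hp, rfl, hm, ?_⟩
    rw [hm, Nat.mul_div_cancel_left _ h3]
  -- The coprimality of g and d has been replaced by a Möbius sum over l ∣ g with l ∣ d. On the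
  -- divisors of n divisible by l the map d ↦ l n/d is an involution: if d = l d′ and n = l d′ m,
  -- then d goes to e = l m, which keeps the condition l ∣ e.
  have hmaps : ∀ d, d ∈ n.divisors → l ∣ d → l * (n / d) ∈ n.divisors ∧ l * (n / (l * (n / d))) = d := by
    intro d hd hld
    obtain ⟨d', m, hd', hm, rfl, hnm, he⟩ := hform d hd hld
    rw [he]
    refine ⟨Nat.mem_divisors.mpr ⟨⟨d', by rw [hnm]; ring⟩, hn0⟩, ?_⟩
    have : n = (l * m) * d' := by rw [hnm]; ring
    rw [this, Nat.mul_div_cancel_left _ (Nat.mul_pos hl0 hm)]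
  have hcond : ∀ d, d ∈ n.divisors → l ∣ d →
      (F * (d : ℝ) < g * n ↔ F * l < g * ((l * (n / d) : ℕ) : ℝ)) := by
    intro d hd hld
    obtain ⟨d', m, hd', hm, rfl, hnm, he⟩ := hform d hd hld
    rw [he, hnm]
    push_cast
    have hd'r : (0 : ℝ) < d' := by exact_mod_cast hd'
    constructor
    · intro hlt
      have : (F * l) * d' < (g * (l * m)) * d' := by linarith
      exact lt_of_mul_lt_mul_right this hd'r.le
    · intro hlt
      have := mul_lt_mul_of_pos_right hlt hd'r
      linarith
  refine Finset.sum_nbij' (fun d => l * (n / d)) (fun e => l * (n / e)) ?_ ?_ ?_ ?_ ?_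
  · intro d hd
    rw [mem_filter] at hd ⊢
    exact ⟨(hmaps d hd.1 hd.2.1).1, dvd_mul_right _ _, (hcond d hd.1 hd.2.1).mp hd.2.2⟩
  · intro e he
    rw [mem_filter] at he ⊢
    have hm := hmaps e he.1 he.2.1
    refine ⟨hm.1, dvd_mul_right _ _, (hcond _ hm.1 (dvd_mul_right _ _)).mpr ?_⟩
    rw [hm.2]
    exact he.2.2
  · intro d hd
    rw [mem_filter] at hd
    exact (hmaps d hd.1 hd.2.1).2
  · intro e he
    rw [mem_filter] at he
    exact (hmaps e he.1 he.2.1).2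
  · intro d hd
    rw [mem_filter] at hd
    have hm' := (hmaps d hd.1 hd.2.1).1
    obtain ⟨d', m, hd', hm, rfl, hnm, he⟩ := hform d hd.1 hd.2.1
    rw [he] at hm' ⊢
    have hdvd : l * m ∣ n := Nat.dvd_of_mem_divisors hm'
    rw [varKernel_of_dvd hdvd]
    have hW : (l * d' : ℕ) / D = (n : ℝ) / ((l * m : ℕ) * D / l) := by
      rw [hnm]; push_cast
      have : (0 : ℝ) < m := by exact_mod_cast hm
      field_simp
    rw [hW]
    have hsym := symb_mul_symb_complementary (v₁ := (r₁, s₁)) (v₂ := (r₂, s₂)) hodd hmod h h₁ h₂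
      (d := l * d') (e := m) (by rw [← hnm]) (by rw [← hnm]; exact hn0)
    dsimp only at hsym ⊢
    have hlm : l ∣ n := (dvd_mul_right l m).trans hdvd
    -- The divisor complementary to d is m. Squares of the symbols at l, which equal 1, are inserted
    -- to pass from m to e = l m; the unpaired symbols at l go to the coefficients.
    have q1 := symb_mul_self (Nat.Coprime.coprime_dvd_right hlm c1)
    have q2 := symb_mul_self (Nat.Coprime.coprime_dvd_right hlm c2)
    rw [mul_assoc, ← Int.cast_mul, ← Int.cast_mul, hsym, symb_mul_right r₁ hl0.ne' hm.ne',
      symb_mul_right r₂ hl0.ne' hm.ne']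
    congr 2
    calc symb r₁ m * symb r₂ m * (jacobiSym s₁ r₁ * jacobiSym s₂ r₂)
        = symb r₁ m * symb r₂ m * (jacobiSym s₁ r₁ * jacobiSym s₂ r₂) *
          (symb r₁ l * symb r₁ l) * (symb r₂ l * symb r₂ l) := by rw [q1, q2]; ring
      _ = _ := by ring

/-! ### The weight, and pairs with small determinant -/

theorem weight_nonneg (t : ℝ) : 0 ≤ weight t := by rw [weight]; positivity

theorem weight_le_one (t : ℝ) : weight t ≤ 1 := by
  rw [weight, div_le_one (by positivity)]; nlinarith [sq_nonneg t, sq_nonneg (t ^ 2)]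

theorem weight_le_inv_sq {t : ℝ} (ht : 0 < t) : weight t ≤ 1 / t ^ 2 := by
  rw [weight, div_le_div_iff₀ (by positivity) (by positivity)]
  nlinarith [sq_nonneg t, sq_nonneg (t ^ 2)]

theorem weight_zero : weight 0 = 0 := by simp [weight]

theorem le_weight {t : ℝ} (h1 : 1 ≤ t) (h2 : t ≤ 2) : 4 / 25 ≤ weight t := by
  rw [weight, le_div_iff₀ (by positivity)]
  nlinarith [mul_nonneg (show 0 ≤ t ^ 2 - 1 by nlinarith) (show 0 ≤ 4 - t ^ 2 by nlinarith)]

/-- The weight is at most 1 up to D and at most (D/d)² beyond, so its total mass is of order D. -/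
theorem sum_weight_le {D : ℝ} (hD : 0 < D) (T : ℕ) : ∑ d ∈ Icc 1 T, weight (d / D) ≤ 3 * D := by
  rw [← Finset.sum_filter_add_sum_filter_not (Icc 1 T) (fun d : ℕ => d ≤ ⌊D⌋₊)]
  have h1 : ∑ d ∈ Icc 1 T with d ≤ ⌊D⌋₊, weight (d / D) ≤ D := by
    refine (Finset.sum_le_card_nsmul _ _ 1 fun d _ => weight_le_one _).trans ?_
    rw [nsmul_eq_mul, mul_one]
    refine le_trans ?_ (Nat.floor_le hD.le)
    norm_cast
    calc ((Icc 1 T).filter (fun d : ℕ => d ≤ ⌊D⌋₊)).card ≤ (Icc 1 ⌊D⌋₊).card := by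
          refine Finset.card_le_card fun d hd => ?_
          rw [mem_filter, mem_Icc] at hd
          exact mem_Icc.mpr ⟨hd.1.1, hd.2⟩
      _ = _ := by simp
  have h2 : ∑ d ∈ Icc 1 T with ¬ d ≤ ⌊D⌋₊, weight (d / D) ≤ 2 * D := by
    calc ∑ d ∈ Icc 1 T with ¬ d ≤ ⌊D⌋₊, weight (d / D)
        ≤ ∑ d ∈ Ioo ⌊D⌋₊ (T + 1), D ^ 2 * ((d : ℝ) ^ 2)⁻¹ := by
          have : (Icc 1 T).filter (fun d : ℕ => ¬ d ≤ ⌊D⌋₊) ⊆ Ioo ⌊D⌋₊ (T + 1) := by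
            intro d hd
            rw [mem_filter, mem_Icc] at hd
            rw [mem_Ioo]; omega
          refine (Finset.sum_le_sum_of_subset_of_nonneg this
            fun _ _ _ => weight_nonneg _).trans (Finset.sum_le_sum fun d hd => ?_)
          have hd0 : (0 : ℝ) < d := by
            have := (mem_Ioo.mp hd).1
            exact_mod_cast (by omega : 0 < d)
          refine (weight_le_inv_sq (by positivity)).trans (le_of_eq ?_)
          field_simp
      _ ≤ D ^ 2 * (2 / (⌊D⌋₊ + 1)) := by
          rw [← Finset.mul_sum]
          exact mul_le_mul_of_nonneg_left (sum_Ioo_inv_sq_le _ _) (by positivity)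
      _ ≤ D ^ 2 * (2 / D) := by
          have := (Nat.lt_floor_add_one D).le
          gcongr
      _ = 2 * D := by field_simp
  linarith

/-- A point of the box is determined by its determinant with a fixed primitive point. -/
theorem cross_injective {R S : ℝ} (hR : 0 ≤ R) {v₁ v v' : ℕ × ℕ} (h₁ : v₁ ∈ pairBox R S)
    (hv : v ∈ pairBox R S) (hv' : v' ∈ pairBox R S) (hc : v₁.1.Coprime v₁.2)
    (h : cross v₁ v = cross v₁ v') : v = v' := by
  have m1 := (mem_dyadic hR _).mp (mem_product.mp h₁).1
  have m2 := (mem_dyadic hR _).mp (mem_product.mp hv).1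
  have m3 := (mem_dyadic hR _).mp (mem_product.mp hv').1
  have hr0 : (0 : ℤ) < v₁.1 := by
    exact_mod_cast pos_of_mem_dyadic hR (mem_product.mp h₁).1
  have heq : (v₁.1 : ℤ) * (v.2 - v'.2) = (v.1 - v'.1) * v₁.2 := by
    rw [cross, cross] at h; linarith
  -- Primitivity of `v₁` makes r₁ divide the difference of the two first coordinates. Both lie in
  -- (R, 2R], so the difference is smaller than R < r₁ and must vanish.
  have hdvd : (v₁.1 : ℤ) ∣ v.1 - v'.1 := by
    have : (v₁.1 : ℤ) ∣ (v.1 - v'.1) * v₁.2 := ⟨_, heq.symm⟩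
    exact (Nat.isCoprime_iff_coprime.mpr hc).dvd_of_dvd_mul_right this
  have hlt : |(v.1 : ℤ) - v'.1| < v₁.1 := by
    have : |((v.1 : ℝ)) - v'.1| < v₁.1 := by
      rw [abs_lt]; constructor <;> linarith
    exact_mod_cast this
  have h0 := Int.eq_zero_of_abs_lt_dvd hdvd hlt
  rw [h0, zero_mul] at heq
  have h3 : (v.2 : ℤ) - v'.2 = 0 := by
    rcases mul_eq_zero.mp heq with h4 | h4
    · omega
    · exact h4
  exact Prod.ext (by omega) (by omega)

theorem norm_varKernel_le_one (d : ℕ) (v₁ v₂ : ℕ × ℕ) : ‖varKernel d v₁ v₂‖ ≤ 1 := by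
  rw [varKernel]
  split_ifs
  · rw [norm_mul]
    exact mul_le_one₀ (norm_symb_le_one _ _) (norm_nonneg _) (norm_symb_le_one _ _)
  · simp

/-- Schur's test for symmetric nonnegative kernels. -/
theorem norm_sum_le_of_row_le {ι : Type*} (P : Finset ι) (α : ι → ℂ) (k : ι → ι → ℂ)
    (M : ι → ι → ℝ) {B : ℝ} (hk : ∀ v₁ ∈ P, ∀ v₂ ∈ P, ‖k v₁ v₂‖ ≤ M v₁ v₂)
    (hsymm : ∀ v₁ ∈ P, ∀ v₂ ∈ P, M v₁ v₂ = M v₂ v₁)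
    (hrow : ∀ v₁ ∈ P, ∑ v₂ ∈ P, M v₁ v₂ ≤ B) :
    ‖∑ v₁ ∈ P, ∑ v₂ ∈ P, α v₁ * (starRingEnd ℂ) (α v₂) * k v₁ v₂‖ ≤ B * ∑ v ∈ P, ‖α v‖ ^ 2 := by
  have h1 : ‖∑ v₁ ∈ P, ∑ v₂ ∈ P, α v₁ * (starRingEnd ℂ) (α v₂) * k v₁ v₂‖ ≤
      ∑ v₁ ∈ P, ∑ v₂ ∈ P, (‖α v₁‖ ^ 2 * M v₁ v₂ / 2 + ‖α v₂‖ ^ 2 * M v₁ v₂ / 2) := by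
    refine (norm_sum_le _ _).trans (Finset.sum_le_sum fun v₁ h₁ => ?_)
    refine (norm_sum_le _ _).trans (Finset.sum_le_sum fun v₂ h₂ => ?_)
    rw [norm_mul, norm_mul, RCLike.norm_conj]
    have hM := hk v₁ h₁ v₂ h₂
    have hM0 : 0 ≤ M v₁ v₂ := (norm_nonneg _).trans hM
    have h3 : ‖α v₁‖ * ‖α v₂‖ * ‖k v₁ v₂‖ ≤ ‖α v₁‖ * ‖α v₂‖ * M v₁ v₂ := by gcongr
    nlinarith [mul_nonneg hM0 (sq_nonneg (‖α v₁‖ - ‖α v₂‖))]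
  have h2 : ∑ v₁ ∈ P, ∑ v₂ ∈ P, (‖α v₁‖ ^ 2 * M v₁ v₂ / 2 + ‖α v₂‖ ^ 2 * M v₁ v₂ / 2) =
      ∑ v₁ ∈ P, ‖α v₁‖ ^ 2 * ∑ v₂ ∈ P, M v₁ v₂ := by
    simp_rw [Finset.sum_add_distrib]
    rw [Finset.sum_comm (f := fun v₁ v₂ => ‖α v₂‖ ^ 2 * M v₁ v₂ / 2), ← Finset.sum_add_distrib]
    refine Finset.sum_congr rfl fun v₁ h₁ => ?_
    rw [← Finset.sum_add_distrib, Finset.mul_sum]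
    exact Finset.sum_congr rfl fun v₂ h₂ => by rw [hsymm v₂ h₂ v₁ h₁]; ring
  refine h1.trans (h2.le.trans ?_)
  rw [Finset.mul_sum]
  refine Finset.sum_le_sum fun v hv => ?_
  rw [mul_comm B]
  exact mul_le_mul_of_nonneg_left (hrow v hv) (by positivity)

/-- The contribution of pairs of points whose determinant is a small multiple of the modulus. -/
theorem norm_small_part_le {F R S W : ℝ} (hF : 0 ≤ F) (hR : 0 ≤ R) {Ds : Finset ℕ}
    (hDs : ∀ d ∈ Ds, 0 < d) {w : ℕ → ℝ} (hw : ∀ d, 0 ≤ w d) (hW : ∑ d ∈ Ds, w d ≤ W)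
    {P : Finset (ℕ × ℕ)} (hP : P ⊆ pairBox R S) (hc : ∀ v ∈ P, v.1.Coprime v.2)
    (α : ℕ × ℕ → ℂ) :
    ‖∑ v₁ ∈ P, ∑ v₂ ∈ P, α v₁ * (starRingEnd ℂ) (α v₂) * (if cross v₁ v₂ = 0 then 0 else
      ∑ d ∈ Ds with ¬ F * ((d : ℕ) : ℝ) < (cross v₁ v₂).natAbs,
        (w d : ℂ) * varKernel d v₁ v₂)‖ ≤ 2 * F * W * ∑ v ∈ P, ‖α v‖ ^ 2 := by
  set M : ℕ × ℕ → ℕ × ℕ → ℝ := fun v₁ v₂ => ∑ d ∈ Ds,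
    if cross v₁ v₂ ≠ 0 ∧ ((cross v₁ v₂).natAbs : ℝ) ≤ F * d ∧ d ∣ (cross v₁ v₂).natAbs
      then w d else 0 with hM
  refine norm_sum_le_of_row_le P α _ M ?_ ?_ ?_
  · intro v₁ _ v₂ _
    rw [hM]
    split_ifs with h0
    · rw [norm_zero]
      exact Finset.sum_nonneg fun d _ => by split_ifs <;> simp [hw]
    · rw [Finset.sum_filter]
      refine (norm_sum_le _ _).trans (Finset.sum_le_sum fun d _ => ?_)
      by_cases h1 : F * (d : ℝ) < (cross v₁ v₂).natAbs
      · rw [if_neg (not_not_intro h1), norm_zero]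
        split_ifs <;> simp [hw]
      · rw [if_pos h1]
        by_cases h2 : d ∣ (cross v₁ v₂).natAbs
        · rw [if_pos ⟨h0, not_lt.mp h1, h2⟩, norm_mul, Complex.norm_real,
            Real.norm_of_nonneg (hw _)]
          exact mul_le_of_le_one_right (hw _) (norm_varKernel_le_one _ _ _)
        · rw [varKernel_of_not_dvd h2, mul_zero, norm_zero]
          split_ifs <;> simp [hw]
  · intro v₁ _ v₂ _
    simp only [hM, cross_comm v₁ v₂, Int.natAbs_neg, neg_ne_zero]
  · intro v₁ h₁
    rw [hM, Finset.sum_comm]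
    have hd : ∀ d ∈ Ds, (∑ v₂ ∈ P, if cross v₁ v₂ ≠ 0 ∧ ((cross v₁ v₂).natAbs : ℝ) ≤ F * d ∧
        d ∣ (cross v₁ v₂).natAbs then w d else 0) ≤ 2 * F * w d := by
      intro d hd
      have hd0 := hDs d hd
      rw [← Finset.sum_filter, Finset.sum_const, nsmul_eq_mul]
      refine mul_le_mul_of_nonneg_right ?_ (hw _)
      -- For fixed `v₁` and d the point `v₂` is determined by the sign of the determinant and the
      -- quotient |Δ|/d, an integer in [1, F].
      have hcard : (P.filter fun v₂ => cross v₁ v₂ ≠ 0 ∧ ((cross v₁ v₂).natAbs : ℝ) ≤ F * d ∧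
          d ∣ (cross v₁ v₂).natAbs).card ≤ (Icc 1 ⌊F⌋₊ ×ˢ (univ : Finset Bool)).card := by
        refine Finset.card_le_card_of_injOn
          (fun v₂ => ((cross v₁ v₂).natAbs / d, decide (0 < cross v₁ v₂))) ?_ ?_
        · intro v₂ hv₂
          obtain ⟨-, h0, hle, hdv⟩ := mem_filter.mp hv₂
          simp only [coe_product, Set.mem_prod, mem_coe, mem_Icc, mem_univ, and_true]
          obtain ⟨m, hm⟩ := hdv
          rw [hm, Nat.mul_div_cancel_left _ hd0]
          have hm0 : m ≠ 0 := by
            rintro rfl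
            rw [mul_zero, Int.natAbs_eq_zero] at hm
            exact h0 hm
          refine ⟨Nat.one_le_iff_ne_zero.mpr hm0, Nat.le_floor ?_⟩
          rw [hm] at hle
          push_cast at hle
          have hdr : (0 : ℝ) < d := by exact_mod_cast hd0
          nlinarith
        · intro v₂ hv₂ v₃ hv₃ heq
          obtain ⟨hp2, h0, -, hdv⟩ := mem_filter.mp hv₂
          obtain ⟨hp3, h0', -, hdv'⟩ := mem_filter.mp hv₃
          simp only [Prod.mk.injEq, decide_eq_decide] at heq
          have habs : (cross v₁ v₂).natAbs = (cross v₁ v₃).natAbs := by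
            rw [← Nat.div_mul_cancel hdv, heq.1, Nat.div_mul_cancel hdv']
          refine cross_injective hR (hP h₁) (hP hp2) (hP hp3) (hc v₁ h₁) ?_
          have h4 := heq.2
          omega
      have hc2 : (Icc 1 ⌊F⌋₊ ×ˢ (univ : Finset Bool)).card = ⌊F⌋₊ * 2 := by
        rw [card_product]; simp
      rw [hc2] at hcard
      have := Nat.floor_le hF
      calc _ ≤ ((⌊F⌋₊ * 2 : ℕ) : ℝ) := by exact_mod_cast hcard
        _ ≤ 2 * F := by push_cast; linarith
    refine (Finset.sum_le_sum hd).trans ?_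
    rw [← Finset.mul_sum]
    gcongr

/-! ### Removing the common factor of the first coordinates -/

/-- Decomposition of a double sum according to the greatest common divisor. -/
theorem sum_gcd_decomposition {R : ℝ} (hR : 0 ≤ R) {T : ℕ} (hT : 2 * R ≤ T) (H : ℕ → ℕ → ℕ → ℂ) :
    ∑ r₁ ∈ dyadic R, ∑ r₂ ∈ dyadic R, H (r₁.gcd r₂) r₁ r₂ =
      ∑ g ∈ Icc 1 T, ∑ h ∈ Icc 1 T, (ArithmeticFunction.moebius h : ℂ) *
        ∑ r₁ ∈ dyadic (R / (g * h : ℕ)), ∑ r₂ ∈ dyadic (R / (g * h : ℕ)),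
          H g (g * h * r₁) (g * h * r₂) := by
  have hrw : ∀ g ∈ Icc 1 T, ∀ h ∈ Icc 1 T,
      ∑ r₁ ∈ dyadic (R / (g * h : ℕ)), ∑ r₂ ∈ dyadic (R / (g * h : ℕ)),
          H g (g * h * r₁) (g * h * r₂) =
      ∑ r₁ ∈ dyadic R, ∑ r₂ ∈ dyadic R, if g * h ∣ r₁.gcd r₂ then H g r₁ r₂ else 0 := by
    intro g hg h hh
    have hk : 0 < g * h := Nat.mul_pos (mem_Icc.mp hg).1 (mem_Icc.mp hh).1
    rw [← sum_dyadic_multiples hR hk (fun r₁ => ∑ r₂ ∈ dyadic (R / (g * h : ℕ)),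
      H g r₁ (g * h * r₂)), Finset.sum_filter]
    refine Finset.sum_congr rfl fun r₁ _ => ?_
    rw [← sum_dyadic_multiples hR hk (fun r₂ => H g r₁ r₂), Finset.sum_filter]
    simp only [Nat.dvd_gcd_iff]
    split_ifs with h1
    · simp [h1]
    · simp [h1]
  -- Möbius inversion over h: the divisibility g h ∣ gcd(r₁, r₂), summed with μ(h), singles out
  -- gcd(r₁, r₂) = g.
  have hinner : ∀ r₁ ∈ dyadic R, ∀ r₂ ∈ dyadic R, ∀ g ∈ Icc 1 T,
      ∑ h ∈ Icc 1 T, (ArithmeticFunction.moebius h : ℂ) *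
        (if g * h ∣ r₁.gcd r₂ then H g r₁ r₂ else 0) =
      if g = r₁.gcd r₂ then H g r₁ r₂ else 0 := by
    intro r₁ h₁ r₂ h₂ g hg
    have hg0 : 0 < g := (mem_Icc.mp hg).1
    have hr1 := pos_of_mem_dyadic hR h₁
    set G := r₁.gcd r₂ with hG
    have hG0 : 0 < G := Nat.gcd_pos_of_pos_left _ hr1
    have hGT : G ≤ T := by
      refine (Nat.le_of_dvd hr1 (Nat.gcd_dvd_left _ _)).trans ?_
      have := ((mem_dyadic hR _).mp h₁).2
      exact_mod_cast this.trans hT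
    by_cases hgG : g ∣ G
    · obtain ⟨m, hm⟩ := hgG
      have hm0 : m ≠ 0 := by rintro rfl; simp at hm; omega
      have hmT : m ≤ T := le_trans (by rw [hm]; exact Nat.le_mul_of_pos_left m hg0) hGT
      simp only [mul_ite, mul_zero]
      rw [← Finset.sum_filter, ← Finset.sum_mul]
      have hset : (Icc 1 T).filter (fun h => g * h ∣ G) = m.divisors := by
        ext h
        rw [mem_filter, mem_Icc, Nat.mem_divisors, hm, Nat.mul_dvd_mul_iff_left hg0]
        constructor
        · rintro ⟨_, h1⟩; exact ⟨h1, hm0⟩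
        · rintro ⟨h1, _⟩
          exact ⟨⟨Nat.pos_of_dvd_of_pos h1 (Nat.pos_of_ne_zero hm0),
            (Nat.le_of_dvd (Nat.pos_of_ne_zero hm0) h1).trans hmT⟩, h1⟩
      rw [hset, ← Int.cast_sum, sum_moebius_divisors]
      have hiff : m = 1 ↔ g = G := by
        constructor
        · rintro rfl; rw [hm, mul_one]
        · intro h
          rw [← h] at hm
          exact (Nat.eq_of_mul_eq_mul_left hg0 (by rw [mul_one]; exact hm)).symm
      by_cases h1 : m = 1
      · rw [if_pos h1, if_pos (hiff.mp h1)]; simp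
      · rw [if_neg h1, if_neg (fun h => h1 (hiff.mpr h))]; simp
    · rw [if_neg (fun h : g = G => hgG (dvd_of_eq h))]
      refine Finset.sum_eq_zero fun h _ => ?_
      rw [if_neg (fun hd => hgG ((dvd_mul_right g h).trans hd)), mul_zero]
  have hcalc : ∑ g ∈ Icc 1 T, ∑ h ∈ Icc 1 T, (ArithmeticFunction.moebius h : ℂ) *
        ∑ r₁ ∈ dyadic (R / (g * h : ℕ)), ∑ r₂ ∈ dyadic (R / (g * h : ℕ)),
          H g (g * h * r₁) (g * h * r₂) =
      ∑ r₁ ∈ dyadic R, ∑ r₂ ∈ dyadic R, ∑ g ∈ Icc 1 T, ∑ h ∈ Icc 1 T,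
        (ArithmeticFunction.moebius h : ℂ) * (if g * h ∣ r₁.gcd r₂ then H g r₁ r₂ else 0) := by
    rw [Finset.sum_congr rfl fun g hg => Finset.sum_congr rfl fun h hh => by rw [hrw g hg h hh]]
    simp_rw [Finset.mul_sum]
    have e1 : ∀ g, (∑ h ∈ Icc 1 T, ∑ r₁ ∈ dyadic R, ∑ r₂ ∈ dyadic R,
        (ArithmeticFunction.moebius h : ℂ) * (if g * h ∣ r₁.gcd r₂ then H g r₁ r₂ else 0)) =
        ∑ r₁ ∈ dyadic R, ∑ r₂ ∈ dyadic R, ∑ h ∈ Icc 1 T,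
        (ArithmeticFunction.moebius h : ℂ) * (if g * h ∣ r₁.gcd r₂ then H g r₁ r₂ else 0) := by
      intro g
      rw [Finset.sum_comm]
      exact Finset.sum_congr rfl fun r₁ _ => Finset.sum_comm
    simp_rw [e1]
    rw [Finset.sum_comm]
    exact Finset.sum_congr rfl fun r₁ _ => Finset.sum_comm
  rw [hcalc]
  refine Finset.sum_congr rfl fun r₁ h₁ => Finset.sum_congr rfl fun r₂ h₂ => ?_
  rw [Finset.sum_congr rfl fun g hg => hinner r₁ h₁ r₂ h₂ g hg, Finset.sum_ite_eq' , if_pos]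
  rw [mem_Icc]
  have hr1 := pos_of_mem_dyadic hR h₁
  refine ⟨Nat.gcd_pos_of_pos_left _ hr1, (Nat.le_of_dvd hr1 (Nat.gcd_dvd_left _ _)).trans ?_⟩
  have := ((mem_dyadic hR _).mp h₁).2
  exact_mod_cast this.trans hT

/-- A range is covered by dyadic ranges. -/
theorem exists_dyadic_cover {E : ℝ} (hE : 0 < E) (T : ℕ) :
    ∃ I : Finset ℕ, (∀ i ∈ I, E * 2 ^ i ≤ T) ∧ ∀ f : ℕ → ℝ, (∀ e, 0 ≤ f e) →
      ∑ e ∈ Icc 1 T with E < ((e : ℕ) : ℝ), f e ≤ ∑ i ∈ I, ∑ e ∈ dyadic (E * 2 ^ i), f e := by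
  have hidx : ∀ e : ℕ, E < e → ∃ i : ℕ, e ∈ dyadic (E * 2 ^ i) := by
    intro e he
    obtain ⟨n, hn⟩ := pow_unbounded_of_one_lt ((e : ℝ) / E) (one_lt_two)
    have hex : ∃ n : ℕ, (e : ℝ) ≤ E * 2 ^ n := ⟨n, by
      rw [div_lt_iff₀ hE] at hn; linarith⟩
    classical
    have hspec := Nat.find_spec hex
    have hpos : Nat.find hex ≠ 0 := by
      intro h0
      rw [h0] at hspec
      simp at hspec; linarith
    obtain ⟨i, hi⟩ := Nat.exists_eq_succ_of_ne_zero hpos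
    refine ⟨i, (mem_dyadic (by positivity) _).mpr ⟨?_, ?_⟩⟩
    · have := Nat.find_min hex (m := i) (by omega)
      exact not_le.mp this
    · rw [hi, Nat.succ_eq_add_one, pow_succ] at hspec
      linarith
  choose! ix hix using hidx
  classical
  set A := (Icc 1 T).filter (fun e : ℕ => E < (e : ℝ)) with hA
  refine ⟨A.image ix, ?_, ?_⟩
  · intro i hi
    obtain ⟨e, he, rfl⟩ := mem_image.mp hi
    rw [hA, mem_filter, mem_Icc] at he
    have := ((mem_dyadic (by positivity) _).mp (hix e he.2)).1
    refine this.le.trans ?_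
    exact_mod_cast he.1.2
  · intro f hf
    rw [← Finset.sum_fiberwise_of_maps_to (fun e he => mem_image_of_mem ix he)]
    refine Finset.sum_le_sum fun i _ => ?_
    refine Finset.sum_le_sum_of_subset_of_nonneg ?_ fun _ _ _ => hf _
    intro e he
    rw [mem_filter] at he
    rw [← he.2]
    exact hix e (mem_filter.mp he.1).2

/-- The coefficients that appear after the passage to complementary divisors. -/
noncomputable def flipCoeff (α : ℕ → ℕ → ℂ) (g h l : ℕ) (v : ℕ × ℕ) : ℂ :=
  α (g * h * v.1) v.2 * ((jacobiSym v.2 (h * v.1) * symb (h * v.1) l : ℤ) : ℂ)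

/-- The pairing of the points with large complementary divisors, for given first coordinates. -/
noncomputable def flipPairing (D F S : ℝ) (T : ℕ) (α : ℕ → ℕ → ℂ) (g r₁ r₂ : ℕ) : ℂ :=
  ∑ s₁ ∈ dyadic S, ∑ s₂ ∈ dyadic S, α r₁ s₁ * (starRingEnd ℂ) (α r₂ s₂) *
    ∑ l ∈ g.divisors, (ArithmeticFunction.moebius l : ℂ) *
      ∑ e ∈ Icc 1 T with l ∣ e ∧ F * l < g * ((e : ℕ) : ℝ),
        (weight ((cross (r₁ / g, s₁) (r₂ / g, s₂)).natAbs / (e * D / l)) : ℂ) *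
          varKernel e (r₁ / g, s₁) (r₂ / g, s₂) *
            ((jacobiSym s₁ (r₁ / g) * symb (r₁ / g) l : ℤ) *
              (jacobiSym s₂ (r₂ / g) * symb (r₂ / g) l : ℤ))

theorem natAbs_cross_le {R S : ℝ} (hR : 0 ≤ R) (hS : 0 ≤ S) {v₁ v₂ : ℕ × ℕ}
    (h₁ : v₁ ∈ pairBox R S) (h₂ : v₂ ∈ pairBox R S) :
    ((cross v₁ v₂).natAbs : ℝ) ≤ 4 * (R * S) := by
  have m1 := ((mem_dyadic hR _).mp (mem_product.mp h₁).1).2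
  have m2 := ((mem_dyadic hR _).mp (mem_product.mp h₂).1).2
  have n1 := ((mem_dyadic hS _).mp (mem_product.mp h₁).2).2
  have n2 := ((mem_dyadic hS _).mp (mem_product.mp h₂).2).2
  rw [Nat.cast_natAbs, cross]
  push_cast
  have p1 : (v₁.1 : ℝ) * v₂.2 ≤ (2 * R) * (2 * S) := by gcongr
  have p2 : (v₂.1 : ℝ) * v₁.2 ≤ (2 * R) * (2 * S) := by gcongr
  have q1 : (0 : ℝ) ≤ v₁.1 * v₂.2 := by positivity
  have q2 : (0 : ℝ) ≤ v₂.1 * v₁.2 := by positivity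
  rw [abs_le]
  constructor <;> linarith

/-- Reciprocity needs coprime first coordinates, so g = gcd(r₁, r₂) is divided out and
`sum_varKernel_flip` is applied to the reduced points. -/
theorem big_part_eq_sum_flipPairing {D F R S : ℝ} (hD : 0 < D) (hR : 0 ≤ R) (hS : 0 ≤ S) {T : ℕ}
    (hT : 4 * (R * S) ≤ T) {α : ℕ → ℕ → ℂ} (hα : SupportedInBox R S α) {c : ℕ}
    (hc : ∀ r s, α r s ≠ 0 → r % 8 = c) :
    ∑ v₁ ∈ pairBox R S, ∑ v₂ ∈ pairBox R S, α v₁.1 v₁.2 * (starRingEnd ℂ) (α v₂.1 v₂.2) *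
      (if cross v₁ v₂ = 0 then 0 else
        ∑ d ∈ Icc 1 T with F * ((d : ℕ) : ℝ) < (cross v₁ v₂).natAbs,
          (weight (d / D) : ℂ) * varKernel d v₁ v₂) =
      ∑ r₁ ∈ dyadic R, ∑ r₂ ∈ dyadic R, flipPairing D F S T α (r₁.gcd r₂) r₁ r₂ := by
  rw [pairBox, Finset.sum_product]
  refine Finset.sum_congr rfl fun r₁ h₁ => ?_
  simp_rw [Finset.sum_product]
  rw [Finset.sum_comm]
  refine Finset.sum_congr rfl fun r₂ h₂ => ?_
  rw [flipPairing]
  refine Finset.sum_congr rfl fun s₁ k₁ => Finset.sum_congr rfl fun s₂ k₂ => ?_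
  by_cases ha1 : α r₁ s₁ = 0
  · simp [ha1]
  by_cases ha2 : α r₂ s₂ = 0
  · simp [ha2]
  congr 1
  have c1 := (hα r₁ s₁ ha1).2.2
  have c2 := (hα r₂ s₂ ha2).2.2
  have hr1 := pos_of_mem_dyadic hR h₁
  set g := r₁.gcd r₂ with hg
  have hg0 : 0 < g := Nat.gcd_pos_of_pos_left _ hr1
  have e1 : g * (r₁ / g) = r₁ := Nat.mul_div_cancel' (Nat.gcd_dvd_left _ _)
  have e2 : g * (r₂ / g) = r₂ := Nat.mul_div_cancel' (Nat.gcd_dvd_right _ _)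
  have hcop : (r₁ / g).Coprime (r₂ / g) := Nat.coprime_div_gcd_div_gcd hg0
  set r₁' := r₁ / g with hr₁'
  set r₂' := r₂ / g with hr₂'
  have hcross : cross (r₁, s₁) (r₂, s₂) = g * cross (r₁', s₁) (r₂', s₂) := by
    rw [← cross_scale, e1, e2]
  have hnat : (cross (r₁, s₁) (r₂, s₂)).natAbs = g * (cross (r₁', s₁) (r₂', s₂)).natAbs := by
    rw [hcross, Int.natAbs_mul, Int.natAbs_natCast]
  by_cases h0 : cross (r₁', s₁) (r₂', s₂) = 0
  -- Determinant zero was excluded on the left; on the right such pairs vanish because the weight is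
  -- 0 at 0.
  · rw [if_pos (by rw [hcross, h0, mul_zero])]
    symm
    refine Finset.sum_eq_zero fun l _ => ?_
    rw [Finset.sum_eq_zero, mul_zero]
    intro e _
    rw [h0]
    simp [weight_zero]
  · rw [if_neg (by rw [hcross]; exact mul_ne_zero (by exact_mod_cast hg0.ne') h0)]
    have hodd1 : Odd r₁ := Nat.coprime_two_right.mp (Nat.Coprime.coprime_mul_right_right c1)
    have ho1 : Odd (g * r₁') := by rw [e1]; exact hodd1
    have hgo : Odd g := (Nat.odd_mul.mp ho1).1
    have hr1o : Odd r₁' := (Nat.odd_mul.mp ho1).2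
    -- The common factor is odd, so it cancels modulo 8.
    have hmod : r₁' % 8 = r₂' % 8 := by
      have h8 : g * r₁' ≡ g * r₂' [MOD 8] := by
        rw [e1, e2]
        exact (hc r₁ s₁ ha1).trans (hc r₂ s₂ ha2).symm
      refine Nat.ModEq.cancel_left_of_coprime (c := g) ?_ h8
      have : Nat.Coprime (2 ^ 3) g := Nat.Coprime.pow_left 3 (Nat.coprime_two_left.mpr hgo)
      exact this
    have q1 : r₁'.Coprime s₁ := by
      have h3 : r₁.Coprime s₁ := Nat.Coprime.coprime_mul_left_right c1
      rw [← e1] at h3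
      exact Nat.Coprime.coprime_mul_left h3
    have q2 : r₂'.Coprime s₂ := by
      have h3 : r₂.Coprime s₂ := Nat.Coprime.coprime_mul_left_right c2
      rw [← e2] at h3
      exact Nat.Coprime.coprime_mul_left h3
    have hT' : (cross (r₁', s₁) (r₂', s₂)).natAbs ≤ T := by
      have h4 := natAbs_cross_le hR hS (v₁ := (r₁, s₁)) (v₂ := (r₂, s₂))
        (mem_product.mpr ⟨h₁, k₁⟩) (mem_product.mpr ⟨h₂, k₂⟩)
      have h5 : (cross (r₁, s₁) (r₂, s₂)).natAbs ≤ T := by exact_mod_cast h4.trans hT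
      refine le_trans ?_ h5
      rw [hnat]
      exact Nat.le_mul_of_pos_left _ hg0
    have key := sum_varKernel_flip (F := F) weight hg0 hD hr1o hmod hcop q1 q2 h0 hT'
    rw [e1, e2] at key
    rw [← key, hnat]
    push_cast
    rfl

/-- With g h removed from the first coordinates, the factor h still present in r/g acts through
`varKernel_scale` as the condition (h, e) = 1. It also multiplies the determinant by h, which is
moved into the scale of the weight. What is left is a form in a box of first side R/(gh), with all
other factors in the coefficients. -/
theorem sum_flipPairing_eq {D F R S : ℝ} (T : ℕ) (α : ℕ → ℕ → ℂ) {g : ℕ} (hg : 0 < g)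
    (h : ℕ) :
    ∑ r₁ ∈ dyadic (R / (g * h : ℕ)), ∑ r₂ ∈ dyadic (R / (g * h : ℕ)),
      flipPairing D F S T α g (g * h * r₁) (g * h * r₂) =
    ∑ l ∈ g.divisors, (ArithmeticFunction.moebius l : ℂ) *
      ∑ e ∈ Icc 1 T with l ∣ e ∧ F * l < g * ((e : ℕ) : ℝ), (if h.Coprime e then 1 else 0) *
        ∑ v₁ ∈ pairBox (R / (g * h : ℕ)) S, ∑ v₂ ∈ pairBox (R / (g * h : ℕ)) S,
          flipCoeff α g h l v₁ * (starRingEnd ℂ) (flipCoeff α g h l v₂) *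
            ((weight (cross v₁ v₂ / (e * D / (l * h))) : ℂ) * varKernel e v₁ v₂) := by
  set J := dyadic (R / (g * h : ℕ)) with hJ
  have hterm : ∀ r₁ r₂ s₁ s₂ l e : ℕ, α (g * h * r₁) s₁ * (starRingEnd ℂ) (α (g * h * r₂) s₂) *
      ((weight ((cross (g * h * r₁ / g, s₁) (g * h * r₂ / g, s₂)).natAbs / (e * D / l)) : ℂ) *
          varKernel e (g * h * r₁ / g, s₁) (g * h * r₂ / g, s₂) *
            ((jacobiSym s₁ (g * h * r₁ / g) * symb (g * h * r₁ / g) l : ℤ) *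
              (jacobiSym s₂ (g * h * r₂ / g) * symb (g * h * r₂ / g) l : ℤ))) =
      (if h.Coprime e then 1 else 0) *
        (flipCoeff α g h l (r₁, s₁) * (starRingEnd ℂ) (flipCoeff α g h l (r₂, s₂)) *
            ((weight (cross (r₁, s₁) (r₂, s₂) / (e * D / (l * h))) : ℂ) *
              varKernel e (r₁, s₁) (r₂, s₂))) := by
    intro r₁ r₂ s₁ s₂ l e
    have d1 : ∀ r, g * h * r / g = h * r := fun r => by
      rw [mul_assoc, Nat.mul_div_cancel_left _ hg]
    rw [d1, d1, varKernel_scale]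
    by_cases hhe : h.Coprime e
    · rw [if_pos hhe, if_pos hhe]
      have hw : weight ((cross (h * r₁, s₁) (h * r₂, s₂)).natAbs / (e * D / l)) =
          weight (cross (r₁, s₁) (r₂, s₂) / (e * D / (l * h))) := by
        have hsq : ((cross (h * r₁, s₁) (h * r₂, s₂)).natAbs / (e * D / l) : ℝ) ^ 2 =
            (cross (r₁, s₁) (r₂, s₂) / (e * D / (l * h)) : ℝ) ^ 2 := by
          rw [div_div_eq_mul_div, div_div_eq_mul_div, div_pow, div_pow, mul_pow, Nat.cast_natAbs,
            Int.cast_abs, sq_abs, cross_scale]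
          push_cast
          ring
        rw [weight, weight, hsq]
      rw [hw, flipCoeff, flipCoeff, map_mul, map_intCast (starRingEnd ℂ)]
      ring
    · rw [if_neg hhe, if_neg hhe]; simp
  simp only [flipPairing, pairBox, ← hJ]
  simp_rw [Finset.mul_sum]
  have lhs : ∀ (f : ℕ → ℕ → ℕ → ℕ → ℕ → ℕ → ℂ), (∑ r₁ ∈ J, ∑ r₂ ∈ J, ∑ s₁ ∈ dyadic S,
      ∑ s₂ ∈ dyadic S, ∑ l ∈ g.divisors,
        ∑ e ∈ Icc 1 T with l ∣ e ∧ F * l < g * ((e : ℕ) : ℝ), f r₁ r₂ s₁ s₂ l e) =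
      ∑ l ∈ g.divisors, ∑ e ∈ Icc 1 T with l ∣ e ∧ F * l < g * ((e : ℕ) : ℝ),
        ∑ v₁ ∈ J ×ˢ dyadic S, ∑ v₂ ∈ J ×ˢ dyadic S, f v₁.1 v₂.1 v₁.2 v₂.2 l e := by
    intro f
    simp_rw [Finset.sum_product]
    symm
    have step : ∀ (A : ℕ → ℕ → ℕ → ℕ → ℕ → ℂ) (U : Finset ℕ),
        ∑ x ∈ U, ∑ r₁ ∈ J, ∑ s₁ ∈ dyadic S, ∑ r₂ ∈ J, ∑ s₂ ∈ dyadic S, A x r₁ s₁ r₂ s₂ =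
        ∑ r₁ ∈ J, ∑ s₁ ∈ dyadic S, ∑ r₂ ∈ J, ∑ s₂ ∈ dyadic S, ∑ x ∈ U, A x r₁ s₁ r₂ s₂ := by
      intro A U
      rw [Finset.sum_comm]
      refine Finset.sum_congr rfl fun r₁ _ => ?_
      rw [Finset.sum_comm]
      refine Finset.sum_congr rfl fun s₁ _ => ?_
      rw [Finset.sum_comm]
      refine Finset.sum_congr rfl fun r₂ _ => ?_
      rw [Finset.sum_comm]
    simp_rw [step]
    refine Finset.sum_congr rfl fun r₁ _ => ?_
    rw [Finset.sum_comm]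
  rw [lhs]
  refine Finset.sum_congr rfl fun l _ => Finset.sum_congr rfl fun e _ =>
    Finset.sum_congr rfl fun v₁ _ => Finset.sum_congr rfl fun v₂ _ => ?_
  have := hterm v₁.1 v₂.1 v₁.2 v₂.2 l e
  rw [← this]
  ring

/-! ### Summation over complementary divisors -/

/-- Used to count l ∣ g against the factor 1/√g that the leading term gains in
`sum_norm_flipForm_le`. -/
theorem card_divisors_le_two_sqrt (n : ℕ) : (n.divisors.card : ℝ) ≤ 2 * √n := by
  have h1 : n.divisors.card ≤ 2 * Nat.sqrt n := by
    rw [← Finset.card_filter_add_card_filter_not (s := n.divisors) (fun d => d ≤ Nat.sqrt n), two_mul]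
    have hcard : (Icc 1 (Nat.sqrt n)).card = Nat.sqrt n := by simp
    refine add_le_add ?_ ?_
    · conv_rhs => rw [← hcard]
      refine Finset.card_le_card fun d hd => ?_
      rw [mem_filter] at hd
      exact mem_Icc.mpr ⟨Nat.pos_of_mem_divisors hd.1, hd.2⟩
    · conv_rhs => rw [← hcard]
      refine Finset.card_le_card_of_injOn (fun d => n / d) ?_ ?_
      · intro d hd
        obtain ⟨hd1, hd2⟩ := mem_filter.mp hd
        obtain ⟨m, hm⟩ := Nat.dvd_of_mem_divisors hd1
        have hn0 : n ≠ 0 := (Nat.mem_divisors.mp hd1).2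
        have hd0 := Nat.pos_of_mem_divisors hd1
        have hm0 : 0 < m := Nat.pos_of_ne_zero (by rintro rfl; simp at hm; exact hn0 hm)
        have hq : n / d = m := by rw [hm, Nat.mul_div_cancel_left _ hd0]
        simp only [coe_Icc, Set.mem_Icc, hq]
        refine ⟨hm0, ?_⟩
        by_contra hlt
        have h2 : (Nat.sqrt n + 1) * (Nat.sqrt n + 1) ≤ d * m := Nat.mul_le_mul (by omega) (by omega)
        rw [← hm] at h2
        exact absurd h2 (not_le.mpr (Nat.lt_succ_sqrt n))
      · intro d hd d' hd' h
        obtain ⟨hd1, -⟩ := mem_filter.mp hd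
        obtain ⟨hd1', -⟩ := mem_filter.mp hd'
        have h' : n / d = n / d' := h
        have hn0 : n ≠ 0 := (Nat.mem_divisors.mp hd1).2
        rw [← Nat.div_div_self (Nat.dvd_of_mem_divisors hd1) hn0, h',
          Nat.div_div_self (Nat.dvd_of_mem_divisors hd1') hn0]
  calc (n.divisors.card : ℝ) ≤ ((2 * Nat.sqrt n : ℕ) : ℝ) := by exact_mod_cast h1
    _ ≤ 2 * √n := by
      push_cast
      gcongr
      exact Real.nat_sqrt_le_real_sqrt

theorem norm_flipCoeff_le (α : ℕ → ℕ → ℂ) (g h l : ℕ) (v : ℕ × ℕ) :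
    ‖flipCoeff α g h l v‖ ≤ ‖α (g * h * v.1) v.2‖ := by
  rw [flipCoeff, norm_mul]
  refine mul_le_of_le_one_right (norm_nonneg _) ?_
  have h1 : ‖((jacobiSym v.2 (h * v.1) : ℤ) : ℂ)‖ ≤ 1 := by
    rcases jacobiSym.trichotomy (v.2 : ℤ) (h * v.1) with h | h | h <;> rw [h] <;> simp
  push_cast
  rw [norm_mul]
  exact mul_le_one₀ h1 (norm_nonneg _) (norm_symb_le_one _ _)

theorem sum_geometric_finset_le {κ : ℝ} (h0 : 0 ≤ κ) (h1 : κ < 1) (I : Finset ℕ) :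
    ∑ i ∈ I, κ ^ i ≤ 1 / (1 - κ) := by
  rw [one_div, ← tsum_geometric_of_lt_one h0 h1]
  exact (summable_geometric_of_lt_one h0 h1).sum_le_tsum I fun _ _ => by positivity

/-- Interpolation between the two bounds for the weight. The exponents δ and 1 + δ are used, so that
sums over dyadic ranges become geometric. -/
theorem min_one_sq_le_rpow {y p : ℝ} (hy : 0 ≤ y) (hp0 : 0 ≤ p) (hp2 : p ≤ 2) :
    min 1 (y ^ 2) ≤ y ^ p := by
  rcases le_total 1 y with h | h
  · exact (min_le_left _ _).trans (Real.one_le_rpow h hp0)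
  · refine (min_le_right _ _).trans ?_
    rcases hy.eq_or_lt with rfl | hy'
    · simp; positivity
    · rw [← Real.rpow_natCast]
      exact Real.rpow_le_rpow_of_exponent_ge hy' h (by exact_mod_cast hp2)

theorem sqrt_two_geometric (I : Finset ℕ) : ∑ i ∈ I, 1 / √((2 : ℝ) ^ i) ≤ 4 := by
  have h1 : ∀ i ∈ I, 1 / √((2 : ℝ) ^ i) = (1 / √2) ^ i := by
    intro i _
    have : √((2 : ℝ) ^ i) = √2 ^ i := by
      rw [Real.sqrt_eq_iff_mul_self_eq (by positivity) (by positivity), ← mul_pow,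
        Real.mul_self_sqrt (by norm_num)]
    rw [this, one_div_pow]
  rw [Finset.sum_congr rfl h1]
  have h2 : (1 / √2 : ℝ) ≤ 3 / 4 := by
    rw [div_le_iff₀ (by positivity)]
    have : (4 / 3 : ℝ) ≤ √2 := Real.le_sqrt_of_sq_le (by norm_num)
    linarith
  refine (sum_geometric_finset_le (by positivity) (by linarith) I).trans ?_
  rw [div_le_iff₀ (by linarith)]
  linarith

/-- The loss factor in the summation over dyadic ranges of complementary divisors. -/
noncomputable def flipLoss (δ ρ : ℝ) : ℝ := ρ ^ δ / (1 - 2 ^ (-δ))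

theorem sum_rpow_dyadic_le {δ ρ : ℝ} (hδ : 0 < δ) (hρ : 0 ≤ ρ) (I : Finset ℕ) :
    ∑ i ∈ I, (ρ / 2 ^ i) ^ δ ≤ flipLoss δ ρ := by
  have hκ : (2 : ℝ) ^ (-δ) < 1 := Real.rpow_lt_one_of_one_lt_of_neg (by norm_num) (by linarith)
  have h1 : ∀ i ∈ I, (ρ / 2 ^ i) ^ δ = ρ ^ δ * ((2 : ℝ) ^ (-δ)) ^ i := by
    intro i _
    rw [Real.div_rpow hρ (by positivity), div_eq_mul_inv]
    congr 1
    rw [← Real.rpow_natCast, ← Real.rpow_mul (by norm_num), ← Real.rpow_neg (by norm_num),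
      ← Real.rpow_natCast, ← Real.rpow_mul (by norm_num)]
    congr 1; ring
  rw [Finset.sum_congr rfl h1, ← Finset.mul_sum, flipLoss, ← mul_one_div]
  exact mul_le_mul_of_nonneg_left (sum_geometric_finset_le (by positivity) hκ I) (by positivity)

theorem flipLoss_nonneg {δ ρ : ℝ} (hδ : 0 < δ) (hρ : 0 ≤ ρ) : 0 ≤ flipLoss δ ρ := by
  simpa using sum_rpow_dyadic_le hδ hρ ∅

/-- The family of forms for one common factor, summed over large complementary divisors. -/
theorem sum_norm_flipForm_le {D F R S a b c δ : ℝ} (hD : 0 < D) (hF : 0 < F) (hR : 0 < R)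
    (hS : 0 < S) (ha : 0 ≤ a) (hb : 0 ≤ b) (hc : 0 ≤ c) (hδ : 0 < δ) (hδ1 : δ ≤ 1) {T : ℕ}
    (hVB : ∀ E R' : ℝ, 0 < E → E ≤ T → 0 < R' → R' ≤ R →
      VarianceBound E R' S (a * (R' * S) / √E + b + c * E))
    (α : ℕ → ℕ → ℂ) {g h l : ℕ} (hg : 0 < g) (hh : 0 < h) (hl : l ∣ g) :
    ∑ e ∈ Icc 1 T with l ∣ e ∧ F * l < g * ((e : ℕ) : ℝ),
      ‖∑ v₁ ∈ pairBox (R / (g * h : ℕ)) S, ∑ v₂ ∈ pairBox (R / (g * h : ℕ)) S,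
        flipCoeff α g h l v₁ * (starRingEnd ℂ) (flipCoeff α g h l v₂) *
          ((weight (cross v₁ v₂ / (e * D / (l * h))) : ℂ) * varKernel e v₁ v₂)‖ ≤
      2 ^ 26 * (4 * a * (R * S) / √F * (1 / (√g * h)) +
        (b + c * (R * S) / D) * flipLoss δ (R * S / (F * D))) *
        ∑ v ∈ pairBox (R / (g * h : ℕ)) S, ‖α (g * h * v.1) v.2‖ ^ 2 := by
  have hl0 : 0 < l := Nat.pos_of_dvd_of_pos hl hg
  have hgr : (0 : ℝ) < g := by exact_mod_cast hg
  have hhr : (0 : ℝ) < h := by exact_mod_cast hh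
  have hlr : (0 : ℝ) < l := by exact_mod_cast hl0
  have hl1 : (1 : ℝ) ≤ l := by exact_mod_cast hl0
  have hlg : (l : ℝ) ≤ g := by exact_mod_cast Nat.le_of_dvd hg hl
  set R' := R / (g * h : ℕ) with hR'
  have hR'eq : R' = R / (g * h) := by rw [hR']; push_cast; rfl
  have hgh1 : (1 : ℝ) ≤ g * h := by
    exact_mod_cast Nat.mul_pos hg hh
  have hR'0 : 0 < R' := by rw [hR'eq]; positivity
  have hR'R : R' ≤ R := by rw [hR'eq]; exact div_le_self hR.le hgh1
  -- The condition F l < g e reads e > E₀, and E₀ ≥ F/g because l ≥ 1.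
  set E₀ := l * F / g with hE₀
  have hE₀0 : 0 < E₀ := by positivity
  set ρ := R * S / (F * D) with hρ
  have hρ0 : 0 < ρ := by positivity
  obtain ⟨I, hI, hcover⟩ := exists_dyadic_cover hE₀0 T
  set U := ∑ v ∈ pairBox R' S, ‖α (g * h * v.1) v.2‖ ^ 2 with hU
  have hU0 : 0 ≤ U := by positivity
  set f : ℕ → ℝ := fun e => ‖∑ v₁ ∈ pairBox R' S, ∑ v₂ ∈ pairBox R' S,
        flipCoeff α g h l v₁ * (starRingEnd ℂ) (flipCoeff α g h l v₂) *
          ((weight (cross v₁ v₂ / (e * D / (l * h))) : ℂ) * varKernel e v₁ v₂)‖ with hf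
  have h1 : ∑ e ∈ Icc 1 T with l ∣ e ∧ F * l < g * ((e : ℕ) : ℝ), f e ≤
      ∑ e ∈ Icc 1 T with E₀ < ((e : ℕ) : ℝ), f e := by
    refine Finset.sum_le_sum_of_subset_of_nonneg ?_ fun _ _ _ => norm_nonneg _
    intro e he
    rw [mem_filter] at he ⊢
    refine ⟨he.1, ?_⟩
    rw [hE₀, div_lt_iff₀ hgr]
    linarith [he.2.2]
  refine h1.trans ((hcover f fun _ => norm_nonneg _).trans ?_)
  have hcell : ∀ i ∈ I, ∑ e ∈ dyadic (E₀ * 2 ^ i), f e ≤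
      2 ^ 26 * (a * (R' * S) / √E₀ * (1 / √((2 : ℝ) ^ i)) + b * (ρ / 2 ^ i) ^ δ +
        c * (E₀ * ρ) * (ρ / 2 ^ i) ^ δ) * U := by
    intro i hi
    set E := E₀ * 2 ^ i with hE
    have hE0 : 0 < E := by positivity
    set N := a * (R' * S) / √E + b + c * E with hN
    have hN0 : 0 ≤ N := by positivity
    set q := E * D / (l * h) with hq
    have hq0 : 0 < q := by positivity
    have hfb := ((hVB E R' hE0 (hI i hi) hR'0 hR'R).formBound hE0.le hN0).mul_weight hN0 hR'0.le hS
      (Q := fun e : ℕ => e * D / (l * h)) hq0 (fun e he => by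
        have := (mem_dyadic hE0.le e).mp he
        rw [hq]
        refine ⟨?_, ?_⟩
        · have := this.1.le; gcongr
        · rw [← mul_div_assoc, ← mul_assoc]; have := this.2; gcongr)
    have h2 := hfb (flipCoeff α g h l) (flipCoeff α g h l)
    rw [Real.mul_self_sqrt (by positivity)] at h2
    refine h2.trans ?_
    -- The factors g, h, l cancel between the side R/(gh), the start E₀ of the range of e and the
    -- scale of the weight.
    have hy : R' * S / q = ρ / 2 ^ i := by
      rw [hq, hE, hE₀, hρ, hR'eq]; field_simp
    rw [hy]
    set y := ρ / 2 ^ i with hydef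
    have hy0 : 0 < y := by positivity
    have hUle : ∑ v ∈ pairBox R' S, ‖flipCoeff α g h l v‖ ^ 2 ≤ U :=
      Finset.sum_le_sum fun v _ => pow_le_pow_left₀ (norm_nonneg _) (norm_flipCoeff_le α g h l v) 2
    -- The first term decays in E by itself, so the weight is bounded by 1. The constant b needs a
    -- factor y^δ, and c E needs y^(1+δ), where y cancels the growth of E.
    have hmN : min 1 (y ^ 2) * N ≤ a * (R' * S) / √E₀ * (1 / √((2 : ℝ) ^ i)) + b * y ^ δ +
        c * (E₀ * ρ) * y ^ δ := by
      rw [hN, mul_add, mul_add]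
      have t1 : min 1 (y ^ 2) * (a * (R' * S) / √E) ≤ a * (R' * S) / √E₀ * (1 / √((2 : ℝ) ^ i)) := by
        have : a * (R' * S) / √E = a * (R' * S) / √E₀ * (1 / √((2 : ℝ) ^ i)) := by
          rw [hE, Real.sqrt_mul hE₀0.le]; field_simp
        rw [← this]
        exact mul_le_of_le_one_left (by positivity) (min_le_left _ _)
      have t2 : min 1 (y ^ 2) * b ≤ b * y ^ δ := by
        rw [mul_comm]
        exact mul_le_mul_of_nonneg_left (min_one_sq_le_rpow hy0.le hδ.le (by linarith)) hb
      have t3 : min 1 (y ^ 2) * (c * E) ≤ c * (E₀ * ρ) * y ^ δ := by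
        have e1 := min_one_sq_le_rpow (p := 1 + δ) hy0.le (by linarith) (by linarith)
        rw [Real.rpow_add hy0, Real.rpow_one] at e1
        calc min 1 (y ^ 2) * (c * E) ≤ (y * y ^ δ) * (c * E) := by gcongr
          _ = c * (E₀ * ρ) * y ^ δ := by rw [hE, hydef]; field_simp
      linarith
    calc 2 ^ 26 * min 1 (y ^ 2) * N * ∑ v ∈ pairBox R' S, ‖flipCoeff α g h l v‖ ^ 2
        ≤ 2 ^ 26 * min 1 (y ^ 2) * N * U := by gcongr
      _ = 2 ^ 26 * (min 1 (y ^ 2) * N) * U := by ring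
      _ ≤ _ := by gcongr
  refine (Finset.sum_le_sum hcell).trans ?_
  rw [← Finset.sum_mul, ← Finset.mul_sum, Finset.sum_add_distrib, Finset.sum_add_distrib,
    ← Finset.mul_sum, ← Finset.mul_sum, ← Finset.mul_sum]
  refine mul_le_mul_of_nonneg_right (mul_le_mul_of_nonneg_left ?_ (by norm_num)) hU0
  have g1 := sqrt_two_geometric I
  have g2 := sum_rpow_dyadic_le hδ hρ0.le I
  have f1 : a * (R' * S) / √E₀ * ∑ i ∈ I, 1 / √((2 : ℝ) ^ i) ≤
      4 * a * (R * S) / √F * (1 / (√g * h)) := by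
    have e1 : a * (R' * S) / √E₀ ≤ a * (R * S) / √F * (1 / (√g * h)) := by
      have e2 : √F / √g ≤ √E₀ := by
        rw [← Real.sqrt_div hF.le]
        refine Real.sqrt_le_sqrt ?_
        rw [hE₀]
        gcongr
        nlinarith
      have hsg : 0 < √(g : ℝ) := Real.sqrt_pos.mpr hgr
      have hsF : 0 < √F := Real.sqrt_pos.mpr hF
      calc a * (R' * S) / √E₀ ≤ a * (R' * S) / (√F / √g) := by gcongr
        _ = _ := by
          rw [hR'eq]
          have : (g : ℝ) = √g * √g := (Real.mul_self_sqrt hgr.le).symm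
          field_simp
          rw [Real.sq_sqrt hgr.le]
    calc a * (R' * S) / √E₀ * ∑ i ∈ I, 1 / √((2 : ℝ) ^ i)
        ≤ (a * (R * S) / √F * (1 / (√g * h))) * 4 :=
          mul_le_mul e1 g1 (Finset.sum_nonneg fun _ _ => by positivity) (by positivity)
      _ = _ := by ring
  have f2 : b * ∑ i ∈ I, (ρ / 2 ^ i) ^ δ ≤ b * flipLoss δ ρ := by gcongr
  have f3 : c * (E₀ * ρ) * ∑ i ∈ I, (ρ / 2 ^ i) ^ δ ≤ c * (R * S) / D * flipLoss δ ρ := by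
    have e1 : E₀ * ρ ≤ R * S / D := by
      have : E₀ * ρ = l / g * (R * S / D) := by rw [hE₀, hρ]; field_simp
      rw [this]
      exact mul_le_of_le_one_left (by positivity) ((div_le_one hgr).mpr hlg)
    have e2 : c * (E₀ * ρ) ≤ c * (R * S) / D := by
      rw [mul_div_assoc]; gcongr
    exact mul_le_mul e2 g2 (Finset.sum_nonneg fun _ _ => by positivity) (by positivity)
  linarith

/-- The contribution of pairs of points with large complementary divisors. -/
theorem norm_big_part_le {D F R S a b c δ P : ℝ} (hD : 0 < D) (hF : 0 < F) (hR : 0 < R)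
    (hS : 0 < S) (ha : 0 ≤ a) (hb : 0 ≤ b) (hc : 0 ≤ c) (hδ : 0 < δ) (hδ1 : δ ≤ 1) {T : ℕ}
    (hT : 4 * (R * S) ≤ T) (hT' : 2 * R ≤ T)
    (hP : ∀ r ∈ dyadic R, (r.divisors.card : ℝ) ≤ P)
    (hVB : ∀ E R' : ℝ, 0 < E → E ≤ T → 0 < R' → R' ≤ R →
      VarianceBound E R' S (a * (R' * S) / √E + b + c * E))
    {α : ℕ → ℕ → ℂ} (hα : SupportedInBox R S α) {m : ℕ} (hm : ∀ r s, α r s ≠ 0 → r % 8 = m) :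
    ‖∑ v₁ ∈ pairBox R S, ∑ v₂ ∈ pairBox R S, α v₁.1 v₁.2 * (starRingEnd ℂ) (α v₂.1 v₂.2) *
      (if cross v₁ v₂ = 0 then 0 else
        ∑ d ∈ Icc 1 T with F * ((d : ℕ) : ℝ) < (cross v₁ v₂).natAbs,
          (weight (d / D) : ℂ) * varKernel d v₁ v₂)‖ ≤
      2 ^ 26 * (8 * a * (R * S) / √F * (1 + Real.log T) +
        (b + c * (R * S) / D) * flipLoss δ (R * S / (F * D)) * P ^ 2) *
        ∑ r ∈ dyadic R, ∑ s ∈ dyadic S, (r.divisors.card : ℝ) * ‖α r s‖ ^ 2 := by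
  rw [big_part_eq_sum_flipPairing hD hR.le hS.le hT hα hm,
    sum_gcd_decomposition hR.le hT' (flipPairing D F S T α)]
  set A := 4 * a * (R * S) / √F with hA
  have hA0 : 0 ≤ A := by positivity
  set B := (b + c * (R * S) / D) * flipLoss δ (R * S / (F * D)) with hB
  have hB0 : 0 ≤ B := mul_nonneg (by positivity) (flipLoss_nonneg hδ (by positivity))
  set n : ℕ → ℝ := fun r => ∑ s ∈ dyadic S, ‖α r s‖ ^ 2 with hn
  have hn0 : ∀ r, 0 ≤ n r := fun r => by rw [hn]; positivity
  have hmoeb : ∀ k : ℕ, ‖(ArithmeticFunction.moebius k : ℂ)‖ ≤ 1 := by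
    intro k
    rw [Complex.norm_intCast]
    exact_mod_cast ArithmeticFunction.abs_moebius_le_one
  have hgh : ∀ g ∈ Icc 1 T, ∀ h ∈ Icc 1 T, ‖(ArithmeticFunction.moebius h : ℂ) *
      ∑ r₁ ∈ dyadic (R / (g * h : ℕ)), ∑ r₂ ∈ dyadic (R / (g * h : ℕ)),
        flipPairing D F S T α g (g * h * r₁) (g * h * r₂)‖ ≤
      ∑ r ∈ dyadic R, n r * (2 ^ 26 * if g * h ∣ r then
        ∑ l ∈ g.divisors, (A * (1 / (√g * h)) + B) else 0) := by
    intro g hg h hh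
    have hg0 : 0 < g := (mem_Icc.mp hg).1
    have hh0 : 0 < h := (mem_Icc.mp hh).1
    rw [norm_mul]
    refine (mul_le_of_le_one_left (norm_nonneg _) (hmoeb h)).trans ?_
    rw [sum_flipPairing_eq T α hg0 h]
    have hU : ∑ v ∈ pairBox (R / (g * h : ℕ)) S, ‖α (g * h * v.1) v.2‖ ^ 2 =
        ∑ r ∈ dyadic R, if g * h ∣ r then n r else 0 := by
      rw [← Finset.sum_filter, sum_dyadic_multiples hR.le (Nat.mul_pos hg0 hh0), pairBox,
        Finset.sum_product]
    calc _ ≤ ∑ l ∈ g.divisors, 2 ^ 26 * (A * (1 / (√g * h)) + B) *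
          ∑ r ∈ dyadic R, (if g * h ∣ r then n r else 0) := by
          refine (norm_sum_le _ _).trans (Finset.sum_le_sum fun l hl => ?_)
          rw [norm_mul]
          refine (mul_le_of_le_one_left (norm_nonneg _) (hmoeb l)).trans ?_
          refine (norm_sum_le _ _).trans ?_
          rw [← hU]
          refine le_trans (Finset.sum_le_sum fun e _ => ?_) (sum_norm_flipForm_le hD hF hR hS ha hb hc
            hδ hδ1 hVB α hg0 hh0 (Nat.dvd_of_mem_divisors hl))
          rw [norm_mul]
          refine mul_le_of_le_one_left (norm_nonneg _) ?_
          split_ifs <;> simp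
      _ = _ := by
          simp_rw [Finset.mul_sum]
          rw [Finset.sum_comm]
          refine Finset.sum_congr rfl fun r _ => ?_
          split_ifs
          · simp_rw [Finset.mul_sum]
            exact Finset.sum_congr rfl fun _ _ => by ring
          · simp
  refine (norm_sum_le _ _).trans ((Finset.sum_le_sum fun g hg => (norm_sum_le _ _).trans
    (Finset.sum_le_sum fun h hh => hgh g hg h hh)).trans ?_)
  have hswap : ∑ g ∈ Icc 1 T, ∑ h ∈ Icc 1 T, ∑ r ∈ dyadic R, n r * (2 ^ 26 * if g * h ∣ r then
        ∑ l ∈ g.divisors, (A * (1 / (√g * h)) + B) else 0) =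
      ∑ r ∈ dyadic R, n r * (2 ^ 26 * ∑ g ∈ Icc 1 T, ∑ h ∈ Icc 1 T, if g * h ∣ r then
        ∑ l ∈ g.divisors, (A * (1 / (√g * h)) + B) else 0) := by
    simp_rw [Finset.mul_sum]
    rw [Finset.sum_congr rfl fun g _ => Finset.sum_comm, Finset.sum_comm]
  rw [hswap, Finset.mul_sum]
  refine Finset.sum_le_sum fun r hr => ?_
  have hr0 := pos_of_mem_dyadic hR.le hr
  have hτr := hP r hr
  set t : ℝ := (r.divisors.card : ℝ) with ht
  have ht0 : 0 ≤ t := Nat.cast_nonneg _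
  have hinner : ∑ g ∈ Icc 1 T, ∑ h ∈ Icc 1 T, (if g * h ∣ r then
        ∑ l ∈ g.divisors, (A * (1 / (√g * h)) + B) else 0) ≤
      (2 * A * (1 + Real.log T) + B * P ^ 2) * t := by
    -- In the leading term τ(g) ≤ 2√g cancels 1/√g, and the sum of 1/h gives a single logarithm; g ∣
    -- r remains, which is the source of τ(r) in the norm. The secondary terms carry a power saving
    -- and afford the cruder bound P².
    have hg1 : ∀ g ∈ Icc 1 T, ∑ h ∈ Icc 1 T, (if g * h ∣ r then
        ∑ l ∈ g.divisors, (A * (1 / (√g * h)) + B) else 0) ≤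
        if g ∣ r then 2 * A * (1 + Real.log T) + B * P ^ 2 else 0 := by
      intro g hg
      have hg0 : 0 < g := (mem_Icc.mp hg).1
      have hgr : (0 : ℝ) < g := by exact_mod_cast hg0
      split_ifs with hgr'
      · have hgle : (g.divisors.card : ℝ) ≤ t := by
          rw [ht]
          exact_mod_cast Finset.card_le_card (Nat.divisors_subset_of_dvd hr0.ne' hgr')
        have hτg := card_divisors_le_two_sqrt g
        have hterm : ∀ h ∈ Icc 1 T, (if g * h ∣ r then
            ∑ l ∈ g.divisors, (A * (1 / (√g * h)) + B) else 0) ≤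
            2 * A * (1 / h) + if h ∣ r then B * t else 0 := by
          intro h hh
          have hhr : (0 : ℝ) < h := by exact_mod_cast (mem_Icc.mp hh).1
          split_ifs with h1 h2 h2
          · rw [Finset.sum_const, nsmul_eq_mul, mul_add]
            have q1 : (g.divisors.card : ℝ) * (A * (1 / (√g * h))) ≤ 2 * A * (1 / h) := by
              calc (g.divisors.card : ℝ) * (A * (1 / (√g * h))) ≤
                  2 * √g * (A * (1 / (√g * h))) := by gcongr
                _ = _ := by
                  have : 0 < √(g : ℝ) := Real.sqrt_pos.mpr hgr
                  field_simp
            have q2 : (g.divisors.card : ℝ) * B ≤ B * t := by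
              rw [mul_comm]; gcongr
            linarith
          · exact absurd ((dvd_mul_left h g).trans h1) h2
          · positivity
          · positivity
        refine (Finset.sum_le_sum hterm).trans ?_
        rw [Finset.sum_add_distrib, ← Finset.mul_sum, ← Finset.sum_filter, Finset.sum_const,
          nsmul_eq_mul]
        have hcard : (((Icc 1 T).filter fun h => h ∣ r).card : ℝ) ≤ t := by
          rw [ht]
          norm_cast
          refine Finset.card_le_card fun h hh => ?_
          exact Nat.mem_divisors.mpr ⟨(mem_filter.mp hh).2, hr0.ne'⟩
        have q1 := mul_le_mul_of_nonneg_left (sum_inv_Icc_le T) (show 0 ≤ 2 * A by positivity)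
        have q2 : (((Icc 1 T).filter fun h => h ∣ r).card : ℝ) * (B * t) ≤ B * P ^ 2 := by
          calc _ ≤ P * (B * P) := by
                have : 0 ≤ P := ht0.trans hτr
                gcongr
                exact hcard.trans hτr
            _ = _ := by ring
        linarith
      · refine le_of_eq (Finset.sum_eq_zero fun h _ => ?_)
        rw [if_neg fun hd => hgr' ((dvd_mul_right g h).trans hd)]
    refine (Finset.sum_le_sum hg1).trans ?_
    rw [← Finset.sum_filter, Finset.sum_const, nsmul_eq_mul, mul_comm]
    have hlog : 0 ≤ Real.log T := Real.log_natCast_nonneg T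
    refine mul_le_mul_of_nonneg_left ?_ (by positivity)
    rw [ht]
    norm_cast
    refine Finset.card_le_card fun h hh => ?_
    exact Nat.mem_divisors.mpr ⟨(mem_filter.mp hh).2, hr0.ne'⟩
  rw [← Finset.mul_sum]
  have hfin : n r * (2 ^ 26 * ∑ g ∈ Icc 1 T, ∑ h ∈ Icc 1 T, if g * h ∣ r then
        ∑ l ∈ g.divisors, (A * (1 / (√g * h)) + B) else 0) ≤
      n r * (2 ^ 26 * ((2 * A * (1 + Real.log T) + B * P ^ 2) * t)) := by
    have := hn0 r
    gcongr
  refine hfin.trans (le_of_eq ?_)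
  rw [hA]
  ring

/-! ### From the weighted form to the variance -/

theorem sum_pairBox (R S : ℝ) (f : ℕ × ℕ → ℝ) :
    ∑ v ∈ pairBox R S, f v = ∑ r ∈ dyadic R, ∑ s ∈ dyadic S, f (r, s) :=
  Finset.sum_product _ _ _

/-- A weighted sum of variances, with the pairs of points whose determinant is a small multiple of
the modulus bounded trivially. -/
theorem sum_mul_variance_le {F R S W : ℝ} (hF : 0 ≤ F) (hR : 0 ≤ R) {Ds : Finset ℕ}
    (hDs : ∀ d ∈ Ds, 0 < d) {w : ℕ → ℝ} (hw : ∀ d, 0 ≤ w d) (hW : ∑ d ∈ Ds, w d ≤ W)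
    {α : ℕ → ℕ → ℂ} (hα : SupportedInBox R S α) :
    ∑ d ∈ Ds, w d * variance R S α d ≤
      (1 + 2 * F) * W * ∑ r ∈ dyadic R, ∑ s ∈ dyadic S, ‖α r s‖ ^ 2 +
      ‖∑ v₁ ∈ pairBox R S, ∑ v₂ ∈ pairBox R S, α v₁.1 v₁.2 * (starRingEnd ℂ) (α v₂.1 v₂.2) *
        (if cross v₁ v₂ = 0 then 0 else
          ∑ d ∈ Ds with F * ((d : ℕ) : ℝ) < (cross v₁ v₂).natAbs,
            (w d : ℂ) * varKernel d v₁ v₂)‖ := by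
  classical
  set P := (pairBox R S).filter fun v => α v.1 v.2 ≠ 0 with hP
  have hPc : ∀ v ∈ P, v.1.Coprime v.2 := fun v hv =>
    (hα v.1 v.2 (mem_filter.mp hv).2).2.2.coprime_mul_left_right
  have hPs : P ⊆ pairBox R S := filter_subset _ _
  have hfull : ∀ k : ℕ × ℕ → ℕ × ℕ → ℂ, ∑ v₁ ∈ pairBox R S, ∑ v₂ ∈ pairBox R S,
      α v₁.1 v₁.2 * (starRingEnd ℂ) (α v₂.1 v₂.2) * k v₁ v₂ = ∑ v₁ ∈ P, ∑ v₂ ∈ P,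
        α v₁.1 v₁.2 * (starRingEnd ℂ) (α v₂.1 v₂.2) * k v₁ v₂ := by
    intro k
    symm
    refine (Finset.sum_subset hPs fun v hv hv' => ?_).trans
      (Finset.sum_congr rfl fun v₁ _ => Finset.sum_subset hPs fun v hv hv' => ?_)
    · have h0 : α v.1 v.2 = 0 := by
        by_contra h; exact hv' (mem_filter.mpr ⟨hv, h⟩)
      simp [h0]
    · have h0 : α v.1 v.2 = 0 := by
        by_contra h; exact hv' (mem_filter.mpr ⟨hv, h⟩)
      simp [h0]
  have hnorm : ∑ v ∈ P, ‖α v.1 v.2‖ ^ 2 = ∑ r ∈ dyadic R, ∑ s ∈ dyadic S, ‖α r s‖ ^ 2 := by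
    rw [← sum_pairBox R S fun v => ‖α v.1 v.2‖ ^ 2]
    refine Finset.sum_subset hPs fun v hv hv' => ?_
    have h0 : α v.1 v.2 = 0 := by
      by_contra h; exact hv' (mem_filter.mpr ⟨hv, h⟩)
    simp [h0]
  have hexp : ((∑ d ∈ Ds, w d * variance R S α d : ℝ) : ℂ) = ∑ v₁ ∈ P, ∑ v₂ ∈ P,
      α v₁.1 v₁.2 * (starRingEnd ℂ) (α v₂.1 v₂.2) * ∑ d ∈ Ds, (w d : ℂ) * varKernel d v₁ v₂ := by
    rw [← hfull]
    push_cast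
    rw [Finset.sum_congr rfl fun d hd => by rw [variance_eq α (hDs d hd)]]
    simp_rw [Finset.mul_sum]
    rw [Finset.sum_comm]
    refine Finset.sum_congr rfl fun v₁ _ => ?_
    rw [Finset.sum_comm]
    exact Finset.sum_congr rfl fun v₂ _ => Finset.sum_congr rfl fun d _ => by ring
  set Dg : ℂ := ∑ v₁ ∈ P, ∑ v₂ ∈ P, α v₁.1 v₁.2 * (starRingEnd ℂ) (α v₂.1 v₂.2) *
    (if v₁ = v₂ then ∑ d ∈ Ds, (w d : ℂ) * varKernel d v₁ v₂ else 0) with hDg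
  set Sm : ℂ := ∑ v₁ ∈ P, ∑ v₂ ∈ P, α v₁.1 v₁.2 * (starRingEnd ℂ) (α v₂.1 v₂.2) *
    (if cross v₁ v₂ = 0 then 0 else
      ∑ d ∈ Ds with ¬ F * ((d : ℕ) : ℝ) < (cross v₁ v₂).natAbs, (w d : ℂ) * varKernel d v₁ v₂)
    with hSm
  set Bg : ℂ := ∑ v₁ ∈ P, ∑ v₂ ∈ P, α v₁.1 v₁.2 * (starRingEnd ℂ) (α v₂.1 v₂.2) *
    (if cross v₁ v₂ = 0 then 0 else
      ∑ d ∈ Ds with F * ((d : ℕ) : ℝ) < (cross v₁ v₂).natAbs, (w d : ℂ) * varKernel d v₁ v₂)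
    with hBg
  -- Diagonal, small and large determinants. By primitivity the determinant vanishes only for equal
  -- points.
  have hsplit : ((∑ d ∈ Ds, w d * variance R S α d : ℝ) : ℂ) = Dg + Sm + Bg := by
    rw [hexp, hDg, hSm, hBg, ← Finset.sum_add_distrib, ← Finset.sum_add_distrib]
    refine Finset.sum_congr rfl fun v₁ h₁ => ?_
    rw [← Finset.sum_add_distrib, ← Finset.sum_add_distrib]
    refine Finset.sum_congr rfl fun v₂ h₂ => ?_
    rw [← mul_add, ← mul_add]
    congr 1
    by_cases h0 : cross v₁ v₂ = 0
    · have hv : v₁ = v₂ := cross_injective hR (hPs h₁) (hPs h₁) (hPs h₂) (hPc v₁ h₁)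
        (by rw [h0, cross]; ring)
      rw [if_pos hv, if_pos h0, if_pos h0, add_zero, add_zero]
    · have hv : v₁ ≠ v₂ := by
        rintro rfl
        exact h0 (by rw [cross]; ring)
      rw [if_neg hv, if_neg h0, if_neg h0, zero_add, add_comm,
        Finset.sum_filter_add_sum_filter_not]
  have hDgle : ‖Dg‖ ≤ W * ∑ v ∈ P, ‖α v.1 v.2‖ ^ 2 := by
    refine norm_sum_le_of_row_le P (fun v => α v.1 v.2) _ (fun v₁ v₂ => if v₁ = v₂ then W else 0)
      ?_ ?_ ?_
    · intro v₁ _ v₂ _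
      split_ifs with h
      · refine (norm_sum_le _ _).trans (le_trans (Finset.sum_le_sum fun d _ => ?_) hW)
        rw [norm_mul, Complex.norm_real, Real.norm_of_nonneg (hw d)]
        exact mul_le_of_le_one_right (hw d) (norm_varKernel_le_one _ _ _)
      · simp
    · intro v₁ _ v₂ _
      simp [eq_comm]
    · intro v₁ h₁
      rw [Finset.sum_ite_eq, if_pos h₁]
  have hSmle : ‖Sm‖ ≤ 2 * F * W * ∑ v ∈ P, ‖α v.1 v.2‖ ^ 2 :=
    norm_small_part_le hF hR hDs hw hW hPs hPc fun v => α v.1 v.2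
  rw [hfull, ← hBg, ← hnorm]
  calc ∑ d ∈ Ds, w d * variance R S α d ≤ ‖((∑ d ∈ Ds, w d * variance R S α d : ℝ) : ℂ)‖ := by
        rw [Complex.norm_real]; exact le_abs_self _
    _ = ‖Dg + Sm + Bg‖ := by rw [hsplit]
    _ ≤ ‖Dg‖ + ‖Sm‖ + ‖Bg‖ := norm_add₃_le
    _ ≤ _ := by linarith

/-- The bound `N` for the global variance of coefficients supported in a box, in terms of the norm
weighted by the divisor function. -/
def SupportedBound (D R S N : ℝ) : Prop :=
  ∀ α : ℕ → ℕ → ℂ, SupportedInBox R S α → globalVariance D R S α ≤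
    N * ∑ r ∈ dyadic R, ∑ s ∈ dyadic S, (r.divisors.card : ℝ) * ‖α r s‖ ^ 2

theorem SupportedBound.mono {D R S N N' : ℝ} (h : SupportedBound D R S N) (hN : N ≤ N') :
    SupportedBound D R S N' := fun α hα => (h α hα).trans (by gcongr)

theorem sum_norm_sq_le_sum_card_divisors {R : ℝ} (hR : 0 ≤ R) (S : ℝ) (α : ℕ → ℕ → ℂ) :
    ∑ r ∈ dyadic R, ∑ s ∈ dyadic S, ‖α r s‖ ^ 2 ≤
      ∑ r ∈ dyadic R, ∑ s ∈ dyadic S, (r.divisors.card : ℝ) * ‖α r s‖ ^ 2 := by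
  refine Finset.sum_le_sum fun r hr => Finset.sum_le_sum fun s _ => ?_
  refine le_mul_of_one_le_left (by positivity) ?_
  exact_mod_cast Finset.card_pos.mpr
    ⟨1, Nat.one_mem_divisors.mpr (pos_of_mem_dyadic hR hr).ne'⟩

theorem VarianceBound.supportedBound {D R S N : ℝ} (hR : 0 ≤ R) (hN : 0 ≤ N)
    (h : VarianceBound D R S N) : SupportedBound D R S N := fun α _ =>
  (h α).trans (mul_le_mul_of_nonneg_left (sum_norm_sq_le_sum_card_divisors hR S α) hN)

/-- The trivial bound. -/
theorem supportedBound_trivial {D R S : ℝ} (hD : 0 < D) (hR : 0 ≤ R) (hS : 0 ≤ S) :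
    SupportedBound D R S (3 * D + 24 * (R * S)) := by
  intro α hα
  have hDs : ∀ d ∈ dyadic D, 0 < d := fun d hd => pos_of_mem_dyadic hD.le hd
  -- With this F no determinant exceeds F d, since |Δ| ≤ 4RS and d > D; the part with large
  -- determinants is empty.
  have key := sum_mul_variance_le (F := 4 * (R * S) / D) (by positivity) hR hDs (w := fun _ => 1)
    (fun _ => zero_le_one) (W := 3 * D) (by simpa using card_dyadic_le hD.le) hα
  have hbig : ∑ v₁ ∈ pairBox R S, ∑ v₂ ∈ pairBox R S, α v₁.1 v₁.2 *
      (starRingEnd ℂ) (α v₂.1 v₂.2) * (if cross v₁ v₂ = 0 then 0 else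
        ∑ d ∈ dyadic D with 4 * (R * S) / D * ((d : ℕ) : ℝ) < (cross v₁ v₂).natAbs,
          ((1 : ℝ) : ℂ) * varKernel d v₁ v₂) = 0 := by
    refine Finset.sum_eq_zero fun v₁ h₁ => Finset.sum_eq_zero fun v₂ h₂ => ?_
    rw [Finset.filter_false_of_mem, Finset.sum_empty, ite_self, mul_zero]
    intro d hd
    rw [not_lt]
    refine (natAbs_cross_le hR hS h₁ h₂).trans ?_
    rw [div_mul_eq_mul_div, le_div_iff₀ hD]
    exact mul_le_mul_of_nonneg_left ((mem_dyadic hD.le d).mp hd).1.le (by positivity)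
  simp only [one_mul] at key
  simp only [Complex.ofReal_one, one_mul] at hbig
  rw [globalVariance_eq]
  simp only [Complex.ofReal_one, one_mul] at key
  rw [hbig, norm_zero, add_zero] at key
  refine key.trans ?_
  have he : (1 + 2 * (4 * (R * S) / D)) * (3 * D) = 3 * D + 24 * (R * S) := by field_simp; ring
  rw [he]
  exact mul_le_mul_of_nonneg_left (sum_norm_sq_le_sum_card_divisors hR S α) (by positivity)

/-- The variance of a sum of coefficients. -/
theorem globalVariance_sum_le {κ : Type*} (J : Finset κ) (D R S : ℝ) (α : κ → ℕ → ℕ → ℂ) :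
    globalVariance D R S (fun r s => ∑ j ∈ J, α j r s) ≤
      J.card * ∑ j ∈ J, globalVariance D R S (α j) := by
  classical
  have hlin : ∀ d a, twistedSum R S (fun r s => ∑ j ∈ J, α j r s) d a =
      ∑ j ∈ J, twistedSum R S (α j) d a := by
    intro d a
    simp only [twistedSum]
    rw [Finset.sum_comm (s := J)]
    refine Finset.sum_congr rfl fun r _ => ?_
    rw [Finset.sum_comm (s := J)]
    refine Finset.sum_congr rfl fun s _ => ?_
    split_ifs
    · rw [Finset.sum_mul]
    · simp
  simp only [globalVariance, hlin]
  rw [Finset.sum_comm (s := J), Finset.mul_sum]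
  refine Finset.sum_le_sum fun d _ => ?_
  rw [Finset.sum_comm (s := J), Finset.mul_sum]
  exact Finset.sum_le_sum fun a _ => norm_sum_mul_sq_le_card_mul J _

/-- Variances are nonnegative and the weight is at least 4/25 on [1, 2], so the sharp range of
moduli may be replaced by the weighted sum. Keeping r in one class modulo 8 makes reciprocity free
of signs. -/
theorem globalVariance_le_of_flip {D F R S a b c δ P : ℝ} (hD : 0 < D) (hF : 0 < F) (hR : 0 < R)
    (hS : 0 < S) (ha : 0 ≤ a) (hb : 0 ≤ b) (hc : 0 ≤ c) (hδ : 0 < δ) (hδ1 : δ ≤ 1) {T : ℕ}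
    (hT : 4 * (R * S) ≤ T) (hT' : 2 * R ≤ T) (hTD : 2 * D ≤ T)
    (hP : ∀ r ∈ dyadic R, (r.divisors.card : ℝ) ≤ P)
    (hVB : ∀ E R' : ℝ, 0 < E → E ≤ T → 0 < R' → R' ≤ R →
      VarianceBound E R' S (a * (R' * S) / √E + b + c * E))
    {β : ℕ → ℕ → ℂ} (hβ : SupportedInBox R S β) {m : ℕ} (hm : ∀ r s, β r s ≠ 0 → r % 8 = m) :
    globalVariance D R S β ≤ 2 ^ 32 * (D + F * D + a * (R * S) / √F * (1 + Real.log T) +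
        (b + c * (R * S) / D) * flipLoss δ (R * S / (F * D)) * P ^ 2) *
        ∑ r ∈ dyadic R, ∑ s ∈ dyadic S, (r.divisors.card : ℝ) * ‖β r s‖ ^ 2 := by
  set A := a * (R * S) / √F * (1 + Real.log T) with hA
  set B := (b + c * (R * S) / D) * flipLoss δ (R * S / (F * D)) * P ^ 2 with hB
  have hB0 : 0 ≤ B :=
    mul_nonneg (mul_nonneg (by positivity) (flipLoss_nonneg hδ (by positivity))) (sq_nonneg _)
  have hT0 : (0 : ℝ) < T := lt_of_lt_of_le (by positivity) hT
  have hA0 : 0 ≤ A := by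
    have : 1 ≤ (T : ℝ) := by
      have : 0 < T := by exact_mod_cast hT0
      exact_mod_cast this
    have := Real.log_nonneg this
    positivity
  set Q := ∑ r ∈ dyadic R, ∑ s ∈ dyadic S, (r.divisors.card : ℝ) * ‖β r s‖ ^ 2 with hQ
  have hQ0 : 0 ≤ Q :=
    Finset.sum_nonneg fun r _ => Finset.sum_nonneg fun s _ => by positivity
  have h1 := sum_mul_variance_le hF.le hR.le (Ds := Icc 1 T) (fun d hd => (mem_Icc.mp hd).1)
    (w := fun d => weight (d / D)) (fun d => weight_nonneg _) (sum_weight_le hD T) hβ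
  have h2 := norm_big_part_le hD hF hR hS ha hb hc hδ hδ1 hT hT' hP hVB hβ hm
  have h3 : (4 / 25 : ℝ) * globalVariance D R S β ≤
      ∑ d ∈ Icc 1 T, weight (d / D) * variance R S β d := by
    rw [globalVariance_eq, Finset.mul_sum]
    refine le_trans (Finset.sum_le_sum fun d hd => ?_) (Finset.sum_le_sum_of_subset_of_nonneg
      (s := dyadic D) (fun d hd => ?_) fun d _ _ =>
        mul_nonneg (weight_nonneg _) (variance_nonneg _ _ _ _))
    · have hd' := (mem_dyadic hD.le d).mp hd
      refine mul_le_mul_of_nonneg_right (le_weight ?_ ?_) (variance_nonneg _ _ _ _)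
      · rw [le_div_iff₀ hD]; linarith [hd'.1]
      · rw [div_le_iff₀ hD]; exact hd'.2
    · have hd' := (mem_dyadic hD.le d).mp hd
      refine mem_Icc.mpr ⟨pos_of_mem_dyadic hD.le hd, ?_⟩
      exact_mod_cast hd'.2.trans hTD
  have h4 : (1 + 2 * F) * (3 * D) * ∑ r ∈ dyadic R, ∑ s ∈ dyadic S, ‖β r s‖ ^ 2 ≤
      (1 + 2 * F) * (3 * D) * Q :=
    mul_le_mul_of_nonneg_left (sum_norm_sq_le_sum_card_divisors hR.le S β) (by positivity)
  have h5 : 8 * a * (R * S) / √F * (1 + Real.log T) = 8 * A := by rw [hA]; ring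
  rw [h5] at h2
  have h6 : (4 / 25 : ℝ) * globalVariance D R S β ≤
      ((1 + 2 * F) * (3 * D) + 2 ^ 26 * (8 * A + B)) * Q := by
    rw [add_mul]; linarith
  have h7 : ((1 + 2 * F) * (3 * D) + 2 ^ 26 * (8 * A + B)) * Q ≤
      (4 / 25 * 2 ^ 32 * (D + F * D + A + B)) * Q := by
    refine mul_le_mul_of_nonneg_right ?_ hQ0
    have : 0 ≤ F * D := by positivity
    nlinarith
  linarith
/-- Passage to complementary divisors: bounds for the variance at moduli up to `T` give a bound for
the variance at moduli of size `D`. -/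
theorem supportedBound_flip {D F R S a b c δ P : ℝ} (hD : 0 < D) (hF : 0 < F) (hR : 0 < R)
    (hS : 0 < S) (ha : 0 ≤ a) (hb : 0 ≤ b) (hc : 0 ≤ c) (hδ : 0 < δ) (hδ1 : δ ≤ 1) {T : ℕ}
    (hT : 4 * (R * S) ≤ T) (hT' : 2 * R ≤ T) (hTD : 2 * D ≤ T)
    (hP : ∀ r ∈ dyadic R, (r.divisors.card : ℝ) ≤ P)
    (hVB : ∀ E R' : ℝ, 0 < E → E ≤ T → 0 < R' → R' ≤ R →
      VarianceBound E R' S (a * (R' * S) / √E + b + c * E)) :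
    SupportedBound D R S (2 ^ 35 * (D + F * D + a * (R * S) / √F * (1 + Real.log T) +
        (b + c * (R * S) / D) * flipLoss δ (R * S / (F * D)) * P ^ 2)) := by
  classical
  intro α hα
  set M := D + F * D + a * (R * S) / √F * (1 + Real.log T) +
    (b + c * (R * S) / D) * flipLoss δ (R * S / (F * D)) * P ^ 2 with hM
  -- Splitting into the classes modulo 8 costs a factor 8, whence 2^35 from 2^32.
  have hα' : α = fun r s => ∑ j ∈ range 8, if r % 8 = j then α r s else 0 := by
    funext r s
    rw [Finset.sum_ite_eq, if_pos (mem_range.mpr (Nat.mod_lt _ (by norm_num)))]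
  conv_lhs => rw [hα']
  refine (globalVariance_sum_le (range 8) D R S fun j r s => if r % 8 = j then α r s else 0).trans ?_
  have h8 : ∑ j ∈ range 8, globalVariance D R S (fun r s => if r % 8 = j then α r s else 0) ≤
      ∑ j ∈ range 8, 2 ^ 32 * M * ∑ r ∈ dyadic R, ∑ s ∈ dyadic S,
        (r.divisors.card : ℝ) * ‖if r % 8 = j then α r s else 0‖ ^ 2 := by
    refine Finset.sum_le_sum fun j _ => globalVariance_le_of_flip hD hF hR hS ha hb hc hδ hδ1 hT hT'
      hTD hP hVB (fun r s h => hα r s fun h0 => h ?_) (m := j) fun r s h => ?_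
    · simp [h0]
    · by_contra hne
      exact h (if_neg hne)
  have h9 : ∑ j ∈ range 8, ∑ r ∈ dyadic R, ∑ s ∈ dyadic S,
      (r.divisors.card : ℝ) * ‖if r % 8 = j then α r s else 0‖ ^ 2 =
        ∑ r ∈ dyadic R, ∑ s ∈ dyadic S, (r.divisors.card : ℝ) * ‖α r s‖ ^ 2 := by
    rw [Finset.sum_comm]
    refine Finset.sum_congr rfl fun r _ => ?_
    rw [Finset.sum_comm]
    refine Finset.sum_congr rfl fun s _ => ?_
    rw [Finset.sum_eq_single (r % 8)]
    · rw [if_pos rfl]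
    · intro j _ hj
      rw [if_neg (Ne.symm hj)]; simp
    · intro h
      exact absurd (mem_range.mpr (Nat.mod_lt _ (by norm_num))) h
  rw [← Finset.mul_sum, h9] at h8
  rw [card_range]
  calc _ ≤ ((8 : ℕ) : ℝ) * (2 ^ 32 * M *
        ∑ r ∈ dyadic R, ∑ s ∈ dyadic S, (r.divisors.card : ℝ) * ‖α r s‖ ^ 2) := by gcongr
    _ = _ := by push_cast; ring

/-! ### Enlarging the moduli by squares of primes -/

theorem sum_range_mul_eq (d k : ℕ) (f : ℕ → ℝ) :
    ∑ x ∈ range (d * k), f x = ∑ a ∈ range d, ∑ j ∈ range k, f (a + d * j) := by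
  rw [Finset.sum_comm]
  induction k with
  | zero => simp
  | succ k ih =>
    rw [Finset.sum_range_succ, ← ih, mul_add, mul_one, Finset.sum_range_add]
    congr 1
    exact Finset.sum_congr rfl fun a _ => by rw [add_comm]

theorem invCongr_iff_val {d k r s a : ℕ} (hd : 0 < d) (hk : 0 < k) (hr : r.Coprime (d * k))
    (ha : a < d) :
    InvCongr d r s a ↔ ((r : ZMod (d * k))⁻¹ * (s : ZMod (d * k))).val % d = a := by
  have : NeZero (d * k) := ⟨(Nat.mul_pos hd hk).ne'⟩
  set y := (r : ZMod (d * k))⁻¹ * (s : ZMod (d * k)) with hy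
  have h1 : (r : ZMod d)⁻¹ * (s : ZMod d) = (y.val : ZMod d) := by
    rw [← zmod_cast_inv_mul (Dvd.intro k rfl) hr s, ZMod.natCast_val]
  rw [InvCongr, h1, ZMod.natCast_eq_natCast_iff, Nat.ModEq, Nat.mod_eq_of_lt ha]
  exact ⟨fun h => h.2, fun h => ⟨hr.coprime_mul_right_right, h⟩⟩

/-- A residue class modulo `d` is the union of `k` residue classes modulo `d * k`. -/
theorem twistedSum_eq_sum_lift {R S : ℝ} {α : ℕ → ℕ → ℂ} {d k a : ℕ} (hd : 0 < d) (hk : 0 < k)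
    (ha : a < d) (hα : ∀ r s, α r s ≠ 0 → r.Coprime k)
    (hsymb : ∀ r s, α r s ≠ 0 → extJacobi r (d * k) = extJacobi r d) :
    twistedSum R S α d a = ∑ j ∈ range k, twistedSum R S α (d * k) (a + d * j) := by
  classical
  simp only [twistedSum]
  rw [Finset.sum_comm (s := range k)]
  refine Finset.sum_congr rfl fun r _ => ?_
  rw [Finset.sum_comm (s := range k)]
  refine Finset.sum_congr rfl fun s _ => ?_
  by_cases h0 : α r s = 0
  · simp [h0]
  by_cases hrd : r.Coprime d
  swap
  · rw [if_neg fun h => hrd h.1, Finset.sum_eq_zero]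
    intro j _
    rw [if_neg fun h => hrd h.1.coprime_mul_right_right]
  have hr : r.Coprime (d * k) := hrd.mul_right (hα r s h0)
  have : NeZero (d * k) := ⟨(Nat.mul_pos hd hk).ne'⟩
  set y := ((r : ZMod (d * k))⁻¹ * (s : ZMod (d * k))).val with hy
  have hylt : y < d * k := ZMod.val_lt _
  have hq : ∀ j ∈ range k, InvCongr (d * k) r s (a + d * j) ↔ y = a + d * j := by
    intro j hj
    have hlt : a + d * j < d * k := by
      have : j + 1 ≤ k := mem_range.mp hj
      nlinarith
    rw [InvCongr, ← ZMod.natCast_zmod_val ((r : ZMod (d * k))⁻¹ * (s : ZMod (d * k))),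
      ZMod.natCast_eq_natCast_iff, ← hy, Nat.ModEq, Nat.mod_eq_of_lt hlt, Nat.mod_eq_of_lt hylt]
    exact ⟨fun h => h.2, fun h => ⟨hr, h⟩⟩
  rw [if_congr (invCongr_iff_val hd hk hr ha) rfl rfl, hsymb r s h0,
    Finset.sum_congr rfl fun j hj => if_congr (hq j hj) rfl rfl]
  by_cases hya : y % d = a
  · rw [if_pos hya, Finset.sum_eq_single (y / d)]
    · rw [if_pos]
      rw [← hya]; exact (Nat.mod_add_div y d).symm
    · intro j _ hj
      rw [if_neg]
      intro h
      refine hj ?_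
      rw [h, Nat.add_mul_div_left _ _ hd, Nat.div_eq_of_lt ha, zero_add]
    · intro h
      exact absurd (mem_range.mpr (Nat.div_lt_of_lt_mul hylt)) h
  · rw [if_neg hya, Finset.sum_eq_zero]
    intro j _
    rw [if_neg]
    intro h
    refine hya ?_
    rw [h, Nat.add_mul_mod_self_left, Nat.mod_eq_of_lt ha]

/-- Cauchy–Schwarz over the k classes modulo d k that make up one class modulo d. -/
theorem variance_le_mul_variance_lift {R S : ℝ} {α : ℕ → ℕ → ℂ} {d k : ℕ} (hd : 0 < d)
    (hk : 0 < k) (hα : ∀ r s, α r s ≠ 0 → r.Coprime k)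
    (hsymb : ∀ r s, α r s ≠ 0 → extJacobi r (d * k) = extJacobi r d) :
    variance R S α d ≤ k * variance R S α (d * k) := by
  rw [variance, variance, sum_range_mul_eq, Finset.mul_sum]
  refine Finset.sum_le_sum fun a ha => ?_
  rw [twistedSum_eq_sum_lift hd hk (mem_range.mp ha) hα hsymb]
  simpa using norm_sum_mul_sq_le_card_mul (range k) fun j => twistedSum R S α (d * k) (a + d * j)

theorem sum_dyadic_two_pow {Y : ℝ} (hY : 0 ≤ Y) (J : ℕ) (f : ℕ → ℝ) :
    ∑ j ∈ range J, ∑ n ∈ dyadic (2 ^ j * Y), f n = ∑ n ∈ Ioc ⌊Y⌋₊ ⌊2 ^ J * Y⌋₊, f n := by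
  induction J with
  | zero => simp
  | succ J ih =>
    rw [Finset.sum_range_succ, ih, dyadic, ← mul_assoc, ← pow_succ']
    refine Finset.sum_Ioc_consecutive f (Nat.floor_mono ?_) (Nat.floor_mono ?_)
    · exact le_mul_of_one_le_left hY (one_le_pow₀ (by norm_num))
    · gcongr <;> norm_num

theorem extJacobi_mul_sq {r d b : ℕ} (hd : d ≠ 0) (hb : b ≠ 0) (hr : r.Coprime b) :
    extJacobi r (d * b ^ 2) = extJacobi r d := by
  have hc : (r : ℤ).gcd (oddPart b) = 1 := by
    exact_mod_cast Nat.Coprime.coprime_dvd_right (oddPart_dvd b) hr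
  rw [extJacobi_eq, extJacobi_eq, oddPart_mul, sq, oddPart_mul, jacobiSym.mul_right' _
    (oddPart_ne_zero hd) (mul_ne_zero (oddPart_ne_zero hb) (oddPart_ne_zero hb)),
    jacobiSym.mul_right' _ (oddPart_ne_zero hb) (oddPart_ne_zero hb)]
  rcases jacobiSym.eq_one_or_neg_one hc with h | h <;> rw [h] <;> norm_num

/-- A sum over products `d * b²` is bounded by the sum over all integers of the same size. -/
theorem sum_mul_sq_le {D B M : ℝ} (hD : 0 < D) (hB : 0 < B) {Bs : Finset ℕ}
    (hBs : ∀ b ∈ Bs, B < b ∧ (b : ℝ) ≤ 4 * B)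
    (hM : ∀ n : ℕ, n ≠ 0 → (n : ℝ) ≤ 32 * (D * B ^ 2) → (n.divisors.card : ℝ) ≤ M)
    {f : ℕ → ℝ} (hf : ∀ n, 0 ≤ f n) :
    ∑ b ∈ Bs, ∑ d ∈ dyadic D, f (d * b ^ 2) ≤
      M * ∑ j ∈ range 5, ∑ n ∈ dyadic (2 ^ j * (D * B ^ 2)), f n := by
  classical
  have hY : 0 < D * B ^ 2 := by positivity
  -- The products d b² lie in (DB², 32DB²], five dyadic ranges. A given n arises at most τ(n) times,
  -- since d ∣ n determines b.
  rw [sum_dyadic_two_pow hY.le, ← Finset.sum_product',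
    ← Finset.sum_fiberwise_of_maps_to (g := fun p : ℕ × ℕ => p.2 * p.1 ^ 2)
      (t := Ioc ⌊D * B ^ 2⌋₊ ⌊2 ^ 5 * (D * B ^ 2)⌋₊), Finset.mul_sum]
  · refine Finset.sum_le_sum fun n hn => ?_
    obtain ⟨hn1, hn2⟩ := mem_Ioc.mp hn
    have hn0 : n ≠ 0 := by omega
    rw [Finset.sum_congr rfl (g := fun _ => f n) fun p hp => by rw [(mem_filter.mp hp).2],
      Finset.sum_const, nsmul_eq_mul]
    refine mul_le_mul_of_nonneg_right (le_trans ?_ (hM n hn0 ?_)) (hf n)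
    · norm_cast
      refine Finset.card_le_card_of_injOn (fun p => p.2) ?_ ?_
      · intro p hp
        have h := (mem_filter.mp hp).2
        exact Nat.mem_divisors.mpr ⟨Dvd.intro _ h, hn0⟩
      · intro p hp q hq h
        have hp' := (mem_filter.mp hp).2
        have hq' := (mem_filter.mp hq).2
        have h' : p.2 = q.2 := h
        have hp2 : 0 < q.2 := Nat.pos_of_ne_zero fun h0 => hn0 (by rw [← hq', h0, zero_mul])
        rw [← hq', h'] at hp'
        have h3 := Nat.eq_of_mul_eq_mul_left hp2 hp'
        exact Prod.ext (Nat.pow_left_injective (by norm_num) h3) h'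
    · refine ((Nat.le_floor_iff (by positivity)).mp hn2).trans (le_of_eq (by norm_num))
  · intro p hp
    obtain ⟨hb, hd⟩ := mem_product.mp hp
    obtain ⟨hb1, hb2⟩ := hBs _ hb
    obtain ⟨hd1, hd2⟩ := (mem_dyadic hD.le _).mp hd
    rw [mem_Ioc, Nat.floor_lt hY.le, Nat.le_floor_iff (by positivity)]
    push_cast
    constructor
    · gcongr
    · calc (p.2 : ℝ) * p.1 ^ 2 ≤ 2 * D * (4 * B) ^ 2 := by gcongr
        _ = _ := by ring

/-- Passage to larger moduli, by means of multiplication with squares of primes. -/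
theorem SupportedBound.enlarge {D R S B N M : ℝ} (hD : 0 < D) (hR : 0 ≤ R) (hB : 0 < B)
    (hN : 0 ≤ N) {Bs : Finset ℕ} (hprime : ∀ b ∈ Bs, b.Prime)
    (hBs : ∀ b ∈ Bs, B < b ∧ (b : ℝ) ≤ 4 * B) (hM1 : 1 ≤ M) (hcard : 2 * M ≤ Bs.card)
    (hMr : ∀ r ∈ dyadic R, (r.divisors.card : ℝ) ≤ M)
    (hM : ∀ n : ℕ, n ≠ 0 → (n : ℝ) ≤ 32 * (D * B ^ 2) → (n.divisors.card : ℝ) ≤ M)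
    (h : ∀ j < 5, SupportedBound (2 ^ j * (D * B ^ 2)) R S N) :
    SupportedBound D R S (320 * (B ^ 2 * M / Bs.card) * N) := by
  classical
  intro α hα
  obtain ⟨K, hK⟩ : ∃ K : ℝ, K = Bs.card := ⟨_, rfl⟩
  rw [← hK] at hcard ⊢
  have hK0 : 0 < K := by linarith
  -- The number of primes b that do not divide r. Dividing the coefficients by it makes α the sum
  -- over b of the parts with b ∤ r. It is at least K/2, because at most M ≤ K/2 of the primes
  -- divide r.
  obtain ⟨n, hn⟩ : ∃ n : ℕ → ℝ, ∀ r, n r = (Bs.filter fun b => ¬ b ∣ r).card := ⟨_, fun _ => rfl⟩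
  have hnr : ∀ r ∈ dyadic R, K / 2 ≤ n r := by
    intro r hr
    have h1 := Finset.card_filter_add_card_filter_not (s := Bs) (fun b => b ∣ r)
    have h2 : ((Bs.filter fun b => b ∣ r).card : ℝ) ≤ M := by
      refine le_trans ?_ (hMr r hr)
      exact_mod_cast Finset.card_le_card fun b hb =>
        Nat.mem_divisors.mpr ⟨(mem_filter.mp hb).2, (pos_of_mem_dyadic hR hr).ne'⟩
    have h3 : ((Bs.filter fun b => b ∣ r).card : ℝ) + n r = K := by
      rw [hn, hK]; exact_mod_cast h1
    linarith
  have hrmem : ∀ r s, α r s ≠ 0 → r ∈ dyadic R := fun r s h0 =>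
    (mem_dyadic hR r).mpr (hα r s h0).1
  set γ : ℕ → ℕ → ℂ := fun r s => α r s / n r with hγ
  have hγs : SupportedInBox R S γ := fun r s h0 => hα r s fun h1 => h0 (by simp [hγ, h1])
  set γb : ℕ → ℕ → ℕ → ℂ := fun b r s => if b ∣ r then 0 else γ r s with hγb
  have hαeq : α = fun r s => ∑ b ∈ Bs, γb b r s := by
    funext r s
    by_cases h0 : α r s = 0
    · simp [hγb, hγ, h0]
    · have hpos : 0 < n r := lt_of_lt_of_le (by positivity) (hnr r (hrmem r s h0))
      have h1 : ∑ b ∈ Bs, γb b r s = ∑ b ∈ Bs with ¬ b ∣ r, γ r s := by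
        rw [Finset.sum_filter]
        exact Finset.sum_congr rfl fun b _ => by simp only [hγb]; split_ifs <;> simp_all
      rw [h1, Finset.sum_const, nsmul_eq_mul, hγ]
      have h2 : (((Bs.filter fun b => ¬ b ∣ r).card : ℕ) : ℂ) = ((n r : ℝ) : ℂ) := by
        rw [hn]; push_cast; rfl
      rw [h2, mul_div_cancel₀]
      exact_mod_cast hpos.ne'
  have hlift : ∀ b ∈ Bs, globalVariance D R S (γb b) ≤
      16 * B ^ 2 * ∑ d ∈ dyadic D, variance R S γ (d * b ^ 2) := by
    intro b hb
    have hbp := hprime b hb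
    rw [globalVariance_eq, Finset.mul_sum]
    refine Finset.sum_le_sum fun d hd => ?_
    have hd0 := pos_of_mem_dyadic hD.le hd
    have hcop : ∀ r s, γb b r s ≠ 0 → r.Coprime b := by
      intro r s h0
      refine Nat.Coprime.symm ((Nat.Prime.coprime_iff_not_dvd hbp).mpr fun hdv => h0 ?_)
      simp [hγb, hdv]
    have h1 := variance_le_mul_variance_lift (R := R) (S := S) hd0 (pow_pos hbp.pos 2)
      (fun r s h0 => (hcop r s h0).pow_right 2)
      (fun r s h0 => extJacobi_mul_sq hd0.ne' hbp.ne_zero (hcop r s h0))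
    -- Modulo d b² the restriction b ∤ r is automatic, so one coefficient family γ serves all b.
    -- This allows the sum over b to be merged with the sum over d.
    have h2 : variance R S (γb b) (d * b ^ 2) = variance R S γ (d * b ^ 2) := by
      simp only [variance, twistedSum]
      refine Finset.sum_congr rfl fun a _ => ?_
      congr 2
      refine Finset.sum_congr rfl fun r _ => Finset.sum_congr rfl fun s _ => ?_
      by_cases hI : InvCongr (d * b ^ 2) r s a
      · have hnd : ¬ b ∣ r := fun hdv => by
          have h3 : r.Coprime b := (hI.1.coprime_mul_left_right).coprime_dvd_right
            (dvd_pow_self b (by norm_num))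
          exact (Nat.Prime.coprime_iff_not_dvd hbp).mp h3.symm hdv
        simp only [hγb, if_neg hnd]
      · rw [if_neg hI, if_neg hI]
    rw [h2] at h1
    refine h1.trans (mul_le_mul_of_nonneg_right ?_ (variance_nonneg _ _ _ _))
    push_cast
    calc (b : ℝ) ^ 2 ≤ (4 * B) ^ 2 := by gcongr; exact (hBs b hb).2
      _ = 16 * B ^ 2 := by ring
  have hmult := sum_mul_sq_le hD hB hBs hM fun n => variance_nonneg R S γ n
  obtain ⟨Q, hQ⟩ : ∃ Q, Q = ∑ r ∈ dyadic R, ∑ s ∈ dyadic S, (r.divisors.card : ℝ) * ‖α r s‖ ^ 2 :=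
    ⟨_, rfl⟩
  rw [← hQ]
  have hγQ : ∑ r ∈ dyadic R, ∑ s ∈ dyadic S, (r.divisors.card : ℝ) * ‖γ r s‖ ^ 2 ≤
      4 / K ^ 2 * Q := by
    rw [hQ, Finset.mul_sum]
    refine Finset.sum_le_sum fun r hr => ?_
    rw [Finset.mul_sum]
    refine Finset.sum_le_sum fun s _ => ?_
    have hn1 := hnr r hr
    have hn0 : 0 < n r := by linarith
    rw [hγ]
    simp only [norm_div, Complex.norm_real, Real.norm_of_nonneg hn0.le, div_pow]
    have h4 : ‖α r s‖ ^ 2 / n r ^ 2 ≤ 4 / K ^ 2 * ‖α r s‖ ^ 2 := by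
      rw [div_le_iff₀ (by positivity), mul_right_comm]
      refine le_mul_of_one_le_left (by positivity) ?_
      rw [div_mul_eq_mul_div, le_div_iff₀ (by positivity)]
      nlinarith
    calc _ ≤ (r.divisors.card : ℝ) * (4 / K ^ 2 * ‖α r s‖ ^ 2) :=
          mul_le_mul_of_nonneg_left h4 (Nat.cast_nonneg _)
      _ = _ := by ring
  have hsum : ∑ j ∈ range 5, ∑ m ∈ dyadic (2 ^ j * (D * B ^ 2)), variance R S γ m ≤
      5 * (N * (4 / K ^ 2 * Q)) := by
    calc _ ≤ ∑ j ∈ range 5, N * (4 / K ^ 2 * Q) := by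
          refine Finset.sum_le_sum fun j hj => ?_
          refine (h j (mem_range.mp hj) γ hγs).trans (mul_le_mul_of_nonneg_left hγQ hN)
      _ = _ := by rw [Finset.sum_const, card_range, nsmul_eq_mul]; norm_num
  -- The losses are K from Cauchy–Schwarz over b, 16B² from lifting, M from multiplicity, 5 from the
  -- ranges, and 4/K² from the division by n r.
  calc globalVariance D R S α ≤ K * ∑ b ∈ Bs, globalVariance D R S (γb b) := by
        conv_lhs => rw [hαeq]
        rw [hK]
        exact globalVariance_sum_le Bs D R S γb
    _ ≤ K * ∑ b ∈ Bs, 16 * B ^ 2 * ∑ d ∈ dyadic D, variance R S γ (d * b ^ 2) := by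
        gcongr with b hb
        exact hlift b hb
    _ = K * (16 * B ^ 2 * ∑ b ∈ Bs, ∑ d ∈ dyadic D, variance R S γ (d * b ^ 2)) := by
        rw [← Finset.mul_sum]
    _ ≤ K * (16 * B ^ 2 * (M * (5 * (N * (4 / K ^ 2 * Q))))) := by
        gcongr
        exact hmult.trans (by gcongr)
    _ = 320 * (B ^ 2 * M / K) * N * Q := by field_simp; ring

/-- Chebyshev's lower bound for the number of primes in intervals. -/
theorem exists_primes_Ioc : ∃ B₀ : ℝ, 1 ≤ B₀ ∧ ∀ B : ℝ, B₀ ≤ B → ∃ Bs : Finset ℕ,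
    (∀ b ∈ Bs, b.Prime) ∧ (∀ b ∈ Bs, B < b ∧ (b : ℝ) ≤ 4 * B) ∧
      B ≤ Bs.card * Real.log (4 * B) := by
  have h1 : ∀ᶠ x : ℝ in Filter.atTop,
      Real.log 2 + Real.log (x + 2) + 2 * √x * Real.log x ≤ x / 100 := by
    have hlog := Real.isLittleO_log_id_atTop.bound (show (0 : ℝ) < 1 / 1000 by norm_num)
    have hsq := (isLittleO_log_rpow_atTop (show (0 : ℝ) < 1 / 2 by norm_num)).bound
      (show (0 : ℝ) < 1 / 1000 by norm_num)
    have hshift := (Filter.tendsto_atTop_add_const_right Filter.atTop (2 : ℝ)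
      Filter.tendsto_id).eventually hlog
    filter_upwards [hlog, hsq, hshift, Filter.eventually_ge_atTop (1000 : ℝ)] with x h1 h2 h3 hx
    have hl : 0 ≤ Real.log x := Real.log_nonneg (by linarith)
    have hl2 : 0 ≤ Real.log (x + 2) := Real.log_nonneg (by linarith)
    simp only [id, Real.norm_eq_abs] at h1 h3
    rw [abs_of_nonneg hl2, abs_of_nonneg (by linarith)] at h3
    rw [← Real.sqrt_eq_rpow, Real.norm_of_nonneg hl, Real.norm_of_nonneg (Real.sqrt_nonneg _)] at h2
    have h4 : √x * √x = x := Real.mul_self_sqrt (by linarith)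
    have h5 : √x * Real.log x ≤ √x * (1 / 1000 * √x) := by gcongr
    have h6 := Real.log_two_lt_d9
    nlinarith
  obtain ⟨x₀, hx₀⟩ := Filter.eventually_atTop.mp h1
  refine ⟨max 1 x₀, le_max_left _ _, fun B hB => ?_⟩
  have hB1 : 1 ≤ B := (le_max_left _ _).trans hB
  have hB2 : x₀ ≤ 4 * B := by linarith [(le_max_right 1 x₀).trans hB]
  set Bs := (Ioc ⌊B⌋₊ ⌊4 * B⌋₊).filter Nat.Prime with hBs
  have hmem : ∀ b ∈ Bs, B < b ∧ (b : ℝ) ≤ 4 * B := by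
    intro b hb
    have h2 := mem_Ioc.mp (mem_filter.mp hb).1
    exact ⟨(Nat.floor_lt (by linarith)).mp h2.1, (Nat.le_floor_iff (by linarith)).mp h2.2⟩
  refine ⟨Bs, fun b hb => (mem_filter.mp hb).2, hmem, ?_⟩
  -- θ(4B) is at least about 4B log 2, while θ(B) ≤ B log 4 = 2B log 2. The ratio 4 between the
  -- endpoints leaves a difference exceeding B.
  have h2 := Chebyshev.theta_ge' (x := 4 * B) (by linarith)
  have h3 := Chebyshev.theta_le_log4_mul_x (x := B) (by linarith)
  have h4 := hx₀ _ hB2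
  have h5 : Chebyshev.theta B + ∑ b ∈ Bs, Real.log b = Chebyshev.theta (4 * B) := by
    rw [Chebyshev.theta, Chebyshev.theta, hBs, Finset.sum_filter, Finset.sum_filter,
      Finset.sum_filter]
    exact Finset.sum_Ioc_consecutive _ (Nat.zero_le _) (Nat.floor_mono (by linarith))
  have h6 : ∑ b ∈ Bs, Real.log b ≤ Bs.card * Real.log (4 * B) := by
    rw [← nsmul_eq_mul]
    refine Finset.sum_le_card_nsmul _ _ _ fun b hb => ?_
    obtain ⟨hb1, hb2⟩ := hmem b hb
    exact Real.log_le_log (by linarith) hb2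
  have h7 : Real.log 4 = 2 * Real.log 2 := by
    rw [show (4 : ℝ) = 2 ^ 2 by norm_num, Real.log_pow]; norm_num
  have h8 := Real.log_two_gt_d9
  rw [h7] at h3
  nlinarith

/-! ### Bounds in a box, by the size of the moduli -/

/-- The saving u^6 is chosen to pay for an enlargement factor of size up to g u^4 and still leave
u²; the exponent 24 is 4 · 6. -/
theorem rpow_three_quarters_le {R u : ℝ} (hu : 1 ≤ u) (hR : u ^ 24 ≤ R) :
    R ^ (3 / 4 : ℝ) ≤ R / u ^ 6 := by
  have hR0 : 0 < R := lt_of_lt_of_le (by positivity) hR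
  have h1 : u ^ 6 ≤ R ^ (1 / 4 : ℝ) := by
    calc u ^ 6 = ((u ^ 24 : ℝ)) ^ (1 / 4 : ℝ) := by
          rw [← Real.rpow_natCast u 24, ← Real.rpow_mul (by linarith), ← Real.rpow_natCast u 6]
          norm_num
      _ ≤ _ := by gcongr
  rw [le_div_iff₀ (by positivity)]
  calc R ^ (3 / 4 : ℝ) * u ^ 6 ≤ R ^ (3 / 4 : ℝ) * R ^ (1 / 4 : ℝ) := by gcongr
    _ = R := by rw [← Real.rpow_add hR0]; norm_num

/-- The direct bound in a box whose sides have length at least `u ^ 24`. -/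
theorem exists_varianceBound_box {ε : ℝ} (hε : 0 < ε) : ∃ C : ℝ, 1 ≤ C ∧ ∀ R S u : ℝ, 1 ≤ u →
    u ^ 24 ≤ R → u ^ 24 ≤ S → ∀ E R' : ℝ, 0 < E → E ≤ 100 * (R * S) ^ 2 → 0 < R' → R' ≤ R →
      VarianceBound E R' S (C * (R * S) ^ ε * (R' * S) / √E + C * (R * S) ^ ε * (R * S / u ^ 6) +
        C * (R * S) ^ ε * √(R * S) * E) := by
  obtain ⟨C, hC, h⟩ := exists_varianceBound (half_pos hε)
  refine ⟨2 * C * 100 ^ (ε / 2), ?_, ?_⟩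
  · have : (1 : ℝ) ≤ 100 ^ (ε / 2) := Real.one_le_rpow (by norm_num) (by positivity)
    nlinarith
  intro R S u hu hRu hSu E R' hE hEZ hR' hR'R
  have hu24 : (1 : ℝ) ≤ u ^ 24 := one_le_pow₀ hu
  have hR1 : 1 ≤ R := hu24.trans hRu
  have hS1 : 1 ≤ S := hu24.trans hSu
  have hX1 : 1 ≤ R * S := by nlinarith
  have hRX : R ≤ R * S := by nlinarith
  have hSX : S ≤ R * S := by nlinarith
  have hXZ : R * S ≤ 100 * (R * S) ^ 2 := by nlinarith
  refine (h (100 * (R * S) ^ 2) E R' S (hX1.trans hXZ) hE hEZ hR'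
    ((hR'R.trans hRX).trans hXZ) (by linarith) (hSX.trans hXZ)).mono ?_
  have hZ : (100 * (R * S) ^ 2) ^ (ε / 2) = 100 ^ (ε / 2) * (R * S) ^ ε := by
    rw [Real.mul_rpow (by norm_num) (by positivity), ← Real.rpow_natCast (R * S) 2,
      ← Real.rpow_mul (by positivity)]
    congr 2
    push_cast
    ring
  have h1 : R' ^ (3 / 4 : ℝ) * S ≤ R * S / u ^ 6 := by
    calc R' ^ (3 / 4 : ℝ) * S ≤ R ^ (3 / 4 : ℝ) * S := by gcongr
      _ ≤ R / u ^ 6 * S := by gcongr; exact rpow_three_quarters_le hu hRu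
      _ = _ := by ring
  have h2 : R' * S ^ (3 / 4 : ℝ) ≤ R * S / u ^ 6 := by
    calc R' * S ^ (3 / 4 : ℝ) ≤ R * (S / u ^ 6) := by
          gcongr; exact rpow_three_quarters_le hu hSu
      _ = _ := by ring
  have h3 : √(R' * S) ≤ √(R * S) := Real.sqrt_le_sqrt (by gcongr)
  rw [hZ]
  have hK : 0 ≤ C * (100 ^ (ε / 2) * (R * S) ^ ε) := by positivity
  have h4 : E * √(R' * S) ≤ E * √(R * S) := by gcongr
  have h5 : 0 ≤ R' * S / √E := by positivity
  have h6 : 0 ≤ E * √(R * S) := by positivity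
  calc C * (100 ^ (ε / 2) * (R * S) ^ ε) * (R' * S / √E + (R' ^ (3 / 4 : ℝ) * S +
        R' * S ^ (3 / 4 : ℝ)) + E * √(R' * S))
      ≤ C * (100 ^ (ε / 2) * (R * S) ^ ε) * (2 * (R' * S / √E) + 2 * (R * S / u ^ 6) +
        2 * (E * √(R * S))) := mul_le_mul_of_nonneg_left (by linarith) hK
    _ = _ := by ring

/-- The direct bound in a box, with an absolute constant in the leading term. -/
theorem exists_varianceBound_box_clean {ε : ℝ} (hε : 0 < ε) : ∃ C : ℝ, 1 ≤ C ∧ ∀ R S u : ℝ,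
    1 ≤ u → u ^ 24 ≤ R → u ^ 24 ≤ S → ∀ E R' : ℝ, 0 < E → E ≤ 100 * (R * S) ^ 2 → 0 < R' →
      R' ≤ R → VarianceBound E R' S (36 * (R' * S) / √E + C * (R * S) ^ ε * (R * S / u ^ 3) +
        C * (R * S) ^ ε * √(R * S) * E) := by
  obtain ⟨C, hC, h⟩ := exists_varianceBound_box hε
  refine ⟨72 * C, by linarith, ?_⟩
  intro R S u hu hRu hSu E R' hE hEZ hR' hR'R
  have hu24 : (1 : ℝ) ≤ u ^ 24 := one_le_pow₀ hu
  have hR1 : 1 ≤ R := hu24.trans hRu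
  have hS1 : 1 ≤ S := hu24.trans hSu
  have hX1 : 1 ≤ R * S := by nlinarith
  have hXε : 1 ≤ (R * S) ^ ε := Real.one_le_rpow hX1 hε.le
  have hu0 : 0 < u := by linarith
  have hY0 : 0 ≤ R * S / u ^ 3 := by positivity
  have hCX : 1 ≤ C * (R * S) ^ ε := one_le_mul_of_one_le_of_one_le hC hXε
  -- For small E the bound without loss of small powers applies, as E² ≤ u^12 is harmless against
  -- u^24. For larger E one has √E ≥ u³, so even the leading term with its loss fits into R S / u³.
  rcases le_or_gt E (u ^ 6) with hEu | hEu
  · refine (varianceBound_small hE hR'.le (by linarith)).mono ?_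
    have h1 : (R' + S) * E ^ 2 ≤ 2 * (R * S / u ^ 3) := by
      have hR2 : R ≤ R * S / u ^ 24 := by
        rw [le_div_iff₀ (by positivity)]
        exact mul_le_mul_of_nonneg_left hSu (by linarith)
      have hS2 : S ≤ R * S / u ^ 24 := by
        rw [le_div_iff₀ (by positivity), mul_comm]
        exact mul_le_mul_of_nonneg_right hRu (by linarith)
      calc (R' + S) * E ^ 2 ≤ (R * S / u ^ 24 + R * S / u ^ 24) * (u ^ 6) ^ 2 := by
            gcongr
            exact hR'R.trans hR2
        _ = 2 * (R * S / u ^ 12) := by field_simp; ring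
        _ ≤ 2 * (R * S / u ^ 3) := by
            gcongr
            norm_num
    have h2 : R * S / u ^ 3 ≤ C * (R * S) ^ ε * (R * S / u ^ 3) := le_mul_of_one_le_left hY0 hCX
    have h3 : 0 ≤ 72 * C * (R * S) ^ ε * √(R * S) * E := by positivity
    calc 36 * (R' * S / √E + (R' + S) * E ^ 2)
        ≤ 36 * (R' * S) / √E + 72 * (C * (R * S) ^ ε * (R * S / u ^ 3)) := by
          rw [mul_div_assoc 36]; linarith
      _ ≤ _ := by linarith
  · refine (h R S u hu hRu hSu E R' hE hEZ hR' hR'R).mono ?_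
    have hsq : u ^ 3 ≤ √E := Real.le_sqrt_of_sq_le (by nlinarith)
    have h1 : R' * S / √E ≤ R * S / u ^ 3 := by gcongr
    have h2 : R * S / u ^ 6 ≤ R * S / u ^ 3 := by
      gcongr
      norm_num
    have h3 : C * (R * S) ^ ε * (R' * S / √E) ≤ C * (R * S) ^ ε * (R * S / u ^ 3) := by gcongr
    have h4 : C * (R * S) ^ ε * (R * S / u ^ 6) ≤ C * (R * S) ^ ε * (R * S / u ^ 3) := by gcongr
    have h5 : 0 ≤ C * (R * S) ^ ε * √(R * S) * E := by positivity
    have h6 : 0 ≤ 36 * (R' * S) / √E := by positivity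
    have h7 : 0 ≤ C * (R * S) ^ ε * (R * S / u ^ 3) := by positivity
    rw [mul_div_assoc]
    linarith

/-- The bound obtained from complementary divisors, with the dependence on divisor functions made
explicit. -/
theorem exists_supportedBound_flip {ε : ℝ} (hε : 0 < ε) : ∃ C : ℝ, 1 ≤ C ∧
    ∀ D F R S a b c : ℝ, 0 < D → 0 < F → 1 ≤ R → 1 ≤ S → 0 ≤ a → 0 ≤ b → 0 ≤ c →
      D ≤ 16 * (R * S) ^ 2 → R * S / (F * D) ≤ (R * S) ^ 4 →
      (∀ E R' : ℝ, 0 < E → E ≤ 100 * (R * S) ^ 2 → 0 < R' → R' ≤ R →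
        VarianceBound E R' S (a * (R' * S) / √E + b + c * E)) →
      SupportedBound D R S (C * (D + F * D + a * (R * S) / √F * (1 + Real.log (R * S)) +
        (b + c * (R * S) / D) * (R * S) ^ ε)) := by
  obtain ⟨C₁, hC₁, hτ⟩ := exists_card_divisors_le 2 1 (show 0 < ε / 4 by positivity)
  -- Since the argument of `flipLoss` is at most X⁴, its power δ is at most X^(ε/2).
  set δ := min 1 (ε / 8) with hδ
  have hδ0 : 0 < δ := lt_min one_pos (by positivity)
  have hδ1 : δ ≤ 1 := min_le_left _ _
  have hδε : δ * 4 ≤ ε / 2 := by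
    have := min_le_right 1 (ε / 8)
    rw [← hδ] at this
    linarith
  have hden : 0 < 1 - (2 : ℝ) ^ (-δ) := by
    have : (2 : ℝ) ^ (-δ) < 1 := Real.rpow_lt_one_of_one_lt_of_neg (by norm_num) (by linarith)
    linarith
  set C₂ := 1 / (1 - (2 : ℝ) ^ (-δ)) with hC₂
  have hC₂0 : 0 < C₂ := by positivity
  refine ⟨2 ^ 35 * (8 + C₂ * C₁ ^ 2), ?_, ?_⟩
  · nlinarith [mul_pos hC₂0 (show (0 : ℝ) < C₁ ^ 2 by positivity)]
  intro D F R S a b c hD hF hR hS ha hb hc hDX hρ hVB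
  have hX1 : 1 ≤ R * S := by nlinarith
  set X := R * S with hX
  have hRX : R ≤ X := by rw [hX]; nlinarith
  have hX2 : X ≤ X ^ 2 := by nlinarith
  set T := ⌈32 * X ^ 2⌉₊ with hT
  have hT1 : 32 * X ^ 2 ≤ T := Nat.le_ceil _
  have hT2 : (T : ℝ) ≤ 33 * X ^ 2 := by
    have := (Nat.ceil_lt_add_one (show 0 ≤ 32 * X ^ 2 by positivity)).le
    nlinarith
  have hlog : 1 + Real.log T ≤ 6 * (1 + Real.log X) := by
    have h1 : Real.log T ≤ Real.log (33 * X ^ 2) := by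
      refine Real.log_le_log ?_ hT2
      exact lt_of_lt_of_le (by positivity) hT1
    have h2 : Real.log (33 * X ^ 2) = Real.log 33 + 2 * Real.log X := by
      rw [Real.log_mul (by norm_num) (by positivity), Real.log_pow]; norm_num
    have h3 : Real.log 33 ≤ 5 := by
      rw [Real.log_le_iff_le_exp (by norm_num)]
      have h4 : (2 : ℝ) ^ 5 ≤ Real.exp 1 ^ 5 := by
        gcongr
        linarith [Real.add_one_le_exp (1 : ℝ)]
      have h5 : Real.exp 5 = Real.exp 1 ^ 5 := by rw [← Real.exp_nat_mul]; norm_num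
      have h6 : (2.7 : ℝ) ^ 5 ≤ Real.exp 1 ^ 5 := by
        gcongr
        linarith [Real.exp_one_gt_d9]
      rw [h5]
      refine le_trans ?_ h6
      norm_num
    have h4 : 0 ≤ Real.log X := Real.log_nonneg hX1
    linarith
  have hP : ∀ r ∈ dyadic R, (r.divisors.card : ℝ) ≤ C₁ * X ^ (ε / 4) := by
    intro r hr
    refine hτ X hX1 r (pos_of_mem_dyadic (by linarith) hr).ne' ?_
    have := ((mem_dyadic (by linarith) r).mp hr).2
    rw [pow_one]
    linarith
  have key := supportedBound_flip hD hF (by linarith) (by linarith) ha hb hc hδ0 hδ1 (T := T)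
    (by rw [← hX]; nlinarith) (by nlinarith) (by nlinarith) hP
    (fun E R' h1 h2 h3 h4 => hVB E R' h1 (by nlinarith) h3 h4)
  refine key.mono ?_
  rw [← hX]
  have hloss : flipLoss δ (X / (F * D)) * (C₁ * X ^ (ε / 4)) ^ 2 ≤ C₂ * C₁ ^ 2 * X ^ ε := by
    have h1 : (X / (F * D)) ^ δ ≤ X ^ (ε / 2) := by
      calc (X / (F * D)) ^ δ ≤ (X ^ 4) ^ δ := by gcongr
        _ = X ^ (δ * 4) := by
            rw [← Real.rpow_natCast X 4, ← Real.rpow_mul (by linarith), mul_comm]; norm_num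
        _ ≤ X ^ (ε / 2) := Real.rpow_le_rpow_of_exponent_le hX1 hδε
    have h2 : (X ^ (ε / 4)) ^ 2 = X ^ (ε / 2) := by
      rw [← Real.rpow_natCast, ← Real.rpow_mul (by linarith)]; congr 1; push_cast; ring
    have h3 : X ^ (ε / 2) * X ^ (ε / 2) = X ^ ε := by
      rw [← Real.rpow_add (by linarith)]; congr 1; ring
    calc flipLoss δ (X / (F * D)) * (C₁ * X ^ (ε / 4)) ^ 2
        = (X / (F * D)) ^ δ * C₂ * (C₁ ^ 2 * X ^ (ε / 2)) := by
          rw [flipLoss, mul_pow, h2, hC₂]; ring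
      _ ≤ X ^ (ε / 2) * C₂ * (C₁ ^ 2 * X ^ (ε / 2)) := by gcongr
      _ = C₂ * C₁ ^ 2 * (X ^ (ε / 2) * X ^ (ε / 2)) := by ring
      _ = _ := by rw [h3]
  have hbc : 0 ≤ b + c * X / D := by positivity
  have hA : 0 ≤ a * X / √F := by positivity
  have hL : 0 ≤ 1 + Real.log X := by linarith [Real.log_nonneg hX1]
  have e1 : a * X / √F * (1 + Real.log T) ≤ 6 * (a * X / √F * (1 + Real.log X)) := by
    calc _ ≤ a * X / √F * (6 * (1 + Real.log X)) := by gcongr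
      _ = _ := by ring
  have e2 : (b + c * X / D) * flipLoss δ (X / (F * D)) * (C₁ * X ^ (ε / 4)) ^ 2 ≤
      C₂ * C₁ ^ 2 * ((b + c * X / D) * X ^ ε) := by
    rw [mul_assoc]
    calc _ ≤ (b + c * X / D) * (C₂ * C₁ ^ 2 * X ^ ε) := by gcongr
      _ = _ := by ring
  have p1 : 0 ≤ F * D := by positivity
  have p2 : 0 ≤ a * X / √F * (1 + Real.log X) := mul_nonneg hA hL
  have p3 : 0 ≤ (b + c * X / D) * X ^ ε := by positivity
  have p4 : 0 ≤ C₂ * C₁ ^ 2 := by positivity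
  have q1 := mul_nonneg p4 hD.le
  have q2 := mul_nonneg p4 p1
  have q3 := mul_nonneg p4 p2
  rw [mul_assoc (2 ^ 35 : ℝ)]
  refine mul_le_mul_of_nonneg_left ?_ (by positivity)
  generalize (b + c * X / D) * X ^ ε = U at *
  generalize a * X / √F * (1 + Real.log X) = V at *
  nlinarith

/-- The bound for small moduli. -/
theorem exists_supportedBound_small {ε : ℝ} (hε : 0 < ε) : ∃ C : ℝ, 1 ≤ C ∧ ∀ D R S u : ℝ, 1 ≤ u →
    u ^ 24 ≤ R → u ^ 24 ≤ S → 0 < D → D ≤ √(R * S) / u ^ 2 →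
      SupportedBound D R S (C * (R * S / √D + (R * S) ^ ε * (R * S / u ^ 2))) := by
  obtain ⟨C, hC, h⟩ := exists_varianceBound_box_clean hε
  refine ⟨36 * C, by linarith, ?_⟩
  intro D R S u hu hRu hSu hD hDu
  have hu24 : (1 : ℝ) ≤ u ^ 24 := one_le_pow₀ hu
  have hR1 : 1 ≤ R := hu24.trans hRu
  have hS1 : 1 ≤ S := hu24.trans hSu
  have hX1 : 1 ≤ R * S := by nlinarith
  have hu2 : (1 : ℝ) ≤ u ^ 2 := one_le_pow₀ hu
  have hu0 : 0 < u := by linarith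
  have hsqX : √(R * S) ≤ R * S := by
    rw [Real.sqrt_le_left (by linarith)]; nlinarith
  have hDs : D ≤ √(R * S) := hDu.trans (div_le_self (Real.sqrt_nonneg _) hu2)
  have hDX : D ≤ 100 * (R * S) ^ 2 := by nlinarith
  refine VarianceBound.supportedBound (by linarith) (by positivity)
    ((h R S u hu hRu hSu D R hD hDX (by linarith) le_rfl).mono ?_)
  have h1 : R * S / u ^ 3 ≤ R * S / u ^ 2 := by
    gcongr
    norm_num
  have h2 : √(R * S) * D ≤ R * S / u ^ 2 := by
    calc √(R * S) * D ≤ √(R * S) * (√(R * S) / u ^ 2) := by gcongr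
      _ = R * S / u ^ 2 := by rw [← mul_div_assoc, Real.mul_self_sqrt (by linarith)]
  have hK : 0 ≤ C * (R * S) ^ ε := by positivity
  have h3 := mul_le_mul_of_nonneg_left h1 hK
  have h4 := mul_le_mul_of_nonneg_left h2 hK
  have h5 : 0 ≤ R * S / √D := by positivity
  have h6 : 0 ≤ C * (R * S) ^ ε * (R * S / u ^ 2) := by positivity
  have h7 : R * S / √D ≤ C * (R * S / √D) := le_mul_of_one_le_left h5 hC
  have e1 : 36 * (R * S) / √D = 36 * (R * S / √D) := mul_div_assoc _ _ _
  rw [e1]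
  calc 36 * (R * S / √D) + C * (R * S) ^ ε * (R * S / u ^ 3) + C * (R * S) ^ ε * √(R * S) * D
      = 36 * (R * S / √D) + C * (R * S) ^ ε * (R * S / u ^ 3) +
        C * (R * S) ^ ε * (√(R * S) * D) := by ring
    _ ≤ 36 * (C * (R * S / √D)) + 36 * (C * (R * S) ^ ε * (R * S / u ^ 2)) := by linarith
    _ = _ := by ring

/-- The bound for large moduli. -/
theorem exists_supportedBound_large {ε : ℝ} (hε : 0 < ε) : ∃ C : ℝ, 1 ≤ C ∧ ∀ t R S u : ℝ, 1 ≤ u →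
    u ^ 24 ≤ R → u ^ 24 ≤ S → 0 < t → t ≤ 1 → √(R * S) * u ^ 2 ≤ t ^ 3 * (R * S) →
      SupportedBound (t ^ 3 * (R * S)) R S (C * (t ^ 3 * (R * S) +
        t * (R * S) * (1 + Real.log (R * S)) + (R * S) ^ ε * (R * S / u ^ 2))) := by
  obtain ⟨C, hC, h⟩ := exists_varianceBound_box_clean (half_pos hε)
  obtain ⟨C', hC', h'⟩ := exists_supportedBound_flip (half_pos hε)
  refine ⟨C' * (37 * C), by nlinarith, ?_⟩
  intro t R S u hu hRu hSu ht ht1 hD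
  have hu24 : (1 : ℝ) ≤ u ^ 24 := one_le_pow₀ hu
  have hR1 : 1 ≤ R := hu24.trans hRu
  have hS1 : 1 ≤ S := hu24.trans hSu
  have hX1 : 1 ≤ R * S := by nlinarith
  have hu2 : (1 : ℝ) ≤ u ^ 2 := one_le_pow₀ hu
  have hu0 : 0 < u := by linarith
  have hb := h R S u hu hRu hSu
  set X := R * S with hX
  have hX0 : 0 < X := by linarith
  have hD1 : 1 ≤ t ^ 3 * X := by
    have : 1 ≤ √X := Real.one_le_sqrt.mpr hX1
    nlinarith
  have hD0 : 0 < t ^ 3 * X := by linarith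
  have ht3 : t ^ 3 ≤ 1 := pow_le_one₀ ht.le ht1
  have hXt : 1 / t ≤ X ^ 4 := by
    rw [div_le_iff₀ ht]
    have h1 : t ^ 3 ≤ t := by
      calc t ^ 3 ≤ t ^ 1 := pow_le_pow_of_le_one ht.le ht1 (by norm_num)
        _ = t := pow_one t
    have h2 : 1 ≤ X * t := by nlinarith
    have h3 : X ≤ X ^ 4 := le_self_pow₀ hX1 (by norm_num)
    nlinarith
  -- F = 1/t² balances the trivial cost and the leading term: with D = t³X both F D and X/√F equal t
  -- X.
  have key := h' (t ^ 3 * X) (1 / t ^ 2) R S 36 (C * X ^ (ε / 2) * (X / u ^ 3))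
    (C * X ^ (ε / 2) * √X) hD0 (by positivity) hR1 hS1 (by norm_num) (by positivity)
    (by positivity) (by rw [← hX]; nlinarith) (by
      rw [← hX]
      refine le_trans (le_of_eq ?_) hXt
      field_simp) hb
  rw [← hX] at key
  refine key.mono ?_
  have hs : √(1 / t ^ 2) = 1 / t := by
    rw [Real.sqrt_div zero_le_one, Real.sqrt_one, Real.sqrt_sq ht.le]
  have hL : 0 ≤ 1 + Real.log X := by linarith [Real.log_nonneg hX1]
  have e1 : 1 / t ^ 2 * (t ^ 3 * X) = t * X := by field_simp
  have e2 : 36 * X / √(1 / t ^ 2) = 36 * (t * X) := by rw [hs]; field_simp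
  have e3 : X ^ (ε / 2) * X ^ (ε / 2) = X ^ ε := by
    rw [← Real.rpow_add hX0]; congr 1; ring
  have h1 : X / u ^ 3 ≤ X / u ^ 2 := by
    gcongr
    norm_num
  have h2 : √X * X / (t ^ 3 * X) ≤ X / u ^ 2 := by
    rw [div_le_div_iff₀ hD0 (by positivity)]
    nlinarith
  have h3 : (C * X ^ (ε / 2) * (X / u ^ 3) + C * X ^ (ε / 2) * √X * X / (t ^ 3 * X)) * X ^ (ε / 2) ≤
      2 * C * (X ^ ε * (X / u ^ 2)) := by
    calc _ = C * X ^ (ε / 2) * X ^ (ε / 2) * (X / u ^ 3 + √X * X / (t ^ 3 * X)) := by ring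
      _ ≤ C * X ^ (ε / 2) * X ^ (ε / 2) * (X / u ^ 2 + X / u ^ 2) := by gcongr
      _ = 2 * C * ((X ^ (ε / 2) * X ^ (ε / 2)) * (X / u ^ 2)) := by ring
      _ = _ := by rw [e3]
  rw [e1, e2, mul_assoc C']
  refine mul_le_mul_of_nonneg_left ?_ (by linarith)
  have p1 : 0 ≤ t * X := by positivity
  have hL1 : 1 ≤ 1 + Real.log X := by linarith [Real.log_nonneg hX1]
  have p2 : t * X ≤ t * X * (1 + Real.log X) := le_mul_of_one_le_right p1 hL1
  have p3 : 0 ≤ X ^ ε * (X / u ^ 2) := by positivity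
  have q1 : t ^ 3 * X ≤ C * (t ^ 3 * X) := le_mul_of_one_le_left hD0.le hC
  have q2 : t * X * (1 + Real.log X) ≤ C * (t * X * (1 + Real.log X)) :=
    le_mul_of_one_le_left (by positivity) hC
  have q3 : 0 ≤ C * (X ^ ε * (X / u ^ 2)) := by positivity
  linarith

set_option maxHeartbeats 1000000 in
/-- The bound for moduli of intermediate size, before the passage to larger moduli: here the moduli
are of size `D * B ^ 2`. -/
theorem exists_supportedBound_enlarged {ε : ℝ} (hε : 0 < ε) : ∃ C : ℝ, 1 ≤ C ∧
    ∀ D B R S u g : ℝ, 1 ≤ u → u ^ 24 ≤ R → u ^ 24 ≤ S → 1 ≤ D → 1 ≤ B → 1 ≤ g → g ^ 2 ≤ R * S →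
      D * B = g * √(R * S) * u ^ 2 → B ≤ g * u ^ 4 → ∀ j < 5,
      SupportedBound (2 ^ j * (D * B ^ 2)) R S
        (C * (g ^ 3 * (R * S) ^ ε * (R * S / u ^ 2)) / B) := by
  obtain ⟨C, hC, h⟩ := exists_varianceBound_box (show 0 < ε / 3 by positivity)
  obtain ⟨C', hC', h'⟩ := exists_supportedBound_flip (show 0 < ε / 3 by positivity)
  obtain ⟨C₃, hC₃, h₃⟩ := exists_one_add_log_le 1 1 (show 0 < ε / 3 by positivity)
  refine ⟨C' * (40 * (C * C₃)), by nlinarith [mul_le_mul hC hC₃ zero_le_one (by linarith)], ?_⟩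
  intro D B R S u g hu hRu hSu hD hB hg hgX hDB hBu j hj
  have hu24 : (1 : ℝ) ≤ u ^ 24 := one_le_pow₀ hu
  have hR1 : 1 ≤ R := hu24.trans hRu
  have hS1 : 1 ≤ S := hu24.trans hSu
  have hX1 : 1 ≤ R * S := by nlinarith
  have hu2 : (1 : ℝ) ≤ u ^ 2 := one_le_pow₀ hu
  have hu0 : 0 < u := by linarith
  have huX : u ^ 24 ≤ √(R * S) := Real.le_sqrt_of_sq_le (by
    rw [sq]; exact mul_le_mul hRu hSu (by positivity) (by linarith))
  have hb := h R S u hu hRu hSu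
  set X := R * S with hX
  have hX0 : 0 < X := by linarith
  obtain ⟨x, hx⟩ : ∃ x, x = √X := ⟨_, rfl⟩
  have hxx : X = x * x := by rw [hx, Real.mul_self_sqrt hX0.le]
  have hx1 : 1 ≤ x := by rw [hx]; exact Real.one_le_sqrt.mpr hX1
  rw [← hx] at hDB huX hb
  have hD1 : D * B ^ 2 ≤ g ^ 2 * x * u ^ 6 := by
    calc D * B ^ 2 = (D * B) * B := by ring
      _ ≤ (g * x * u ^ 2) * (g * u ^ 4) := by rw [hDB]; gcongr
      _ = _ := by ring
  have hu624 : u ^ 6 ≤ u ^ 24 := pow_le_pow_right₀ hu (by norm_num)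
  have hu1224 : u ^ 12 ≤ u ^ 24 := pow_le_pow_right₀ hu (by norm_num)
  have hD1X : D * B ^ 2 ≤ X ^ 2 := by
    calc D * B ^ 2 ≤ g ^ 2 * x * u ^ 6 := hD1
      _ ≤ X * x * x := by gcongr; exact hu624.trans huX
      _ = X ^ 2 := by rw [hxx]; ring
  have hD10 : 0 < D * B ^ 2 := by positivity
  have hj2 : (1 : ℝ) ≤ 2 ^ j := one_le_pow₀ (by norm_num)
  have hj16 : (2 : ℝ) ^ j ≤ 16 := by
    calc (2 : ℝ) ^ j ≤ 2 ^ 4 := pow_le_pow_right₀ (by norm_num) (by omega)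
      _ = 16 := by norm_num
  obtain ⟨E, hE⟩ : ∃ E, E = 2 ^ j * (D * B ^ 2) := ⟨_, rfl⟩
  have hE1 : D * B ^ 2 ≤ E := by rw [hE]; nlinarith
  have hE2 : E ≤ 16 * (D * B ^ 2) := by rw [hE]; gcongr
  have hE0 : 0 < E := by linarith
  -- Chosen so that the trivial cost F D B² is X/(u²B), which already contains the required gain
  -- 1/B.
  obtain ⟨F, hF⟩ : ∃ F, F = X / (u ^ 2 * B * (D * B ^ 2)) := ⟨_, rfl⟩
  have hF0 : 0 < F := by rw [hF]; positivity
  have hFD : F * (D * B ^ 2) = X / (u ^ 2 * B) := by rw [hF]; field_simp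
  have hxX : x ≤ X := by rw [hxx]; exact le_mul_of_one_le_left (by linarith) hx1
  have hu2x : u ^ 2 ≤ x := (pow_le_pow_right₀ hu (by norm_num)).trans huX
  have hBX : B ≤ X ^ 2 := by
    have h1 : u ^ 4 ≤ x := (pow_le_pow_right₀ hu (by norm_num)).trans huX
    have h2 : g ≤ X := by nlinarith
    calc B ≤ g * u ^ 4 := hBu
      _ ≤ X * x := by gcongr
      _ ≤ X * X := by gcongr
      _ = X ^ 2 := by ring
  have hρ : X / (F * E) ≤ X ^ 4 := by
    calc X / (F * E) ≤ X / (F * (D * B ^ 2)) := by gcongr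
      _ = u ^ 2 * B := by rw [hFD]; field_simp
      _ ≤ x * X ^ 2 := by gcongr
      _ ≤ X ^ 4 := by
          have : x ≤ X ^ 2 := hxX.trans (le_self_pow₀ hX1 two_ne_zero)
          calc x * X ^ 2 ≤ X ^ 2 * X ^ 2 := by gcongr
            _ = X ^ 4 := by ring
  have key := h' E F R S (C * X ^ (ε / 3)) (C * X ^ (ε / 3) * (X / u ^ 6)) (C * X ^ (ε / 3) * x)
    hE0 hF0 hR1 hS1 (by positivity) (by positivity) (by positivity)
    (by rw [← hX]; linarith) hρ hb
  rw [← hE]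
  refine key.mono ?_
  rw [← hX]
  obtain ⟨Y, hY⟩ : ∃ Y, Y = g ^ 3 * X ^ ε * (X / u ^ 2) := ⟨_, rfl⟩
  have hXε : 1 ≤ X ^ ε := Real.one_le_rpow hX1 hε.le
  have hXε3 : 1 ≤ X ^ (ε / 3) := Real.one_le_rpow hX1 (by positivity)
  have e3 : X ^ (ε / 3) * X ^ (ε / 3) * X ^ (ε / 3) = X ^ ε := by
    rw [← Real.rpow_add hX0, ← Real.rpow_add hX0]; congr 1; ring
  have e2 : X ^ (ε / 3) * X ^ (ε / 3) ≤ X ^ ε := by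
    rw [← e3]; exact le_mul_of_one_le_right (by positivity) hXε3
  have hg3 : 1 ≤ g ^ 3 := one_le_pow₀ hg
  have hgg3 : g ≤ g ^ 3 := le_self_pow₀ hg (by norm_num)
  have hXu : 0 ≤ X / u ^ 2 := by positivity
  have t1 : E * B ≤ 16 * Y := by
    calc E * B ≤ 16 * (g ^ 2 * x * u ^ 6) * (g * u ^ 4) := by gcongr; linarith
      _ = 16 * (g ^ 3 * 1 * (x * u ^ 12 / u ^ 2)) := by field_simp
      _ ≤ 16 * (g ^ 3 * X ^ ε * (X / u ^ 2)) := by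
          gcongr
          rw [hxx]
          gcongr
          exact hu1224.trans huX
      _ = 16 * Y := by rw [hY]
  have t2 : F * E * B ≤ 16 * Y := by
    calc F * E * B ≤ F * (16 * (D * B ^ 2)) * B := by gcongr
      _ = 16 * (F * (D * B ^ 2)) * B := by ring
      _ = 16 * (1 * 1 * (X / u ^ 2)) := by rw [hFD]; field_simp
      _ ≤ 16 * (g ^ 3 * X ^ ε * (X / u ^ 2)) := by gcongr
      _ = 16 * Y := by rw [hY]
  -- After squaring, B ≤ g u^4 and the value of D B reduce the claim to u^24 ≤ √X, together with g ≥
  -- 1.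
  have hsq : X / √F * B ≤ g ^ 3 * (X / u ^ 2) := by
    have h1 : X / √F = √(X * (u ^ 2 * B * (D * B ^ 2))) := by
      rw [eq_comm, Real.sqrt_eq_iff_eq_sq (by positivity) (by positivity), div_pow,
        Real.sq_sqrt hF0.le, hF]
      field_simp
    have h2 : X * (u ^ 2 * B * (D * B ^ 2)) * B ^ 2 ≤ (g ^ 3 * (X / u ^ 2)) ^ 2 := by
      have h3 : B ^ 4 ≤ (g * u ^ 4) ^ 4 := by gcongr
      calc X * (u ^ 2 * B * (D * B ^ 2)) * B ^ 2 = X * (u ^ 2 * (D * B) * B ^ 4) := by ring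
        _ ≤ X * (u ^ 2 * (g * x * u ^ 2) * (g * u ^ 4) ^ 4) := by rw [hDB]; gcongr
        _ = X * (x * u ^ 24) * g ^ 5 / u ^ 4 := by field_simp
        _ ≤ X * (x * x) * g ^ 6 / u ^ 4 := by
            gcongr
            norm_num
        _ = _ := by rw [hxx]; field_simp
    calc X / √F * B = √(X * (u ^ 2 * B * (D * B ^ 2)) * B ^ 2) := by
          rw [h1, Real.sqrt_mul (x := X * (u ^ 2 * B * (D * B ^ 2))) (by positivity) (B ^ 2),
            Real.sqrt_sq (by linarith)]
      _ ≤ _ := (Real.sqrt_le_left (by positivity)).mpr h2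
  have hlog : 1 + Real.log X ≤ C₃ * X ^ (ε / 3) := h₃ X hX1 X hX1 (by simp)
  have hL : 0 ≤ 1 + Real.log X := by linarith [Real.log_nonneg hX1]
  have t3 : C * X ^ (ε / 3) * X / √F * (1 + Real.log X) * B ≤ C * C₃ * Y := by
    calc C * X ^ (ε / 3) * X / √F * (1 + Real.log X) * B
        = C * X ^ (ε / 3) * (1 + Real.log X) * (X / √F * B) := by ring
      _ ≤ C * X ^ (ε / 3) * (C₃ * X ^ (ε / 3)) * (g ^ 3 * (X / u ^ 2)) := by gcongr
      _ = C * C₃ * ((X ^ (ε / 3) * X ^ (ε / 3)) * (g ^ 3 * (X / u ^ 2))) := by ring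
      _ ≤ C * C₃ * (X ^ ε * (g ^ 3 * (X / u ^ 2))) := by gcongr
      _ = _ := by rw [hY]; ring
  -- The first summand uses B ≤ g u^4. The second becomes √X · X/(D B), which fixes the choice D B =
  -- g √X u².
  have t4 : (C * X ^ (ε / 3) * (X / u ^ 6) + C * X ^ (ε / 3) * x * X / E) * X ^ (ε / 3) * B ≤
      2 * C * Y := by
    have h1 : X / u ^ 6 * B ≤ g ^ 3 * (X / u ^ 2) := by
      calc X / u ^ 6 * B ≤ X / u ^ 6 * (g * u ^ 4) := by gcongr
        _ = g * (X / u ^ 2) := by field_simp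
        _ ≤ _ := by gcongr
    have h2 : x * X / E * B ≤ g ^ 3 * (X / u ^ 2) := by
      calc x * X / E * B ≤ x * X / (D * B ^ 2) * B := by gcongr
        _ = x * X / (D * B) := by field_simp
        _ = 1 / g * (X / u ^ 2) := by rw [hDB]; field_simp
        _ ≤ _ := by
            gcongr
            rw [div_le_iff₀ (by linarith)]
            nlinarith
    calc _ = C * (X ^ (ε / 3) * X ^ (ε / 3)) * (X / u ^ 6 * B + x * X / E * B) := by ring
      _ ≤ C * X ^ ε * (g ^ 3 * (X / u ^ 2) + g ^ 3 * (X / u ^ 2)) := by gcongr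
      _ = _ := by rw [hY]; ring
  have hY0 : 0 ≤ Y := by rw [hY]; positivity
  have hCC : 1 ≤ C * C₃ := one_le_mul_of_one_le_of_one_le hC hC₃
  have hCC' : C ≤ C * C₃ := le_mul_of_one_le_right (by linarith) hC₃
  rw [← hY, le_div_iff₀ (show 0 < B by linarith), mul_assoc C', mul_assoc C']
  refine mul_le_mul_of_nonneg_left ?_ (by linarith)
  have s1 : Y ≤ C * C₃ * Y := le_mul_of_one_le_left hY0 hCC
  have s2 : C * Y ≤ C * C₃ * Y := by gcongr
  rw [add_mul, add_mul, add_mul]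
  linarith

/-- The bound for moduli of intermediate size. -/
theorem exists_supportedBound_middle {ε : ℝ} (hε : 0 < ε) : ∃ C X₀ : ℝ, 1 ≤ C ∧ 1 ≤ X₀ ∧
    ∀ D R S u : ℝ, 1 ≤ u → u ^ 24 ≤ R → u ^ 24 ≤ S → 1 ≤ D → X₀ ≤ R * S → √(R * S) / u ^ 2 ≤ D →
      D ≤ √(R * S) * u ^ 2 →
      SupportedBound D R S (C * ((R * S) ^ ε * (R * S / u ^ 2))) := by
  -- The margin g = X^η forces B ≥ g. Hence there are at least √B/4 ≥ X^(η/2)/4 primes, enough to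
  -- exceed twice the divisor bound C₁X^(η/4), while the factor g³ stays below X^ε.
  set η := min (ε / 8) (1 / 2) with hη
  have hη0 : 0 < η := lt_min (by positivity) (by norm_num)
  have hηε : η ≤ ε / 8 := min_le_left _ _
  have hη2 : η ≤ 1 / 2 := min_le_right _ _
  obtain ⟨C₁, hC₁, hτ⟩ := exists_card_divisors_le 32 2 (show 0 < η / 4 by positivity)
  obtain ⟨C₂, hC₂, h₂⟩ := exists_supportedBound_enlarged (show 0 < ε / 8 by positivity)
  obtain ⟨C₃, hC₃, h₃⟩ := exists_one_add_log_le 4 2 (show 0 < ε / 8 by positivity)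
  obtain ⟨B₀, -, hprimes⟩ := exists_primes_Ioc
  have hev : ∀ᶠ X : ℝ in Filter.atTop, B₀ ≤ X ^ η ∧ 8 * C₁ ≤ X ^ (η / 4) :=
    ((tendsto_rpow_atTop hη0).eventually_ge_atTop B₀).and
      ((tendsto_rpow_atTop (show 0 < η / 4 by positivity)).eventually_ge_atTop (8 * C₁))
  obtain ⟨X₀, hX₀⟩ := Filter.eventually_atTop.mp hev
  refine ⟨320 * (C₁ * C₂ * C₃), max 1 X₀, ?_, le_max_left _ _, ?_⟩
  · nlinarith [one_le_mul_of_one_le_of_one_le (one_le_mul_of_one_le_of_one_le hC₁ hC₂) hC₃]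
  intro D R S u hu hRu hSu hD hX hDl hDu
  have hu24 : (1 : ℝ) ≤ u ^ 24 := one_le_pow₀ hu
  have hR1 : 1 ≤ R := hu24.trans hRu
  have hS1 : 1 ≤ S := hu24.trans hSu
  have hX1 : 1 ≤ R * S := (le_max_left _ _).trans hX
  have hRX : R ≤ R * S := by nlinarith
  have hu0 : 0 < u := by linarith
  have huX : u ^ 24 ≤ √(R * S) := Real.le_sqrt_of_sq_le (by
    rw [sq]; exact mul_le_mul hRu hSu (by positivity) (by linarith))
  obtain ⟨hB₀, h8⟩ := hX₀ _ ((le_max_right _ _).trans hX)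
  have hk := h₂ D
  obtain ⟨X, hXdef⟩ : ∃ X, X = R * S := ⟨_, rfl⟩
  rw [← hXdef] at hX1 hRX huX hB₀ h8 hDl hDu ⊢
  have hX0 : 0 < X := by linarith
  obtain ⟨x, hx⟩ : ∃ x, x = √X := ⟨_, rfl⟩
  have hxx : x * x = X := by rw [hx, Real.mul_self_sqrt hX0.le]
  have hx1 : 1 ≤ x := by rw [hx]; exact Real.one_le_sqrt.mpr hX1
  obtain ⟨g, hg⟩ : ∃ g, g = X ^ η := ⟨_, rfl⟩
  have hg1 : 1 ≤ g := by rw [hg]; exact Real.one_le_rpow hX1 hη0.le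
  have hg2 : g ^ 2 ≤ X := by
    calc g ^ 2 = X ^ (η * 2) := by
          rw [hg, Real.rpow_mul hX0.le, ← Real.rpow_natCast]; norm_num
      _ ≤ X ^ (1 : ℝ) := Real.rpow_le_rpow_of_exponent_le hX1 (by linarith)
      _ = X := Real.rpow_one X
  rw [← hx] at hDl hDu huX
  rw [← hg] at hB₀
  -- The limits √X/u² ≤ D ≤ √X u² translate into g ≤ B ≤ g u^4.
  obtain ⟨B, hB⟩ : ∃ B, B = g * x * u ^ 2 / D := ⟨_, rfl⟩
  have hDB : D * B = g * x * u ^ 2 := by rw [hB]; field_simp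
  have hgB : g ≤ B := by
    rw [hB, le_div_iff₀ (by linarith), mul_assoc]
    gcongr
  have hB1 : 1 ≤ B := hg1.trans hgB
  have hB0 : 0 < B := by linarith
  have hBu : B ≤ g * u ^ 4 := by
    rw [div_le_iff₀ (by positivity)] at hDl
    rw [hB, div_le_iff₀ (by linarith)]
    calc g * x * u ^ 2 ≤ g * (D * u ^ 2) * u ^ 2 := by gcongr
      _ = _ := by ring
  have hu424 : u ^ 4 ≤ x := (pow_le_pow_right₀ hu (by norm_num)).trans huX
  have hu624 : u ^ 6 ≤ x := (pow_le_pow_right₀ hu (by norm_num)).trans huX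
  have hxX : x ≤ X := by rw [← hxx]; exact le_mul_of_one_le_left (by linarith) hx1
  have hgX : g ≤ X := (le_self_pow₀ hg1 two_ne_zero).trans hg2
  have hBX : B ≤ X ^ 2 := by
    calc B ≤ g * u ^ 4 := hBu
      _ ≤ X * X := by gcongr; exact hu424.trans hxX
      _ = X ^ 2 := by ring
  have hD1X : D * B ^ 2 ≤ X ^ 2 := by
    calc D * B ^ 2 = (D * B) * B := by ring
      _ ≤ (g * x * u ^ 2) * (g * u ^ 4) := by rw [hDB]; gcongr
      _ = g ^ 2 * x * u ^ 6 := by ring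
      _ ≤ X * x * x := by gcongr
      _ = X ^ 2 := by rw [← hxx]; ring
  obtain ⟨Bs, hprime, hBs, hcard⟩ := hprimes B (hB₀.trans hgB)
  have hlog4 : Real.log (4 * B) ≤ 4 * √B := by
    have h1 : Real.log (4 * B) = 2 * Real.log (2 * √B) := by
      rw [show 4 * B = (2 * √B) ^ 2 by rw [mul_pow, Real.sq_sqrt hB0.le]; ring, Real.log_pow]
      norm_num
    have h2 : Real.log (2 * √B) ≤ 2 * √B - 1 := Real.log_le_sub_one_of_pos (by positivity)
    linarith
  have hlog0 : 0 < Real.log (4 * B) := Real.log_pos (by linarith)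
  have hcard' : √B ≤ 4 * Bs.card := by
    have h1 : B ≤ Bs.card * (4 * √B) := hcard.trans (by gcongr)
    have h2 : √B * √B = B := Real.mul_self_sqrt hB0.le
    have h3 : 0 < √B := Real.sqrt_pos.mpr hB0
    refine le_of_mul_le_mul_right ?_ h3
    rw [h2]; linarith
  have hη4 : X ^ (η / 4) * X ^ (η / 4) = √g := by
    rw [← Real.rpow_add hX0, hg, Real.sqrt_eq_rpow, ← Real.rpow_mul hX0.le]
    congr 1; ring
  have hM2 : 2 * (C₁ * X ^ (η / 4)) ≤ Bs.card := by
    have h1 : √g ≤ √B := Real.sqrt_le_sqrt hgB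
    have h2 : 0 < X ^ (η / 4) := by positivity
    nlinarith
  have hM1 : 1 ≤ C₁ * X ^ (η / 4) :=
    one_le_mul_of_one_le_of_one_le hC₁ (Real.one_le_rpow hX1 (by positivity))
  have hXε : 0 < X ^ (ε / 8) := by positivity
  obtain ⟨Y, hY⟩ : ∃ Y, Y = g ^ 3 * X ^ (ε / 8) * (X / u ^ 2) := ⟨_, rfl⟩
  have hY0 : 0 ≤ Y := by rw [hY]; positivity
  have key := SupportedBound.enlarge (D := D) (R := R) (S := S) (N := C₂ * Y / B) (by linarith)
    (by linarith) hB0 (by positivity) hprime hBs hM1 hM2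
    (fun r hr => hτ X hX1 r (pos_of_mem_dyadic (by linarith) hr).ne' (by
      have h1 := ((mem_dyadic (by linarith) r).mp hr).2
      have h2 : X ≤ X ^ 2 := le_self_pow₀ hX1 two_ne_zero
      linarith))
    (fun n hn hle => hτ X hX1 n hn (by linarith))
    (fun j hj => by
      rw [hY, hXdef]
      refine hk B R S u g hu hRu hSu hD hB1 hg1 ?_ ?_ hBu j hj
      · rw [← hXdef]; exact hg2
      · rw [← hXdef, ← hx]; exact hDB)
  refine key.mono ?_
  have hcard0 : (0 : ℝ) < Bs.card := by linarith
  -- The loss B²/#Bs of the enlargement, combined with the gain 1/B, leaves only a logarithm.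
  have hBc : B / Bs.card ≤ C₃ * X ^ (ε / 8) := by
    rw [div_le_iff₀ hcard0]
    have h1 : 1 + Real.log (4 * B) ≤ C₃ * X ^ (ε / 8) :=
      h₃ X hX1 (4 * B) (by linarith) (by linarith)
    calc B ≤ Bs.card * Real.log (4 * B) := hcard
      _ ≤ Bs.card * (C₃ * X ^ (ε / 8)) := by gcongr; linarith
      _ = _ := by ring
  have hexp : X ^ (η / 4) * (X ^ (ε / 8) * (g ^ 3 * X ^ (ε / 8))) ≤ X ^ ε := by
    have h1 : g ^ 3 = X ^ (η * 3) := by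
      rw [hg, Real.rpow_mul hX0.le, ← Real.rpow_natCast]; norm_num
    rw [h1, ← Real.rpow_add hX0, ← Real.rpow_add hX0, ← Real.rpow_add hX0]
    exact Real.rpow_le_rpow_of_exponent_le hX1 (by linarith)
  calc 320 * (B ^ 2 * (C₁ * X ^ (η / 4)) / Bs.card) * (C₂ * Y / B)
      = 320 * (C₁ * C₂) * X ^ (η / 4) * (B / Bs.card) * Y := by field_simp
    _ ≤ 320 * (C₁ * C₂) * X ^ (η / 4) * (C₃ * X ^ (ε / 8)) * Y := by gcongr
    _ = 320 * (C₁ * C₂ * C₃) * (X ^ (η / 4) * (X ^ (ε / 8) * (g ^ 3 * X ^ (ε / 8))) *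
        (X / u ^ 2)) := by rw [hY]; ring
    _ ≤ _ := by gcongr

/-! ### Assembly of the ranges -/

/-- The bound for the variance in all ranges. -/
theorem exists_supportedBound {ε : ℝ} (hε : 0 < ε) : ∃ C : ℝ, 0 < C ∧ ∀ D R S : ℝ, 1 ≤ D → 1 ≤ R →
    1 ≤ S → SupportedBound D R S (C * (D + D ^ (-(1 / 2) : ℝ) * (R * S)
      + D ^ (1 / 3 : ℝ) * (R * S) ^ (2 / 3 : ℝ) * Real.log (2 * (R * S)) ^ 4
      + (R + S) ^ (1 / 12 : ℝ) * (R * S) ^ (11 / 12 + ε : ℝ))) := by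
  obtain ⟨C₁, hC₁, h₁⟩ := exists_supportedBound_small hε
  obtain ⟨C₂, X₀, hC₂, hX₀, h₂⟩ := exists_supportedBound_middle hε
  obtain ⟨C₃, hC₃, h₃⟩ := exists_supportedBound_large hε
  refine ⟨27 * X₀ + C₁ + C₂ + 16 * C₃, by linarith, ?_⟩
  intro D R S hD hR hS
  have hD0 : 0 < D := by linarith
  have hX1 : 1 ≤ R * S := by nlinarith
  have hX0 : 0 < R * S := by linarith
  have hL2 : 0 < Real.log (2 * (R * S)) := Real.log_pos (by linarith)
  obtain ⟨K, hK⟩ : ∃ K, K = 27 * X₀ + C₁ + C₂ + 16 * C₃ := ⟨_, rfl⟩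
  obtain ⟨G₂, hG₂⟩ : ∃ G, G = D ^ (-(1 / 2) : ℝ) * (R * S) := ⟨_, rfl⟩
  obtain ⟨G₃, hG₃⟩ : ∃ G, G = D ^ (1 / 3 : ℝ) * (R * S) ^ (2 / 3 : ℝ) *
    Real.log (2 * (R * S)) ^ 4 := ⟨_, rfl⟩
  obtain ⟨G₄, hG₄⟩ : ∃ G, G = (R + S) ^ (1 / 12 : ℝ) * (R * S) ^ (11 / 12 + ε : ℝ) := ⟨_, rfl⟩
  rw [← hK, ← hG₂, ← hG₃, ← hG₄]
  have p2 : 0 ≤ G₂ := by rw [hG₂]; positivity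
  have p3 : 0 ≤ G₃ := by rw [hG₃]; positivity
  have p4 : 0 ≤ G₄ := by rw [hG₄]; positivity
  obtain ⟨m, hm⟩ : ∃ m, m = min R S := ⟨_, rfl⟩
  have hm1 : 1 ≤ m := by rw [hm]; exact le_min hR hS
  -- The largest u with u^24 ≤ R and u^24 ≤ S.
  obtain ⟨u, hu⟩ : ∃ u, u = m ^ (1 / 24 : ℝ) := ⟨_, rfl⟩
  have hu1 : 1 ≤ u := by rw [hu]; exact Real.one_le_rpow hm1 (by norm_num)
  have hu24 : u ^ 24 = m := by
    rw [hu, ← Real.rpow_natCast, ← Real.rpow_mul (by linarith)]; norm_num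
  have huR : u ^ 24 ≤ R := by rw [hu24, hm]; exact min_le_left _ _
  have huS : u ^ 24 ≤ S := by rw [hu24, hm]; exact min_le_right _ _
  have hu2 : u ^ 2 = m ^ (1 / 12 : ℝ) := by
    rw [hu, ← Real.rpow_natCast, ← Real.rpow_mul (by linarith)]; norm_num
  -- From R S ≤ (R + S) min(R, S) and u² = min(R, S)^(1/12).
  have hlast : (R * S) ^ ε * (R * S / u ^ 2) ≤ G₄ := by
    have h1 : (R * S) ≤ (R + S) * m := by
      rw [hm]
      rcases le_total R S with h | h
      · rw [min_eq_left h]; nlinarith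
      · rw [min_eq_right h]; nlinarith
    have h2 : (R * S) ^ (1 / 12 : ℝ) ≤ (R + S) ^ (1 / 12 : ℝ) * u ^ 2 := by
      rw [hu2, ← Real.mul_rpow (by linarith) (by linarith)]
      exact Real.rpow_le_rpow hX0.le h1 (by norm_num)
    have h3 : (R * S) = (R * S) ^ (1 / 12 : ℝ) * (R * S) ^ (11 / 12 : ℝ) := by
      rw [← Real.rpow_add hX0]; norm_num
    rw [← mul_div_assoc, div_le_iff₀ (by positivity), hG₄, Real.rpow_add hX0]
    calc (R * S) ^ ε * (R * S) = (R * S) ^ (1 / 12 : ℝ) * ((R * S) ^ (11 / 12 : ℝ) *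
          (R * S) ^ ε) := by
          conv_lhs => rw [h3, Real.mul_rpow (by positivity) (by positivity)]
          rw [← Real.rpow_mul hX0.le, ← Real.rpow_mul hX0.le, ← Real.rpow_add hX0,
            ← Real.rpow_add hX0, ← Real.rpow_add hX0, ← Real.rpow_add hX0, ← Real.rpow_add hX0]
          congr 1; ring
      _ ≤ (R + S) ^ (1 / 12 : ℝ) * u ^ 2 * ((R * S) ^ (11 / 12 : ℝ) * (R * S) ^ ε) := by gcongr
      _ = _ := by ring
  have hKpos : 0 < K := by rw [hK]; linarith
  have hfin : ∀ c H : ℝ, 0 ≤ H → c ≤ K → H ≤ D + G₂ + G₃ + G₄ → c * H ≤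
      K * (D + G₂ + G₃ + G₄) := fun c H h0 hc hH => by
    calc c * H ≤ K * H := by gcongr
      _ ≤ _ := by gcongr
  have htriv := supportedBound_trivial hD0 (show 0 ≤ R by linarith) (show 0 ≤ S by linarith)
  rcases le_total (R * S) D with hDX | hDX
  · refine htriv.mono (le_trans ?_ (hfin 27 D hD0.le (by rw [hK]; linarith) (by linarith)))
    linarith
  -- For bounded R S the trivial bound is at most a constant times D, because D ≥ 1.
  rcases lt_or_ge (R * S) X₀ with hXs | hXs
  · refine htriv.mono (le_trans ?_ (hfin (27 * X₀) D hD0.le (by rw [hK]; linarith) (by linarith)))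
    nlinarith
  rcases le_total D (√(R * S) / u ^ 2) with hc1 | hc1
  · refine (h₁ D R S u hu1 huR huS hD0 hc1).mono (hfin C₁ _ (by positivity)
      (by rw [hK]; linarith) ?_)
    have h1 : R * S / √D = G₂ := by
      rw [hG₂, Real.rpow_neg hD0.le, ← Real.sqrt_eq_rpow]; field_simp
    rw [h1]; linarith
  rcases le_total D (√(R * S) * u ^ 2) with hc2 | hc2
  · exact (h₂ D R S u hu1 huR huS hD hXs hc1 hc2).mono (hfin C₂ _ (by positivity)
      (by rw [hK]; linarith) (by linarith))
  obtain ⟨t, ht⟩ : ∃ t, t = (D / (R * S)) ^ (1 / 3 : ℝ) := ⟨_, rfl⟩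
  have ht0 : 0 < t := by rw [ht]; positivity
  have ht1 : t ≤ 1 := by
    rw [ht]
    exact Real.rpow_le_one (by positivity) ((div_le_one hX0).mpr hDX) (by norm_num)
  have ht3 : t ^ 3 * (R * S) = D := by
    rw [ht, ← Real.rpow_natCast, ← Real.rpow_mul (by positivity)]
    norm_num
    field_simp
  have key := h₃ t R S u hu1 huR huS ht0 ht1 (by rw [ht3]; exact hc2)
  rw [ht3] at key
  have htX : t * (R * S) = D ^ (1 / 3 : ℝ) * (R * S) ^ (2 / 3 : ℝ) := by
    rw [ht, Real.div_rpow hD0.le hX0.le, div_mul_eq_mul_div, mul_div_assoc]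
    congr 1
    rw [div_eq_iff (by positivity), ← Real.rpow_add hX0]; norm_num
  -- Only the first power of the logarithm arises. As log(2RS) ≥ log 2, the fourth power dominates
  -- it up to a constant.
  have hlog : 1 + Real.log (R * S) ≤ 16 * Real.log (2 * (R * S)) ^ 4 := by
    have h1 : Real.log (2 * (R * S)) = Real.log 2 + Real.log (R * S) :=
      Real.log_mul (by norm_num) hX0.ne'
    have h2 := Real.log_two_gt_d9
    have h3 : 0 ≤ Real.log (R * S) := Real.log_nonneg hX1
    obtain ⟨y, hy⟩ : ∃ y, y = Real.log (2 * (R * S)) := ⟨_, rfl⟩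
    rw [← hy] at h1 ⊢
    have hy1 : 0.69 ≤ y := by linarith
    have h4 : 1 + Real.log (R * S) ≤ 2 * y := by linarith [Real.log_two_lt_d9]
    have h5 : 0.69 ^ 3 ≤ y ^ 3 := by gcongr
    have h6 : y ^ 4 = y ^ 3 * y := by ring
    rw [h6]
    nlinarith
  have hmid : t * (R * S) * (1 + Real.log (R * S)) ≤ 16 * G₃ := by
    rw [htX, hG₃]
    calc _ ≤ D ^ (1 / 3 : ℝ) * (R * S) ^ (2 / 3 : ℝ) * (16 * Real.log (2 * (R * S)) ^ 4) := by
          gcongr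
      _ = _ := by ring
  refine key.mono (le_trans ?_ (hfin (16 * C₃) (D + G₃ + G₄) (by positivity)
    (by rw [hK]; linarith) (by linarith)))
  rw [mul_comm 16 C₃, mul_assoc C₃ 16]
  refine mul_le_mul_of_nonneg_left ?_ (by linarith)
  linarith

theorem proposition14p1 :
    ∃ N : ℝ → ℝ → ℝ → ℝ,
      (∀ D R S : ℝ, 1 ≤ D → 1 ≤ R → 1 ≤ S →
        ∀ α : ℕ → ℕ → ℂ, SupportedInBox R S α →
          globalVariance D R S α ≤
            N D R S * ∑ r ∈ dyadic R, ∑ s ∈ dyadic S, (r.divisors.card : ℝ) * ‖α r s‖ ^ 2) ∧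
      ∀ ε : ℝ, 0 < ε → ∃ C : ℝ, 0 < C ∧
        ∀ D R S : ℝ, 1 ≤ D → 1 ≤ R → 1 ≤ S →
          |N D R S| ≤ C * (D + D ^ (-(1 / 2) : ℝ) * (R * S)
            + D ^ (1 / 3 : ℝ) * (R * S) ^ (2 / 3 : ℝ) * Real.log (2 * (R * S)) ^ 4
            + (R + S) ^ (1 / 12 : ℝ) * (R * S) ^ (11 / 12 + ε : ℝ)) := by
  -- The function is fixed before ε, so it is taken to be the best nonnegative constant. The
  -- inequality passes to the infimum, and each ε merely supplies an upper bound for it.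
  refine ⟨fun D R S => sInf {N : ℝ | 0 ≤ N ∧ SupportedBound D R S N}, ?_, ?_⟩
  · intro D R S hD hR hS α hα
    have hne : {N : ℝ | 0 ≤ N ∧ SupportedBound D R S N}.Nonempty :=
      ⟨_, by positivity, supportedBound_trivial (by linarith) (by linarith) (by linarith)⟩
    obtain ⟨Q, hQ⟩ : ∃ Q, Q = ∑ r ∈ dyadic R, ∑ s ∈ dyadic S,
      (r.divisors.card : ℝ) * ‖α r s‖ ^ 2 := ⟨_, rfl⟩
    have hQ0 : 0 ≤ Q := by
      rw [hQ]
      exact Finset.sum_nonneg fun r _ => Finset.sum_nonneg fun s _ => by positivity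
    have hle : ∀ N ∈ {N : ℝ | 0 ≤ N ∧ SupportedBound D R S N}, globalVariance D R S α ≤ N * Q :=
      fun N hN => by rw [hQ]; exact hN.2 α hα
    rw [← hQ]
    rcases hQ0.eq_or_lt with h0 | h0
    · obtain ⟨N, hN⟩ := hne
      have := hle N hN
      rw [← h0, mul_zero] at this ⊢
      exact this
    · rw [← div_le_iff₀ h0]
      exact le_csInf hne fun N hN => (div_le_iff₀ h0).mpr (hle N hN)
  · intro ε hε
    obtain ⟨C, hC, h⟩ := exists_supportedBound hε
    refine ⟨C, hC, fun D R S hD hR hS => ?_⟩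
    have hX : 1 ≤ R * S := by nlinarith
    have hlog := (Real.log_pos (show 1 < 2 * (R * S) by linarith)).le
    rw [abs_of_nonneg (Real.sInf_nonneg fun N hN => hN.1)]
    exact csInf_le ⟨0, fun N hN => hN.1⟩ ⟨by positivity, h D R S hD hR hS⟩
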